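/- **Setting.** Let $\mathfrak g_o$ be a real semisimple Lie algebra with Cartan involution $\theta$, let $\mathfrak g$ be its complexification, $\sigma$ the conjugation of $\mathfrak g$ with respect to $\mathfrak g_o$, extend $\theta$ linearly to $\mathfrak g$, and write $\mathfrak g=\mathfrak k\oplus\mathfrak p$ for the eigenspace decomposition of $\theta$ (and $\mathfrak k_o=\mathfrak k\cap\mathfrak g_o$). A *KS-triple* is an $\mathfrak{sl}_2$-triple $(h,e,f)$ in $\mathfrak g$ ($h\ne0$, $[h,e]=2e$, $[h,f]=-2f$, $[e,f]=h$) with $e,f\in\mathfrak p$, $h\in i\mathfrak k_o$ and $f=\sigma(e)$. It is *noticed* if $\mathfrak g$ is the only $\theta$-stable Levi subalgebra containing $e$, where a $\theta$-stable Levi subalgebra is the Levi factor $\mathfrak l$ of a $\theta$-stable parabolic subalgebra $\mathfrak q=\mathfrak l\oplus\mathfrak u$ (both $\mathfrak l$ and the nilradical $\mathfrak u$ are $\theta$-stable). **Diagrams.** A *weighted Vogan diagram* $\Gamma=(D,\theta,J,\omega)$ consists of a (possibly disconnected) Dynkin diagram $D$, an automorphism $\theta$ of $D$ with $\theta^2=1$,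 a set $J$ of $\theta$-fixed (painted) nodes, and $\theta$-invariant weights $\omega_i\in\{0,1,2\}$. Let $\Delta_\Gamma^+$ be the positive roots of the root system of $D$, with simple roots $\alpha_i$; $\theta$ acts on them by $\theta\alpha_i=\alpha_{\theta(i)}$. For $\alpha=\sum_i n_i\alpha_i\in\Delta_\Gamma^+$ put $\omega_\alpha=\sum_i n_i\omega_i$ and $p_\alpha=\sum_{i\in J}n_i$ (the painted length). Put $$P_{np}^{(1)}(\Gamma)=\{\alpha\in\Delta_\Gamma^+:\omega_\alpha=1,\ \theta\alpha=\alpha,\ p_\alpha\text{ even},\ \alpha\neq\gamma+\theta\gamma\text{ for all }\gamma\in\Delta_\Gamma^+\},$$ $$P_{p}^{(1)}(\Gamma)=\{\alpha\in\Delta_\Gamma^+:\omega_\alpha=1,\ \theta\alpha=\alpha,\ p_\alpha\text{ odd}\}\cup\{\gamma+\theta\gamma\in\Delta_\Gamma^+:\gamma\in\Delta_\Gamma^+,\ 2\omega_\gamma=1\}.$$ The diagram $\Gamma$ is *associated to* $(h,e,f)$ if there are a $\theta$-stable Cartan subalgebra $\mathfrak h\ni h$ of $\mathfrak g$ such that $\mathfrak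 h\cap\mathfrak k$ is a maximal abelian subspace of $\mathfrak k$, and a $\theta$-stable set of simple roots $\{\alpha_i\}$ of $\Delta(\mathfrak g,\mathfrak h)$ with $\alpha_i(h)\ge0$, such that $D$ is the Dynkin diagram of $\{\alpha_i\}$, $\theta\alpha_i=\alpha_{\theta(i)}$, $J=\{i:\theta(i)=i,\ \mathfrak g_{\alpha_i}\subset\mathfrak p\}$ and $\omega_i=\alpha_i(h)$. **Theorem.** Let $\Gamma$ be a weighted Vogan diagram associated to a noticed KS-triple $(h,e,f)$ of $\mathfrak g$. Then 1. $P_{np}^{(1)}(\Gamma)$ and $P_p^{(1)}(\Gamma)$ have the same cardinality; 2. for every node $j$ of $\Gamma$ at least one of the following holds: - (a) $j$ lies in a connected subdiagram of $D$ that is not $\theta$-stable and whose weights have sum $2$; - (b) $j$ lies in a connected $\theta$-stable subdiagram $\Gamma^j$ such that either - (I) the sum of the weights of $\Gamma^j$ is positive and at most $2$, and there is a $\theta$-fixed positive root $\alpha=\sum_i n_i\alpha_i$, supported on $\Gamma^j$, with $\omega_\alpha=2$, $p_\alpha$ odd and $n_j>0$; or - (II) $\Gamma^j$ is, for some $r\ge1$,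 a diagram of type $A_{2r}$ whose nodes form two rows $c_1,\dots,c_r$ and $\theta(c_1),\dots,\theta(c_r)$, where consecutive nodes of each row are joined, $c_1$ is joined to $\theta(c_1)$, exactly one pair $c_k,\theta(c_k)$ has weight $1$, and all other nodes have weight $0$. -/

import Mathlib

open scoped TensorProduct

/-! ### Weighted Vogan diagrams -/

/-- An abstract weighted Vogan diagram `(D, θ, J, ω)` with set of nodes `ι`.  The Dynkin diagram `D`
(not necessarily connected) is given by its Cartan matrix `cartan i j = ⟨α_i, α_j^∨⟩`; `θ` is an
automorphism of `D` of order at most two, `J` is a set of `θ`-fixed ("painted") nodes, and `ω` is a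
`θ`-invariant family of weights in `{0, 1, 2}`. -/
structure WeightedVoganDiagram (ι : Type*) [Fintype ι] [DecidableEq ι] where
  cartan : Matrix ι ι ℤ
  cartan_diag : ∀ i, cartan i i = 2
  cartan_nonpos : ∀ i j, i ≠ j → cartan i j ≤ 0
  cartan_eq_zero : ∀ i j, cartan i j = 0 → cartan j i = 0
  cartan_finite : ∃ d : ι → ℝ, (∀ i, 0 < d i) ∧
    (Matrix.of fun i j => d i * (cartan i j : ℝ)).PosDef
  θ : Equiv.Perm ι
  θ_cartan : ∀ i j, cartan (θ i) (θ j) = cartan i j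
  θ_θ : ∀ i, θ (θ i) = i
  J : Finset ι
  θ_of_mem_J : ∀ i ∈ J, θ i = i
  ω : ι → ℕ
  ω_le_two : ∀ i, ω i ≤ 2
  ω_θ : ∀ i, ω (θ i) = ω i

namespace WeightedVoganDiagram

variable {ι : Type*} [Fintype ι] [DecidableEq ι] (Γ : WeightedVoganDiagram ι)

/-- The roots of the root system with Dynkin diagram `D`, written as coefficient vectors
`(n_i)`, `α = ∑ n_i α_i`: the smallest set that contains the simple roots and is stable under the
simple reflections `s_j α = α - ⟨α, α_j^∨⟩ α_j`. -/
inductive IsRoot : (ι → ℤ) → Prop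
  | simple (i : ι) : IsRoot (Pi.single i 1)
  | reflection (j : ι) (v : ι → ℤ) (hv : IsRoot v) :
      IsRoot (v - (∑ i, v i * Γ.cartan i j) • Pi.single j 1)

/-- The set `Δ_Γ⁺` of positive roots. -/
def posRoots : Set (ι → ℤ) := {v | Γ.IsRoot v ∧ ∀ i, 0 ≤ v i}

/-- The action of `θ` on coefficient vectors: `θ (∑ n_i α_i) = ∑ n_i α_{θ i}`. -/
def act (v : ι → ℤ) : ι → ℤ := fun i => v (Γ.θ.symm i)

/-- The weight `ω_α = ∑ n_i ω_i`. -/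
def weight (v : ι → ℤ) : ℤ := ∑ i, v i * (Γ.ω i : ℤ)

/-- The painted length `p_α = ∑_{i ∈ J} n_i`. -/
def paintedLength (v : ι → ℤ) : ℤ := ∑ i ∈ Γ.J, v i

/-- The set `P_np^(j)(Γ)`. -/
def Pnp (j : ℤ) : Set (ι → ℤ) :=
  {α | α ∈ Γ.posRoots ∧ Γ.weight α = j ∧ Γ.act α = α ∧ Even (Γ.paintedLength α) ∧
    ¬ ∃ γ ∈ Γ.posRoots, α = γ + Γ.act γ}

/-- The set `P_p^(j)(Γ)`. -/
def Pp (j : ℤ) : Set (ι → ℤ) :=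
  {α | α ∈ Γ.posRoots ∧ Γ.weight α = j ∧ Γ.act α = α ∧ Odd (Γ.paintedLength α)} ∪
  {α | α ∈ Γ.posRoots ∧ ∃ γ ∈ Γ.posRoots, α = γ + Γ.act γ ∧ 2 * Γ.weight γ = j}

/-- The graph underlying the Dynkin diagram. -/
def graph : SimpleGraph ι where
  Adj i j := i ≠ j ∧ Γ.cartan i j ≠ 0
  symm := ⟨fun i j h => ⟨h.1.symm, fun h0 => h.2 (Γ.cartan_eq_zero j i h0)⟩⟩
  loopless := ⟨fun _ h => h.1 rfl⟩

/-- `S` is the set of nodes of a connected (nonempty) subdiagram. -/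
def IsConnectedSub (S : Finset ι) : Prop := (Γ.graph.induce (S : Set ι)).Connected

/-- `S` is `θ`-stable, that is, the subdiagram with nodes `S` is a Vogan subdiagram. -/
def IsStableSub (S : Finset ι) : Prop := S.image Γ.θ = S

/-- The subdiagram with nodes `S` is the two-row pattern: it consists of nodes `c_0, …, c_{r-1}`
(upper row) and `θ c_0, …, θ c_{r-1}` (lower row), each row is a diagram of type `A_r`, the only
further bond is a simple one between `c_0` and `θ c_0` (so that the subdiagram is of type `A_{2r}`
and `θ` reverses it), one node `c_k` of the upper row and its image `θ c_k` have weight `1`, and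
all the other nodes have weight `0`. (No node is fixed by `θ`, so no node is painted.) -/
def IsTwoRowPattern (S : Finset ι) : Prop :=
  ∃ (r : ℕ) (c : Fin r → ι) (k : Fin r),
    S = Finset.univ.image c ∪ Finset.univ.image (fun a => Γ.θ (c a)) ∧
    Function.Injective c ∧ (∀ a b, c a ≠ Γ.θ (c b)) ∧
    (∀ a b, Γ.cartan (c a) (c b) = CartanMatrix.A r a b) ∧
    (∀ a b : Fin r, Γ.cartan (c a) (Γ.θ (c b)) = if a.val = 0 ∧ b.val = 0 then -1 else 0) ∧
    (∀ a, Γ.ω (c a) = if a = k then 1 else 0)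

/-- The condition on a node `j`: it lies in a connected subdiagram that is not `θ`-stable and has
total weight `2`, or in a connected Vogan subdiagram (I) of total weight in `(0, 2]` having a
(`θ`-fixed) root of weight `2` and odd painted length that involves `α_j`, or (II) that is the
two-row pattern. -/
def NodeCondition (j : ι) : Prop :=
  (∃ S : Finset ι, j ∈ S ∧ Γ.IsConnectedSub S ∧ ¬ Γ.IsStableSub S ∧ ∑ i ∈ S, Γ.ω i = 2) ∨
  (∃ S : Finset ι, j ∈ S ∧ Γ.IsConnectedSub S ∧ Γ.IsStableSub S ∧
    ((0 < ∑ i ∈ S, Γ.ω i ∧ ∑ i ∈ S, Γ.ω i ≤ 2 ∧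
        ∃ α ∈ Γ.posRoots, (∀ i, i ∉ S → α i = 0) ∧ Γ.act α = α ∧ Γ.weight α = 2 ∧
          Odd (Γ.paintedLength α) ∧ 0 < α j) ∨
      Γ.IsTwoRowPattern S))

end WeightedVoganDiagram

/-! ### Real semisimple Lie algebras, KS-triples and their diagrams -/

section Real

variable {L : Type*} [LieRing L] [LieAlgebra ℝ L]

/-- A Cartan involution of a real semisimple Lie algebra `g_o`: an involutive automorphism `θ` such
that `-B(x, θ y)` is positive definite, `B` being the Killing form. -/
structure IsCartanInvolution (θ : L ≃ₗ⁅ℝ⁆ L) : Prop where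
  involutive : ∀ x, θ (θ x) = x
  pos : ∀ x, x ≠ 0 → 0 < -killingForm ℝ L x (θ x)

/-- The `ℂ`-linear extension of `θ` to the complexification `g = ℂ ⊗ g_o`. -/
noncomputable def complexTheta (θ : L ≃ₗ⁅ℝ⁆ L) : ℂ ⊗[ℝ] L →ₗ[ℂ] ℂ ⊗[ℝ] L :=
  (θ : L →ₗ[ℝ] L).baseChange ℂ

/-- The conjugation `σ` of `g = ℂ ⊗ g_o` with respect to `g_o`. -/
noncomputable def complexConj : ℂ ⊗[ℝ] L →ₗ[ℝ] ℂ ⊗[ℝ] L :=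
  LinearMap.rTensor L Complex.conjAe.toLinearMap

/-- A KS-triple `(h, e, f)`: an `sl₂`-triple of `g` with `e, f ∈ p`, `h ∈ i k_o` and `f = σ e`. -/
structure IsKSTriple (θ : L ≃ₗ⁅ℝ⁆ L) (h e f : ℂ ⊗[ℝ] L) : Prop where
  sl2 : IsSl2Triple h e f
  e_mem : complexTheta θ e = -e
  f_mem : complexTheta θ f = -f
  h_mem : ∃ x : L, θ x = x ∧ h = Complex.I ⊗ₜ[ℝ] x
  f_eq : f = complexConj e

/-- `q = l ⊕ u` is a `θ`-stable parabolic subalgebra of `g` with Levi decomposition `l ⊕ u`: for some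
`x ∈ g` such that `ad x` is diagonalizable with real eigenvalues, the Levi factor `l` is the
centralizer of `x` and the nilradical `u` is the sum of the eigenspaces of `ad x` for the positive
eigenvalues, and both `l` and `u` are `θ`-stable. -/
def IsThetaStableParabolic (θ : L ≃ₗ⁅ℝ⁆ L) (l u : Submodule ℂ (ℂ ⊗[ℝ] L)) : Prop :=
  ∃ x : ℂ ⊗[ℝ] L,
    (⨆ r : ℝ, Module.End.eigenspace (LieAlgebra.ad ℂ (ℂ ⊗[ℝ] L) x) (r : ℂ)) = ⊤ ∧
    l = Module.End.eigenspace (LieAlgebra.ad ℂ (ℂ ⊗[ℝ] L) x) 0 ∧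
    u = (⨆ r : {r : ℝ // 0 < r},
      Module.End.eigenspace (LieAlgebra.ad ℂ (ℂ ⊗[ℝ] L) x) ((r : ℝ) : ℂ)) ∧
    l.map (complexTheta θ) = l ∧ u.map (complexTheta θ) = u

/-- `e` is noticed: the only `θ`-stable Levi subalgebra of `g` (Levi factor of a `θ`-stable parabolic
subalgebra) that contains `e` is `g` itself. -/
def IsNoticed (θ : L ≃ₗ⁅ℝ⁆ L) (e : ℂ ⊗[ℝ] L) : Prop :=
  ∀ l u : Submodule ℂ (ℂ ⊗[ℝ] L), IsThetaStableParabolic θ l u → e ∈ l → l = ⊤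

variable [Module.Finite ℝ L] [LieAlgebra.IsSemisimple ℝ L]

/-- The Killing form of the complexification of a semisimple Lie algebra is nondegenerate. -/
instance instIsKillingComplexification : LieAlgebra.IsKilling ℂ (ℂ ⊗[ℝ] L) := by
  classical
  let v := Module.finBasis ℝ L
  have h1 : (killingForm ℝ L).Nondegenerate := LieAlgebra.IsKilling.killingForm_nondegenerate ℝ L
  have h2 : killingForm ℂ (ℂ ⊗[ℝ] L) = LinearMap.BilinForm.baseChange ℂ (killingForm ℝ L) :=
    LieModule.traceForm_baseChange ℝ L L ℂ
  have hM : LinearMap.BilinForm.toMatrix (v.baseChange ℂ) (killingForm ℂ (ℂ ⊗[ℝ] L)) =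
      (LinearMap.BilinForm.toMatrix v (killingForm ℝ L)).map (algebraMap ℝ ℂ) := by
    ext i j
    simp [h2, LinearMap.BilinForm.toMatrix_apply]
  have h3 : (killingForm ℂ (ℂ ⊗[ℝ] L)).Nondegenerate := by
    rw [← LinearMap.BilinForm.nondegenerate_toMatrix_iff (v.baseChange ℂ), hM,
      Matrix.nondegenerate_iff_det_ne_zero]
    rw [← LinearMap.BilinForm.nondegenerate_toMatrix_iff v,
      Matrix.nondegenerate_iff_det_ne_zero] at h1
    intro h0
    rw [← RingHom.mapMatrix_apply, ← RingHom.map_det] at h0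
    exact h1 (by simpa using h0)
  constructor
  rw [← LieSubmodule.toSubmodule_inj]
  exact (LieIdeal.coe_killingCompl_top ℂ (ℂ ⊗[ℝ] L)).trans
    (LinearMap.separatingLeft_iff_ker_eq_bot.mp h3.1)

/-- `H` is a maximally compact `θ`-stable Cartan subalgebra of `g` that contains `h`: it is
`θ`-stable and `t = H ∩ k` is a maximal abelian subspace of `k`. -/
structure IsMaxCompactCartan (θ : L ≃ₗ⁅ℝ⁆ L) (h : ℂ ⊗[ℝ] L)
    (H : LieSubalgebra ℂ (ℂ ⊗[ℝ] L)) : Prop where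
  isCartan : H.IsCartanSubalgebra
  h_mem : h ∈ H
  stable : ∀ x ∈ H, complexTheta θ x ∈ H
  maximal : ∀ x, complexTheta θ x = x →
    (∀ y ∈ H, complexTheta θ y = y → ⁅x, y⁆ = 0) → x ∈ H

/-- `Γ` is a weighted Vogan diagram of a KS-triple with neutral element `h`: there are a Cartan
subalgebra `H` of `g` as in `IsMaxCompactCartan` and a set `Ψ` of simple roots of `Δ(g, H)`,
labelled by the nodes of `Γ`, such that the diagram of `Γ` is the Dynkin diagram of `Ψ`, `Ψ` is
`θ`-stable and `θ α_i = α_{θ i}`, the painted nodes are the `θ`-fixed ones with `g_{α_i} ⊆ p`,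
and `ω_i = α_i(h)` (so `α_i(h) ≥ 0`). All admissible choices of `H` and `Ψ` are allowed. -/
def WeightedVoganDiagram.IsAssociatedTo {ι : Type*} [Fintype ι] [DecidableEq ι]
    (Γ : WeightedVoganDiagram ι) (θ : L ≃ₗ⁅ℝ⁆ L) (h : ℂ ⊗[ℝ] L) : Prop :=
  ∃ (H : LieSubalgebra ℂ (ℂ ⊗[ℝ] L)) (hH : IsMaxCompactCartan θ h H),
    haveI : H.IsCartanSubalgebra := hH.isCartan
    ∃ (Ψ : (LieAlgebra.IsKilling.rootSystem H).Base) (ε : ι ≃ Ψ.support),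
      (∀ i j, Γ.cartan i j = Ψ.cartanMatrix (ε i) (ε j)) ∧
      (∀ i, ∀ x : H, (ε (Γ.θ i)).1.1 x =
        (ε i).1.1 ⟨complexTheta θ (x : ℂ ⊗[ℝ] L), hH.stable x x.2⟩) ∧
      (∀ i, i ∈ Γ.J ↔ Γ.θ i = i ∧
        ∀ x ∈ LieAlgebra.rootSpace H (ε i).1.1, complexTheta θ x = -x) ∧
      (∀ i, (Γ.ω i : ℂ) = (ε i).1.1 ⟨h, hH.h_mem⟩)

end Real

/-! Let `g_m` be the eigenspaces of `ad h`, and let `τ` be the conjugation of `g` with respect to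
the compact form, so that `τ e = -f` and `-B(τ x, y)` is a Hermitian inner product. Being noticed
enters only as follows: no nonzero `θ`-fixed element commutes with `h` and `e`
(`NoticedTriple.eq_zero`). The diagram enters only through a basis of root vectors and of elements
dual to the simple roots (`VoganBasis`).

Cardinalities. `ad e : g_{-1} → g_1` is injective, hence bijective because both spaces have the same
dimension. Since `θ e = -e`, it anticommutes with `θ`, so the traces of `θ` on `g_1` and `g_{-1}`
are opposite. But `θ` has the same sign on the root spaces of `v` and `-v` for a fixed root `v`, so
the traces also agree and vanish. Thus compact and noncompact fixed roots of weight one are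
equinumerous. The sign is the parity of the painted length (`sign_eq_neg_one_zpow`), proved by
descending through simple roots or swapped pairs. This fails only if the support contains an edge
joining a node to its image, and then the weight is even.

Nodes. Expand `e` in root vectors. By noticedness every node lies in the support of a root `v`
occurring in `e`, and `v` has weight two. If `v` is fixed, `θ e = -e` makes its painted length odd,
which is (I), unless its support has an edge between a node and its image. Then the component
contains no fixed node, hence no branching or multiple bond; all coefficients of `v` are one and the
support is the pattern (II). If `v` is moved but its component is stable, the component is simply
laced and its roots have norm two. Without branching the coefficients are again one, which is (a).
With a branch node, either the swapped arms have length one, which a norm estimate excludes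
(`IsBranch.false_of_end`), or the component is `E₆`, settled by listing coefficients and using
noticedness once more (`nodeCondition_of_isE6`).

If the component of `v` is not stable, (a) holds once its weights are known to be even. On the ideal
of that component `ad e` is injective from degree 0 to degree 2, whereas
`HermitianLie.card_degree_two_lt` says `dim g_2 < dim g_0` for any integral grading by a semisimple
element in which degree 1 occurs. This amounts to the evenness of distinguished nilpotents.

The inequality is proved analytically. For the filtration `F_k` by degree, one needs a nonzero `R`
in some conjugate of `F_1` whose centralizer has dimension at most `dim g_0`. Take `R` minimizing
the moment map on unit vectors. The slice `R + ker ad(τ R)` is contracted to `R` by a one-parameter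
group and avoids the cone of conjugates of `F_1` on a small sphere around `R`. It therefore meets
the deformed cone, the conjugates of (grading element + `F_1`), in a nonempty compact set. By the
maximum modulus principle a point `v` of largest norm there is infinitesimally rigid: the tangent
space of its orbit meets the slice directions in zero. Hence `dim ker ad R ≤ dim ker ad v ≤ dim
g_0`, and counting ranks of `ad R` on the filtration finishes. -/

open scoped InnerProductSpace

/-! ### Hermitian Lie algebras and filtrations by degree. -/

/-- A finite-dimensional complex Lie algebra with a positive definite Hermitian form coming from a
compact conjugation `τ`, with trivial centre and only inner derivations. -/
structure HermitianLie (V : Type*) [NormedAddCommGroup V] [InnerProductSpace ℂ V] where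
  br : V →L[ℂ] V →L[ℂ] V
  skew : ∀ x y, br x y = - br y x
  leibniz : ∀ x y z, br x (br y z) = br (br x y) z + br y (br x z)
  τ : V →L⋆[ℂ] V
  τ_τ : ∀ x, τ (τ x) = x
  inner_br : ∀ x y z, ⟪br x y, z⟫_ℂ = - ⟪y, br (τ x) z⟫_ℂ
  τ_br : ∀ x y, τ (br x y) = br (τ x) (τ y)
  br_inj : ∀ x, br x = 0 → x = 0
  inner_derivation : ∀ D : V →ₗ[ℂ] V, (∀ x y, D (br x y) = br (D x) y + br x (D y)) →
    ∃ x, ∀ y, br x y = D y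

/-- The span of the vectors of degree at least `k`. -/
def degreeFiltration {V : Type*} [AddCommGroup V] [Module ℂ V] {n : ℕ} (δ : Fin n → ℤ)
    (w : Fin n → V) (k : ℤ) : Submodule ℂ V :=
  Submodule.span ℂ (w '' {i | k ≤ δ i})

lemma degreeFiltration_anti {V : Type*} [AddCommGroup V] [Module ℂ V] {n : ℕ} (δ : Fin n → ℤ)
    (w : Fin n → V) {k l : ℤ} (h : k ≤ l) : degreeFiltration δ w l ≤ degreeFiltration δ w k :=
  Submodule.span_mono (Set.image_mono fun _ hi => h.trans hi)

/-- Membership becomes a system of equations in the basis vectors, a condition that passes to limits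
of orthonormal bases. -/
lemma mem_degreeFiltration_iff {V : Type*} [NormedAddCommGroup V] [InnerProductSpace ℂ V] {n : ℕ}
    (δ : Fin n → ℤ) (u : OrthonormalBasis (Fin n) ℂ V) (k : ℤ) (y : V) :
    y ∈ degreeFiltration δ u k ↔ ∀ i, δ i < k → ⟪u i, y⟫_ℂ = 0 := by
  constructor
  · intro hy i hi
    induction hy using Submodule.span_induction with
    | mem x hx =>
      obtain ⟨j, hj, rfl⟩ := hx
      rw [orthonormal_iff_ite.mp u.orthonormal, if_neg]
      rintro rfl
      exact absurd hj (by simpa using hi)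
    | zero => simp
    | add x y _ _ hx hy => rw [inner_add_right, hx, hy, add_zero]
    | smul a x _ hx => rw [inner_smul_right, hx, mul_zero]
  · intro h
    rw [← u.sum_repr' y]
    refine Submodule.sum_mem _ fun i _ => ?_
    by_cases hi : δ i < k
    · rw [h i hi, zero_smul]; exact Submodule.zero_mem _
    · exact Submodule.smul_mem _ _ (Submodule.subset_span ⟨i, not_lt.mp hi, rfl⟩)

/-- The degrees decrease along the basis, so each step of the filtration is spanned by an initial
segment, and Gram–Schmidt preserves the spans of initial segments. -/
lemma degreeFiltration_gramSchmidt {V : Type*} [NormedAddCommGroup V] [InnerProductSpace ℂ V]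
    [FiniteDimensional ℂ V] {n : ℕ} (δ : Fin n → ℤ) (hδ : Antitone δ) (w : Module.Basis (Fin n) ℂ V) :
    ∃ u : OrthonormalBasis (Fin n) ℂ V, ∀ k, degreeFiltration δ u k = degreeFiltration δ w k := by
  have hn : Module.finrank ℂ V = Fintype.card (Fin n) := Module.finrank_eq_card_basis w
  refine ⟨InnerProductSpace.gramSchmidtOrthonormalBasis hn w, fun k => ?_⟩
  have h1 : (InnerProductSpace.gramSchmidtOrthonormalBasis hn w : Fin n → V) =
      InnerProductSpace.gramSchmidtNormed ℂ w := by
    funext i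
    refine InnerProductSpace.gramSchmidtOrthonormalBasis_apply hn ?_
    intro h0
    have := InnerProductSpace.gramSchmidtNormed_unit_length (𝕜 := ℂ) i w.linearIndependent
    rw [h0] at this
    simp at this
  unfold degreeFiltration
  rw [h1, InnerProductSpace.span_gramSchmidtNormed]
  apply le_antisymm
  · rw [Submodule.span_le]
    rintro _ ⟨i, hi, rfl⟩
    refine Submodule.span_mono ?_ (InnerProductSpace.gramSchmidt_mem_span ℂ w (le_refl i))
    exact Set.image_mono fun j hj => le_trans hi (hδ hj)
  · rw [Submodule.span_le]
    rintro _ ⟨i, hi, rfl⟩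
    refine Submodule.span_mono ?_ (InnerProductSpace.mem_span_gramSchmidt ℂ w (le_refl i))
    exact Set.image_mono fun j hj => le_trans hi (hδ hj)

namespace HermitianLie

variable {V : Type*} [NormedAddCommGroup V] [InnerProductSpace ℂ V] (G : HermitianLie V)

lemma inner_br_right (x y z : V) : ⟪y, G.br x z⟫_ℂ = - ⟪G.br (G.τ x) y, z⟫_ℂ := by
  rw [G.inner_br, G.τ_τ, neg_neg]

lemma br_self (x : V) : G.br x x = 0 := by
  have := G.skew x x
  rwa [eq_neg_iff_add_eq_zero, ← two_smul ℂ, smul_eq_zero_iff_right two_ne_zero] at this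

/-- The invariant form vanishes on eigenvectors whose degrees do not add up to zero. -/
lemma inner_τ_eq_zero_of_eigen {z x y : V} {a b : ℤ} (hx : G.br z x = (a : ℂ) • x)
    (hy : G.br z y = (b : ℂ) • y) (hab : a + b ≠ 0) : ⟪G.τ x, y⟫_ℂ = 0 := by
  have h1 : ⟪G.τ (G.br z x), y⟫_ℂ = - ⟪G.τ x, G.br z y⟫_ℂ := by
    rw [G.τ_br, G.inner_br, G.τ_τ]
  rw [hx, hy, map_smulₛₗ, inner_smul_left, inner_smul_right] at h1
  simp only [map_intCast] at h1
  have h2 : ((a + b : ℤ) : ℂ) * ⟪G.τ x, y⟫_ℂ = 0 := by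
    push_cast
    linear_combination h1
  exact (mul_eq_zero.mp h2).resolve_left (by exact_mod_cast hab)

/-- A Hermitian element together with an orthonormal eigenbasis of prescribed degrees. -/
structure Adapted {n : ℕ} (δ : Fin n → ℤ) (x : V) (u : Fin n → V) : Prop where
  τ_eq : G.τ x = -x
  orthonormal : Orthonormal ℂ u
  eigen : ∀ i, G.br x (u i) = (δ i : ℂ) • u i

/-- Eigenvalues of the derivation `ad z` add up under the bracket. -/
lemma br_mem_degreeFiltration {n : ℕ} {δ : Fin n → ℤ} {z : V} (w : Module.Basis (Fin n) ℂ V)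
    (hw : ∀ i, G.br z (w i) = (δ i : ℂ) • w i) {k l : ℤ} {x y : V}
    (hx : x ∈ degreeFiltration δ w k) (hy : y ∈ degreeFiltration δ w l) :
    G.br x y ∈ degreeFiltration δ w (k + l) := by
  induction hx using Submodule.span_induction with
  | zero => simp
  | add x y _ _ hx hy => rw [map_add]; exact Submodule.add_mem _ hx hy
  | smul a x _ hx => rw [map_smul]; exact Submodule.smul_mem _ _ hx
  | mem x hx =>
    obtain ⟨i, hi, rfl⟩ := hx
    induction hy using Submodule.span_induction with
    | zero => simp
    | add x y _ _ hx hy => rw [map_add]; exact Submodule.add_mem _ hx hy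
    | smul a x _ hx => rw [map_smul]; exact Submodule.smul_mem _ _ hx
    | mem y hy =>
      obtain ⟨j, hj, rfl⟩ := hy
      have h1 : G.br z (G.br (w i) (w j)) = ((δ i + δ j : ℤ) : ℂ) • G.br (w i) (w j) := by
        rw [G.leibniz, hw, hw]
        simp only [map_smul, smul_apply]
        push_cast
        rw [add_smul]
      rw [← w.sum_repr (G.br (w i) (w j))] at h1 ⊢
      refine Submodule.sum_mem _ fun l _ => ?_
      have h2 := congrArg (fun v => w.repr v l) h1
      simp only [map_sum, map_smul, hw, Finsupp.coe_finsetSum, Finset.sum_apply, Finsupp.smul_apply,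
        Module.Basis.repr_self, Finsupp.single_apply, smul_eq_mul, mul_ite, mul_one, mul_zero,
        Finset.sum_ite_eq', Finset.mem_univ, if_true] at h2
      by_cases h3 : w.repr (G.br (w i) (w j)) l = 0
      · rw [h3, zero_smul]; exact Submodule.zero_mem _
      · have h4 : (δ l : ℂ) = ((δ i + δ j : ℤ) : ℂ) := by
          have : (w.repr (G.br (w i) (w j)) l) * ((δ l : ℂ) - ((δ i + δ j : ℤ) : ℂ)) = 0 := by
            linear_combination h2
          exact sub_eq_zero.mp ((mul_eq_zero.mp this).resolve_left h3)
        have h5 : δ l = δ i + δ j := by exact_mod_cast h4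
        refine Submodule.smul_mem _ _ (Submodule.subset_span ⟨l, ?_, rfl⟩)
        simp only [Set.mem_ofPred_eq] at hi hj ⊢
        omega

/-- Every element with integral eigenvalues has the same filtration as a Hermitian element. -/
theorem exists_adapted [FiniteDimensional ℂ V] {n : ℕ} {δ : Fin n → ℤ} (hδ : Antitone δ) {z : V}
    (w : Module.Basis (Fin n) ℂ V) (hw : ∀ i, G.br z (w i) = (δ i : ℂ) • w i) :
    ∃ (x : V) (u : OrthonormalBasis (Fin n) ℂ V), G.Adapted δ x u ∧
      (∀ k, degreeFiltration δ u k = degreeFiltration δ w k) ∧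
      z - x ∈ degreeFiltration δ u 1 := by
  obtain ⟨u, hu⟩ := degreeFiltration_gramSchmidt δ hδ w
  have huE : ∀ i, u i ∈ degreeFiltration δ u (δ i) := fun i =>
    Submodule.subset_span ⟨i, by simp, rfl⟩
  have hmul : ∀ {k l : ℤ} {x y : V}, x ∈ degreeFiltration δ u k → y ∈ degreeFiltration δ u l →
      G.br x y ∈ degreeFiltration δ u (k + l) := by
    intro k l x y hx hy
    rw [hu] at hx hy ⊢
    exact G.br_mem_degreeFiltration w hw hx hy
  -- The invariant form pairs degree `a` only with degree `-a`. To see that the part `y` of `τ (u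
  -- i)` of too low degree vanishes, its pairings with `w k` are computed directly for `δ k ≤ δ i`,
  -- and through the complementary part `y'` otherwise.
  have hτ : ∀ i, G.τ (u i) ∈ degreeFiltration δ u (-δ i) := by
    intro i
    set y : V := ∑ j with δ j < -δ i, w.repr (G.τ (u i)) j • w j with hy
    set y' : V := ∑ j with ¬ δ j < -δ i, w.repr (G.τ (u i)) j • w j with hy'
    have hsum : y + y' = G.τ (u i) := by
      rw [hy, hy', Finset.sum_filter_add_sum_filter_not, w.sum_repr]
    have hy'E : y' ∈ degreeFiltration δ u (-δ i) := by
      rw [hu]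
      refine Submodule.sum_mem _ fun j hj => Submodule.smul_mem _ _ (Submodule.subset_span ⟨j, ?_, rfl⟩)
      simpa using (Finset.mem_filter.mp hj).2
    have hpair : ∀ (s : Finset (Fin n)) (c : Fin n → ℂ) (k : Fin n), (∀ j ∈ s, δ j + δ k ≠ 0) →
        ⟪G.τ (∑ j ∈ s, c j • w j), w k⟫_ℂ = 0 := by
      intro s c k h
      rw [map_sum, sum_inner]
      refine Finset.sum_eq_zero fun j hj => ?_
      rw [map_smulₛₗ, inner_smul_left, G.inner_τ_eq_zero_of_eigen (hw j) (hw k) (h j hj), mul_zero]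
    have hy0 : y = 0 := by
      have h1 : ∀ k, ⟪G.τ y, w k⟫_ℂ = 0 := by
        intro k
        by_cases hk : δ k ≤ δ i
        · refine hpair _ _ k fun j hj => ?_
          have := (Finset.mem_filter.mp hj).2
          omega
        · have h2 : ⟪G.τ y', w k⟫_ℂ = 0 := by
            refine hpair _ _ k fun j hj => ?_
            have := (Finset.mem_filter.mp hj).2
            omega
          have h3 : ⟪u i, w k⟫_ℂ = 0 := by
            have : w k ∈ degreeFiltration δ u (δ k) := by
              rw [hu]; exact Submodule.subset_span ⟨k, by simp, rfl⟩
            exact (mem_degreeFiltration_iff δ u _ _).mp this i (by omega)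
          have h4 : G.τ y = u i - G.τ y' := by
            rw [eq_sub_iff_add_eq, ← map_add, hsum, G.τ_τ]
          rw [h4, inner_sub_left, h2, h3, sub_zero]
      have h2 : G.τ y = 0 := by
        refine InnerProductSpace.ext_inner_right_basis w fun k => ?_
        rw [h1, inner_zero_left]
      rw [← G.τ_τ y, h2, map_zero]
    rw [← hsum, hy0, zero_add]
    exact hy'E
  -- Multiplicativity of the filtration kills the components of degree too low; passing to the
  -- adjoint of `ad (u i)`, which is `-ad (τ (u i))`, kills those too high. So the orthonormal basis
  -- defines a grading, not merely a filtration.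
  have hdeg : ∀ i j l, δ l ≠ δ i + δ j → ⟪u l, G.br (u i) (u j)⟫_ℂ = 0 := by
    intro i j l hl
    rcases lt_or_gt_of_ne hl with h | h
    · exact (mem_degreeFiltration_iff δ u _ _).mp (hmul (huE i) (huE j)) l h
    · rw [G.inner_br_right, neg_eq_zero, ← inner_conj_symm,
        (mem_degreeFiltration_iff δ u _ _).mp (hmul (hτ i) (huE l)) j (by omega), map_zero]
  -- The degree operator of this grading is a derivation, hence inner; it supplies `x`.
  set D : V →ₗ[ℂ] V := u.toBasis.constr ℂ fun i => (δ i : ℂ) • u i with hD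
  have hDu : ∀ i, D (u i) = (δ i : ℂ) • u i := by
    intro i
    have := u.toBasis.constr_basis ℂ (fun i => (δ i : ℂ) • u i) i
    rwa [OrthonormalBasis.coe_toBasis] at this
  have hDbr : ∀ i j, D (G.br (u i) (u j)) = ((δ i : ℂ) + δ j) • G.br (u i) (u j) := by
    intro i j
    conv_lhs => rw [← u.sum_repr' (G.br (u i) (u j))]
    conv_rhs => rw [← u.sum_repr' (G.br (u i) (u j))]
    rw [map_sum, Finset.smul_sum]
    refine Finset.sum_congr rfl fun l _ => ?_
    by_cases hl : δ l = δ i + δ j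
    · rw [map_smul, hDu, hl, smul_comm]; push_cast; rfl
    · rw [hdeg i j l hl]; simp
  have hder : ∀ x y, D (G.br x y) = G.br (D x) y + G.br x (D y) := by
    intro x y
    rw [← u.sum_repr' x, ← u.sum_repr' y]
    simp only [map_sum, map_smul, sum_apply, smul_apply, hDbr, hDu, Finset.smul_sum,
      ← Finset.sum_add_distrib]
    refine Finset.sum_congr rfl fun j _ => Finset.sum_congr rfl fun i _ => ?_
    module
  obtain ⟨x, hx⟩ := G.inner_derivation D hder
  have hxu : ∀ i, G.br x (u i) = (δ i : ℂ) • u i := fun i => by rw [hx, hDu]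
  -- `ad x` is diagonal with real entries in an orthonormal basis, so it is self-adjoint, and `ad`
  -- is injective.
  have hτx : G.τ x = -x := by
    rw [eq_neg_iff_add_eq_zero]
    apply G.br_inj
    have : ∀ i, G.br (G.τ x + x) (u i) = 0 := by
      intro i
      refine InnerProductSpace.ext_inner_left_basis u.toBasis fun j => ?_
      rw [OrthonormalBasis.coe_toBasis, inner_zero_right, map_add, add_apply, inner_add_right,
        G.inner_br_right, G.τ_τ, hxu, hxu, inner_smul_left, inner_smul_right,
        orthonormal_iff_ite.mp u.orthonormal]
      split_ifs with h
      · subst h; simp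
      · simp
    ext y
    rw [← u.sum_repr' y, map_sum]
    exact Finset.sum_eq_zero fun i _ => by rw [map_smul, this, smul_zero]
  refine ⟨x, u, ⟨hτx, u.orthonormal, hxu⟩, hu, ?_⟩
  -- Both `ad z` and `ad x` act on the `k`-th graded piece as `k`, so `ad y` raises the filtration
  -- by one. It remains to see that `y` has no components of degree at most zero.
  set y := z - x with hy
  have hyu : ∀ i, G.br y (u i) ∈ degreeFiltration δ u (δ i + 1) := by
    intro i
    have h1 : ∀ v ∈ degreeFiltration δ u (δ i), G.br z v - (δ i : ℂ) • v ∈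
        degreeFiltration δ u (δ i + 1) := by
      intro v hv
      rw [hu] at hv ⊢
      induction hv using Submodule.span_induction with
      | zero => simp
      | add a b _ _ ha hb =>
        rw [map_add, smul_add, add_sub_add_comm]
        exact Submodule.add_mem _ ha hb
      | smul c a _ ha =>
        rw [map_smul, smul_comm, ← smul_sub]
        exact Submodule.smul_mem _ _ ha
      | mem v hv =>
        obtain ⟨j, hj, rfl⟩ := hv
        rw [hw, ← sub_smul]
        by_cases h : δ j = δ i
        · rw [h, sub_self, zero_smul]; exact Submodule.zero_mem _
        · refine Submodule.smul_mem _ _ (Submodule.subset_span ⟨j, ?_, rfl⟩)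
          simp only [Set.mem_ofPred_eq] at hj ⊢
          omega
    have h2 := h1 (u i) (huE i)
    rwa [← hxu i, ← sub_apply, ← map_sub] at h2
  have hyE : ∀ {k : ℤ} {v : V}, v ∈ degreeFiltration δ u k → G.br y v ∈ degreeFiltration δ u (k + 1) := by
    intro k v hv
    induction hv using Submodule.span_induction with
    | zero => simp
    | add a b _ _ ha hb => rw [map_add]; exact Submodule.add_mem _ ha hb
    | smul c a _ ha => rw [map_smul]; exact Submodule.smul_mem _ _ ha
    | mem v hv =>
      obtain ⟨j, hj, rfl⟩ := hv
      exact degreeFiltration_anti δ u (by simpa using hj) (hyu j)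
  have hinner : ∀ l v, ⟪u l, G.br x v⟫_ℂ = (δ l : ℂ) * ⟪u l, v⟫_ℂ := by
    intro l v
    rw [G.inner_br_right, hτx, map_neg, neg_apply, inner_neg_left, neg_neg, hxu,
      inner_smul_left, map_intCast]
  have hx0 : x ∈ degreeFiltration δ u 0 := by
    refine (mem_degreeFiltration_iff δ u _ _).mpr fun l hl => ?_
    have := hinner l x
    rw [G.br_self, inner_zero_right] at this
    exact (mul_eq_zero.mp this.symm).resolve_left (by exact_mod_cast hl.ne)
  -- `[y, x]` lies in `F_1`, and its component along `u l` is `-δ l` times that of `y`.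
  have hneg : ∀ l, δ l < 0 → ⟪u l, y⟫_ℂ = 0 := by
    intro l hl
    have h1 := (mem_degreeFiltration_iff δ u _ _).mp (hyE hx0) l (by omega)
    rw [G.skew, inner_neg_right, neg_eq_zero, hinner] at h1
    exact (mul_eq_zero.mp h1).resolve_left (by exact_mod_cast hl.ne)
  set y0 : V := ∑ l with δ l = 0, ⟪u l, y⟫_ℂ • u l with hy0
  have hyy0 : y - y0 ∈ degreeFiltration δ u 1 := by
    refine (mem_degreeFiltration_iff δ u _ _).mpr fun l hl => ?_
    rw [inner_sub_right, hy0, inner_sum]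
    simp only [inner_smul_right, orthonormal_iff_ite.mp u.orthonormal, mul_ite, mul_one, mul_zero,
      Finset.sum_ite_eq, Finset.mem_filter, Finset.mem_univ, true_and]
    split_ifs with h
    · exact sub_self _
    · rw [hneg l (by omega), sub_zero]
  -- `ad y0` raises the filtration, since `ad y` and `ad (y - y0)` do, but it also preserves
  -- degrees; so it is zero.
  have hz : y0 = 0 := by
    apply G.br_inj
    have h0 : ∀ i, G.br y0 (u i) = 0 := by
      intro i
      have h1 : G.br y0 (u i) ∈ degreeFiltration δ u (δ i + 1) := by
        have : G.br y0 (u i) = G.br y (u i) - G.br (y - y0) (u i) := by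
          rw [map_sub G.br y y0, sub_apply, sub_sub_cancel]
        rw [this]
        refine Submodule.sub_mem _ (hyu i) ?_
        rw [add_comm]
        exact hmul hyy0 (huE i)
      refine InnerProductSpace.ext_inner_left_basis u.toBasis fun l => ?_
      rw [OrthonormalBasis.coe_toBasis, inner_zero_right]
      by_cases hl : δ l < δ i + 1
      · exact (mem_degreeFiltration_iff δ u _ _).mp h1 l hl
      · rw [hy0, map_sum, sum_apply, inner_sum]
        refine Finset.sum_eq_zero fun j hj => ?_
        have hj0 := (Finset.mem_filter.mp hj).2
        rw [map_smul, smul_apply, inner_smul_right, hdeg j i l (by omega), mul_zero]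
    ext v
    rw [← u.sum_repr' v, map_sum]
    simp [h0]
  rwa [hz, sub_zero] at hyy0

end HermitianLie

/-! ### Exponentials and the cones attached to a grading. -/

open scoped InnerProductSpace

namespace HermitianLie

open NormedSpace Filter Topology

variable {V : Type*} [NormedAddCommGroup V] [InnerProductSpace ℂ V] (G : HermitianLie V)

section exponential

variable [FiniteDimensional ℂ V]

lemma exp_neg_comp_exp (T : V →L[ℂ] V) (v : V) : exp (-T) (exp T v) = v := by
  have := FiniteDimensional.complete ℂ V
  let _ : NormedAlgebra ℚ (V →L[ℂ] V) := NormedAlgebra.restrictScalars ℚ ℂ _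
  rw [← mul_apply_eq_comp, ← NormedSpace.exp_add_of_commute (Commute.neg_left rfl),
    neg_add_cancel, NormedSpace.exp_zero, one_apply_eq_self]

lemma exp_comp_exp_neg (T : V →L[ℂ] V) (v : V) : exp T (exp (-T) v) = v := by
  simpa using exp_neg_comp_exp (-T) v

lemma hasDerivAt_exp_smul_apply (T : V →L[ℂ] V) (v : V) (s : ℂ) :
    HasDerivAt (fun s : ℂ => exp (s • T) v) (T (exp (s • T) v)) s := by
  have := FiniteDimensional.complete ℂ V
  have h := hasDerivAt_exp_smul_const' (𝕂 := ℂ) T s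
  have h2 := h.clm_apply (hasDerivAt_const s v)
  simpa using h2

/-- The exponential of an inner derivation is an automorphism. -/
lemma exp_br (y a b : V) :
    exp (G.br y) (G.br a b) = G.br (exp (G.br y) a) (exp (G.br y) b) := by
  have := FiniteDimensional.complete ℂ V
  set T := G.br y
  -- The derivative of `exp(-sT) [exp(sT) a, exp(sT) b]` vanishes by the Leibniz rule; comparing `s
  -- = 1` with `s = 0` gives the claim.
  have hF : ∀ s : ℂ, HasDerivAt (fun s : ℂ => exp (s • (-T)) (G.br (exp (s • T) a) (exp (s • T) b))) 0 s := by
    intro s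
    have h1 := hasDerivAt_exp_smul_apply T a s
    have h2 := hasDerivAt_exp_smul_apply T b s
    have h3 := hasDerivAt_exp_smul_const (𝕂 := ℂ) (-T) s
    have h4 : HasDerivAt (fun s : ℂ => G.br (exp (s • T) a)) (G.br (T (exp (s • T) a))) s :=
      G.br.hasFDerivAt.comp_hasDerivAt s h1
    have h5 := h3.clm_apply (h4.clm_apply h2)
    convert h5 using 1
    have hl := G.leibniz y (exp (s • T) a) (exp (s • T) b)
    change T _ = _ at hl
    simp only [mul_apply_eq_comp, neg_apply, map_neg]
    rw [hl]
    exact (neg_add_cancel _).symm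
  have h := is_const_of_deriv_eq_zero (fun s => (hF s).differentiableAt) (fun s => (hF s).deriv) 1 0
  simp only [one_smul, zero_smul, NormedSpace.exp_zero, one_apply_eq_self] at h
  rw [← h, exp_comp_exp_neg]

end exponential

/-- The set of elements that act on the associated graded space of some filtration coming from a
Hermitian element by `t` times the degree. -/
def cone {n : ℕ} (δ : Fin n → ℤ) (t : ℂ) : Set V :=
  {v | ∃ (x : V) (u : OrthonormalBasis (Fin n) ℂ V), G.Adapted δ x u ∧
    v - t • x ∈ degreeFiltration δ u 1}

lemma smul_mem_cone {n : ℕ} {δ : Fin n → ℤ} {t : ℂ} {v : V} (hv : v ∈ G.cone δ t) (c : ℂ) : c • v ∈ G.cone δ (c * t) := by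
  obtain ⟨x, u, hA, hm⟩ := hv
  refine ⟨x, u, hA, ?_⟩
  rw [mul_smul, ← smul_sub]
  exact Submodule.smul_mem _ _ hm

variable [FiniteDimensional ℂ V] {n : ℕ} {δ : Fin n → ℤ}

lemma Adapted.exists_orthonormalBasis (hn : Module.finrank ℂ V = n) {x : V} {u : Fin n → V}
    (h : G.Adapted δ x u) : ∃ b : OrthonormalBasis (Fin n) ℂ V, ⇑b = u := by
  have hc : Fintype.card (Fin n) = Module.finrank ℂ V := by rw [hn, Fintype.card_fin]
  have hs : ⊤ ≤ Submodule.span ℂ (Set.range u) := by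
    rw [h.orthonormal.linearIndependent.span_eq_top_of_card_eq_finrank' hc]
  exact ⟨OrthonormalBasis.mk h.orthonormal hs, OrthonormalBasis.coe_mk _ _⟩

/-- This is why the cones are defined with Hermitian elements: all pairs `(x, u)` have bounded size,
because `ad` is injective and `ad x` is diagonal with prescribed entries in an orthonormal basis. -/
lemma isCompact_adapted (hn : Module.finrank ℂ V = n) :
    IsCompact {p : V × (Fin n → V) | G.Adapted δ p.1 p.2} := by
  have := FiniteDimensional.proper ℂ V
  have hker : LinearMap.ker (G.br : V →ₗ[ℂ] V →L[ℂ] V) = ⊥ := by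
    rw [LinearMap.ker_eq_bot']
    exact fun x hx => G.br_inj x hx
  obtain ⟨K, hK, hanti⟩ := LinearMap.exists_antilipschitzWith (G.br : V →ₗ[ℂ] V →L[ℂ] V) hker
  refine Metric.isCompact_of_isClosed_isBounded ?_ ?_
  · have : {p : V × (Fin n → V) | G.Adapted δ p.1 p.2} =
        {p | G.τ p.1 = -p.1} ∩ ({p | ∀ i j, ⟪p.2 i, p.2 j⟫_ℂ = if i = j then 1 else 0} ∩
          {p | ∀ i, G.br p.1 (p.2 i) = (δ i : ℂ) • p.2 i}) := by
      ext p
      constructor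
      · intro h
        exact ⟨h.τ_eq, orthonormal_iff_ite.mp h.orthonormal, h.eigen⟩
      · rintro ⟨h1, h2, h3⟩
        exact ⟨h1, orthonormal_iff_ite.mpr h2, h3⟩
    rw [this]
    refine (isClosed_eq (G.τ.continuous.comp continuous_fst) continuous_fst.neg).inter
      (IsClosed.inter ?_ ?_)
    · simp only [Set.ofPred_forall]
      refine isClosed_iInter fun i => isClosed_iInter fun j => isClosed_eq ?_ continuous_const
      exact ((continuous_apply i).comp continuous_snd).inner ((continuous_apply j).comp continuous_snd)
    · simp only [Set.ofPred_forall]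
      refine isClosed_iInter fun i => isClosed_eq ?_ ?_
      · exact (G.br.continuous.comp continuous_fst).clm_apply ((continuous_apply i).comp continuous_snd)
      · exact ((continuous_apply i).comp continuous_snd).const_smul _
  · set C : ℝ := ∑ i, |(δ i : ℝ)|
    have hC : 0 ≤ C := Finset.sum_nonneg fun i _ => abs_nonneg _
    rw [isBounded_iff_forall_norm_le]
    refine ⟨max (K * C) 1, ?_⟩
    rintro ⟨x, u⟩ h
    obtain ⟨b, hb⟩ := Adapted.exists_orthonormalBasis G hn h
    refine max_le_max ?_ ?_
    · have h1 : ‖x‖ ≤ K * ‖G.br x‖ := by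
        have := hanti.le_mul_dist x 0
        simpa [dist_eq_norm] using this
      refine h1.trans (mul_le_mul_of_nonneg_left ?_ K.2)
      refine ContinuousLinearMap.opNorm_le_bound _ hC fun y => ?_
      conv_lhs => rw [← b.sum_repr' y, map_sum]
      refine (norm_sum_le _ _).trans ?_
      rw [Finset.sum_mul]
      refine Finset.sum_le_sum fun i _ => ?_
      have h2 : G.br x (b i) = (δ i : ℂ) • b i := by rw [hb]; exact h.eigen i
      rw [map_smul, h2, norm_smul, norm_smul, b.orthonormal.1 i, mul_one, mul_comm]
      have h3 : ‖⟪b i, y⟫_ℂ‖ ≤ ‖y‖ := by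
        have := norm_inner_le_norm (𝕜 := ℂ) (b i) y
        rwa [b.orthonormal.1 i, one_mul] at this
      refine mul_le_mul ?_ h3 (norm_nonneg _) (abs_nonneg _)
      simp
    · refine (pi_norm_le_iff_of_nonneg zero_le_one).mpr fun i => ?_
      exact (h.orthonormal.1 i).le

/-- The family of cones is closed. -/
lemma mem_cone_of_tendsto (hn : Module.finrank ℂ V = n) {v : ℕ → V} {t : ℕ → ℂ} {v0 : V} {t0 : ℂ}
    (hv : ∀ k, v k ∈ G.cone δ (t k)) (hv0 : Tendsto v atTop (𝓝 v0)) (ht0 : Tendsto t atTop (𝓝 t0)) :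
    v0 ∈ G.cone δ t0 := by
  choose x u hA hmem using hv
  -- The grading elements and bases subconverge by compactness, and the equations defining `F_1`
  -- survive in the limit.
  obtain ⟨⟨x0, u0⟩, h0, φ, hφ, hlim⟩ := (G.isCompact_adapted (δ := δ) hn).tendsto_subseq
    (x := fun k => (x k, (u k : Fin n → V))) (fun k => hA k)
  obtain ⟨b, hb⟩ := Adapted.exists_orthonormalBasis G hn h0
  refine ⟨x0, b, by rw [hb]; exact h0, ?_⟩
  rw [mem_degreeFiltration_iff]
  intro i hi
  have hx : Tendsto (fun k => x (φ k)) atTop (𝓝 x0) := (continuous_fst.tendsto _).comp hlim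
  have hu : Tendsto (fun k => u (φ k) i) atTop (𝓝 (u0 i)) :=
    ((continuous_apply i).tendsto _).comp ((continuous_snd.tendsto _).comp hlim)
  have h1 : Tendsto (fun k => ⟪u (φ k) i, v (φ k) - t (φ k) • x (φ k)⟫_ℂ) atTop
      (𝓝 ⟪u0 i, v0 - t0 • x0⟫_ℂ) :=
    hu.inner ((hv0.comp hφ.tendsto_atTop).sub ((ht0.comp hφ.tendsto_atTop).smul hx))
  have h2 : ∀ k, ⟪u (φ k) i, v (φ k) - t (φ k) • x (φ k)⟫_ℂ = 0 := fun k =>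
    (mem_degreeFiltration_iff δ _ _ _).mp (hmem (φ k)) i hi
  rw [hb]
  simp only [h2] at h1
  exact tendsto_nhds_unique h1 tendsto_const_nhds |>.symm ▸ rfl

/-- The cones are stable under inner automorphisms. -/
lemma exp_mem_cone (hδ : Antitone δ) {t : ℂ} {v : V} (hv : v ∈ G.cone δ t) (y : V) :
    exp (G.br y) v ∈ G.cone δ t := by
  obtain ⟨x, u, hA, hm⟩ := hv
  set a := exp (G.br y)
  have hinv : ∀ v, exp (-(G.br y)) (a v) = v := exp_neg_comp_exp _
  have hinv' : ∀ v, a (exp (-(G.br y)) v) = v := exp_comp_exp_neg _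
  let e : V ≃ₗ[ℂ] V := LinearEquiv.ofLinearMap (a : V →ₗ[ℂ] V) (exp (-(G.br y)) : V →L[ℂ] V)
    (by ext v; exact hinv' v) (by ext v; exact hinv v)
  -- An inner automorphism destroys the relation `τ x = -x`; the transported element is replaced by
  -- a Hermitian one with the same filtration, at the cost of a term in `F_1`.
  obtain ⟨x', u', hA', hE, hx'⟩ := G.exists_adapted hδ (z := a x) (u.toBasis.map e) (by
    intro i
    rw [Module.Basis.map_apply, OrthonormalBasis.coe_toBasis]
    change G.br (a x) (a (u i)) = _ • a (u i)
    rw [← G.exp_br, hA.eigen, map_smul])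
  refine ⟨x', u', hA', ?_⟩
  have h1 : a (v - t • x) ∈ degreeFiltration δ u' 1 := by
    rw [hE]
    have : degreeFiltration δ (u.toBasis.map e) 1 = (degreeFiltration δ u 1).map (a : V →ₗ[ℂ] V) := by
      unfold degreeFiltration
      rw [Submodule.map_span, ← Set.image_comp]
      congr 1
    rw [this]
    exact ⟨_, hm, rfl⟩
  have h2 : a v - t • x' = a (v - t • x) + t • (a x - x') := by
    rw [map_sub, map_smul, smul_sub]; abel
  rw [h2]
  exact Submodule.add_mem _ h1 (Submodule.smul_mem _ _ hx')

end HermitianLie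

/-! ### The moment map and its minimal points. -/

open scoped InnerProductSpace

namespace HermitianLie

open NormedSpace Filter Topology

variable {V : Type*} [NormedAddCommGroup V] [InnerProductSpace ℂ V] (G : HermitianLie V)

/-- The moment map of the action of the adjoint group. -/
noncomputable def moment (v : V) : V := G.br (G.τ v) v

lemma τ_moment (v : V) : G.τ (G.moment v) = - G.moment v := by
  rw [moment, G.τ_br, G.τ_τ, G.skew]

/-- The property that makes `moment` a moment map: it represents the infinitesimal action paired
with `v`. -/
lemma inner_moment (y v : V) : ⟪y, G.moment v⟫_ℂ = ⟪G.br y v, v⟫_ℂ := by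
  rw [moment, G.inner_br_right, G.τ_τ, G.skew, inner_neg_left, neg_neg]

lemma br_selfAdjoint {y : V} (hy : G.τ y = -y) (v w : V) : ⟪G.br y v, w⟫_ℂ = ⟪v, G.br y w⟫_ℂ := by
  rw [G.inner_br, hy, map_neg, neg_apply, inner_neg_right, neg_neg]

lemma continuous_moment : Continuous G.moment :=
  (G.br.continuous.comp G.τ.continuous).clm_apply continuous_id

lemma moment_smul (a : ℂ) (v : V) : G.moment (a • v) = ((‖a‖ ^ 2 : ℝ) : ℂ) • G.moment v := by
  rw [moment, map_smulₛₗ G.τ, map_smul G.br, smul_apply, map_smul, smul_smul, ← moment]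
  congr 1
  rw [← Complex.normSq_eq_conj_mul_self, Complex.normSq_eq_norm_sq]

lemma norm_moment_le (v : V) : ‖G.moment v‖ ≤ (‖G.br‖ * ‖G.τ‖) * ‖v‖ ^ 2 := by
  have h1 := (G.br (G.τ v)).le_opNorm v
  have h2 := G.br.le_opNorm (G.τ v)
  have h3 := G.τ.le_opNorm v
  have h0 := norm_nonneg v
  calc ‖G.moment v‖ ≤ ‖G.br (G.τ v)‖ * ‖v‖ := h1
    _ ≤ (‖G.br‖ * (‖G.τ‖ * ‖v‖)) * ‖v‖ := by gcongr; exact h2.trans (by gcongr)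
    _ = _ := by ring

/-- If the moment vanished, so would the pairing of `v` with `[x, v]`, which is `∑ δ_i |v_i|²`; only
degrees at least one occur in `v`, so all `v_i` would vanish. -/
lemma moment_ne_zero {n : ℕ} {δ : Fin n → ℤ} {v : V} (hv : v ∈ G.cone δ 0) (hv0 : v ≠ 0) :
    G.moment v ≠ 0 := by
  obtain ⟨x, u, hA, hm⟩ := hv
  rw [zero_smul, sub_zero] at hm
  intro h0
  have h1 : ⟪v, G.br x v⟫_ℂ = 0 := by
    rw [← G.br_selfAdjoint hA.τ_eq, ← G.inner_moment, h0, inner_zero_right]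
  have h2 : ∀ i, ⟪u i, G.br x v⟫_ℂ = δ i * ⟪u i, v⟫_ℂ := by
    intro i
    rw [← G.br_selfAdjoint hA.τ_eq, hA.eigen, inner_smul_left, map_intCast]
  rw [← u.sum_inner_mul_inner] at h1
  have h3 : ∑ i, (δ i : ℝ) * ‖⟪u i, v⟫_ℂ‖ ^ 2 = 0 := by
    have h4 : ∀ i, ⟪v, u i⟫_ℂ * ⟪u i, G.br x v⟫_ℂ = (((δ i : ℝ) * ‖⟪u i, v⟫_ℂ‖ ^ 2 : ℝ) : ℂ) := by
      intro i
      rw [h2, ← inner_conj_symm v, mul_left_comm, ← Complex.normSq_eq_conj_mul_self,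
        Complex.normSq_eq_norm_sq]
      push_cast
      rfl
    simp only [h4] at h1
    exact_mod_cast h1
  have hz : ∀ i, δ i < 1 → ⟪u i, v⟫_ℂ = 0 := (mem_degreeFiltration_iff δ u _ _).mp hm
  have h5 := (Finset.sum_eq_zero_iff_of_nonneg (fun i _ => by
    by_cases hi : δ i < 1
    · rw [hz i hi]; simp
    · have : (1 : ℝ) ≤ δ i := by exact_mod_cast not_lt.mp hi
      positivity)).mp h3
  apply hv0
  rw [← u.sum_repr' v]
  refine Finset.sum_eq_zero fun i _ => ?_
  have : ⟪u i, v⟫_ℂ = 0 := by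
    by_cases hi : δ i < 1
    · exact hz i hi
    · have h6 := h5 i (Finset.mem_univ _)
      have : (δ i : ℝ) ≠ 0 := by
        have : δ i ≠ 0 := by omega
        exact_mod_cast this
      simpa [this] using h6
  rw [this, zero_smul]

variable [FiniteDimensional ℂ V] {n : ℕ} {δ : Fin n → ℤ}

/-- A nonzero element of the nilpotent cone minimizing the normalized moment map. -/
lemma exists_minimal_moment (hn : Module.finrank ℂ V = n) (h : ∃ v ∈ G.cone δ 0, v ≠ 0) :
    ∃ R ∈ G.cone δ 0, ‖R‖ = 1 ∧ ∀ v ∈ G.cone δ 0, ‖G.moment R‖ * ‖v‖ ^ 2 ≤ ‖G.moment v‖ := by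
  have := FiniteDimensional.proper ℂ V
  have hnorm : ∀ v ∈ G.cone δ 0, v ≠ 0 → ((‖v‖⁻¹ : ℝ) : ℂ) • v ∈ G.cone δ 0 ∩ Metric.sphere 0 1 := by
    intro v hv hv0
    have h1 := G.smul_mem_cone hv ((‖v‖⁻¹ : ℝ) : ℂ)
    rw [mul_zero] at h1
    refine ⟨h1, ?_⟩
    rw [mem_sphere_zero_iff_norm, norm_smul, Complex.norm_real, norm_inv, norm_norm,
      inv_mul_cancel₀ (norm_ne_zero_iff.mpr hv0)]
  have hcl : IsClosed (G.cone δ 0) := by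
    refine isClosed_of_closure_subset fun v hv => ?_
    obtain ⟨w, hw, hlim⟩ := mem_closure_iff_seq_limit.mp hv
    exact G.mem_cone_of_tendsto hn hw hlim tendsto_const_nhds
  have hK : IsCompact (G.cone δ 0 ∩ Metric.sphere (0 : V) 1) :=
    (isCompact_sphere (0 : V) 1).inter_left hcl
  obtain ⟨v, hv, hv0⟩ := h
  obtain ⟨R, hR, hmin⟩ := hK.exists_isMinOn ⟨_, hnorm v hv hv0⟩
    (f := fun v => ‖G.moment v‖) G.continuous_moment.norm.continuousOn
  refine ⟨R, hR.1, mem_sphere_zero_iff_norm.mp hR.2, fun v hv => ?_⟩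
  by_cases hv0 : v = 0
  · simp [hv0]
  · have h1 := hmin (hnorm v hv hv0)
    simp only [Set.mem_ofPred_eq, G.moment_smul, norm_smul, Complex.norm_real, norm_inv,
      norm_norm, norm_pow] at h1
    have h2 : 0 < ‖v‖ := norm_pos_iff.mpr hv0
    calc ‖G.moment R‖ * ‖v‖ ^ 2 ≤ (‖v‖⁻¹ ^ 2 * ‖G.moment v‖) * ‖v‖ ^ 2 := by gcongr
      _ = ‖G.moment v‖ := by field_simp

/-- The minimality is tested along the curve `exp(s ad H) R` with `H = moment R`. The first-order
condition gives `‖[H, R]‖ = ‖H‖²`, while the real part of the pairing of `[H, R]` with `R` is also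
`‖H‖²`. This is equality in Cauchy–Schwarz for the unit vector `R`. -/
lemma br_moment_of_minimal (hδ : Antitone δ) {R : V} (hR : R ∈ G.cone δ 0) (hR1 : ‖R‖ = 1)
    (hmin : ∀ v ∈ G.cone δ 0, ‖G.moment R‖ * ‖v‖ ^ 2 ≤ ‖G.moment v‖) :
    G.br (G.moment R) R = ((‖G.moment R‖ ^ 2 : ℝ) : ℂ) • R := by
  set H := G.moment R with hH
  have hτH : G.τ H = -H := G.τ_moment R
  set T := G.br H
  let _ : InnerProductSpace ℝ V := InnerProductSpace.complexToReal
  have hγ0 : exp (((0 : ℝ) : ℂ) • T) R = R := by simp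
  have hγ : HasDerivAt (fun s : ℝ => exp ((s : ℂ) • T) R) (T R) 0 := by
    have h1 := (hasDerivAt_exp_smul_apply T R 0).scomp_of_eq (0 : ℝ)
      (Complex.ofRealCLM.hasDerivAt (x := (0 : ℝ))) (by simp)
    rw [Complex.ofRealCLM_apply, Complex.ofReal_one, one_smul] at h1
    exact h1.congr_deriv (by simp)
  -- The curve has a real parameter, and `τ` is only conjugate linear.
  let τR : V →L[ℝ] V := AddMonoidHom.toRealLinearMap (G.τ : V →+ V) G.τ.continuous
  let brR : V →L[ℝ] V →L[ℝ] V := G.br.bilinearRestrictScalars ℝ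
  have hmom : HasDerivAt (fun s : ℝ => G.moment (exp ((s : ℂ) • T) R))
      (G.br (G.τ (T R)) R + G.br (G.τ R) (T R)) 0 := by
    have h1 : HasDerivAt (fun s : ℝ => τR (exp ((s : ℂ) • T) R)) (τR (T R)) 0 :=
      τR.hasFDerivAt.comp_hasDerivAt _ hγ
    have h2 : HasDerivAt (fun s : ℝ => brR (τR (exp ((s : ℂ) • T) R))) (brR (τR (T R))) 0 :=
      brR.hasFDerivAt.comp_hasDerivAt _ h1
    have h3 := h2.clm_apply hγ
    rw [hγ0] at h3
    exact h3
  -- The moment is homogeneous of degree two, so `‖moment‖²` is compared with the fourth power of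
  -- the norm. The difference is nonnegative on the cone and vanishes at `s = 0`.
  have hF : HasDerivAt (fun s : ℝ => ‖G.moment (exp ((s : ℂ) • T) R)‖ ^ 2 -
      ‖H‖ ^ 2 * (‖exp ((s : ℂ) • T) R‖ ^ 2) ^ 2) (4 * ‖T R‖ ^ 2 - ‖H‖ ^ 2 * (4 * ‖H‖ ^ 2)) 0 := by
    have h1 := hmom.norm_sq
    have h2 := hγ.norm_sq
    have h3 := h1.sub ((h2.pow 2).const_mul (‖H‖ ^ 2))
    refine h3.congr_deriv ?_
    rw [hγ0, hR1, ← hH]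
    have e1 : ⟪H, G.br (G.τ (T R)) R + G.br (G.τ R) (T R)⟫_ℝ = 2 * ‖T R‖ ^ 2 := by
      rw [real_inner_eq_re_inner ℂ, inner_add_right, G.inner_br_right, G.inner_br_right, G.τ_τ, G.τ_τ,
        G.skew (T R) H, G.skew R H, inner_neg_left, inner_neg_left, neg_neg, neg_neg,
        G.br_selfAdjoint hτH]
      change RCLike.re (⟪T R, T R⟫_ℂ + ⟪T R, T R⟫_ℂ) = _
      rw [map_add, inner_self_eq_norm_sq]
      ring
    have e2 : ⟪R, T R⟫_ℝ = ‖H‖ ^ 2 := by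
      rw [real_inner_eq_re_inner ℂ, ← G.br_selfAdjoint hτH, ← G.inner_moment, ← hH,
        inner_self_eq_norm_sq]
    rw [e1, e2]
    norm_num
    ring
  have hnonneg : IsLocalMin (fun s : ℝ => ‖G.moment (exp ((s : ℂ) • T) R)‖ ^ 2 -
      ‖H‖ ^ 2 * (‖exp ((s : ℂ) • T) R‖ ^ 2) ^ 2) 0 := by
    refine Eventually.of_forall fun s => ?_
    simp only [hγ0, hR1, ← hH]
    have h1 : exp ((s : ℂ) • T) R ∈ G.cone δ 0 := by
      have := G.exp_mem_cone hδ hR ((s : ℂ) • H)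
      rwa [map_smul] at this
    have h2 := hmin _ h1
    have h3 := pow_le_pow_left₀ (by positivity) h2 2
    rw [mul_pow] at h3
    linarith
  have h0 := hnonneg.hasDerivAt_eq_zero hF
  have hTR : ‖T R‖ ^ 2 = (‖H‖ ^ 2) ^ 2 := by nlinarith
  have e2 : RCLike.re ⟪T R, R⟫_ℂ = ‖H‖ ^ 2 := by
    rw [← G.inner_moment, ← hH, inner_self_eq_norm_sq]
  rw [← sub_eq_zero, ← norm_eq_zero, ← sq_eq_zero_iff, norm_sub_sq (𝕜 := ℂ), hTR, inner_smul_right,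
    norm_smul, hR1, Complex.norm_real, mul_one]
  have e3 : RCLike.re (((‖H‖ ^ 2 : ℝ) : ℂ) * ⟪T R, R⟫_ℂ) = ‖H‖ ^ 2 * ‖H‖ ^ 2 := by
    rw [← e2]
    exact RCLike.re_ofReal_mul (K := ℂ) _ _
  rw [e3, norm_pow, norm_norm]
  ring

/-- Existence of a point of the nilpotent cone with an isolated transversal slice. -/
theorem exists_isolated (hδ : Antitone δ) (hn : Module.finrank ℂ V = n)
    (h : ∃ v ∈ G.cone δ 0, v ≠ 0) :
    ∃ R ∈ G.cone δ 0, ∃ (H : V) (c ε : ℝ), R ≠ 0 ∧ 0 < c ∧ 0 < ε ∧ G.τ H = -H ∧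
      G.br H R = (c : ℂ) • R ∧
      (∀ s, G.br (G.τ R) s = 0 → G.br (G.τ R) (G.br H s) = 0 ∧ RCLike.re ⟪G.br H s, s⟫_ℂ ≤ 0) ∧
      (∀ s, G.br (G.τ R) s = 0 → ‖s‖ = ε → R + s ∉ G.cone δ 0) := by
  obtain ⟨R, hR, hR1, hmin⟩ := G.exists_minimal_moment hn h
  have hbr := G.br_moment_of_minimal hδ hR hR1 hmin
  have hR0 : R ≠ 0 := by rintro rfl; simp at hR1
  set H := G.moment R with hH
  have hH0 : 0 < ‖H‖ := norm_pos_iff.mpr (G.moment_ne_zero hR hR0)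
  have hτH : G.τ H = -H := G.τ_moment R
  have hc : 0 < ‖H‖ ^ 2 := by positivity
  -- On the slice, `[H, s] = [[τR, R], s] = [τR, [R, s]]`, and `ad (τ R)` is minus the adjoint of
  -- `ad R`.
  have hneg : ∀ s, G.br (G.τ R) s = 0 → ⟪G.br H s, s⟫_ℂ = - ((‖G.br R s‖ ^ 2 : ℝ) : ℂ) := by
    intro s hs
    have h1 : G.br H s = G.br (G.τ R) (G.br R s) := by
      rw [G.leibniz, hs, map_zero, add_zero, hH, moment]
    rw [h1, G.inner_br, G.τ_τ, inner_self_eq_norm_sq_to_K]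
    simp
  set C := ‖G.br‖ * ‖G.τ‖
  have hC : 0 ≤ C := by positivity
  -- The radius is chosen so that `C ‖s‖ ≤ ‖H‖`, where `C` bounds the moment by `‖moment s‖ ≤ C
  -- ‖s‖²`; the `+ 1` avoids division by zero.
  refine ⟨R, hR, H, ‖H‖ ^ 2, ‖H‖ / (C + 1), hR0, hc, by positivity, hτH, hbr, fun s hs => ⟨?_, ?_⟩, ?_⟩
  · have h1 : G.br (G.τ R) H = ((‖H‖ ^ 2 : ℝ) : ℂ) • G.τ R := by
      have := congrArg G.τ hbr
      rw [G.τ_br, hτH, map_smulₛₗ, Complex.conj_ofReal, map_neg, neg_apply, ← G.skew] at this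
      exact this
    rw [G.leibniz, h1, map_smul, smul_apply, hs, map_zero, smul_zero, add_zero]
  · rw [hneg s hs, map_neg, neg_nonpos]
    exact (sq_nonneg ‖G.br R s‖).trans_eq (Complex.ofReal_re _).symm
  · intro s hs hsε hmem
    have hs0 : 0 < ‖s‖ := by rw [hsε]; positivity
    -- The cross terms `[τR, s]` and `[τs, R]` vanish; the latter is `τ` of the former up to sign.
    have h1 : G.moment (R + s) = H + G.moment s := by
      have h2 : G.br (G.τ s) R = 0 := by
        have := congrArg G.τ hs
        rw [G.τ_br, G.τ_τ, map_zero, G.skew, neg_eq_zero] at this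
        exact this
      simp only [moment, map_add, add_apply, hs, h2, add_zero, zero_add, hH]
    have horth : ⟪R, s⟫_ℂ = 0 := by
      have h3 : ⟪G.br H R, s⟫_ℂ = 0 := by
        rw [G.skew, inner_neg_left, G.inner_br, hs, inner_zero_right, neg_zero, neg_zero]
      rw [hbr, inner_smul_left] at h3
      refine (mul_eq_zero.mp h3).resolve_left ?_
      rw [Complex.conj_ofReal]
      exact_mod_cast hc.ne'
    have h4 := hmin _ hmem
    have h5 : ‖R + s‖ ^ 2 = 1 + ‖s‖ ^ 2 := by
      rw [norm_add_sq (𝕜 := ℂ), horth, hR1]; simp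
    -- The cross term is the pairing of `[H, s]` with `s`, hence nonpositive. Minimality would
    -- instead give at least `‖H‖² (1 + ‖s‖²)²`, too large for this radius.
    have h6 : ‖G.moment (R + s)‖ ^ 2 ≤ ‖H‖ ^ 2 + ‖G.moment s‖ ^ 2 := by
      rw [h1, norm_add_sq (𝕜 := ℂ), G.inner_moment, hneg s hs, map_neg]
      have : (0 : ℝ) ≤ RCLike.re (((‖G.br R s‖ ^ 2 : ℝ) : ℂ)) := by
        exact (sq_nonneg ‖G.br R s‖).trans_eq (Complex.ofReal_re _).symm
      linarith
    have h7 := G.norm_moment_le s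
    rw [h5] at h4
    have h8 : ‖H‖ * (1 + ‖s‖ ^ 2) ≥ 0 := by positivity
    have h9 := pow_le_pow_left₀ h8 h4 2
    have h10 : ‖G.moment s‖ ^ 2 ≤ (C * ‖s‖ ^ 2) ^ 2 := pow_le_pow_left₀ (norm_nonneg _) h7 2
    have h11 : (C + 1) * ‖s‖ = ‖H‖ := by rw [hsε]; field_simp
    have h12 : C * ‖s‖ ≤ ‖H‖ := by rw [← h11]; nlinarith
    have h13 : (C * ‖s‖) ^ 2 ≤ ‖H‖ ^ 2 := pow_le_pow_left₀ (by positivity) h12 2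
    have h14 : (C * ‖s‖ ^ 2) ^ 2 ≤ ‖H‖ ^ 2 * ‖s‖ ^ 2 := by
      calc (C * ‖s‖ ^ 2) ^ 2 = (C * ‖s‖) ^ 2 * ‖s‖ ^ 2 := by ring
        _ ≤ _ := by gcongr
    have h15 : 0 < ‖H‖ ^ 2 * ‖s‖ ^ 2 := by positivity
    nlinarith [sq_nonneg (‖H‖ * ‖s‖ ^ 2)]

end HermitianLie

/-! ### Holomorphic curves in transversal slices. -/

open scoped InnerProductSpace

namespace HermitianLie

open NormedSpace Filter Topology

variable {V : Type*} [NormedAddCommGroup V] [InnerProductSpace ℂ V] (G : HermitianLie V)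
  [FiniteDimensional ℂ V]

lemma contDiff_exp : ContDiff ℂ 1 (fun T : V →L[ℂ] V => exp T) := by
  have := FiniteDimensional.complete ℂ V
  exact contDiff_iff_contDiffAt.mpr fun T => (NormedSpace.exp_analytic (𝕂 := ℂ) T).contDiffAt

lemma contDiff_exp_br : ContDiff ℂ 1 (fun p : V × V => exp (G.br p.1) p.2) :=
  (contDiff_exp.comp (G.br.contDiff.comp contDiff_fst)).clm_apply contDiff_snd

lemma hasFDerivAt_exp_br (v : V) : HasFDerivAt (fun p : V × V => exp (G.br p.1) p.2)
    ((G.br.flip v).comp (ContinuousLinearMap.fst ℂ V V) + ContinuousLinearMap.snd ℂ V V) (0, v) := by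
  have := FiniteDimensional.complete ℂ V
  have h1 : HasFDerivAt (fun p : V × V => G.br p.1) (G.br.comp (ContinuousLinearMap.fst ℂ V V)) (0, v) :=
    (G.br.comp (ContinuousLinearMap.fst ℂ V V)).hasFDerivAt
  have h2 : HasFDerivAt (exp : (V →L[ℂ] V) → V →L[ℂ] V) (1 : (V →L[ℂ] V) →L[ℂ] V →L[ℂ] V)
      (G.br (0, v).1) := by
    simpa using hasFDerivAt_exp_zero (𝕂 := ℂ) (𝔸 := V →L[ℂ] V)
  have h3 := (h2.comp (0, v) h1).clm_apply (hasFDerivAt_snd (𝕜 := ℂ) (E := V) (F := V))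
  refine h3.congr_fderiv ?_
  ext p <;> simp

/-- Curves in a slice transversal to the orbits of the adjoint group. -/
lemma exists_curve {F : Type*} [NormedAddCommGroup F] [NormedSpace ℂ F] [FiniteDimensional ℂ F]
    (P : V →L[ℂ] F) {v c' : V} (hA : ∀ z, ∃ y, P (G.br y v) = z) {c : ℂ → V}
    (hc : ContDiff ℂ 1 c) (h0 : c 0 = v) (hc' : HasDerivAt c c' 0) :
    ∃ y : ℂ → V, y 0 = 0 ∧
      (∀ᶠ t in 𝓝 0, DifferentiableAt ℂ y t ∧ P (exp (G.br (y t)) (c t)) = P v) ∧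
      (P c' = 0 → HasDerivAt y 0 0) := by
  have := FiniteDimensional.complete ℂ F
  -- Restricting the group parameter to the image of a right inverse of `y ↦ P [y, v]` makes the
  -- partial derivative the identity, so the implicit function theorem applies.
  obtain ⟨B, hB⟩ := LinearMap.exists_rightInverse_of_surjective
    (P.comp (G.br.flip v) : V →L[ℂ] F).toLinearMap (LinearMap.range_eq_top.mpr fun z => hA z)
  have hB' : ∀ z, P (G.br (B z) v) = z := fun z => LinearMap.congr_fun hB z
  set B' : F →L[ℂ] V := LinearMap.toContinuousLinearMap B with hB'def
  set g : ℂ × F → F := fun p => P (exp (G.br (B' p.2)) (c p.1)) with hg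
  have hgC : ContDiff ℂ 1 g := by
    refine P.contDiff.comp (G.contDiff_exp_br.comp (ContDiff.prodMk ?_ ?_))
    · exact B'.contDiff.comp contDiff_snd
    · exact hc.comp contDiff_fst
  have hgd : HasFDerivAt g (P.comp (((G.br.flip v).comp (B'.comp (ContinuousLinearMap.snd ℂ ℂ F))) +
      (ContinuousLinearMap.toSpanSingleton ℂ c').comp (ContinuousLinearMap.fst ℂ ℂ F)))
      (0, 0) := by
    have hcf : HasFDerivAt c (ContinuousLinearMap.toSpanSingleton ℂ c') ((0 : ℂ), (0 : F)).1 :=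
      hc'.hasFDerivAt
    have h1 : HasFDerivAt (fun p : ℂ × F => (B' p.2, c p.1))
        ((B'.comp (ContinuousLinearMap.snd ℂ ℂ F)).prod
        ((ContinuousLinearMap.toSpanSingleton ℂ c').comp (ContinuousLinearMap.fst ℂ ℂ F)))
        ((0 : ℂ), (0 : F)) :=
      HasFDerivAt.prodMk ((B'.comp (ContinuousLinearMap.snd ℂ ℂ F)).hasFDerivAt)
        (hcf.comp ((0 : ℂ), (0 : F)) hasFDerivAt_fst)
    have h2 : HasFDerivAt (fun p : V × V => exp (G.br p.1) p.2)
      ((G.br.flip v).comp (ContinuousLinearMap.fst ℂ V V) + ContinuousLinearMap.snd ℂ V V)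
      (B' (0 : F), c 0) := by rw [map_zero, h0]; exact G.hasFDerivAt_exp_br v
    have h3 := P.hasFDerivAt.comp ((0 : ℂ), (0 : F)) (HasFDerivAt.comp ((0 : ℂ), (0 : F)) h2 h1)
    refine h3.congr_fderiv ?_
    ext <;> simp
  have hid : fderiv ℂ g (0, 0) ∘L .inr ℂ ℂ F = ContinuousLinearMap.id ℂ F := by
    rw [hgd.fderiv]
    ext z
    simpa [hB'def] using hB' z
  have hinv : (fderiv ℂ g (0, 0) ∘L .inr ℂ ℂ F).IsInvertible := by
    rw [hid]; exact ⟨ContinuousLinearEquiv.refl ℂ F, rfl⟩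
  have hg0 : ContDiffAt ℂ 1 g (0, 0) := hgC.contDiffAt
  set ψ := hg0.implicitFunction one_ne_zero hinv with hψ
  have hψ0 : ψ 0 = 0 := hg0.implicitFunction_apply_self one_ne_zero hinv
  have hψ1 : ContDiffAt ℂ 1 ψ 0 := hg0.contDiffAt_implicitFunction one_ne_zero hinv
  have hψ2 : ∀ᶠ t in 𝓝 (0 : ℂ), g (t, ψ t) = g (0, 0) :=
    hg0.eventually_apply_implicitFunction one_ne_zero hinv
  have hψ3 : ∀ᶠ t in 𝓝 (0 : ℂ), DifferentiableAt ℂ ψ t :=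
    (hψ1.eventually (by simp)).mono fun t ht => ht.differentiableAt one_ne_zero
  refine ⟨fun t => B' (ψ t), by simp [hψ0], ?_, fun hPc => ?_⟩
  · filter_upwards [hψ2, hψ3] with t h2 h3
    refine ⟨B'.differentiableAt.comp t h3, ?_⟩
    have : g (t, ψ t) = P (exp (G.br (B' (ψ t))) (c t)) := rfl
    rw [← this, h2]
    simp [hg, h0]
  · have h4 : HasDerivAt ψ 0 0 := by
      have := (hg0.hasStrictFDerivAt_implicitFunction one_ne_zero hinv).hasFDerivAt.hasDerivAt
      refine this.congr_deriv ?_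
      rw [hid, hgd.fderiv]
      simp [hPc]
    have := B'.hasFDerivAt.comp_hasDerivAt (0 : ℂ) h4
    rw [map_zero] at this
    exact this

end HermitianLie

/-! ### The contracted slice. -/

open scoped InnerProductSpace

namespace HermitianLie

open NormedSpace Filter Topology

variable {V : Type*} [NormedAddCommGroup V] [InnerProductSpace ℂ V] (G : HermitianLie V)

lemma exp_apply_of_eigen [FiniteDimensional ℂ V] {T : V →L[ℂ] V} {w : V} {a : ℂ} (h : T w = a • w) :
    exp T w = Complex.exp a • w := by
  have hF : ∀ s : ℂ, HasDerivAt (fun s : ℂ => exp (s • (-T)) (Complex.exp (s * a) • w)) 0 s := by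
    intro s
    have := FiniteDimensional.complete ℂ V
    have h3 := hasDerivAt_exp_smul_const (𝕂 := ℂ) (-T) s
    have h4 : HasDerivAt (fun s : ℂ => Complex.exp (s * a) • w) ((Complex.exp (s * a) * a) • w) s :=
      ((hasDerivAt_mul_const a).cexp).smul_const w
    have h5 := h3.clm_apply h4
    convert h5 using 1
    simp [h, smul_smul]
  have h := is_const_of_deriv_eq_zero (fun s => (hF s).differentiableAt) (fun s => (hF s).deriv) 1 0
  simp only [one_smul, zero_smul, NormedSpace.exp_zero, one_apply_eq_self, one_mul, zero_mul,
    Complex.exp_zero] at h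
  have h2 := congrArg (fun x => (exp T : V →L[ℂ] V) x) h
  rwa [exp_comp_exp_neg, eq_comm] at h2

/-- The centralizer of `τ R`, which is orthogonal to the tangent space of the orbit of `R`. -/
noncomputable def slice (R : V) : Submodule ℂ V := LinearMap.ker (G.br (G.τ R) : V →ₗ[ℂ] V)

lemma mem_slice {R s : V} : s ∈ G.slice R ↔ G.br (G.τ R) s = 0 := Iff.rfl

/-- `H` generates a contraction of the slice through `R`. -/
structure Contracts (H R : V) (c : ℝ) : Prop where
  pos : 0 < c
  τ_eq : G.τ H = -H
  br_eq : G.br H R = (c : ℂ) • R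
  mem : ∀ s ∈ G.slice R, G.br H s ∈ G.slice R
  nonpos : ∀ s ∈ G.slice R, RCLike.re ⟪G.br H s, s⟫_ℂ ≤ 0

variable [FiniteDimensional ℂ V] {G} {H R : V} {c : ℝ}

/-- The automorphism `exp(u ad H)` only rescales `τ R`, so it preserves the centralizer of `τ R`. -/
lemma Contracts.exp_mem (h : G.Contracts H R c) (u : ℝ) {s : V} (hs : s ∈ G.slice R) :
    exp ((u : ℂ) • G.br H) s ∈ G.slice R := by
  have h1 : G.br H (G.τ R) = (-c : ℂ) • G.τ R := by
    have := congrArg G.τ h.br_eq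
    rw [G.τ_br, h.τ_eq, map_smulₛₗ, Complex.conj_ofReal, map_neg, neg_apply] at this
    rw [neg_smul, ← this, neg_neg]
  have h2 : ((u : ℂ) • G.br H) (G.τ R) = ((u : ℂ) * (-c : ℂ)) • G.τ R := by
    rw [smul_apply, h1, smul_smul]
  have h3 : G.br (exp ((u : ℂ) • G.br H) (G.τ R)) (exp ((u : ℂ) • G.br H) s) = 0 := by
    rw [← map_smul G.br, ← G.exp_br, G.mem_slice.mp hs, map_zero]
  rw [exp_apply_of_eigen h2, map_smul, smul_apply] at h3
  exact (smul_eq_zero.mp h3).resolve_left (Complex.exp_ne_zero _)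

lemma Contracts.norm_exp_le (h : G.Contracts H R c) {u : ℝ} (hu : 0 ≤ u) {s : V}
    (hs : s ∈ G.slice R) : ‖exp ((u : ℂ) • G.br H) s‖ ≤ ‖s‖ := by
  let _ : InnerProductSpace ℝ V := InnerProductSpace.complexToReal
  set T := G.br H
  have hγ : ∀ u : ℝ, HasDerivAt (fun u : ℝ => exp ((u : ℂ) • T) s) (T (exp ((u : ℂ) • T) s)) u := by
    intro u
    have h1 := (hasDerivAt_exp_smul_apply T s u).scomp (u : ℝ)
      (Complex.ofRealCLM.hasDerivAt (x := u))
    rw [Complex.ofRealCLM_apply, Complex.ofReal_one, one_smul] at h1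
    exact h1
  have hanti : Antitone (fun u : ℝ => ‖exp ((u : ℂ) • T) s‖ ^ 2) := by
    refine antitone_of_hasDerivAt_nonpos (fun u => (hγ u).norm_sq) fun u => ?_
    have h1 := h.nonpos _ (h.exp_mem u hs)
    rw [Pi.zero_apply]
    refine mul_nonpos_of_nonneg_of_nonpos zero_le_two ?_
    rw [real_inner_comm, real_inner_eq_re_inner ℂ]
    exact h1
  have h2 := hanti hu
  simp only [Complex.ofReal_zero, zero_smul, NormedSpace.exp_zero, one_apply_eq_self] at h2
  exact le_of_sq_le_sq h2 (norm_nonneg _)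

lemma norm_exp_le_exp_norm (T : V →L[ℂ] V) : ‖exp T‖ ≤ Real.exp ‖T‖ := by
  have := FiniteDimensional.complete ℂ V
  have h1 : Summable fun k : ℕ => ‖((k.factorial : ℂ)⁻¹) • T ^ k‖ := norm_expSeries_summable' T
  have h2 : Summable fun k : ℕ => ((k.factorial : ℝ)⁻¹) • ‖T‖ ^ k := expSeries_summable' ‖T‖
  rw [exp_eq_tsum ℂ, Real.exp_eq_exp_ℝ, exp_eq_tsum ℝ]
  refine (norm_tsum_le_tsum_norm h1).trans (h1.tsum_le_tsum (fun k => ?_) h2)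
  rw [norm_smul, norm_inv, RCLike.norm_natCast, smul_eq_mul]
  gcongr
  rcases Nat.eq_zero_or_pos k with rfl | hk
  · rw [pow_zero, pow_zero]
    exact ContinuousLinearMap.norm_id_le
  · exact norm_pow_le' T hk

lemma le_norm_exp_smul (T : V →L[ℂ] V) {u : ℝ} (hu : 0 ≤ u) (s : V) :
    Real.exp (-(u * ‖T‖)) * ‖s‖ ≤ ‖exp ((u : ℂ) • T) s‖ := by
  have := FiniteDimensional.complete ℂ V
  set A := (u : ℂ) • T
  have hA : ‖-A‖ = u * ‖T‖ := by rw [norm_neg, norm_smul, Complex.norm_real, Real.norm_of_nonneg hu]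
  have h1 : ‖exp (-A)‖ ≤ Real.exp (u * ‖T‖) := by
    rw [← hA]
    exact norm_exp_le_exp_norm _
  have h2 : ‖s‖ ≤ Real.exp (u * ‖T‖) * ‖exp A s‖ := by
    conv_lhs => rw [← exp_neg_comp_exp A s]
    exact ((exp (-A)).le_opNorm _).trans (by gcongr)
  calc _ ≤ Real.exp (-(u * ‖T‖)) * (Real.exp (u * ‖T‖) * ‖exp A s‖) := by gcongr
    _ = _ := by rw [← mul_assoc, ← Real.exp_add, neg_add_cancel, Real.exp_zero, one_mul]

/-- The contraction of the slice through `R`. -/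
noncomputable def contraction (G : HermitianLie V) (H : V) (c u : ℝ) : V →L[ℂ] V :=
  (Real.exp (-(c * u)) : ℂ) • exp ((u : ℂ) • G.br H)

lemma contraction_apply (u : ℝ) (s : V) : contraction G H c u s =
    (Real.exp (-(c * u)) : ℂ) • exp ((u : ℂ) • G.br H) s := rfl

/-- Inner automorphisms fix the level and scalars multiply it, so the contraction moves level one
towards level zero. -/
lemma contraction_mem_cone {n : ℕ} {δ : Fin n → ℤ} (hδ : Antitone δ) {t : ℂ} {v : V}
    (hv : v ∈ G.cone δ t) (u : ℝ) :
    contraction G H c u v ∈ G.cone δ ((Real.exp (-(c * u)) : ℂ) * t) := by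
  have := G.exp_mem_cone hδ hv ((u : ℂ) • H)
  rw [map_smul] at this
  exact G.smul_mem_cone this _

/-- The scalar `e^{-cu}` was chosen to cancel the eigenvalue `e^{cu}` on `R`. -/
lemma Contracts.contraction_self (h : G.Contracts H R c) (u : ℝ) : contraction G H c u R = R := by
  have h2 : ((u : ℂ) • G.br H) R = ((u : ℂ) * (c : ℂ)) • R := by
    rw [smul_apply, h.br_eq, smul_smul]
  rw [contraction_apply, exp_apply_of_eigen h2, smul_smul, Complex.ofReal_exp, ← Complex.exp_add]
  push_cast
  rw [show -(c * u : ℂ) + u * c = 0 by ring, Complex.exp_zero, one_smul]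

lemma Contracts.contraction_mem (h : G.Contracts H R c) (u : ℝ) {s : V} (hs : s ∈ G.slice R) :
    contraction G H c u s ∈ G.slice R :=
  Submodule.smul_mem _ _ (h.exp_mem u hs)

lemma Contracts.norm_contraction_le (h : G.Contracts H R c) {u : ℝ} (hu : 0 ≤ u) {s : V}
    (hs : s ∈ G.slice R) : ‖contraction G H c u s‖ ≤ Real.exp (-(c * u)) * ‖s‖ := by
  rw [contraction_apply, norm_smul, Complex.norm_real, Real.norm_of_nonneg (Real.exp_nonneg _)]
  gcongr
  exact h.norm_exp_le hu hs

/-- The contraction is not arbitrarily fast: a long vector needs a long time to reach a given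
sphere. -/
lemma le_norm_contraction {u : ℝ} (hu : 0 ≤ u) (s : V) :
    Real.exp (-((c + ‖G.br H‖) * u)) * ‖s‖ ≤ ‖contraction G H c u s‖ := by
  rw [contraction_apply, norm_smul, Complex.norm_real, Real.norm_of_nonneg (Real.exp_nonneg _)]
  calc _ = Real.exp (-(c * u)) * (Real.exp (-(u * ‖G.br H‖)) * ‖s‖) := by
        rw [← mul_assoc, ← Real.exp_add]; ring_nf
    _ ≤ _ := by gcongr; exact le_norm_exp_smul _ hu s

lemma continuous_contraction (s : V) : Continuous fun u : ℝ => contraction G H c u s := by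
  refine Continuous.smul (by fun_prop) ?_
  have h1 : Continuous fun u : ℝ => exp ((u : ℂ) • G.br H) :=
    contDiff_exp.continuous.comp (by fun_prop)
  exact h1.clm_apply continuous_const

variable {n : ℕ} {δ : Fin n → ℤ}

/-- The elements of the cone of level one in an isolated slice are bounded. -/
lemma Contracts.bounded (h : G.Contracts H R c) (hδ : Antitone δ) (hn : Module.finrank ℂ V = n)
    {ε : ℝ} (hε : 0 < ε) (hiso : ∀ s ∈ G.slice R, ‖s‖ = ε → R + s ∉ G.cone δ 0) :
    ∃ K : ℝ, ∀ s ∈ G.slice R, R + s ∈ G.cone δ 1 → ‖s‖ ≤ K := by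
  have := FiniteDimensional.proper ℂ V
  by_contra! hcon
  set b := c + ‖G.br H‖
  have hb : 0 < b := add_pos_of_pos_of_nonneg h.pos (norm_nonneg _)
  have key : ∀ k : ℕ, ∃ (s : V) (u : ℝ), s ∈ G.slice R ∧ ‖s‖ = ε ∧ (k : ℝ) ≤ u ∧
      R + s ∈ G.cone δ (Real.exp (-(c * u)) : ℂ) := by
    intro k
    -- A vector this long is still outside the sphere of radius `ε` at time `k`. It crosses the
    -- sphere at some time `u ≥ k`, at level `e^{-cu}`; a limit of the crossing points violates
    -- isolation at level zero.
    obtain ⟨s, hs, hsc, hsn⟩ := hcon (max 1 (ε * Real.exp (b * k)))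
    have hs1 : 1 < ‖s‖ := (le_max_left _ _).trans_lt hsn
    have hs2 : ε * Real.exp (b * k) < ‖s‖ := (le_max_right _ _).trans_lt hsn
    have hk : ε ≤ ‖contraction G H c k s‖ := by
      refine le_trans ?_ (le_norm_contraction (Nat.cast_nonneg k) s)
      calc ε = Real.exp (-(b * k)) * (ε * Real.exp (b * k)) := by
            rw [mul_left_comm, ← Real.exp_add, neg_add_cancel, Real.exp_zero, mul_one]
        _ ≤ _ := by gcongr
    have htend : Tendsto (fun u : ℝ => Real.exp (-(c * u)) * ‖s‖) atTop (𝓝 (0 * ‖s‖)) := by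
      refine Tendsto.mul_const _ (Real.tendsto_exp_neg_atTop_nhds_zero.comp ?_)
      exact tendsto_id.const_mul_atTop h.pos
    rw [zero_mul] at htend
    obtain ⟨u1, hu1, hu1k⟩ := ((htend.eventually (gt_mem_nhds hε)).and (eventually_ge_atTop (k : ℝ))).exists
    have hu10 : (0 : ℝ) ≤ u1 := (Nat.cast_nonneg k).trans hu1k
    have hle : ‖contraction G H c u1 s‖ ≤ ε := (h.norm_contraction_le hu10 hs).trans hu1.le
    obtain ⟨u, hu, hueq⟩ := intermediate_value_Icc' hu1k
      ((continuous_contraction (G := G) (H := H) (c := c) s).norm.continuousOn) ⟨hle, hk⟩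
    refine ⟨contraction G H c u s, u, h.contraction_mem u hs, hueq, hu.1, ?_⟩
    have h3 := contraction_mem_cone (H := H) (c := c) hδ hsc u
    rwa [map_add, h.contraction_self, mul_one] at h3
  choose s u hs hsε hu hcone using key
  obtain ⟨s0, hs0, φ, hφ, hlim⟩ := (isCompact_sphere (0 : V) ε).tendsto_subseq
    (x := s) (fun k => mem_sphere_zero_iff_norm.mpr (hsε k))
  refine hiso s0 ?_ (mem_sphere_zero_iff_norm.mp hs0) ?_
  · have hcl : IsClosed (G.slice R : Set V) := Submodule.closed_of_finiteDimensional _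
    exact hcl.mem_of_tendsto hlim (Eventually.of_forall fun k => hs _)
  · refine G.mem_cone_of_tendsto hn (fun k => hcone (φ k)) (hlim.const_add R) ?_
    have h1 : Tendsto u atTop atTop := tendsto_atTop_mono hu tendsto_natCast_atTop_atTop
    have h2 : Tendsto (fun k => Real.exp (-(c * u k))) atTop (𝓝 0) :=
      Real.tendsto_exp_neg_atTop_nhds_zero.comp (h1.const_mul_atTop h.pos)
    exact (Complex.continuous_ofReal.tendsto' 0 0 Complex.ofReal_zero).comp (h2.comp hφ.tendsto_atTop)

/-- Every point of a contracted slice is transversal to the slice. -/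
lemma Contracts.transversal (h : G.Contracts H R c) {s : V} (hs : s ∈ G.slice R) (z : V) :
    ∃ y, z - G.br y (R + s) ∈ G.slice R := by
  -- near the base point
  obtain ⟨κ, hκ, hκz⟩ : ∃ κ : ℝ, 0 < κ ∧ ∀ z ∈ (G.slice R)ᗮ, κ * ‖z‖ ≤ ‖G.br (G.τ R) z‖ := by
    have hker : LinearMap.ker ((G.br (G.τ R) : V →ₗ[ℂ] V).domRestrict (G.slice R)ᗮ) = ⊥ := by
      rw [LinearMap.ker_eq_bot']
      rintro ⟨z, hz⟩ hz0
      have h1 : z ∈ G.slice R := hz0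
      have h2 := Submodule.inner_right_of_mem_orthogonal h1 hz
      rw [inner_self_eq_zero] at h2
      exact Subtype.ext h2
    obtain ⟨K, hK, hanti⟩ := LinearMap.exists_antilipschitzWith _ hker
    refine ⟨(K : ℝ)⁻¹, by positivity, fun z hz => ?_⟩
    have h1 := hanti.le_mul_dist ⟨z, hz⟩ 0
    rw [map_zero, dist_zero_right, dist_zero_right] at h1
    have hK' : (0 : ℝ) < K := hK
    rw [inv_mul_le_iff₀ hK']
    exact h1
  have hnear : ∀ s ∈ G.slice R, ‖G.br‖ * ‖G.τ‖ * ‖s‖ < κ → ∀ z, ∃ y, z - G.br y (R + s) ∈ G.slice R := by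
    intro s hs hsκ z
    -- A vector orthogonal both to the tangent space of the orbit of `R + s` and to the slice is
    -- killed by `ad (τ (R + s))`, while `ad (τ R)` is bounded below there; for small `s` it must
    -- vanish.
    set W : Submodule ℂ V := LinearMap.range (G.br.flip (R + s) : V →ₗ[ℂ] V) ⊔ G.slice R with hW
    have hWtop : W = ⊤ := by
      rw [← Submodule.orthogonal_eq_bot_iff, Submodule.eq_bot_iff]
      intro w hw
      rw [hW, ← Submodule.inf_orthogonal] at hw
      have h1 : G.br (G.τ (R + s)) w = 0 := by
        refine ext_inner_left ℂ fun y => ?_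
        have h2 : ⟪G.br y (R + s), w⟫_ℂ = 0 :=
          Submodule.inner_right_of_mem_orthogonal (LinearMap.mem_range_self _ y) hw.1
        rw [G.skew, inner_neg_left, G.inner_br, neg_neg] at h2
        rw [h2, inner_zero_right]
      have h2 := hκz w hw.2
      have h3 : G.br (G.τ R) w = - G.br (G.τ s) w := by
        rw [map_add, map_add, add_apply] at h1
        exact eq_neg_of_add_eq_zero_left h1
      rw [h3, norm_neg] at h2
      have h4 : ‖G.br (G.τ s) w‖ ≤ ‖G.br‖ * ‖G.τ‖ * ‖s‖ * ‖w‖ := by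
        refine ((G.br (G.τ s)).le_opNorm w).trans ?_
        gcongr
        refine (G.br.le_opNorm _).trans ?_
        rw [mul_assoc]
        gcongr
        exact G.τ.le_opNorm s
      by_contra hw0
      have h5 : 0 < ‖w‖ := norm_pos_iff.mpr hw0
      nlinarith
    have hz : z ∈ W := hWtop ▸ Submodule.mem_top
    obtain ⟨_, ⟨y, rfl⟩, t, ht, hyt⟩ := Submodule.mem_sup.mp hz
    refine ⟨y, ?_⟩
    have : z - G.br y (R + s) = t := by rw [← hyt]; exact add_sub_cancel_left _ _
    rwa [this]
  -- The contraction moves the given point close to `R`; the transversality found there is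
  -- transported back by the inverse automorphism.
  obtain ⟨u, hu0, hu⟩ : ∃ u : ℝ, 0 ≤ u ∧ ‖G.br‖ * ‖G.τ‖ * ‖contraction G H c u s‖ < κ := by
    have htend : Tendsto (fun u : ℝ => ‖G.br‖ * ‖G.τ‖ * (Real.exp (-(c * u)) * ‖s‖)) atTop
        (𝓝 (‖G.br‖ * ‖G.τ‖ * (0 * ‖s‖))) := by
      refine Tendsto.const_mul _ (Tendsto.mul_const _ (Real.tendsto_exp_neg_atTop_nhds_zero.comp ?_))
      exact tendsto_id.const_mul_atTop h.pos
    rw [zero_mul, mul_zero] at htend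
    obtain ⟨u, hu, hu0⟩ := ((htend.eventually (gt_mem_nhds hκ)).and (eventually_ge_atTop 0)).exists
    refine ⟨u, hu0, lt_of_le_of_lt ?_ hu⟩
    gcongr
    exact h.norm_contraction_le hu0 hs
  set a := exp ((u : ℂ) • G.br H) with ha
  obtain ⟨y, hy⟩ := hnear _ (h.contraction_mem u hs) hu (a z)
  have h1 : R + contraction G H c u s = (Real.exp (-(c * u)) : ℂ) • a (R + s) := by
    conv_lhs => rw [← h.contraction_self u, ← map_add]
    rfl
  set a' := exp (((-u : ℝ) : ℂ) • G.br H) with ha'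
  have haa' : ∀ x, a' (a x) = x := by
    intro x
    rw [ha', ha, Complex.ofReal_neg, neg_smul, exp_neg_comp_exp]
  have ha'br : ∀ y w, a' (G.br y w) = G.br (a' y) (a' w) := by
    intro y w
    rw [ha', ← map_smul G.br]
    exact G.exp_br _ _ _
  have h2 := h.exp_mem (-u) hy
  rw [← ha', map_sub, h1, haa', ha'br, map_smul a', haa', map_smul (G.br _)] at h2
  refine ⟨(Real.exp (-(c * u)) : ℂ) • a' y, ?_⟩
  rwa [map_smul G.br, smul_apply]

end HermitianLie

/-! ### Rigid points by the maximum modulus principle. -/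

open scoped InnerProductSpace

namespace HermitianLie

open NormedSpace Filter Topology

variable {V : Type*} [NormedAddCommGroup V] [InnerProductSpace ℂ V] {G : HermitianLie V}
  [FiniteDimensional ℂ V] {H R : V} {c : ℝ} {n : ℕ} {δ : Fin n → ℤ}

/-- Curves through a point of a contracted slice that stay in the slice and are translates of a
given curve. -/
lemma Contracts.exists_slice_curve (h : G.Contracts H R c) {v c' : V} (hv : v - R ∈ G.slice R)
    {γ : ℂ → V} (hγ : ContDiff ℂ 1 γ) (h0 : γ 0 = v) (hγ' : HasDerivAt γ c' 0) :
    ∃ w y : ℂ → V, w 0 = v ∧ (∀ t, w t = exp (G.br (y t)) (γ t)) ∧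
      (∀ᶠ t in 𝓝 0, DifferentiableAt ℂ w t ∧ w t - R ∈ G.slice R) ∧
      (c' ∈ G.slice R → HasDerivAt w c' 0) := by
  set P := (G.slice R)ᗮ.orthogonalProjectionOnto with hP
  have hP0 : ∀ x, P x = 0 ↔ x ∈ G.slice R := by
    intro x
    rw [hP, Submodule.orthogonalProjectionOnto_eq_zero_iff, Submodule.orthogonal_orthogonal]
  -- `P` projects onto the orthogonal complement of the slice directions, so keeping `P` constant
  -- keeps the curve in the slice; transversality is the required surjectivity.
  obtain ⟨y, hy0, hy, hy'⟩ := G.exists_curve P (v := v) (fun z => by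
    obtain ⟨y, hy⟩ := h.transversal hv z
    rw [add_sub_cancel, ← hP0, map_sub, sub_eq_zero] at hy
    refine ⟨y, ?_⟩
    rw [← hy, hP, Submodule.orthogonalProjectionOnto_mem_subspace_eq_self]) hγ h0 hγ'
  have hw : ∀ t, DifferentiableAt ℂ y t → DifferentiableAt ℂ (fun t => exp (G.br (y t)) (γ t)) t := by
    intro t ht
    have h1 : DifferentiableAt ℂ (fun t => (y t, γ t)) t :=
      ht.prodMk (hγ.differentiable one_ne_zero t)
    exact (G.contDiff_exp_br.differentiable one_ne_zero (y t, γ t)).comp t h1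
  refine ⟨fun t => exp (G.br (y t)) (γ t), y, ?_, fun t => rfl, ?_, fun hc' => ?_⟩
  · simp [hy0, h0]
  · filter_upwards [hy] with t ht
    refine ⟨hw t ht.1, ?_⟩
    rw [← hP0, map_sub, ht.2, ← map_sub, hP0]
    exact hv
  · have h1 : HasDerivAt (fun t => (y t, γ t)) (0, c') 0 :=
      (hy' ((hP0 _).mpr hc')).prodMk hγ'
    have h2 : HasFDerivAt (fun p : V × V => exp (G.br p.1) p.2)
      ((G.br.flip v).comp (ContinuousLinearMap.fst ℂ V V) + ContinuousLinearMap.snd ℂ V V)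
      (y 0, γ 0) := by rw [hy0, h0]; exact G.hasFDerivAt_exp_br v
    have h3 := h2.comp_hasDerivAt (0 : ℂ) h1
    exact h3.congr_deriv (by simp)

/-- The curve `R + t x` lies at level `t`. It is pushed into the slice by inner automorphisms for
small `t`, and for `t = e^{-cN}` the inverse contraction raises the level to one. -/
lemma Contracts.exists_mem_cone_one (h : G.Contracts H R c) (hδ : Antitone δ) (hR : R ∈ G.cone δ 0) :
    ∃ v ∈ G.cone δ 1, v - R ∈ G.slice R := by
  obtain ⟨x, u, hA, hm⟩ := hR
  rw [zero_smul, sub_zero] at hm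
  have hγ' : HasDerivAt (fun t : ℂ => R + t • x) x 0 := by
    simpa using ((hasDerivAt_id (0 : ℂ)).smul_const x).const_add R
  obtain ⟨w, y, -, hwy, hw, -⟩ := h.exists_slice_curve (v := R) (by simp) (γ := fun t : ℂ => R + t • x)
    (by fun_prop) (by simp) hγ'
  obtain ⟨r, hr, hball⟩ := Metric.eventually_nhds_iff.mp hw
  obtain ⟨N, hN, hN0⟩ : ∃ N : ℝ, Real.exp (-(c * N)) < r ∧ 0 ≤ N := by
    have htend : Tendsto (fun u : ℝ => Real.exp (-(c * u))) atTop (𝓝 0) :=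
      Real.tendsto_exp_neg_atTop_nhds_zero.comp (tendsto_id.const_mul_atTop h.pos)
    exact ((htend.eventually (gt_mem_nhds hr)).and (eventually_ge_atTop 0)).exists
  set t : ℂ := (Real.exp (-(c * N)) : ℂ)
  have ht : dist t 0 < r := by
    rw [dist_zero_right, Complex.norm_real, Real.norm_of_nonneg (Real.exp_nonneg _)]
    exact hN
  have h1 : w t ∈ G.cone δ t := by
    rw [hwy]
    refine G.exp_mem_cone hδ ⟨x, u, hA, ?_⟩ _
    rwa [add_sub_cancel_right]
  refine ⟨contraction G H c (-N) (w t), ?_, ?_⟩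
  · have h2 := contraction_mem_cone (H := H) (c := c) hδ h1 (-N)
    have h3 : (Real.exp (-(c * -N)) : ℂ) * t = 1 := by
      rw [← Complex.ofReal_mul, ← Real.exp_add]
      simp
    rwa [h3] at h2
  · have h2 := h.contraction_mem (-N) (hball ht).2
    rwa [map_sub, h.contraction_self] at h2

/-- A point of maximal norm in a bounded slice is infinitesimally rigid. -/
lemma Contracts.exists_rigid (h : G.Contracts H R c) (hδ : Antitone δ) (hn : Module.finrank ℂ V = n)
    (hR : R ∈ G.cone δ 0) {ε : ℝ} (hε : 0 < ε)
    (hiso : ∀ s ∈ G.slice R, ‖s‖ = ε → R + s ∉ G.cone δ 0) :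
    ∃ v ∈ G.cone δ 1, v - R ∈ G.slice R ∧ ∀ k, G.br k v ∈ G.slice R → G.br k v = 0 := by
  have := FiniteDimensional.proper ℂ V
  let _ : InnerProductSpace ℝ V := InnerProductSpace.complexToReal
  have : StrictConvexSpace ℝ V := inferInstance
  obtain ⟨K, hK⟩ := h.bounded hδ hn hε hiso
  set M : Set V := {v | v ∈ G.cone δ 1 ∧ v - R ∈ G.slice R} with hM
  have hMc : IsCompact M := by
    refine Metric.isCompact_of_isClosed_isBounded ?_ ?_
    · refine isClosed_of_closure_subset fun v hv => ?_
      obtain ⟨w, hw, hlim⟩ := mem_closure_iff_seq_limit.mp hv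
      refine ⟨G.mem_cone_of_tendsto hn (fun k => (hw k).1) hlim tendsto_const_nhds, ?_⟩
      have hcl : IsClosed (G.slice R : Set V) := Submodule.closed_of_finiteDimensional _
      exact hcl.mem_of_tendsto (hlim.sub_const R) (Eventually.of_forall fun k => (hw k).2)
    · rw [isBounded_iff_forall_norm_le]
      refine ⟨‖R‖ + K, fun v hv => ?_⟩
      have h1 := hK (v - R) hv.2 (by rw [add_sub_cancel]; exact hv.1)
      calc ‖v‖ = ‖R + (v - R)‖ := by rw [add_sub_cancel]
        _ ≤ _ := (norm_add_le _ _).trans (by gcongr)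
  obtain ⟨v0, hv0⟩ := h.exists_mem_cone_one hδ hR
  -- If `[k, v]` is a slice direction, the curve `exp(t ad k) v` can be corrected to a holomorphic
  -- curve inside `M` with derivative `[k, v]` at zero. Its norm has a maximum there, so it is
  -- locally constant.
  obtain ⟨v, hv, hmax⟩ := hMc.exists_isMaxOn ⟨v0, hv0⟩ continuous_norm.continuousOn
  refine ⟨v, hv.1, hv.2, fun k hk => ?_⟩
  have hγ' : HasDerivAt (fun t : ℂ => exp (t • G.br k) v) (G.br k v) 0 := by
    simpa using hasDerivAt_exp_smul_apply (G.br k) v 0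
  have hγC : ContDiff ℂ 1 (fun t : ℂ => exp (t • G.br k) v) :=
    (contDiff_exp.comp (contDiff_id.smul contDiff_const)).clm_apply contDiff_const
  obtain ⟨w, y, hw0, hwy, hw, hw'⟩ := h.exists_slice_curve hv.2 hγC (by simp) hγ'
  have hwM : ∀ᶠ t in 𝓝 (0 : ℂ), w t ∈ M := by
    filter_upwards [hw] with t ht
    refine ⟨?_, ht.2⟩
    rw [hwy]
    refine G.exp_mem_cone hδ ?_ _
    rw [← map_smul G.br]
    exact G.exp_mem_cone hδ hv.1 _
  have hconst := Complex.eventually_eq_of_isLocalMax_norm (hw.mono fun t ht => ht.1) (by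
    filter_upwards [hwM] with t ht
    simpa [hw0] using hmax ht)
  have h1 := hw' hk
  have h2 : HasDerivAt w 0 0 := (hasDerivAt_const (0 : ℂ) (w 0)).congr_of_eventuallyEq hconst
  exact h1.unique h2

end HermitianLie

/-! ### Comparison of the dimensions in degrees zero and two. -/

open scoped InnerProductSpace

namespace HermitianLie

variable {V : Type*} [NormedAddCommGroup V] [InnerProductSpace ℂ V] {G : HermitianLie V}
  {n : ℕ} {δ : Fin n → ℤ}

lemma finrank_degreeFiltration (u : OrthonormalBasis (Fin n) ℂ V) (k : ℤ) :
    Module.finrank ℂ (degreeFiltration δ u k) = (Finset.univ.filter fun i => k ≤ δ i).card := by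
  classical
  unfold degreeFiltration
  have h1 : LinearIndependent ℂ fun i : {i | k ≤ δ i} => u i :=
    u.orthonormal.linearIndependent.comp _ Subtype.val_injective
  rw [Set.image_eq_range, finrank_span_eq_card h1, Fintype.card_subtype]
  rfl

lemma Adapted.br_mem {x : V} {u : OrthonormalBasis (Fin n) ℂ V} (h : G.Adapted δ x u) {k l : ℤ}
    {y z : V} (hy : y ∈ degreeFiltration δ u k) (hz : z ∈ degreeFiltration δ u l) :
    G.br y z ∈ degreeFiltration δ u (k + l) := by
  have h1 := G.br_mem_degreeFiltration (z := x) u.toBasis (fun i => by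
    rw [OrthonormalBasis.coe_toBasis]; exact h.eigen i) (k := k) (l := l) (x := y) (y := z)
  rw [OrthonormalBasis.coe_toBasis] at h1
  exact h1 hy hz

/-- The centralizer of an element of level one is no larger than the degree zero part. -/
lemma finrank_ker_br_le {v : V} [FiniteDimensional ℂ V] (hv : v ∈ G.cone δ 1) :
    Module.finrank ℂ (LinearMap.ker (G.br v : V →ₗ[ℂ] V)) ≤
      (Finset.univ.filter fun i => δ i = 0).card := by
  classical
  obtain ⟨x, u, hA, hm⟩ := hv
  rw [one_smul] at hm
  set F : V →ₗ[ℂ] ({i // δ i = 0} → ℂ) := LinearMap.pi fun i => (innerSL ℂ (u i) : V →ₗ[ℂ] ℂ) with hF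
  have hinj : LinearMap.ker (F.domRestrict (LinearMap.ker (G.br v : V →ₗ[ℂ] V))) = ⊥ := by
    rw [LinearMap.ker_eq_bot']
    rintro ⟨y, hy⟩ hy0
    have hy1 : ∀ i, δ i = 0 → ⟪u i, y⟫_ℂ = 0 := fun i hi => congrFun hy0 ⟨i, hi⟩
    have hy2 : G.br v y = 0 := hy
    by_contra hne
    have hne' : y ≠ 0 := fun h => hne (Subtype.ext h)
    have hex : ∃ i, ⟪u i, y⟫_ℂ ≠ 0 := by
      by_contra! hall
      apply hne'
      rw [← u.sum_repr' y]
      exact Finset.sum_eq_zero fun i _ => by rw [hall i, zero_smul]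
    -- Modulo higher degrees the element acts on the lowest component of `y` by multiplication by
    -- its degree, so that degree is zero. Hence the degree-zero coordinates determine an element of
    -- the kernel.
    obtain ⟨i, hi, hmin⟩ := Finset.exists_min_image
      (Finset.univ.filter fun i => ⟪u i, y⟫_ℂ ≠ 0) δ (by
        obtain ⟨i, hi⟩ := hex
        exact ⟨i, by simpa using hi⟩)
    have hi' : ⟪u i, y⟫_ℂ ≠ 0 := by simpa using hi
    have hyE : y ∈ degreeFiltration δ u (δ i) := by
      rw [mem_degreeFiltration_iff]
      intro j hj
      by_contra hj0
      exact absurd (hmin j (by simpa using hj0)) (not_le.mpr hj)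
    have h1 := (mem_degreeFiltration_iff δ u _ _).mp (hA.br_mem hm hyE) i (by omega)
    rw [map_sub, sub_apply, hy2, zero_sub, inner_neg_right, neg_eq_zero, ← G.br_selfAdjoint hA.τ_eq,
      hA.eigen, inner_smul_left, map_intCast] at h1
    have h2 : (δ i : ℂ) = 0 := (mul_eq_zero.mp h1).resolve_right hi'
    exact hi' (hy1 i (by exact_mod_cast h2))
  have h1 := LinearMap.finrank_le_finrank_of_injective (LinearMap.ker_eq_bot.mp hinj)
  rwa [Module.finrank_pi, Fintype.card_subtype] at h1

/-- The slice directions form the orthogonal complement of `[R, g]`. -/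
lemma finrank_slice (R : V) [FiniteDimensional ℂ V] :
    Module.finrank ℂ (G.slice R) = Module.finrank ℂ (LinearMap.ker (G.br R : V →ₗ[ℂ] V)) := by
  have h1 : G.slice R = (LinearMap.range (G.br R : V →ₗ[ℂ] V))ᗮ := by
    ext s
    rw [Submodule.mem_orthogonal, G.mem_slice]
    constructor
    · rintro hs _ ⟨y, rfl⟩
      change ⟪G.br R y, s⟫_ℂ = 0
      rw [G.inner_br, hs, inner_zero_right, neg_zero]
    · intro hs
      refine ext_inner_left ℂ fun y => ?_
      have h2 : ⟪G.br R y, s⟫_ℂ = 0 := hs _ (LinearMap.mem_range_self _ y)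
      rwa [G.inner_br, neg_eq_zero, ← inner_zero_right y] at h2
  have h2 := LinearMap.finrank_range_add_finrank_ker (G.br R : V →ₗ[ℂ] V)
  have h3 := Submodule.finrank_add_finrank_orthogonal (LinearMap.range (G.br R : V →ₗ[ℂ] V))
  rw [h1]
  omega

/-- If a diagonalizable element with integral eigenvalues of a semisimple Lie algebra has the
eigenvalue one, then its eigenvalue zero has a larger multiplicity than its eigenvalue two. -/
theorem card_degree_two_lt [FiniteDimensional ℂ V] (G : HermitianLie V) (hδ : Antitone δ)
    {z : V} (w : Module.Basis (Fin n) ℂ V) (hw : ∀ i, G.br z (w i) = (δ i : ℂ) • w i)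
    (h1 : ∃ i, δ i = 1) :
    (Finset.univ.filter fun i => δ i = 2).card < (Finset.univ.filter fun i => δ i = 0).card := by
  classical
  have hn : Module.finrank ℂ V = n := by rw [Module.finrank_eq_card_basis w, Fintype.card_fin]
  obtain ⟨x, u, hA, -, -⟩ := G.exists_adapted hδ w hw
  obtain ⟨i1, hi1⟩ := h1
  obtain ⟨R, hR, H, c, ε, hR0, hc, hε, hτH, hbr, hcontr, hiso⟩ := G.exists_isolated hδ hn
    ⟨u i1, ⟨x, u, hA, by
      rw [zero_smul, sub_zero]
      exact Submodule.subset_span ⟨i1, by simp [hi1], rfl⟩⟩, u.orthonormal.ne_zero i1⟩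
  have hC : G.Contracts H R c :=
    ⟨hc, hτH, hbr, fun s hs => (hcontr s hs).1, fun s hs => (hcontr s hs).2⟩
  obtain ⟨v, hv, hvR, hrigid⟩ := hC.exists_rigid hδ hn hR hε hiso
  set d := fun k : ℤ => (Finset.univ.filter fun i => δ i = k).card with hd
  -- By rigidity the slice directions are disjoint from `[g, v]`, so their dimension is at most that
  -- of the centralizer of `v`.
  have hslice : Module.finrank ℂ (G.slice R) ≤ d 0 := by
    refine le_trans ?_ (finrank_ker_br_le hv)
    have h2 := LinearMap.finrank_range_add_finrank_ker (G.br v : V →ₗ[ℂ] V)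
    have h3 : Disjoint (LinearMap.range (G.br v : V →ₗ[ℂ] V)) (G.slice R) := by
      rw [Submodule.disjoint_def]
      rintro _ ⟨k, rfl⟩ hk
      have hk' : G.br k v ∈ G.slice R := by
        rw [G.skew]; exact Submodule.neg_mem _ hk
      have := hrigid k hk'
      rw [G.skew, neg_eq_zero] at this
      exact this
    have h4 := Submodule.finrank_add_finrank_le_of_disjoint h3
    omega
  rw [finrank_slice] at hslice
  obtain ⟨x', u', hA', hm⟩ := hR
  rw [zero_smul, sub_zero] at hm
  -- Rank–nullity for `ad R` on `W`, whose kernel has dimension at most `d 0`.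
  have key : ∀ W : Submodule ℂ V, ∀ k : ℤ, (∀ y ∈ W, G.br R y ∈ degreeFiltration δ u' k) →
      Module.finrank ℂ W ≤ Module.finrank ℂ (degreeFiltration δ u' k) + d 0 := by
    intro W k hWk
    have h2 := LinearMap.finrank_range_add_finrank_ker ((G.br R : V →ₗ[ℂ] V).domRestrict W)
    have h3 : Module.finrank ℂ (LinearMap.range ((G.br R : V →ₗ[ℂ] V).domRestrict W)) ≤
        Module.finrank ℂ (degreeFiltration δ u' k) := by
      refine Submodule.finrank_mono ?_
      rintro _ ⟨y, rfl⟩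
      exact hWk y y.2
    have h4 : Module.finrank ℂ (LinearMap.ker ((G.br R : V →ₗ[ℂ] V).domRestrict W)) ≤
        Module.finrank ℂ (LinearMap.ker (G.br R : V →ₗ[ℂ] V)) := by
      rw [← Submodule.finrank_map_subtype_eq]
      refine Submodule.finrank_mono ?_
      rintro _ ⟨y, hy, rfl⟩
      exact hy
    omega
  have hsplit : ∀ k l, l = k + 1 → Module.finrank ℂ (degreeFiltration δ u' k) =
      d k + Module.finrank ℂ (degreeFiltration δ u' l) := by
    rintro k l rfl
    rw [finrank_degreeFiltration, finrank_degreeFiltration, hd, ← Finset.card_union_of_disjoint]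
    · congr 1
      ext i
      simp only [Finset.mem_filter, Finset.mem_univ, true_and, Finset.mem_union]
      omega
    · rw [Finset.disjoint_left]
      intro i
      simp only [Finset.mem_filter, Finset.mem_univ, true_and]
      omega
  have hE0 := hsplit 0 1 (by norm_num)
  have hE1 := hsplit 1 2 (by norm_num)
  have hE2 := hsplit 2 3 (by norm_num)
  change d 2 < d 0
  have hd1 : 0 < d 1 := Finset.card_pos.mpr ⟨i1, by simp [hi1]⟩
  -- If `R` were in `F_2`, it would map `F_0` into `F_2`, forcing `d 1 = 0`. Otherwise the line of
  -- `R` enlarges `F_2` without enlarging its image in `F_3`, and this extra dimension makes the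
  -- inequality strict.
  by_cases hR2 : R ∈ degreeFiltration δ u' 2
  · have := key (degreeFiltration δ u' 0) 2 fun y hy => by
      simpa using hA'.br_mem hR2 hy
    omega
  · have h2 := key (degreeFiltration δ u' 2 ⊔ Submodule.span ℂ {R}) 3 fun y hy => by
      obtain ⟨a, ha, b, hb, rfl⟩ := Submodule.mem_sup.mp hy
      obtain ⟨t, rfl⟩ := Submodule.mem_span_singleton.mp hb
      rw [map_add, map_smul, G.br_self, smul_zero, add_zero]
      simpa using hA'.br_mem hm ha
    have h3 : Module.finrank ℂ (degreeFiltration δ u' 2) <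
        Module.finrank ℂ (degreeFiltration δ u' 2 ⊔ Submodule.span ℂ {R} : Submodule ℂ V) := by
      refine Submodule.finrank_lt_finrank_of_lt (lt_of_le_of_ne le_sup_left fun h => hR2 ?_)
      rw [h]
      exact Submodule.mem_sup_right (Submodule.mem_span_singleton_self R)
    omega

end HermitianLie

/-! ### Compact conjugations and their inner products. -/

open scoped InnerProductSpace

/-- The bracket as a bilinear map. -/
def lieLinear (g : Type*) [LieRing g] [LieAlgebra ℂ g] : g →ₗ[ℂ] g →ₗ[ℂ] g :=
  LinearMap.mk₂ ℂ (fun x y => ⁅x, y⁆) add_lie smul_lie lie_add lie_smul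

lemma eq_zero_of_lie_eq_zero {g : Type*} [LieRing g] [LieAlgebra ℂ g] [Module.Finite ℂ g]
    [LieAlgebra.IsKilling ℂ g] {x : g} (h : ∀ y : g, ⁅x, y⁆ = 0) : x = 0 := by
  have h1 : x ∈ LieAlgebra.center ℂ g := by
    rw [LieModule.mem_maxTrivSubmodule]
    intro y
    rw [← lie_skew, h, neg_zero]
  rw [LieAlgebra.center_eq_bot] at h1
  exact (LieSubmodule.mem_bot x).mp h1

/-- A compact conjugation of a complex semisimple Lie algebra. -/
structure IsCompactConj {g : Type*} [LieRing g] [LieAlgebra ℂ g] (τ : g →ₗ⋆[ℂ] g) : Prop where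
  involutive : ∀ x, τ (τ x) = x
  map_lie : ∀ x y, τ ⁅x, y⁆ = ⁅τ x, τ y⁆
  killing_conj : ∀ x y, killingForm ℂ g (τ x) (τ y) = starRingEnd ℂ (killingForm ℂ g x y)
  pos : ∀ x, x ≠ 0 → 0 < (-killingForm ℂ g (τ x) x).re

namespace IsCompactConj

variable {g : Type*} [LieRing g] [LieAlgebra ℂ g] {τ : g →ₗ⋆[ℂ] g} (hτ : IsCompactConj τ)

/-- The Hermitian inner product defined by a compact conjugation. -/
@[reducible] noncomputable def core : InnerProductSpace.Core ℂ g where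
  inner x y := -killingForm ℂ g (τ x) y
  conj_inner_symm x y := by
    rw [map_neg, ← hτ.killing_conj, hτ.involutive, LieModule.traceForm_comm]
  re_inner_nonneg x := by
    by_cases hx : x = 0
    · simp [hx]
    · exact (hτ.pos x hx).le
  add_left x y z := by rw [map_add, map_add, LinearMap.add_apply, neg_add]
  smul_left x y r := by
    rw [map_smulₛₗ, map_smul, LinearMap.smul_apply, smul_eq_mul, mul_neg]
  definite x hx := by
    by_contra h0
    have := hτ.pos x h0
    rw [hx] at this
    simp at this

/-- The norm defined by a compact conjugation. -/
@[reducible] noncomputable def normedAddCommGroup : NormedAddCommGroup g :=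
  letI := hτ.core
  InnerProductSpace.Core.toNormedAddCommGroup (𝕜 := ℂ)

/-- The inner product space structure defined by a compact conjugation. -/
@[reducible] noncomputable def innerProductSpace :
    letI := hτ.normedAddCommGroup
    InnerProductSpace ℂ g :=
  letI := hτ.core
  InnerProductSpace.ofCore hτ.core.toCore

lemma inner_eq (x y : g) :
    letI := hτ.normedAddCommGroup
    letI := hτ.innerProductSpace
    ⟪x, y⟫_ℂ = -killingForm ℂ g (τ x) y := rfl

lemma norm_map (x : g) :
    letI := hτ.normedAddCommGroup
    ‖τ x‖ = ‖x‖ := by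
  let _ := hτ.normedAddCommGroup
  let _ := hτ.innerProductSpace
  rw [← sq_eq_sq₀ (norm_nonneg _) (norm_nonneg _), ← inner_self_eq_norm_sq (𝕜 := ℂ),
    ← inner_self_eq_norm_sq (𝕜 := ℂ), hτ.inner_eq, hτ.inner_eq, hτ.involutive,
    LieModule.traceForm_comm]

lemma inner_lie (x y z : g) :
    letI := hτ.normedAddCommGroup
    letI := hτ.innerProductSpace
    ⟪⁅x, y⁆, z⟫_ℂ = -⟪y, ⁅τ x, z⁆⟫_ℂ := by
  rw [hτ.inner_eq, hτ.inner_eq, hτ.map_lie, ← lie_skew, map_neg, LinearMap.neg_apply,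
    LieModule.traceForm_apply_lie_apply]

/-- The adjoint action of an element negated by a compact conjugation has real eigenvalues. -/
lemma iSup_eigenspace_eq_top [Module.Finite ℂ g] (hτ : IsCompactConj τ) {x : g} (hx : τ x = -x) :
    (⨆ r : ℝ, Module.End.eigenspace (LieAlgebra.ad ℂ g x) (r : ℂ)) = ⊤ := by
  let _ := hτ.normedAddCommGroup
  let _ := hτ.innerProductSpace
  have hsym : (LieAlgebra.ad ℂ g x).IsSymmetric := fun y z => by
    rw [LieAlgebra.ad_apply, LieAlgebra.ad_apply, hτ.inner_lie, hx, neg_lie, inner_neg_right, neg_neg]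
  have h1 := hsym.orthogonalComplement_iSup_eigenspaces_eq_bot
  rw [Submodule.orthogonal_eq_bot_iff] at h1
  rw [eq_top_iff, ← h1]
  refine iSup_le fun μ => ?_
  by_cases h2 : Module.End.eigenspace (LieAlgebra.ad ℂ g x) μ = ⊥
  · rw [h2]; exact bot_le
  · have h3 := hsym.conj_eigenvalue_eq_self (μ := μ) h2
    obtain ⟨r, rfl⟩ := Complex.conj_eq_iff_real.mp h3
    exact le_iSup (fun r : ℝ => Module.End.eigenspace (LieAlgebra.ad ℂ g x) (r : ℂ)) r

variable [Module.Finite ℂ g] [LieAlgebra.IsKilling ℂ g]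

/-- The Hermitian Lie algebra defined by a compact conjugation. -/
noncomputable def hermitianLie :
    letI := hτ.normedAddCommGroup
    letI := hτ.innerProductSpace
    HermitianLie g :=
  letI := hτ.normedAddCommGroup
  letI := hτ.innerProductSpace
  { br := LinearMap.toContinuousLinearMap
      ((LinearMap.toContinuousLinearMap : (g →ₗ[ℂ] g) ≃ₗ[ℂ] g →L[ℂ] g).toLinearMap ∘ₗ
        lieLinear g)
    skew := fun x y => (lie_skew x y).symm
    leibniz := fun x y z => leibniz_lie x y z
    τ := LinearMap.mkContinuous τ 1 fun x => by rw [one_mul, hτ.norm_map]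
    τ_τ := hτ.involutive
    inner_br := hτ.inner_lie
    τ_br := hτ.map_lie
    br_inj := fun x hx => by
      have h1 : ∀ y : g, ⁅x, y⁆ = 0 := fun y => congrArg (fun T : g →L[ℂ] g => T y) hx
      exact eq_zero_of_lie_eq_zero h1
    inner_derivation := fun D hD => by
      obtain ⟨x, hx⟩ := LieDerivation.IsKilling.exists_eq_ad (R := ℂ) (L := g)
        { toLinearMap := D
          leibniz' := fun a b => by
            rw [show D ⁅a, b⁆ = ⁅D a, b⁆ + ⁅a, D b⁆ from hD a b, ← lie_skew b]
            abel }
      refine ⟨x, fun y => ?_⟩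
      have h := congrArg (fun T : LieDerivation ℂ g g => T y) hx
      rw [LieDerivation.ad_apply_apply] at h
      exact h }

/-- If a diagonalizable element with integral eigenvalues of a semisimple Lie algebra has the
eigenvalue one, then its eigenvalue zero has a larger multiplicity than its eigenvalue two. -/
theorem card_degree_two_lt (hτ : IsCompactConj τ) {κ : Type*} [Fintype κ] {z : g} (w : Module.Basis κ ℂ g) {δ : κ → ℤ}
    (hw : ∀ i, ⁅z, w i⁆ = (δ i : ℂ) • w i) (h1 : ∃ i, δ i = 1) :
    (Finset.univ.filter fun i => δ i = 2).card < (Finset.univ.filter fun i => δ i = 0).card := by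
  let _ := hτ.normedAddCommGroup
  let _ := hτ.innerProductSpace
  set e := Fintype.equivFin κ
  -- The negative sign sorts the degrees in decreasing order, as the filtrations require.
  set s := Tuple.sort (fun i => -δ (e.symm i))
  have hs := Tuple.monotone_sort (fun i => -δ (e.symm i))
  set e' : κ ≃ Fin (Fintype.card κ) := e.trans s.symm
  have hanti : Antitone (fun i => δ (e'.symm i)) := fun i j hij => by
    have := hs hij
    simpa [e', s] using this
  have h2 := hτ.hermitianLie.card_degree_two_lt hanti (z := z) (w.reindex e') (fun i => by
    rw [Module.Basis.reindex_apply]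
    exact hw _) (by obtain ⟨i, hi⟩ := h1; exact ⟨e' i, by simpa using hi⟩)
  have h3 : ∀ k, (Finset.univ.filter fun i => δ (e'.symm i) = k).card =
      (Finset.univ.filter fun i => δ i = k).card := by
    intro k
    refine Finset.card_equiv e'.symm fun i => ?_
    simp
  rwa [h3, h3] at h2

end IsCompactConj

/-! ### Noticed triples. -/

open scoped InnerProductSpace

/-- A normal triple `(h, e, f)` with `θ e = -e` and `τ e = -f` such that no nonzero Hermitian
element fixed by `θ` commutes with `e`. -/
structure NoticedTriple {g : Type*} [LieRing g] [LieAlgebra ℂ g] (θ : g →ₗ[ℂ] g) (τ : g →ₗ⋆[ℂ] g)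
    (h e f : g) : Prop where
  compact : IsCompactConj τ
  θ_θ : ∀ x, θ (θ x) = x
  θ_lie : ∀ x y, θ ⁅x, y⁆ = ⁅θ x, θ y⁆
  θ_τ : ∀ x, θ (τ x) = τ (θ x)
  sl2 : IsSl2Triple h e f
  θ_e : θ e = -e
  θ_h : θ h = h
  τ_h : τ h = -h
  τ_e : τ e = -f
  noticed : ∀ x, θ x = x → τ x = -x → ⁅e, x⁆ = 0 → x = 0

namespace NoticedTriple

variable {g : Type*} [LieRing g] [LieAlgebra ℂ g] {θ : g →ₗ[ℂ] g} {τ : g →ₗ⋆[ℂ] g} {h e f : g}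

lemma τ_f (hT : NoticedTriple θ τ h e f) : τ f = -e := by
  rw [← neg_eq_iff_eq_neg, ← map_neg, ← hT.τ_e, hT.compact.involutive]

/-- The operator `ad e` is injective on the eigenspaces of `ad h` for negative eigenvalues. -/
lemma eq_zero_of_lie_e_eq_zero (hT : NoticedTriple θ τ h e f) {y : g} {r : ℝ} (hr : r < 0)
    (hhy : ⁅h, y⁆ = (r : ℂ) • y) (hey : ⁅e, y⁆ = 0) : y = 0 := by
  let _ := hT.compact.normedAddCommGroup
  let _ := hT.compact.innerProductSpace
  -- The adjoint of `ad f` is `ad e`, so a vector killed by `e` gives `‖[f, y]‖² = r ‖y‖²`,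
  -- impossible for `r < 0` unless `y = 0`.
  have h1 : ⟪⁅f, y⁆, ⁅f, y⁆⟫_ℂ = (r : ℂ) * ⟪y, y⟫_ℂ := by
    rw [hT.compact.inner_lie, hT.τ_f, neg_lie, inner_neg_right, neg_neg, leibniz_lie,
      hey, lie_zero, add_zero, hT.sl2.lie_e_f, hhy, inner_smul_right]
  have h2 := congrArg Complex.re h1
  rw [Complex.re_ofReal_mul] at h2
  have h3 : 0 ≤ (⟪⁅f, y⁆, ⁅f, y⁆⟫_ℂ).re := inner_self_nonneg (𝕜 := ℂ) (x := ⁅f, y⁆)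
  have h4 : 0 ≤ (⟪y, y⟫_ℂ).re := inner_self_nonneg (𝕜 := ℂ) (x := y)
  have h5 : (⟪y, y⟫_ℂ).re = 0 := by nlinarith
  exact inner_self_eq_zero.mp (Complex.ext h5 (inner_self_im (𝕜 := ℂ) y))

/-- No nonzero element fixed by `θ` commutes with `h` and `e`. -/
theorem eq_zero (hT : NoticedTriple θ τ h e f) {y : g} (hk : θ y = y) (hhy : ⁅h, y⁆ = 0)
    (hey : ⁅e, y⁆ = 0) : y = 0 := by
  -- The same identity in degree zero shows that `f` kills `y`; hence `e` kills `τ y`, and the two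
  -- combinations `y - τ y` and `i (y + τ y)` are Hermitian and commute with `e`.
  have hfy : ⁅f, y⁆ = 0 := by
    let _ := hT.compact.normedAddCommGroup
    let _ := hT.compact.innerProductSpace
    rw [← inner_self_eq_zero (𝕜 := ℂ), hT.compact.inner_lie, hT.τ_f, neg_lie, inner_neg_right, neg_neg,
      leibniz_lie, hey, lie_zero, add_zero, hT.sl2.lie_e_f, hhy, inner_zero_right]
  have heτ : ⁅e, τ y⁆ = 0 := by
    have := congrArg τ hfy
    rw [hT.compact.map_lie, map_zero, hT.τ_f, neg_lie, neg_eq_zero] at this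
    exact this
  have hkτ : θ (τ y) = τ y := by rw [hT.θ_τ, hk]
  have h1 := hT.noticed (y - τ y) (by rw [map_sub, hk, hkτ])
    (by rw [map_sub, hT.compact.involutive, neg_sub]) (by rw [lie_sub, hey, heτ, sub_zero])
  have h2 := hT.noticed (Complex.I • (y + τ y))
    (by rw [map_smul, map_add, hk, hkτ])
    (by rw [map_smulₛₗ, map_add, hT.compact.involutive, Complex.conj_I, neg_smul, add_comm])
    (by rw [lie_smul, lie_add, hey, heτ, add_zero, smul_zero])
  have h3 := (smul_eq_zero.mp h2).resolve_left Complex.I_ne_zero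
  rw [sub_eq_zero] at h1
  rw [← h1, ← two_smul ℂ] at h3
  exact (smul_eq_zero.mp h3).resolve_left two_ne_zero

end NoticedTriple

/-- For tensor products, multiplicativity then needs checking on pure tensors only, also for maps
that are not complex linear. -/
lemma map_lie_of_closure {g : Type*} [LieRing g] (φ : g →+ g) {S : Set g}
    (hS : AddSubmonoid.closure S = ⊤) (h : ∀ x ∈ S, ∀ y ∈ S, φ ⁅x, y⁆ = ⁅φ x, φ y⁆) (x y : g) :
    φ ⁅x, y⁆ = ⁅φ x, φ y⁆ := by
  have hx : x ∈ AddSubmonoid.closure S := hS ▸ AddSubmonoid.mem_top x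
  have hy : y ∈ AddSubmonoid.closure S := hS ▸ AddSubmonoid.mem_top y
  induction hx using AddSubmonoid.closure_induction with
  | zero => simp
  | add a b _ _ ha hb => rw [add_lie, map_add, ha, hb, map_add, add_lie]
  | mem a ha =>
    induction hy using AddSubmonoid.closure_induction with
    | zero => simp
    | add c d _ _ hc hd => rw [lie_add, map_add, hc, hd, map_add, lie_add]
    | mem c hc => exact h a ha c hc

/-! ### The complexification of a real semisimple Lie algebra. -/

section Complexification

open scoped TensorProduct

variable {L : Type*} [LieRing L] [LieAlgebra ℝ L]

lemma exists_eq_tmul_add (x : ℂ ⊗[ℝ] L) : ∃ a b : L, x = (1 : ℂ) ⊗ₜ[ℝ] a + Complex.I ⊗ₜ[ℝ] b := by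
  induction x using TensorProduct.induction_on with
  | zero => exact ⟨0, 0, by simp⟩
  | tmul z a =>
    refine ⟨z.re • a, z.im • a, ?_⟩
    rw [← TensorProduct.smul_tmul, ← TensorProduct.smul_tmul, ← TensorProduct.add_tmul]
    congr 1
    rw [Complex.real_smul, Complex.real_smul, mul_one, Complex.re_add_im]
  | add x y hx hy =>
    obtain ⟨a, b, rfl⟩ := hx
    obtain ⟨a', b', rfl⟩ := hy
    refine ⟨a + a', b + b', ?_⟩
    rw [TensorProduct.tmul_add, TensorProduct.tmul_add]
    abel

lemma complexConj_tmul (z : ℂ) (a : L) :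
    complexConj (z ⊗ₜ[ℝ] a) = (starRingEnd ℂ z) ⊗ₜ[ℝ] a := rfl

lemma complexTheta_tmul (θ : L ≃ₗ⁅ℝ⁆ L) (z : ℂ) (a : L) :
    complexTheta θ (z ⊗ₜ[ℝ] a) = z ⊗ₜ[ℝ] θ a := rfl

lemma complexConj_smul (z : ℂ) (x : ℂ ⊗[ℝ] L) :
    complexConj (z • x) = starRingEnd ℂ z • complexConj x := by
  induction x using TensorProduct.induction_on with
  | zero => simp
  | tmul w a =>
    rw [TensorProduct.smul_tmul', complexConj_tmul, complexConj_tmul, TensorProduct.smul_tmul',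
      smul_eq_mul, smul_eq_mul, map_mul]
  | add x y hx hy => rw [smul_add, map_add, hx, hy, map_add, smul_add]

lemma complexConj_complexConj (x : ℂ ⊗[ℝ] L) : complexConj (complexConj x) = x := by
  induction x using TensorProduct.induction_on with
  | zero => simp
  | tmul w a => rw [complexConj_tmul, complexConj_tmul, Complex.conj_conj]
  | add x y hx hy => rw [map_add, map_add, hx, hy]

lemma closure_tmul_eq_top :
    AddSubmonoid.closure {x : ℂ ⊗[ℝ] L | ∃ (z : ℂ) (a : L), x = z ⊗ₜ[ℝ] a} = ⊤ := by
  refine top_le_iff.mp fun x _ => ?_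
  induction x using TensorProduct.induction_on with
  | zero => exact zero_mem _
  | tmul z a => exact AddSubmonoid.subset_closure ⟨z, a, rfl⟩
  | add x y hx hy => exact add_mem (hx trivial) (hy trivial)

lemma complexConj_lie (x y : ℂ ⊗[ℝ] L) : complexConj ⁅x, y⁆ = ⁅complexConj x, complexConj y⁆ := by
  refine map_lie_of_closure complexConj.toAddMonoidHom closure_tmul_eq_top ?_ x y
  rintro _ ⟨z, a, rfl⟩ _ ⟨w, b, rfl⟩
  change complexConj ((z * w) ⊗ₜ[ℝ] ⁅a, b⁆) = (starRingEnd ℂ z * starRingEnd ℂ w) ⊗ₜ[ℝ] ⁅a, b⁆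
  rw [complexConj_tmul, map_mul]

lemma complexTheta_lie (θ : L ≃ₗ⁅ℝ⁆ L) (x y : ℂ ⊗[ℝ] L) :
    complexTheta θ ⁅x, y⁆ = ⁅complexTheta θ x, complexTheta θ y⁆ := by
  refine map_lie_of_closure (complexTheta θ).toAddMonoidHom closure_tmul_eq_top ?_ x y
  rintro _ ⟨z, a, rfl⟩ _ ⟨w, b, rfl⟩
  change complexTheta θ ((z * w) ⊗ₜ[ℝ] ⁅a, b⁆) = (z * w) ⊗ₜ[ℝ] ⁅θ a, θ b⁆
  rw [complexTheta_tmul, LieEquiv.map_lie]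

lemma complexTheta_complexConj (θ : L ≃ₗ⁅ℝ⁆ L) (x : ℂ ⊗[ℝ] L) :
    complexTheta θ (complexConj x) = complexConj (complexTheta θ x) := by
  induction x using TensorProduct.induction_on with
  | zero => simp
  | tmul w a => rfl
  | add x y hx hy => rw [map_add, map_add, hx, hy, map_add, map_add]

lemma complexTheta_complexTheta {θ : L ≃ₗ⁅ℝ⁆ L} (hθ : ∀ x, θ (θ x) = x) (x : ℂ ⊗[ℝ] L) :
    complexTheta θ (complexTheta θ x) = x := by
  induction x using TensorProduct.induction_on with
  | zero => simp
  | tmul w a => rw [complexTheta_tmul, complexTheta_tmul, hθ]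
  | add x y hx hy => rw [map_add, map_add, hx, hy]

/-- The conjugation of the complexification with respect to the compact real form. -/
noncomputable def compactConj (θ : L ≃ₗ⁅ℝ⁆ L) : ℂ ⊗[ℝ] L →ₗ⋆[ℂ] ℂ ⊗[ℝ] L where
  toFun x := complexConj (complexTheta θ x)
  map_add' x y := by rw [map_add, map_add]
  map_smul' z x := by rw [map_smul, complexConj_smul]

lemma compactConj_apply (θ : L ≃ₗ⁅ℝ⁆ L) (x : ℂ ⊗[ℝ] L) :
    compactConj θ x = complexConj (complexTheta θ x) := rfl

lemma complexTheta_compactConj (θ : L ≃ₗ⁅ℝ⁆ L) (x : ℂ ⊗[ℝ] L) :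
    complexTheta θ (compactConj θ x) = compactConj θ (complexTheta θ x) := by
  rw [compactConj_apply, compactConj_apply, complexTheta_complexConj]

variable [Module.Finite ℝ L]

lemma killingForm_tmul (z w : ℂ) (a b : L) :
    killingForm ℂ (ℂ ⊗[ℝ] L) (z ⊗ₜ[ℝ] a) (w ⊗ₜ[ℝ] b) = z * w * (killingForm ℝ L a b : ℂ) := by
  have h2 : killingForm ℂ (ℂ ⊗[ℝ] L) = LinearMap.BilinForm.baseChange ℂ (killingForm ℝ L) :=
    LieModule.traceForm_baseChange ℝ L L ℂ
  rw [h2, LinearMap.BilinForm.baseChange_tmul]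
  simp [mul_comm]

lemma isCompactConj_compactConj {θ : L ≃ₗ⁅ℝ⁆ L} (hθ : IsCartanInvolution θ) :
    IsCompactConj (compactConj θ) where
  involutive x := by
    rw [compactConj_apply, compactConj_apply, complexTheta_complexConj, complexConj_complexConj,
      complexTheta_complexTheta hθ.involutive]
  map_lie x y := by
    rw [compactConj_apply, complexTheta_lie, complexConj_lie]; rfl
  killing_conj x y := by
    have hk : ∀ a b, killingForm ℝ L (θ a) (θ b) = killingForm ℝ L a b := fun a b =>
      LieAlgebra.killingForm_of_equiv_apply θ a b
    induction x using TensorProduct.induction_on with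
    | zero => simp
    | add x x' hx hx' =>
      simp only [map_add, LinearMap.add_apply, hx, hx']
    | tmul z a =>
      induction y using TensorProduct.induction_on with
      | zero => simp
      | add x y hx hy => simp only [map_add, hx, hy]
      | tmul w b =>
        rw [compactConj_apply, compactConj_apply, complexTheta_tmul, complexTheta_tmul,
          complexConj_tmul, complexConj_tmul, killingForm_tmul, killingForm_tmul, hk]
        simp
  pos x hx := by
    obtain ⟨a, b, rfl⟩ := exists_eq_tmul_add x
    have h0 : ∀ a, 0 ≤ -killingForm ℝ L (θ a) a := by
      intro a
      by_cases ha : a = 0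
      · simp [ha]
      · rw [LieModule.traceForm_comm]; exact (hθ.pos a ha).le
    -- The cross terms between `a` and `b` are purely imaginary.
    have h1 : (-killingForm ℂ (ℂ ⊗[ℝ] L) (compactConj θ ((1 : ℂ) ⊗ₜ[ℝ] a + Complex.I ⊗ₜ[ℝ] b))
        ((1 : ℂ) ⊗ₜ[ℝ] a + Complex.I ⊗ₜ[ℝ] b)).re =
        -killingForm ℝ L (θ a) a + -killingForm ℝ L (θ b) b := by
      rw [compactConj_apply]
      simp only [map_add, complexTheta_tmul, complexConj_tmul, LinearMap.add_apply, killingForm_tmul]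
      simp
      ring
    rw [h1]
    by_cases ha : a = 0
    · have hb : b ≠ 0 := by
        rintro rfl
        apply hx
        simp [ha]
      have := hθ.pos b hb
      rw [LieModule.traceForm_comm] at this
      exact add_pos_of_nonneg_of_pos (h0 a) this
    · have := hθ.pos a ha
      rw [LieModule.traceForm_comm] at this
      exact add_pos_of_pos_of_nonneg this (h0 b)

/-- The only nonformal field is `noticed`. An element fixed by `θ` and negated by the compact
conjugation acts with real eigenvalues and `θ`-stable eigenspaces, so it defines a `θ`-stable
parabolic subalgebra with its centralizer as Levi factor. If it commutes with `e`, this centralizer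
is everything, so the element is central and vanishes. -/
lemma IsKSTriple.noticedTriple [LieAlgebra.IsSemisimple ℝ L] {θ : L ≃ₗ⁅ℝ⁆ L}
    (hθ : IsCartanInvolution θ) {h e f : ℂ ⊗[ℝ] L} (hT : IsKSTriple θ h e f) (hN : IsNoticed θ e) :
    NoticedTriple (complexTheta θ) (compactConj θ) h e f where
  compact := isCompactConj_compactConj hθ
  θ_θ := complexTheta_complexTheta hθ.involutive
  θ_lie := complexTheta_lie θ
  θ_τ := complexTheta_compactConj θ
  sl2 := hT.sl2
  θ_e := hT.e_mem
  θ_h := by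
    obtain ⟨x, hx, rfl⟩ := hT.h_mem
    rw [complexTheta_tmul, hx]
  τ_h := by
    obtain ⟨x, hx, rfl⟩ := hT.h_mem
    rw [compactConj_apply, complexTheta_tmul, complexConj_tmul, hx, Complex.conj_I,
      TensorProduct.neg_tmul]
  τ_e := by rw [compactConj_apply, hT.e_mem, map_neg, hT.f_eq]
  noticed x hxk hx hex := by
    have hτ := isCompactConj_compactConj hθ
    have hcomm : ∀ (r : ℂ) y, y ∈ Module.End.eigenspace (LieAlgebra.ad ℂ (ℂ ⊗[ℝ] L) x) r →
        complexTheta θ y ∈ Module.End.eigenspace (LieAlgebra.ad ℂ (ℂ ⊗[ℝ] L) x) r := by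
      intro r y hy
      rw [Module.End.mem_eigenspace_iff, LieAlgebra.ad_apply] at hy ⊢
      have h1 := complexTheta_lie θ x y
      rw [hxk] at h1
      refine h1.symm.trans ((congrArg _ hy).trans (map_smul _ _ _))
    have hmap : ∀ r : ℂ, (Module.End.eigenspace (LieAlgebra.ad ℂ (ℂ ⊗[ℝ] L) x) r).map
        (complexTheta θ) = Module.End.eigenspace (LieAlgebra.ad ℂ (ℂ ⊗[ℝ] L) x) r := by
      intro r
      apply le_antisymm
      · rintro _ ⟨y, hy, rfl⟩
        exact hcomm r y hy
      · intro y hy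
        exact ⟨_, hcomm r y hy, complexTheta_complexTheta hθ.involutive y⟩
    have h1 := hN _ _ ⟨x, hτ.iSup_eigenspace_eq_top hx, rfl, rfl, hmap 0, by
      rw [Submodule.map_iSup]
      simp only [hmap]⟩ (by
        rw [Module.End.mem_eigenspace_iff, LieAlgebra.ad_apply, ← lie_skew, hex, neg_zero, zero_smul])
    refine eq_zero_of_lie_eq_zero fun y => ?_
    have h2 : y ∈ Module.End.eigenspace (LieAlgebra.ad ℂ (ℂ ⊗[ℝ] L) x) 0 := h1 ▸ Submodule.mem_top
    rwa [Module.End.mem_eigenspace_iff, LieAlgebra.ad_apply, zero_smul] at h2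

end Complexification

/-! ### Coefficient vectors of roots. -/

namespace WeightedVoganDiagram

variable {ι : Type*} [Fintype ι] [DecidableEq ι] (Γ : WeightedVoganDiagram ι)

/-- The pairing of a vector with the simple coroot at `i`. -/
def pair (v : ι → ℤ) (i : ι) : ℤ := ∑ k, v k * Γ.cartan k i

/-- The properties of the roots that hold for the root system of a Lie algebra. -/
structure IsRealized : Prop where
  finite : {v | Γ.IsRoot v}.Finite
  nonneg_or_nonpos : ∀ v, Γ.IsRoot v → (∀ i, 0 ≤ v i) ∨ ∀ i, v i ≤ 0
  sub : ∀ v i, Γ.IsRoot v → 0 < Γ.pair v i → v ≠ Pi.single i 1 → Γ.IsRoot (v - Pi.single i 1)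

variable {Γ}

lemma pair_single (i j : ι) : Γ.pair (Pi.single i 1) j = Γ.cartan i j := by
  simp [pair, Pi.single_apply]

lemma pair_neg (v : ι → ℤ) (i : ι) : Γ.pair (-v) i = -Γ.pair v i := by
  simp [pair]

lemma pair_sub (v w : ι → ℤ) (i : ι) : Γ.pair (v - w) i = Γ.pair v i - Γ.pair w i := by
  simp [pair, sub_mul]

lemma IsRoot.neg {v : ι → ℤ} (hv : Γ.IsRoot v) : Γ.IsRoot (-v) := by
  induction hv with
  | simple i =>
    have h := IsRoot.reflection (Γ := Γ) i _ (IsRoot.simple i)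
    have h2 : ∑ k, (Pi.single i 1 : ι → ℤ) k * Γ.cartan k i = 2 := by
      rw [← Γ.cartan_diag i]; exact pair_single i i
    rw [h2] at h
    convert h using 1
    module
  | reflection j v _ ih =>
    have h := IsRoot.reflection j _ ih
    have h2 : ∑ k, (-v) k * Γ.cartan k j = -∑ k, v k * Γ.cartan k j := pair_neg v j
    rw [h2] at h
    convert h using 1
    module

end WeightedVoganDiagram

/-! ### The dictionary between coefficient vectors and roots of the Lie algebra. -/

section Bridge

open LieAlgebra LieAlgebra.IsKilling Module

variable {g : Type*} [LieRing g] [LieAlgebra ℂ g] [Module.Finite ℂ g] [LieAlgebra.IsKilling ℂ g]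
  {H : LieSubalgebra ℂ g} [H.IsCartanSubalgebra] (Ψ : (rootSystem H).Base)
  {ι : Type*} [Fintype ι] [DecidableEq ι] (ε : ι ≃ Ψ.support)

/-- The linear form with given coefficients in a basis of simple roots. -/
noncomputable def rootForm (v : ι → ℤ) : Dual ℂ H := ∑ i, (v i : ℂ) • (rootSystem H).root (ε i)

lemma rootForm_single (i : ι) : rootForm Ψ ε (Pi.single i 1) = (rootSystem H).root (ε i) := by
  rw [rootForm, Finset.sum_eq_single i]
  · simp
  · intro j _ hj; simp [hj]
  · simp

lemma rootForm_sub (v w : ι → ℤ) : rootForm Ψ ε (v - w) = rootForm Ψ ε v - rootForm Ψ ε w := by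
  simp [rootForm, sub_smul]

lemma rootForm_smul (a : ℤ) (v : ι → ℤ) : rootForm Ψ ε (a • v) = (a : ℂ) • rootForm Ψ ε v := by
  simp [rootForm, Finset.smul_sum, smul_smul]

lemma rootForm_neg (v : ι → ℤ) : rootForm Ψ ε (-v) = -rootForm Ψ ε v := by
  simp [rootForm]

lemma rootForm_injective : Function.Injective (rootForm Ψ ε) := by
  intro v w h
  have h0 : rootForm Ψ ε (v - w) = 0 := by rw [rootForm_sub, h, sub_self]
  have hli : LinearIndependent ℂ fun i : ι => (rootSystem H).root (ε i) :=
    Ψ.linearIndepOn_root.comp ε ε.injective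
  have h1 := Fintype.linearIndependent_iff.mp hli _ h0
  funext i
  have := h1 i
  rw [Pi.sub_apply, Int.cast_eq_zero, sub_eq_zero] at this
  exact this

variable {Γ : WeightedVoganDiagram ι}

lemma rootForm_coroot (hcart : ∀ i j, Γ.cartan i j = Ψ.cartanMatrix (ε i) (ε j)) (v : ι → ℤ) (j : ι) :
    rootForm Ψ ε v ((rootSystem H).coroot (ε j)) = (Γ.pair v j : ℂ) := by
  rw [rootForm, WeightedVoganDiagram.pair, LinearMap.sum_apply]
  push_cast
  refine Finset.sum_congr rfl fun i _ => ?_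
  rw [LinearMap.smul_apply, smul_eq_mul, hcart]
  congr 1
  have := Ψ.algebraMap_cartanMatrixIn_apply ℤ (ε i) (ε j)
  exact this.symm

lemma exists_root_eq_rootForm (hcart : ∀ i j, Γ.cartan i j = Ψ.cartanMatrix (ε i) (ε j)) {v : ι → ℤ}
    (hv : Γ.IsRoot v) : ∃ α : H.root, (rootSystem H).root α = rootForm Ψ ε v := by
  induction hv with
  | simple i => exact ⟨ε i, (rootForm_single Ψ ε i).symm⟩
  | reflection j v _ ih =>
    obtain ⟨α, hα⟩ := ih
    refine ⟨(rootSystem H).reflectionPerm (ε j) α, ?_⟩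
    rw [RootPairing.root_reflectionPerm, RootPairing.reflection_apply, hα, rootForm_sub, rootForm_smul,
      rootForm_single]
    congr 2
    exact rootForm_coroot Ψ ε hcart v j

lemma exists_isRoot_rootForm (hcart : ∀ i j, Γ.cartan i j = Ψ.cartanMatrix (ε i) (ε j)) (α : H.root) :
    ∃ v, Γ.IsRoot v ∧ (rootSystem H).root α = rootForm Ψ ε v := by
  refine Ψ.induction_reflect (p := fun α => ∃ v, Γ.IsRoot v ∧ (rootSystem H).root α = rootForm Ψ ε v)
    α ?_ ?_ ?_
  · rintro α ⟨v, hv, h⟩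
    refine ⟨-v, hv.neg, ?_⟩
    rw [RootPairing.root_reflectionPerm, RootPairing.reflection_apply_self, h, rootForm_neg]
  · intro α hα
    refine ⟨Pi.single (ε.symm ⟨α, hα⟩) 1, .simple _, ?_⟩
    rw [rootForm_single, Equiv.apply_symm_apply]
  · rintro α β ⟨v, hv, h⟩ hβ
    obtain ⟨j, hj⟩ := ε.surjective ⟨β, hβ⟩
    have hj' : (ε j : H.root) = β := by rw [hj]
    refine ⟨_, .reflection j v hv, ?_⟩
    rw [RootPairing.root_reflectionPerm, RootPairing.reflection_apply, h, rootForm_sub, rootForm_smul,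
      rootForm_single, hj']
    congr 2
    rw [← hj']
    exact rootForm_coroot Ψ ε hcart v j

/-- Both sides are generated from the simple roots by simple reflections, and `rootForm` is
injective because simple roots are linearly independent. -/
lemma isRoot_iff (hcart : ∀ i j, Γ.cartan i j = Ψ.cartanMatrix (ε i) (ε j)) (v : ι → ℤ) :
    Γ.IsRoot v ↔ ∃ α : H.root, (rootSystem H).root α = rootForm Ψ ε v := by
  refine ⟨exists_root_eq_rootForm Ψ ε hcart, ?_⟩
  rintro ⟨α, hα⟩
  obtain ⟨w, hw, h⟩ := exists_isRoot_rootForm Ψ ε hcart α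
  rwa [rootForm_injective Ψ ε (hα.symm.trans h)]

lemma isRealized (hcart : ∀ i j, Γ.cartan i j = Ψ.cartanMatrix (ε i) (ε j)) : Γ.IsRealized where
  finite := by
    refine Set.Finite.of_finite_image (f := rootForm Ψ ε) ?_ (rootForm_injective Ψ ε).injOn
    refine (Set.finite_range (rootSystem H).root).subset ?_
    rintro _ ⟨v, hv, rfl⟩
    exact exists_root_eq_rootForm Ψ ε hcart hv
  nonneg_or_nonpos v hv := by
    obtain ⟨α, hα⟩ := exists_root_eq_rootForm Ψ ε hcart hv
    obtain ⟨f, -, hf, h⟩ := Ψ.exists_root_eq_sum_int α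
    have h1 : v = fun i => f (ε i) := by
      apply rootForm_injective Ψ ε
      rw [← hα, h, rootForm, ← Finset.sum_coe_sort, ← ε.sum_comp]
      simp [Int.cast_smul_eq_zsmul]
    rw [h1]
    rcases hf with hf | hf
    · exact .inl fun i => hf.le _
    · exact .inr fun i => hf.le _
  sub v i hv hp hne := by
    obtain ⟨α, hα⟩ := exists_root_eq_rootForm Ψ ε hcart hv
    rw [isRoot_iff Ψ ε hcart, rootForm_sub, ← hα, rootForm_single]
    refine RootPairing.root_sub_root_mem_of_pairingIn_pos (P := rootSystem H) ?_ ?_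
    · have h1 : ((rootSystem H).pairingIn ℤ α (ε i) : ℂ) = (Γ.pair v i : ℂ) := by
        rw [← rootForm_coroot Ψ ε hcart, ← hα]
        exact (rootSystem H).algebraMap_pairingIn ℤ α (ε i)
      have h2 : (rootSystem H).pairingIn ℤ α (ε i) = Γ.pair v i := by exact_mod_cast h1
      rwa [h2]
    · rintro rfl
      apply hne
      apply rootForm_injective Ψ ε
      rw [← hα, rootForm_single]

end Bridge

/-! ### The basis of the Lie algebra adapted to a diagram. -/

section Bridge

open LieAlgebra LieAlgebra.IsKilling Module

variable {g : Type*} [LieRing g] [LieAlgebra ℂ g]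

/-- A basis of `g` consisting of the vectors `y i` dual to the simple roots and of root vectors `x v`,
compatible with the diagram `Γ`. -/
structure VoganBasis {ι : Type*} [Fintype ι] [DecidableEq ι] (Γ : WeightedVoganDiagram ι)
    (θ : g →ₗ[ℂ] g) (h : g) where
  realized : Γ.IsRealized
  basis : Basis (ι ⊕ {v // Γ.IsRoot v}) ℂ g
  lie_inl_inl : ∀ i j, ⁅basis (.inl i), basis (.inl j)⁆ = 0
  lie_inl_inr : ∀ i r, ⁅basis (.inl i), basis (.inr r)⁆ = ((r.1 i : ℤ) : ℂ) • basis (.inr r)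
  lie_inr_neg : ∀ r : {v // Γ.IsRoot v}, ∃ c : ι → ℂ,
    ⁅basis (.inr r), basis (.inr ⟨-r.1, r.2.neg⟩)⁆ = ∑ i, c i • basis (.inl i) ∧
      ∑ i, c i * (r.1 i : ℂ) ≠ 0
  lie_lower_ne_zero : ∀ i (r : {v // Γ.IsRoot v}), 0 < Γ.pair r.1 i →
    ⁅basis (.inr ⟨-Pi.single i 1, (WeightedVoganDiagram.IsRoot.simple i).neg⟩), basis (.inr r)⁆ ≠ 0
  θ_inl : ∀ i, θ (basis (.inl i)) = basis (.inl (Γ.θ i))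
  h_eq : h = ∑ i, (Γ.ω i : ℂ) • basis (.inl i)
  mem_J : ∀ i, i ∈ Γ.J ↔ Γ.θ i = i ∧
    θ (basis (.inr ⟨Pi.single i 1, .simple i⟩)) = -basis (.inr ⟨Pi.single i 1, .simple i⟩)

variable [Module.Finite ℂ g] [LieAlgebra.IsKilling ℂ g]
  {H : LieSubalgebra ℂ g} [H.IsCartanSubalgebra] (Ψ : (rootSystem H).Base)
  {ι : Type*} [Fintype ι] [DecidableEq ι] (ε : ι ≃ Ψ.support) {Γ : WeightedVoganDiagram ι}

/-- The basis of the Cartan subalgebra dual to the simple roots. -/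
noncomputable def fundamentalBasis : Basis ι ℂ H :=
  (Ψ.toWeightBasis.reindex ε.symm).dualBasis.map (evalEquiv ℂ H).symm

lemma fundamentalBasis_repr (y : H) (i : ι) :
    (fundamentalBasis Ψ ε).repr y i = (rootSystem H).root (ε i) y := by
  rw [fundamentalBasis, Basis.map_repr, LinearEquiv.trans_apply, LinearEquiv.symm_symm,
    Basis.dualBasis_repr, Basis.reindex_apply, Equiv.symm_symm, Ψ.toWeightBasis_apply]
  rfl

lemma rootForm_fundamentalBasis (v : ι → ℤ) (i : ι) :
    rootForm Ψ ε v (fundamentalBasis Ψ ε i) = (v i : ℂ) := by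
  rw [rootForm, LinearMap.sum_apply]
  simp [LinearMap.smul_apply, ← fundamentalBasis_repr, -rootSystem_root_apply, Finsupp.single_apply]

lemma rootForm_eq_sum (v : ι → ℤ) (y : H) :
    rootForm Ψ ε v y = ∑ i, (rootSystem H).root (ε i) y * (v i : ℂ) := by
  rw [rootForm, LinearMap.sum_apply]
  exact Finset.sum_congr rfl fun i _ => by rw [LinearMap.smul_apply, smul_eq_mul, mul_comm]

lemma eq_sum_smul_fundamentalBasis (y : H) :
    (y : g) = ∑ i, (rootSystem H).root (ε i) y • (fundamentalBasis Ψ ε i : g) := by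
  conv_lhs => rw [← (fundamentalBasis Ψ ε).sum_repr y]
  simp only [fundamentalBasis_repr]
  simp

lemma exists_ne_zero_mem_rootSpace_rootForm
    (hcart : ∀ i j, Γ.cartan i j = Ψ.cartanMatrix (ε i) (ε j)) (r : {v // Γ.IsRoot v}) :
    ∃ x : g, x ≠ 0 ∧ x ∈ rootSpace H (rootForm Ψ ε r.1) := by
  obtain ⟨α, hα⟩ := exists_root_eq_rootForm Ψ ε hcart r.2
  obtain ⟨x, hx, h0⟩ := α.1.exists_ne_zero
  refine ⟨x, h0, ?_⟩
  rw [← hα]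
  exact hx

lemma exists_smul_eq_of_mem_rootSpace
    (hcart : ∀ i j, Γ.cartan i j = Ψ.cartanMatrix (ε i) (ε j)) {v : ι → ℤ} (hv : Γ.IsRoot v) {x y : g}
    (hx0 : x ≠ 0) (hx : x ∈ rootSpace H (rootForm Ψ ε v)) (hy : y ∈ rootSpace H (rootForm Ψ ε v)) :
    ∃ c : ℂ, c • x = y := by
  obtain ⟨α, hα⟩ := exists_root_eq_rootForm Ψ ε hcart hv
  rw [← hα] at hx hy
  have h1 := finrank_rootSpace_eq_one α.1 (LieSubalgebra.isNonZero_coe_root α)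
  obtain ⟨c, hc⟩ := exists_smul_eq_of_finrank_eq_one h1 (x := ⟨x, hx⟩)
    (fun h => hx0 (congrArg Subtype.val h)) ⟨y, hy⟩
  exact ⟨c, congrArg Subtype.val hc⟩

lemma linearIndependent_fundamentalBasis_rootVectors
    (x : {v // Γ.IsRoot v} → g) (hx0 : ∀ r, x r ≠ 0) (hx : ∀ r, x r ∈ rootSpace H (rootForm Ψ ε r.1))
    (hne : ∀ v, Γ.IsRoot v → v ≠ 0) :
    LinearIndependent ℂ (Sum.elim (fun i => (fundamentalBasis Ψ ε i : g)) x) := by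
  have hind := LieSubmodule.iSupIndep_toSubmodule.mpr (LieModule.iSupIndep_genWeightSpace ℂ H g)
  have hinj : Function.Injective fun r : {v // Γ.IsRoot v} => (rootForm Ψ ε r.1 : H → ℂ) := by
    intro r s hrs
    exact Subtype.ext (rootForm_injective Ψ ε (DFunLike.coe_injective hrs))
  refine LinearIndependent.sum_type ?_ ?_ ?_
  · exact (fundamentalBasis Ψ ε).linearIndependent.map' H.toSubmodule.subtype
      (Submodule.ker_subtype _)
  · exact (hind.comp hinj).linearIndependent _ hx hx0
  · refine (hind 0).mono ?_ ?_
    · rw [Submodule.span_le]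
      rintro _ ⟨i, rfl⟩
      exact toLieSubmodule_le_rootSpace_zero ℂ g H (fundamentalBasis Ψ ε i).2
    · rw [Submodule.span_le]
      rintro _ ⟨r, rfl⟩
      refine Submodule.mem_iSup_of_mem (rootForm Ψ ε r.1) (Submodule.mem_iSup_of_mem ?_ (hx r))
      intro h0
      refine hne r.1 r.2 (rootForm_injective Ψ ε (DFunLike.coe_injective ?_))
      rw [h0]
      simp [rootForm]
      rfl

lemma span_fundamentalBasis_rootVectors
    (hcart : ∀ i j, Γ.cartan i j = Ψ.cartanMatrix (ε i) (ε j))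
    (x : {v // Γ.IsRoot v} → g) (hx0 : ∀ r, x r ≠ 0) (hx : ∀ r, x r ∈ rootSpace H (rootForm Ψ ε r.1)) :
    ⊤ ≤ Submodule.span ℂ (Set.range (Sum.elim (fun i => (fundamentalBasis Ψ ε i : g)) x)) := by
  rw [← LieSubmodule.iSup_toSubmodule_eq_top.mpr (LieModule.iSup_genWeightSpace_eq_top' ℂ H g)]
  refine iSup_le fun χ => ?_
  intro z hz
  by_cases h0 : χ.IsZero
  · have hz' : z ∈ H := by
      have h1 : z ∈ rootSpace H (0 : H → ℂ) := by rw [← h0]; exact hz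
      rwa [rootSpace_zero_eq] at h1
    have h3 := eq_sum_smul_fundamentalBasis Ψ ε ⟨z, hz'⟩
    dsimp only at h3
    rw [h3]
    exact Submodule.sum_mem _ fun i _ => Submodule.smul_mem _ _ (Submodule.subset_span ⟨.inl i, rfl⟩)
  · obtain ⟨v, hv, h1⟩ := exists_isRoot_rootForm Ψ ε hcart ⟨χ, by simpa using h0⟩
    have h2 : z ∈ rootSpace H (rootForm Ψ ε v) := by rw [← h1]; exact hz
    obtain ⟨c, rfl⟩ := exists_smul_eq_of_mem_rootSpace Ψ ε hcart hv (hx0 ⟨v, hv⟩) (hx ⟨v, hv⟩) h2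
    exact Submodule.smul_mem _ _ (Submodule.subset_span ⟨.inr ⟨v, hv⟩, rfl⟩)

lemma exists_isSl2Triple_rootForm (hcart : ∀ i j, Γ.cartan i j = Ψ.cartanMatrix (ε i) (ε j))
    {v : ι → ℤ} (hv : Γ.IsRoot v) : ∃ (k : H) (e f : g), IsSl2Triple (k : g) e f ∧
      e ∈ rootSpace H (rootForm Ψ ε v) ∧ f ∈ rootSpace H (rootForm Ψ ε (-v)) ∧ rootForm Ψ ε v k = 2 ∧
      ∀ i, v = Pi.single i 1 → k = (rootSystem H).coroot (ε i) := by
  obtain ⟨α, hα⟩ := exists_root_eq_rootForm Ψ ε hcart hv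
  have hα0 := LieSubalgebra.isNonZero_coe_root α
  obtain ⟨k, e, f, ht, he, hf⟩ := exists_isSl2Triple_of_weight_isNonZero hα0
  have hk := ht.h_eq_coroot hα0 he hf
  refine ⟨coroot α.1, e, f, hk ▸ ht, ?_, ?_, ?_, ?_⟩
  · rw [← hα]; exact he
  · rw [rootForm_neg, ← hα]; exact hf
  · rw [← hα]; exact root_apply_coroot hα0
  · rintro i rfl
    have h1 : α = (ε i : H.root) := by
      apply (rootSystem H).root.injective
      rw [hα, rootForm_single]
    rw [h1]; rfl

lemma isRoot_ne_zero (hcart : ∀ i j, Γ.cartan i j = Ψ.cartanMatrix (ε i) (ε j))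
    {v : ι → ℤ} (hv : Γ.IsRoot v) : v ≠ 0 := by
  rintro rfl
  obtain ⟨α, hα⟩ := exists_root_eq_rootForm Ψ ε hcart hv
  apply (rootSystem H).ne_zero α
  rw [hα]
  simp [rootForm]

/-- If the bracket vanished, `x` would be primitive for the reversed `sl₂`-triple of the simple
root, with weight minus the pairing; but weights of primitive vectors are natural numbers. -/
lemma lie_ne_zero_of_pair_pos (hcart : ∀ i j, Γ.cartan i j = Ψ.cartanMatrix (ε i) (ε j))
    {v : ι → ℤ} {i : ι} (hp : 0 < Γ.pair v i) {x z : g} (hx0 : x ≠ 0) (hz0 : z ≠ 0)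
    (hx : x ∈ rootSpace H (rootForm Ψ ε v)) (hz : z ∈ rootSpace H (rootForm Ψ ε (-Pi.single i 1))) :
    ⁅z, x⁆ ≠ 0 := by
  intro h0
  obtain ⟨k, e, f, ht, he, hf, -, hk⟩ := exists_isSl2Triple_rootForm Ψ ε hcart
    (WeightedVoganDiagram.IsRoot.simple (Γ := Γ) i)
  obtain ⟨c, rfl⟩ := exists_smul_eq_of_mem_rootSpace Ψ ε hcart
    (WeightedVoganDiagram.IsRoot.simple (Γ := Γ) i).neg hz0 hz hf
  have P : ht.symm.HasPrimitiveVectorWith x (-(Γ.pair v i : ℂ)) :=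
    { ne_zero := hx0
      lie_h := by
        rw [neg_lie, neg_smul, hk i rfl]
        congr 1
        have := lie_eq_smul_of_mem_rootSpace hx ((rootSystem H).coroot (ε i))
        rw [rootForm_coroot Ψ ε hcart] at this
        exact this
      lie_e := by rw [smul_lie, h0, smul_zero] }
  obtain ⟨n, hn⟩ := P.exists_nat
  have : -Γ.pair v i = n := by exact_mod_cast hn
  omega

/-- Root spaces are lines, so the bracket is a nonzero multiple of the coroot element, on which the
root takes the value two. -/
lemma exists_lie_eq_sum (hcart : ∀ i j, Γ.cartan i j = Ψ.cartanMatrix (ε i) (ε j))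
    {v : ι → ℤ} (hv : Γ.IsRoot v) {x z : g} (hx0 : x ≠ 0) (hz0 : z ≠ 0)
    (hx : x ∈ rootSpace H (rootForm Ψ ε v)) (hz : z ∈ rootSpace H (rootForm Ψ ε (-v))) :
    ∃ c : ι → ℂ, ⁅x, z⁆ = ∑ i, c i • (fundamentalBasis Ψ ε i : g) ∧ ∑ i, c i * (v i : ℂ) ≠ 0 := by
  obtain ⟨k, e, f, ht, he, hf, hk, -⟩ := exists_isSl2Triple_rootForm Ψ ε hcart hv
  obtain ⟨a, rfl⟩ := exists_smul_eq_of_mem_rootSpace Ψ ε hcart hv ht.e_ne_zero he hx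
  obtain ⟨b, rfl⟩ := exists_smul_eq_of_mem_rootSpace Ψ ε hcart hv.neg ht.f_ne_zero hf hz
  refine ⟨fun i => a * b * (rootSystem H).root (ε i) k, ?_, ?_⟩
  · rw [lie_smul, smul_lie, ht.lie_e_f, smul_smul, mul_comm b a]
    conv_lhs => rw [eq_sum_smul_fundamentalBasis Ψ ε k]
    rw [Finset.smul_sum]
    exact Finset.sum_congr rfl fun i _ => by rw [smul_smul]
  · simp only [mul_assoc, ← Finset.mul_sum]
    rw [← rootForm_eq_sum, hk]
    have ha : a ≠ 0 := by rintro rfl; simp at hx0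
    have hb : b ≠ 0 := by rintro rfl; simp at hz0
    exact mul_ne_zero ha (mul_ne_zero hb two_ne_zero)

theorem exists_voganBasis (hcart : ∀ i j, Γ.cartan i j = Ψ.cartanMatrix (ε i) (ε j))
    (θ : g →ₗ[ℂ] g) (hst : ∀ x ∈ H, θ x ∈ H)
    (hθ : ∀ i, ∀ x : H, (ε (Γ.θ i)).1.1 x = (ε i).1.1 ⟨θ (x : g), hst x x.2⟩)
    (hJ : ∀ i, i ∈ Γ.J ↔ Γ.θ i = i ∧ ∀ x ∈ rootSpace H (ε i).1.1, θ x = -x)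
    {h : g} (hh : h ∈ H) (hω : ∀ i, (Γ.ω i : ℂ) = (ε i).1.1 ⟨h, hh⟩) :
    Nonempty (VoganBasis Γ θ h) := by
  choose x hx0 hx using exists_ne_zero_mem_rootSpace_rootForm Ψ ε hcart
  have hli := linearIndependent_fundamentalBasis_rootVectors Ψ ε x hx0 hx
    fun v hv => isRoot_ne_zero Ψ ε hcart hv
  have hsp := span_fundamentalBasis_rootVectors Ψ ε hcart x hx0 hx
  have hl : ∀ i, Basis.mk hli hsp (.inl i) = (fundamentalBasis Ψ ε i : g) := fun i => by
    rw [Basis.mk_apply, Sum.elim_inl]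
  have hr : ∀ r, Basis.mk hli hsp (.inr r) = x r := fun i => by rw [Basis.mk_apply, Sum.elim_inr]
  refine ⟨⟨isRealized Ψ ε hcart, Basis.mk hli hsp, ?_, ?_, ?_, ?_, ?_, ?_, ?_⟩⟩
  · intro i j
    rw [hl, hl]
    exact congrArg Subtype.val (LieModule.IsTrivial.trivial (L := H) (M := H) _ _)
  · intro i r
    rw [hl, hr]
    have h1 := rootForm_fundamentalBasis Ψ ε r.1 i
    rw [← h1]
    exact lie_eq_smul_of_mem_rootSpace (hx r) (fundamentalBasis Ψ ε i)
  · intro r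
    have h1 := exists_lie_eq_sum Ψ ε hcart r.2 (hx0 r) (hx0 ⟨-r.1, r.2.neg⟩) (hx r)
      (hx ⟨-r.1, r.2.neg⟩)
    simpa only [hl, hr] using h1
  · intro i r hp
    rw [hr, hr]
    exact lie_ne_zero_of_pair_pos Ψ ε hcart hp (hx0 r) (hx0 _) (hx r)
      (hx ⟨-Pi.single i 1, (WeightedVoganDiagram.IsRoot.simple i).neg⟩)
  · intro i
    rw [hl, hl]
    have h1 : (⟨θ (fundamentalBasis Ψ ε i : g), hst _ (fundamentalBasis Ψ ε i).2⟩ : H) =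
        fundamentalBasis Ψ ε (Γ.θ i) := by
      apply (fundamentalBasis Ψ ε).ext_elem
      intro j
      rw [fundamentalBasis_repr, (fundamentalBasis Ψ ε).repr_self]
      refine (hθ j _).symm.trans ?_
      have h2 := fundamentalBasis_repr Ψ ε (fundamentalBasis Ψ ε i) (Γ.θ j)
      rw [(fundamentalBasis Ψ ε).repr_self] at h2
      refine h2.symm.trans ?_
      rw [Finsupp.single_apply, Finsupp.single_apply]
      refine if_congr ?_ rfl rfl
      constructor
      · rintro rfl; exact Γ.θ_θ j
      · rintro rfl; exact (Γ.θ_θ i).symm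
    exact congrArg Subtype.val h1
  · simp only [hl]
    refine (eq_sum_smul_fundamentalBasis Ψ ε ⟨h, hh⟩).trans ?_
    exact Finset.sum_congr rfl fun i _ => by rw [hω]; rfl
  · intro i
    rw [hJ i, hr]
    refine and_congr_right fun _ => ?_
    have h1 : rootSpace H (rootForm Ψ ε (Pi.single i 1)) = rootSpace H (ε i).1.1 := by
      rw [rootForm_single]; rfl
    have hxi := hx ⟨Pi.single i 1, .simple i⟩
    constructor
    · intro H1
      exact H1 _ (h1 ▸ hxi)
    · intro H1 z hz
      obtain ⟨c, rfl⟩ := exists_smul_eq_of_mem_rootSpace Ψ ε hcart (.simple i) (hx0 ⟨_, .simple i⟩) hxi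
        (h1 ▸ hz)
      rw [map_smul, H1, smul_neg]

end Bridge

/-! ### The action of `θ` on coefficient vectors. -/

namespace WeightedVoganDiagram

variable {ι : Type*} [Fintype ι] [DecidableEq ι] {Γ : WeightedVoganDiagram ι}

lemma θ_symm_apply (i : ι) : Γ.θ.symm i = Γ.θ i := by
  rw [Equiv.symm_apply_eq, Γ.θ_θ]

lemma act_apply (v : ι → ℤ) (i : ι) : Γ.act v i = v (Γ.θ i) := by
  rw [act, θ_symm_apply]

lemma act_act (v : ι → ℤ) : Γ.act (Γ.act v) = v := by
  funext i
  rw [act_apply, act_apply, Γ.θ_θ]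

lemma act_neg (v : ι → ℤ) : Γ.act (-v) = -Γ.act v := rfl

lemma act_sub (v w : ι → ℤ) : Γ.act (v - w) = Γ.act v - Γ.act w := rfl

lemma act_single (i : ι) (n : ℤ) : Γ.act (Pi.single i n) = Pi.single (Γ.θ i) n := by
  funext j
  rw [act_apply, Pi.single_apply, Pi.single_apply]
  refine if_congr ?_ rfl rfl
  constructor
  · rintro rfl; exact (Γ.θ_θ j).symm
  · rintro rfl; exact Γ.θ_θ i

lemma sum_comp_θ {M : Type*} [AddCommMonoid M] (f : ι → M) : ∑ i, f (Γ.θ i) = ∑ i, f i :=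
  Equiv.sum_comp Γ.θ f

lemma pair_act (v : ι → ℤ) (j : ι) : Γ.pair (Γ.act v) (Γ.θ j) = Γ.pair v j := by
  rw [pair, pair, ← sum_comp_θ (Γ := Γ)]
  exact Finset.sum_congr rfl fun i _ => by rw [act_apply, Γ.θ_θ, Γ.θ_cartan]

lemma weight_act (v : ι → ℤ) : Γ.weight (Γ.act v) = Γ.weight v := by
  rw [weight, weight, ← sum_comp_θ (Γ := Γ)]
  exact Finset.sum_congr rfl fun i _ => by rw [act_apply, Γ.θ_θ, Γ.ω_θ]

lemma weight_neg (v : ι → ℤ) : Γ.weight (-v) = -Γ.weight v := by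
  simp [weight]

lemma weight_add (v w : ι → ℤ) : Γ.weight (v + w) = Γ.weight v + Γ.weight w := by
  simp [weight, add_mul, Finset.sum_add_distrib]

lemma IsRoot.act {v : ι → ℤ} (hv : Γ.IsRoot v) : Γ.IsRoot (Γ.act v) := by
  induction hv with
  | simple i => rw [act_single]; exact .simple _
  | reflection j v _ ih =>
    have h := IsRoot.reflection (Γ.θ j) _ ih
    have h1 : ∑ i, Γ.act v i * Γ.cartan i (Γ.θ j) = ∑ i, v i * Γ.cartan i j := pair_act v j
    rw [h1, ← act_single] at h
    exact h

lemma IsRealized.nonneg_of_weight_pos (hΓ : Γ.IsRealized) {v : ι → ℤ} (hv : Γ.IsRoot v)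
    (hw : 0 < Γ.weight v) (i : ι) : 0 ≤ v i := by
  rcases hΓ.nonneg_or_nonpos v hv with h | h
  · exact h i
  · exact absurd hw (not_lt.mpr (Finset.sum_nonpos fun i _ =>
      mul_nonpos_of_nonpos_of_nonneg (h i) (Int.natCast_nonneg _)))

end WeightedVoganDiagram

/-! ### Root vectors, signs of `θ`, and the support of `e`. -/

namespace VoganBasis

open Module WeightedVoganDiagram

variable {g : Type*} [LieRing g] [LieAlgebra ℂ g] {θ : g →ₗ[ℂ] g} {τ : g →ₗ⋆[ℂ] g} {h e f : g}
  {ι : Type*} [Fintype ι] [DecidableEq ι] {Γ : WeightedVoganDiagram ι} (b : VoganBasis Γ θ h)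

/-- The element of the Cartan subalgebra dual to a simple root. -/
noncomputable def y (i : ι) : g := b.basis (.inl i)

open Classical in
/-- The root vector for `v`, which is zero if `v` is not a root. -/
noncomputable def x (v : ι → ℤ) : g := if hv : Γ.IsRoot v then b.basis (.inr ⟨v, hv⟩) else 0

open Classical in
/-- The coefficient of an element at a root vector. -/
noncomputable def coeff (v : ι → ℤ) : g →ₗ[ℂ] ℂ :=
  if hv : Γ.IsRoot v then b.basis.coord (.inr ⟨v, hv⟩) else 0

lemma x_eq {v : ι → ℤ} (hv : Γ.IsRoot v) : b.x v = b.basis (.inr ⟨v, hv⟩) := dif_pos hv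

lemma x_eq_zero {v : ι → ℤ} (hv : ¬ Γ.IsRoot v) : b.x v = 0 := dif_neg hv

lemma x_ne_zero {v : ι → ℤ} (hv : Γ.IsRoot v) : b.x v ≠ 0 := by
  rw [b.x_eq hv]
  exact b.basis.ne_zero _

lemma coeff_eq {v : ι → ℤ} (hv : Γ.IsRoot v) : b.coeff v = b.basis.coord (.inr ⟨v, hv⟩) := dif_pos hv

lemma isRoot_of_coeff_ne_zero {v : ι → ℤ} {z : g} (hv : b.coeff v z ≠ 0) : Γ.IsRoot v := by
  by_contra h0
  rw [coeff, dif_neg h0] at hv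
  exact hv rfl

lemma coeff_x_self {v : ι → ℤ} (hv : Γ.IsRoot v) : b.coeff v (b.x v) = 1 := by
  rw [b.coeff_eq hv, b.x_eq hv, Basis.coord_apply, Basis.repr_self, Finsupp.single_eq_same]

lemma coeff_x_of_ne {u v : ι → ℤ} (hne : u ≠ v) : b.coeff v (b.x u) = 0 := by
  by_cases hv : Γ.IsRoot v
  · by_cases hu : Γ.IsRoot u
    · rw [b.coeff_eq hv, b.x_eq hu, Basis.coord_apply, Basis.repr_self,
        Finsupp.single_eq_of_ne (by simpa using hne.symm)]
    · rw [b.x_eq_zero hu, map_zero]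
  · rw [coeff, dif_neg hv]; rfl

lemma isRoot_ne_zero (b : VoganBasis Γ θ h) {v : ι → ℤ} (hv : Γ.IsRoot v) : v ≠ 0 := by
  rintro rfl
  obtain ⟨c, -, hc⟩ := b.lie_inr_neg ⟨0, hv⟩
  simp at hc

/-- The weight of a basis vector. -/
def wt (_ : VoganBasis Γ θ h) : ι ⊕ {v // Γ.IsRoot v} → ι → ℤ := Sum.elim (fun _ => 0) (fun r => r.1)

lemma lie_y_basis (i : ι) (k : ι ⊕ {v // Γ.IsRoot v}) :
    ⁅b.y i, b.basis k⁆ = (b.wt k i : ℂ) • b.basis k := by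
  rcases k with j | r
  · rw [y, b.lie_inl_inl]; simp [wt]
  · exact b.lie_inl_inr i r

lemma lie_sum_y_basis (c : ι → ℂ) (k : ι ⊕ {v // Γ.IsRoot v}) :
    ⁅∑ i, c i • b.y i, b.basis k⁆ = (∑ i, c i * (b.wt k i : ℂ)) • b.basis k := by
  rw [sum_lie, Finset.sum_smul]
  exact Finset.sum_congr rfl fun i _ => by rw [smul_lie, b.lie_y_basis, smul_smul]

lemma repr_lie_sum_y (c : ι → ℂ) (z : g) (k : ι ⊕ {v // Γ.IsRoot v}) :
    b.basis.repr ⁅∑ i, c i • b.y i, z⁆ k = (∑ i, c i * (b.wt k i : ℂ)) * b.basis.repr z k := by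
  have h1 : b.basis.coord k ∘ₗ (LieAlgebra.ad ℂ g (∑ i, c i • b.y i) : g →ₗ[ℂ] g) =
      (∑ i, c i * (b.wt k i : ℂ)) • b.basis.coord k := by
    refine b.basis.ext fun l => ?_
    rw [LinearMap.comp_apply, LieAlgebra.ad_apply, b.lie_sum_y_basis, map_smul, LinearMap.smul_apply]
    by_cases hkl : l = k
    · rw [hkl]
    · rw [Basis.coord_apply, Basis.repr_self, Finsupp.single_eq_of_ne (Ne.symm hkl), smul_zero, smul_zero]
  exact LinearMap.congr_fun h1 z

lemma repr_lie_y (i : ι) (z : g) (k : ι ⊕ {v // Γ.IsRoot v}) :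
    b.basis.repr ⁅b.y i, z⁆ k = (b.wt k i : ℂ) * b.basis.repr z k := by
  have h1 := b.repr_lie_sum_y (Pi.single i 1) z k
  rwa [Finset.sum_eq_single i (by intro j _ hj; simp [hj]) (by simp),
    Finset.sum_eq_single i (by intro j _ hj; simp [hj]) (by simp), Pi.single_eq_same, one_smul,
    one_mul] at h1

lemma repr_lie_h (z : g) (k : ι ⊕ {v // Γ.IsRoot v}) :
    b.basis.repr ⁅h, z⁆ k = (Γ.weight (b.wt k) : ℂ) * b.basis.repr z k := by
  have h1 := b.repr_lie_sum_y (fun i => (Γ.ω i : ℂ)) z k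
  have h2 : h = ∑ i, (Γ.ω i : ℂ) • b.y i := b.h_eq
  rw [← h2] at h1
  rw [h1, weight]
  push_cast
  congr 1
  exact Finset.sum_congr rfl fun i _ => mul_comm _ _

lemma lie_y_x (i : ι) (v : ι → ℤ) : ⁅b.y i, b.x v⁆ = (v i : ℂ) • b.x v := by
  by_cases hv : Γ.IsRoot v
  · rw [b.x_eq hv]; exact b.lie_y_basis i _
  · rw [b.x_eq_zero hv, lie_zero, smul_zero]

lemma lie_sum_y_x (c : ι → ℂ) (v : ι → ℤ) :
    ⁅∑ i, c i • b.y i, b.x v⁆ = (∑ i, c i * (v i : ℂ)) • b.x v := by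
  by_cases hv : Γ.IsRoot v
  · rw [b.x_eq hv]; exact b.lie_sum_y_basis c _
  · rw [b.x_eq_zero hv, lie_zero, smul_zero]

lemma lie_h_x (v : ι → ℤ) : ⁅h, b.x v⁆ = (Γ.weight v : ℂ) • b.x v := by
  have h2 : h = ∑ i, (Γ.ω i : ℂ) • b.y i := b.h_eq
  have h1 := b.lie_sum_y_x (fun i => (Γ.ω i : ℂ)) v
  rw [← h2] at h1
  rw [h1, weight]
  push_cast
  congr 1
  exact Finset.sum_congr rfl fun i _ => mul_comm _ _

lemma lie_y_y (i j : ι) : ⁅b.y i, b.y j⁆ = 0 := b.lie_inl_inl i j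

lemma θ_y (i : ι) : θ (b.y i) = b.y (Γ.θ i) := b.θ_inl i

lemma lie_h_y (i : ι) : ⁅h, b.y i⁆ = 0 := by
  have h2 : h = ∑ i, (Γ.ω i : ℂ) • b.y i := b.h_eq
  refine (congrArg (⁅·, b.y i⁆) h2).trans ?_
  rw [sum_lie]
  exact Finset.sum_eq_zero fun j _ => by rw [smul_lie, b.lie_y_y, smul_zero]

/-- Simultaneous eigenvectors of nonzero weight are multiples of root vectors. -/
lemma exists_eq_smul_x {z : g} {u : ι → ℤ} (hz : ∀ i, ⁅b.y i, z⁆ = (u i : ℂ) • z) (hu : u ≠ 0) :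
    ∃ c : ℂ, z = c • b.x u := by
  have h1 : ∀ k, b.wt k ≠ u → b.basis.repr z k = 0 := by
    intro k hk
    obtain ⟨i, hi⟩ := Function.ne_iff.mp hk
    have h2 := b.repr_lie_y i z k
    rw [hz, map_smul, Finsupp.smul_apply, smul_eq_mul, ← sub_eq_zero, ← sub_mul, mul_eq_zero] at h2
    refine h2.resolve_left fun h3 => hi ?_
    rw [sub_eq_zero] at h3
    exact_mod_cast h3.symm
  refine ⟨b.coeff u z, b.basis.ext_elem fun k => ?_⟩
  by_cases hk : b.wt k = u
  · rcases k with j | r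
    · exact absurd hk.symm hu
    · subst hk
      rw [map_smul, Finsupp.smul_apply, smul_eq_mul]
      change _ = b.coeff r.1 z * b.basis.repr (b.x r.1) _
      rw [b.coeff_eq r.2, b.x_eq r.2, Basis.repr_self]
      simp
  · rw [h1 k hk, map_smul, Finsupp.smul_apply, smul_eq_mul]
    by_cases hur : Γ.IsRoot u
    · rw [b.x_eq hur, Basis.repr_self, Finsupp.single_eq_of_ne, mul_zero]
      rintro rfl
      exact hk rfl
    · rw [b.x_eq_zero hur]; simp

lemma lie_y_lie_x_x (i : ι) (u v : ι → ℤ) :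
    ⁅b.y i, ⁅b.x u, b.x v⁆⁆ = ((u + v) i : ℂ) • ⁅b.x u, b.x v⁆ := by
  rw [leibniz_lie, b.lie_y_x, b.lie_y_x, smul_lie, lie_smul, ← add_smul, Pi.add_apply]
  push_cast
  rfl

lemma exists_lie_x_x (u v : ι → ℤ) (huv : u + v ≠ 0) : ∃ c : ℂ, ⁅b.x u, b.x v⁆ = c • b.x (u + v) :=
  b.exists_eq_smul_x (fun i => by exact_mod_cast b.lie_y_lie_x_x i u v) huv

lemma exists_lie_x_neg {v : ι → ℤ} (hv : Γ.IsRoot v) : ∃ c : ι → ℂ,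
    ⁅b.x v, b.x (-v)⁆ = ∑ i, c i • b.y i ∧ ∑ i, c i * (v i : ℂ) ≠ 0 := by
  rw [b.x_eq hv, b.x_eq hv.neg]
  exact b.lie_inr_neg ⟨v, hv⟩

lemma lie_x_neg_single_ne_zero {v : ι → ℤ} (hv : Γ.IsRoot v) {i : ι} (hp : 0 < Γ.pair v i) :
    ⁅b.x (-Pi.single i 1), b.x v⁆ ≠ 0 := by
  rw [b.x_eq hv, b.x_eq (IsRoot.simple i).neg]
  exact b.lie_lower_ne_zero i ⟨v, hv⟩ hp

lemma mem_J_iff (i : ι) :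
    i ∈ Γ.J ↔ Γ.θ i = i ∧ θ (b.x (Pi.single i 1)) = -b.x (Pi.single i 1) := by
  rw [b.x_eq (.simple i)]
  exact b.mem_J i

lemma exists_θ_x (hT : NoticedTriple θ τ h e f) {v : ι → ℤ} (hv : Γ.IsRoot v) :
    ∃ c : ℂ, θ (b.x v) = c • b.x (Γ.act v) := by
  refine b.exists_eq_smul_x (fun i => ?_) (b.isRoot_ne_zero hv.act)
  have h1 := congrArg θ (b.lie_y_x (Γ.θ i) v)
  rwa [hT.θ_lie, b.θ_y, Γ.θ_θ, map_smul, ← act_apply v] at h1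

/-- The sign of `θ` on the root space of a fixed root. -/
noncomputable def sign (v : ι → ℤ) : ℂ := b.coeff v (θ (b.x v))

lemma θ_x_of_act_eq (hT : NoticedTriple θ τ h e f) {v : ι → ℤ} (hv : Γ.IsRoot v) (hfix : Γ.act v = v) :
    θ (b.x v) = b.sign v • b.x v := by
  obtain ⟨c, hc⟩ := b.exists_θ_x hT hv
  rw [hfix] at hc
  rw [sign, hc, map_smul, b.coeff_x_self hv, smul_eq_mul, mul_one]

lemma sign_of_act_ne (hT : NoticedTriple θ τ h e f) {v : ι → ℤ} (hv : Γ.IsRoot v) (hfix : Γ.act v ≠ v) :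
    b.sign v = 0 := by
  obtain ⟨c, hc⟩ := b.exists_θ_x hT hv
  rw [sign, hc, map_smul, b.coeff_x_of_ne hfix, smul_zero]

lemma sign_eq_one_or (hT : NoticedTriple θ τ h e f) {v : ι → ℤ} (hv : Γ.IsRoot v)
    (hfix : Γ.act v = v) : b.sign v = 1 ∨ b.sign v = -1 := by
  have h1 := congrArg θ (b.θ_x_of_act_eq hT hv hfix)
  rw [hT.θ_θ, map_smul, b.θ_x_of_act_eq hT hv hfix, smul_smul] at h1
  have h2 : (b.sign v * b.sign v - 1) • b.x v = 0 := by rw [sub_smul, one_smul, ← h1, sub_self]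
  have h3 := (smul_eq_zero.mp h2).resolve_right (b.x_ne_zero hv)
  exact mul_self_eq_one_iff.mp (sub_eq_zero.mp h3)

lemma linearIndependent_y : LinearIndependent ℂ b.y :=
  b.basis.linearIndependent.comp _ Sum.inl_injective

/-- Applying `θ` to `[x_v, x_{-v}]` multiplies it by the product of the two signs. The bracket lies
in the Cartan subalgebra, and `v` takes a nonzero value on it, unchanged by `θ` because `v` is
fixed. So the product is one. -/
lemma sign_neg (hT : NoticedTriple θ τ h e f) {v : ι → ℤ} (hv : Γ.IsRoot v) (hfix : Γ.act v = v) :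
    b.sign (-v) = b.sign v := by
  obtain ⟨c, hc, hc0⟩ := b.exists_lie_x_neg hv
  have hfix' : Γ.act (-v) = -v := by rw [act_neg, hfix]
  have h1 := congrArg θ hc
  rw [hT.θ_lie, b.θ_x_of_act_eq hT hv hfix, b.θ_x_of_act_eq hT hv.neg hfix', lie_smul, smul_lie, hc,
    map_sum] at h1
  have h2 : ∑ i, θ (c i • b.y i) = ∑ i, c (Γ.θ i) • b.y i := by
    rw [← sum_comp_θ (Γ := Γ)]
    exact Finset.sum_congr rfl fun i _ => by rw [map_smul, b.θ_y, Γ.θ_θ]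
  rw [h2, smul_smul, Finset.smul_sum, ← sub_eq_zero, ← Finset.sum_sub_distrib] at h1
  simp only [smul_smul, ← sub_smul] at h1
  have h3 := Fintype.linearIndependent_iff.mp b.linearIndependent_y _ h1
  have h4 : ∑ i, c (Γ.θ i) * (v i : ℂ) = ∑ i, c i * (v i : ℂ) := by
    rw [← sum_comp_θ (Γ := Γ)]
    exact Finset.sum_congr rfl fun i _ => by rw [Γ.θ_θ, ← act_apply v, hfix]
  have h5 : b.sign (-v) * b.sign v * ∑ i, c i * (v i : ℂ) = ∑ i, c i * (v i : ℂ) := by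
    conv_rhs => rw [← h4]
    rw [Finset.mul_sum]
    exact Finset.sum_congr rfl fun i _ => by rw [← sub_eq_zero.mp (h3 i)]; ring
  have h6 : b.sign (-v) * b.sign v = 1 := mul_right_cancel₀ hc0 (by rw [h5, one_mul])
  rcases b.sign_eq_one_or hT hv hfix with h7 | h7 <;> rw [h7] at h6 ⊢
  · rwa [mul_one] at h6
  · rw [mul_neg_one] at h6; rw [← h6, neg_neg]

lemma weight_eq_of_coeff_ne_zero {z : g} {r : ℤ} (hz : ⁅h, z⁆ = (r : ℂ) • z) {v : ι → ℤ}
    (hv : b.coeff v z ≠ 0) : Γ.weight v = r := by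
  have hr := b.isRoot_of_coeff_ne_zero hv
  rw [b.coeff_eq hr] at hv
  have h1 := b.repr_lie_h z (.inr ⟨v, hr⟩)
  rw [hz, map_smul, Finsupp.smul_apply, smul_eq_mul] at h1
  have h2 := mul_right_cancel₀ hv h1
  exact_mod_cast h2.symm

lemma coeff_y (v : ι → ℤ) (i : ι) : b.coeff v (b.y i) = 0 := by
  by_cases hv : Γ.IsRoot v
  · rw [b.coeff_eq hv, y, Basis.coord_apply, Basis.repr_self, Finsupp.single_eq_of_ne (by simp)]
  · rw [coeff, dif_neg hv]; rfl

lemma coeff_act_θ (hT : NoticedTriple θ τ h e f) {v : ι → ℤ} {c : ℂ}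
    (hc : θ (b.x v) = c • b.x (Γ.act v)) (z : g) : b.coeff (Γ.act v) (θ z) = c * b.coeff v z := by
  have h1 : b.coeff (Γ.act v) ∘ₗ θ = c • b.coeff v := by
    refine b.basis.ext fun k => ?_
    rw [LinearMap.comp_apply, LinearMap.smul_apply, smul_eq_mul]
    rcases k with i | r
    · change b.coeff _ (θ (b.y i)) = c * b.coeff v (b.y i)
      rw [b.θ_y, b.coeff_y, b.coeff_y, mul_zero]
    · rw [← b.x_eq r.2]
      by_cases hrv : r.1 = v
      · subst hrv
        rw [hc, map_smul, b.coeff_x_self r.2, b.coeff_x_self r.2.act, smul_eq_mul]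
      · obtain ⟨c', hc'⟩ := b.exists_θ_x hT r.2
        rw [hc', map_smul, b.coeff_x_of_ne hrv, b.coeff_x_of_ne, smul_zero, mul_zero]
        intro h0
        apply hrv
        rw [← act_act (Γ := Γ) r.1, h0, act_act]
  exact LinearMap.congr_fun h1 z

lemma coeff_act_ne_zero (hT : NoticedTriple θ τ h e f) {v : ι → ℤ} (hv : b.coeff v e ≠ 0) :
    b.coeff (Γ.act v) e ≠ 0 := by
  obtain ⟨c, hc⟩ := b.exists_θ_x hT (b.isRoot_of_coeff_ne_zero hv)
  have h1 := b.coeff_act_θ hT hc e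
  rw [hT.θ_e, map_neg] at h1
  intro h2
  rw [h2, neg_zero, zero_eq_mul] at h1
  rcases h1 with h1 | h1
  · rw [h1, zero_smul] at hc
    apply b.x_ne_zero (b.isRoot_of_coeff_ne_zero hv)
    rw [← hT.θ_θ (b.x v), hc, map_zero]
  · exact hv h1

/-- The element `e` lies in the `-1` eigenspace of `θ`, so only noncompact fixed roots can occur in
it. -/
lemma sign_eq_neg_one (hT : NoticedTriple θ τ h e f) {v : ι → ℤ} (hv : b.coeff v e ≠ 0)
    (hfix : Γ.act v = v) : b.sign v = -1 := by
  have hc := b.θ_x_of_act_eq hT (b.isRoot_of_coeff_ne_zero hv) hfix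
  have h1 := b.coeff_act_θ hT (c := b.sign v) (by rw [hfix]; exact hc) e
  rw [hT.θ_e, map_neg, hfix] at h1
  exact mul_right_cancel₀ hv (by rw [← h1, neg_one_mul])

lemma weight_eq_two (hT : NoticedTriple θ τ h e f) {v : ι → ℤ} (hv : b.coeff v e ≠ 0) :
    Γ.weight v = 2 :=
  b.weight_eq_of_coeff_ne_zero (r := 2) (by rw [hT.sl2.lie_h_e_smul ℂ]; norm_num) hv

lemma mem_posRoots (hT : NoticedTriple θ τ h e f) {v : ι → ℤ} (hv : b.coeff v e ≠ 0) :
    v ∈ Γ.posRoots :=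
  ⟨b.isRoot_of_coeff_ne_zero hv, b.realized.nonneg_of_weight_pos (b.isRoot_of_coeff_ne_zero hv)
    (by rw [b.weight_eq_two hT hv]; norm_num)⟩

/-- A `θ`-invariant element of the Cartan subalgebra on which all the roots in the support of `e`
vanish is zero. -/
lemma eq_zero_of_forall_support (hT : NoticedTriple θ τ h e f) (c : ι → ℂ) (hc : ∀ i, c (Γ.θ i) = c i)
    (h0 : ∀ v, b.coeff v e ≠ 0 → ∑ i, c i * (v i : ℂ) = 0) : c = 0 := by
  have h1 : ∑ i, c i • b.y i = 0 := by
    apply hT.eq_zero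
    · rw [map_sum, ← sum_comp_θ (Γ := Γ)]
      exact Finset.sum_congr rfl fun i _ => by rw [map_smul, b.θ_y, Γ.θ_θ, hc]
    · rw [lie_sum]
      exact Finset.sum_eq_zero fun i _ => by rw [lie_smul, b.lie_h_y, smul_zero]
    · rw [← lie_skew, neg_eq_zero]
      refine b.basis.ext_elem fun k => ?_
      rw [b.repr_lie_sum_y, map_zero, Finsupp.zero_apply, mul_eq_zero, or_iff_not_imp_right]
      intro hk
      rcases k with i | r
      · simp [wt]
      · refine h0 r.1 ?_
        rwa [b.coeff_eq r.2]
  exact funext (Fintype.linearIndependent_iff.mp b.linearIndependent_y c h1)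

/-- Every node occurs in the support of `e`. -/
lemma exists_coeff_ne_zero (hT : NoticedTriple θ τ h e f) (j : ι) :
    ∃ v, b.coeff v e ≠ 0 ∧ 0 < v j := by
  by_contra! hcon
  have h0 : ∀ v, b.coeff v e ≠ 0 → v j = 0 := fun v hv =>
    le_antisymm (hcon v hv) ((b.mem_posRoots hT hv).2 j)
  -- The indicator of the orbit of `j` gives a nonzero `θ`-invariant Cartan element; if `j` never
  -- occurred, neither would `θ j`, and all roots in the support would vanish on it.
  have h1 := b.eq_zero_of_forall_support hT (fun i => if i = j ∨ i = Γ.θ j then 1 else 0) ?_ ?_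
  · have := congrFun h1 j
    simp at this
  · intro i
    refine if_congr ?_ rfl rfl
    constructor
    · rintro (h | h)
      · exact .inr (by rw [← h, Γ.θ_θ])
      · exact .inl (Γ.θ.injective h)
    · rintro (h | h)
      · exact .inr (by rw [h])
      · exact .inl (by rw [h, Γ.θ_θ])
  · intro v hv
    refine Finset.sum_eq_zero fun i _ => ?_
    split_ifs with h
    · rcases h with rfl | rfl
      · rw [h0 v hv]; simp
      · rw [← act_apply v, h0 _ (b.coeff_act_ne_zero hT hv)]; simp
    · rw [zero_mul]

end VoganBasis

/-! ### The trace of `θ` in degree one. -/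

namespace VoganBasis

open Module WeightedVoganDiagram

variable {g : Type*} [LieRing g] [LieAlgebra ℂ g] {θ : g →ₗ[ℂ] g} {τ : g →ₗ⋆[ℂ] g} {h e f : g}
  {ι : Type*} [Fintype ι] [DecidableEq ι] {Γ : WeightedVoganDiagram ι} (b : VoganBasis Γ θ h)

lemma finite_rootsOfWeight (b : VoganBasis Γ θ h) (n : ℤ) :
    Finite {v : ι → ℤ // Γ.IsRoot v ∧ Γ.weight v = n} :=
  (b.realized.finite.subset fun _ hv => hv.1).to_subtype

lemma ext_of_lie_h {z z' : g} {n : ℤ} (hn : n ≠ 0) (hz : ⁅h, z⁆ = (n : ℂ) • z)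
    (hz' : ⁅h, z'⁆ = (n : ℂ) • z')
    (hc : ∀ v, Γ.IsRoot v → Γ.weight v = n → b.coeff v z = b.coeff v z') : z = z' := by
  have h0 : ∀ {z : g}, ⁅h, z⁆ = (n : ℂ) • z → ∀ k, Γ.weight (b.wt k) ≠ n → b.basis.repr z k = 0 := by
    intro z hz k hk
    have h1 := b.repr_lie_h z k
    rw [hz, map_smul, Finsupp.smul_apply, smul_eq_mul, ← sub_eq_zero, ← sub_mul, mul_eq_zero] at h1
    refine h1.resolve_left fun h2 => hk ?_
    exact_mod_cast (sub_eq_zero.mp h2).symm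
  refine b.basis.ext_elem fun k => ?_
  by_cases hk : Γ.weight (b.wt k) = n
  · rcases k with i | r
    · exact absurd (by simpa [wt, weight] using hk) hn.symm
    · have := hc r.1 r.2 hk
      rwa [b.coeff_eq r.2] at this
  · rw [h0 hz k hk, h0 hz' k hk]

section

variable (n : ℤ) [Fintype {v : ι → ℤ // Γ.IsRoot v ∧ Γ.weight v = n}]

/-- The linear combination of root vectors of a given weight. -/
noncomputable def inclusion : ({v : ι → ℤ // Γ.IsRoot v ∧ Γ.weight v = n} → ℂ) →ₗ[ℂ] g :=
  Fintype.linearCombination ℂ fun r => b.x r.1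

/-- The coefficients at the root vectors of a given weight. -/
noncomputable def projection (n : ℤ) : g →ₗ[ℂ] ({v : ι → ℤ // Γ.IsRoot v ∧ Γ.weight v = n} → ℂ) :=
  LinearMap.pi fun r => b.coeff r.1

lemma lie_h_inclusion (c : {v : ι → ℤ // Γ.IsRoot v ∧ Γ.weight v = n} → ℂ) :
    ⁅h, b.inclusion n c⁆ = (n : ℂ) • b.inclusion n c := by
  rw [inclusion, Fintype.linearCombination_apply, lie_sum, Finset.smul_sum]
  exact Finset.sum_congr rfl fun r _ => by rw [lie_smul, b.lie_h_x, r.2.2, smul_comm]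

lemma projection_inclusion (c : {v : ι → ℤ // Γ.IsRoot v ∧ Γ.weight v = n} → ℂ) :
    b.projection n (b.inclusion n c) = c := by
  funext r
  rw [projection, LinearMap.pi_apply, inclusion, Fintype.linearCombination_apply, map_sum,
    Finset.sum_eq_single r]
  · rw [map_smul, b.coeff_x_self r.2.1, smul_eq_mul, mul_one]
  · intro s _ hs
    rw [map_smul, b.coeff_x_of_ne (fun h0 => hs (Subtype.ext h0)), smul_zero]
  · simp

lemma inclusion_projection {z : g} (hn : n ≠ 0) (hz : ⁅h, z⁆ = (n : ℂ) • z) :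
    b.inclusion n (b.projection n z) = z := by
  refine b.ext_of_lie_h hn (b.lie_h_inclusion n _) hz fun v hv hw => ?_
  exact congrFun (b.projection_inclusion n (b.projection n z)) ⟨v, hv, hw⟩

/-- The action of `θ` on the coordinates at the root vectors of a given weight. -/
noncomputable def θRestrict : ({v : ι → ℤ // Γ.IsRoot v ∧ Γ.weight v = n} → ℂ) →ₗ[ℂ]
    ({v : ι → ℤ // Γ.IsRoot v ∧ Γ.weight v = n} → ℂ) :=
  b.projection n ∘ₗ θ ∘ₗ b.inclusion n

lemma trace_θRestrict : LinearMap.trace ℂ _ (b.θRestrict n) =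
    ∑ r : {v : ι → ℤ // Γ.IsRoot v ∧ Γ.weight v = n}, b.sign r.1 := by
  classical
  rw [LinearMap.trace_eq_matrix_trace ℂ (Pi.basisFun ℂ _), Matrix.trace]
  refine Finset.sum_congr rfl fun r _ => ?_
  rw [Matrix.diag_apply, LinearMap.toMatrix_apply, Pi.basisFun_apply, Pi.basisFun_repr, θRestrict,
    LinearMap.comp_apply, LinearMap.comp_apply, inclusion, Fintype.linearCombination_apply_single,
    one_smul]
  rfl

end

/-- `ad e` identifies degree `-1` with degree `1` and intertwines `θ` with `-θ`, so the two traces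
are opposite; they also coincide, because negation of roots preserves signs. -/
lemma sum_sign_eq_zero (hT : NoticedTriple θ τ h e f)
    [Fintype {v : ι → ℤ // Γ.IsRoot v ∧ Γ.weight v = 1}] :
    ∑ r : {v : ι → ℤ // Γ.IsRoot v ∧ Γ.weight v = 1}, b.sign r.1 = 0 := by
  have := b.finite_rootsOfWeight (-1)
  let _ := Fintype.ofFinite {v : ι → ℤ // Γ.IsRoot v ∧ Γ.weight v = -1}
  let ν : {v : ι → ℤ // Γ.IsRoot v ∧ Γ.weight v = 1} ≃ {v : ι → ℤ // Γ.IsRoot v ∧ Γ.weight v = -1} :=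
    (Equiv.neg _).subtypeEquiv fun v => by
      rw [Equiv.neg_apply, weight_neg, neg_inj]
      exact and_congr_left fun _ => ⟨fun h => h.neg, fun h => neg_neg v ▸ h.neg⟩
  have hsum : ∑ r : {v : ι → ℤ // Γ.IsRoot v ∧ Γ.weight v = -1}, b.sign r.1 =
      ∑ r : {v : ι → ℤ // Γ.IsRoot v ∧ Γ.weight v = 1}, b.sign r.1 := by
    rw [← ν.sum_comp]
    refine Finset.sum_congr rfl fun r _ => ?_
    change b.sign (-r.1) = b.sign r.1
    by_cases hfix : Γ.act r.1 = r.1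
    · exact b.sign_neg hT r.2.1 hfix
    · rw [b.sign_of_act_ne hT r.2.1 hfix, b.sign_of_act_ne hT r.2.1.neg]
      rwa [act_neg, Ne, neg_inj]
  have hh : ∀ {z : g} {n : ℤ}, ⁅h, z⁆ = (n : ℂ) • z → ⁅h, θ z⁆ = (n : ℂ) • θ z := by
    intro z n hz
    have := congrArg θ hz
    rwa [hT.θ_lie, hT.θ_h, map_smul] at this
  have he : ∀ {z : g}, ⁅h, z⁆ = ((-1 : ℤ) : ℂ) • z → ⁅h, ⁅e, z⁆⁆ = ((1 : ℤ) : ℂ) • ⁅e, z⁆ := by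
    intro z hz
    rw [leibniz_lie, hz, hT.sl2.lie_h_e_smul ℂ, smul_lie, lie_smul, ← add_smul]
    norm_num
  let T : ({v : ι → ℤ // Γ.IsRoot v ∧ Γ.weight v = -1} → ℂ) →ₗ[ℂ]
      ({v : ι → ℤ // Γ.IsRoot v ∧ Γ.weight v = 1} → ℂ) :=
    b.projection 1 ∘ₗ (LieAlgebra.ad ℂ g e : g →ₗ[ℂ] g) ∘ₗ b.inclusion (-1)
  have hT1 : ∀ c, b.inclusion 1 (T c) = ⁅e, b.inclusion (-1) c⁆ := fun c =>
    b.inclusion_projection 1 one_ne_zero (he (b.lie_h_inclusion (-1) c))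
  have hinj : Function.Injective T := by
    rw [← LinearMap.ker_eq_bot, LinearMap.ker_eq_bot']
    intro c hc
    have h1 := hT1 c
    rw [hc, map_zero] at h1
    have h2 := hT.eq_zero_of_lie_e_eq_zero (r := -1) (by norm_num)
      (by simpa using b.lie_h_inclusion (-1) c) h1.symm
    rw [← b.projection_inclusion (-1) c, h2, map_zero]
  have hcomm : ∀ c, T (b.θRestrict (-1) c) = -b.θRestrict 1 (T c) := by
    intro c
    have h1 : b.inclusion (-1) (b.θRestrict (-1) c) = θ (b.inclusion (-1) c) :=
      b.inclusion_projection (-1) (by norm_num) (hh (b.lie_h_inclusion (-1) c))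
    have h2 : b.inclusion 1 (b.θRestrict 1 (T c)) = θ (b.inclusion 1 (T c)) :=
      b.inclusion_projection 1 (by norm_num) (hh (b.lie_h_inclusion 1 _))
    have h3 : b.inclusion 1 (T (b.θRestrict (-1) c)) = b.inclusion 1 (-b.θRestrict 1 (T c)) := by
      rw [hT1, h1, map_neg, h2, hT1, hT.θ_lie, hT.θ_e, neg_lie, neg_neg]
    rw [← b.projection_inclusion 1 (T (b.θRestrict (-1) c)), h3, b.projection_inclusion]
  let E := LinearEquiv.ofInjectiveOfFinrankEq T hinj (by
    rw [Module.finrank_fintype_fun_eq_card, Module.finrank_fintype_fun_eq_card,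
      Fintype.card_congr ν])
  have hconj : E.conj (b.θRestrict (-1)) = -b.θRestrict 1 := by
    refine LinearMap.ext fun c => ?_
    rw [LinearEquiv.conj_apply_apply, LinearMap.neg_apply]
    refine (hcomm _).trans ?_
    congr 2
    exact E.apply_symm_apply c
  have htr := LinearMap.trace_conj' (b.θRestrict (-1)) E
  rw [hconj, map_neg, b.trace_θRestrict, b.trace_θRestrict, hsum] at htr
  exact CharZero.neg_eq_self_iff.mp htr

/-- There are as many compact as noncompact roots of weight one among the `θ`-fixed roots. -/
theorem encard_sign_one_eq (hT : NoticedTriple θ τ h e f) :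
    {v | Γ.IsRoot v ∧ Γ.weight v = 1 ∧ Γ.act v = v ∧ b.sign v = 1}.encard =
      {v | Γ.IsRoot v ∧ Γ.weight v = 1 ∧ Γ.act v = v ∧ b.sign v = -1}.encard := by
  classical
  have := b.finite_rootsOfWeight 1
  let _ := Fintype.ofFinite {v : ι → ℤ // Γ.IsRoot v ∧ Γ.weight v = 1}
  have h0 := b.sum_sign_eq_zero hT
  have key : ∀ s : ℂ, s ≠ 0 → {v | Γ.IsRoot v ∧ Γ.weight v = 1 ∧ Γ.act v = v ∧ b.sign v = s} =
      ((Finset.univ.filter fun r : {v : ι → ℤ // Γ.IsRoot v ∧ Γ.weight v = 1} => b.sign r.1 = s).map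
        (Function.Embedding.subtype _) : Finset (ι → ℤ)) := by
    intro s hs
    ext v
    simp only [Set.mem_ofPred_eq, Finset.coe_map, Set.mem_image, Finset.mem_coe, Finset.mem_filter,
      Finset.mem_univ, true_and, Function.Embedding.subtype_apply, Subtype.exists, exists_and_right,
      exists_eq_right]
    constructor
    · rintro ⟨h1, h2, -, h4⟩
      exact ⟨⟨h1, h2⟩, h4⟩
    · rintro ⟨⟨h1, h2⟩, h4⟩
      refine ⟨h1, h2, ?_, h4⟩
      by_contra hfix
      exact hs (h4 ▸ b.sign_of_act_ne hT h1 hfix)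
  rw [key 1 one_ne_zero, key (-1) (by norm_num), Set.encard_coe_eq_coe_finsetCard,
    Set.encard_coe_eq_coe_finsetCard, Finset.card_map, Finset.card_map]
  -- Moved roots contribute zero to the trace, fixed ones contribute `1` or `-1`.
  have h1 : ∀ r : {v : ι → ℤ // Γ.IsRoot v ∧ Γ.weight v = 1},
      b.sign r.1 = (if b.sign r.1 = 1 then 1 else 0) - (if b.sign r.1 = -1 then 1 else 0) := by
    intro r
    by_cases hfix : Γ.act r.1 = r.1
    · rcases b.sign_eq_one_or hT r.2.1 hfix with h | h <;> rw [h] <;> norm_num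
    · rw [b.sign_of_act_ne hT r.2.1 hfix]; norm_num
  rw [Finset.sum_congr rfl fun r _ => h1 r, Finset.sum_sub_distrib, sub_eq_zero, Finset.sum_boole,
    Finset.sum_boole] at h0
  exact_mod_cast h0

end VoganBasis

/-! ### The Dynkin diagram as a graph, and positivity of its form. -/

namespace WeightedVoganDiagram

variable {ι : Type*} [Fintype ι] [DecidableEq ι] {Γ : WeightedVoganDiagram ι}

/-- The invariant form is positive definite. -/
lemma exists_form (Γ : WeightedVoganDiagram ι) : ∃ d : ι → ℝ, (∀ i, 0 < d i) ∧
    (∀ i j, d i * (Γ.cartan i j : ℝ) = d j * (Γ.cartan j i : ℝ)) ∧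
    ∀ v : ι → ℤ, v ≠ 0 → 0 < ∑ j, (v j : ℝ) / d j * (Γ.pair v j : ℝ) := by
  obtain ⟨d, hd, hpos⟩ := Γ.cartan_finite
  have hsymm : ∀ i j, d i * (Γ.cartan i j : ℝ) = d j * (Γ.cartan j i : ℝ) := by
    intro i j
    have := hpos.isHermitian.apply i j
    simpa using this.symm
  refine ⟨d, hd, hsymm, fun v hv => ?_⟩
  have hv' : (fun i => (v i : ℝ) / d i) ≠ 0 := by
    obtain ⟨i, hi⟩ := Function.ne_iff.mp hv
    refine Function.ne_iff.mpr ⟨i, ?_⟩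
    exact div_ne_zero (by exact_mod_cast hi) (hd i).ne'
  have h1 := hpos.dotProduct_mulVec_pos hv'
  refine h1.trans_eq ?_
  rw [star_trivial, dotProduct]
  refine Finset.sum_congr rfl fun j _ => ?_
  congr 1
  rw [Matrix.mulVec, dotProduct, pair]
  push_cast
  refine Finset.sum_congr rfl fun i _ => ?_
  rw [Matrix.of_apply, hsymm]
  have := (hd i).ne'
  field_simp

/-- The norm of a nonzero vector is positive and is a sum of its coefficients times its pairings,
with positive factors. This drives every induction on height and every exclusion of a subdiagram
below. -/
lemma exists_pair_pos {v : ι → ℤ} (h0 : ∀ i, 0 ≤ v i) (hv : v ≠ 0) :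
    ∃ i, 0 < v i ∧ 0 < Γ.pair v i := by
  obtain ⟨d, hd, -, hpos⟩ := Γ.exists_form
  by_contra! hcon
  refine absurd (hpos v hv) (not_lt.mpr (Finset.sum_nonpos fun i _ => ?_))
  rcases (h0 i).eq_or_lt with h | h
  · rw [← h]; simp
  · exact mul_nonpos_of_nonneg_of_nonpos (div_nonneg (by exact_mod_cast h0 i) (hd i).le)
      (by exact_mod_cast hcon i h)

lemma cartan_nonpos_of_adj {i j : ι} (h : Γ.graph.Adj i j) : Γ.cartan i j ≤ -1 := by
  have h1 := Γ.cartan_nonpos i j h.1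
  have h2 := h.2
  omega

lemma cartan_eq_zero_of_not_adj {i j : ι} (hij : i ≠ j) (h : ¬ Γ.graph.Adj i j) : Γ.cartan i j = 0 := by
  by_contra h0
  exact h ⟨hij, h0⟩

lemma pair_le_of_subset {v : ι → ℤ} (h0 : ∀ i, 0 ≤ v i) {i : ι} {N : Finset ι} (hN : i ∉ N) :
    Γ.pair v i ≤ 2 * v i + ∑ k ∈ N, v k * Γ.cartan k i := by
  have h1 : Γ.pair v i = 2 * v i + ∑ k ∈ Finset.univ.erase i, v k * Γ.cartan k i := by
    rw [pair, ← Finset.add_sum_erase _ _ (Finset.mem_univ i), Γ.cartan_diag, mul_comm]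
  rw [h1]
  have hsub : N ⊆ Finset.univ.erase i := fun k hk =>
    Finset.mem_erase.mpr ⟨fun h => hN (h ▸ hk), Finset.mem_univ k⟩
  rw [← Finset.sum_sdiff hsub, ← add_assoc, add_right_comm]
  refine add_le_of_nonpos_right (Finset.sum_nonpos fun k hk => ?_)
  refine mul_nonpos_of_nonneg_of_nonpos (h0 k) (Γ.cartan_nonpos k i ?_)
  exact Finset.ne_of_mem_erase (Finset.mem_sdiff.mp hk).1

lemma pair_le_of_adj {v : ι → ℤ} (h0 : ∀ i, 0 ≤ v i) {i : ι} {N : Finset ι}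
    (hN : ∀ k ∈ N, Γ.graph.Adj k i) : Γ.pair v i ≤ 2 * v i - ∑ k ∈ N, v k := by
  have hi : i ∉ N := fun h => (hN i h).ne rfl
  refine (pair_le_of_subset h0 hi).trans ?_
  rw [sub_eq_add_neg, ← Finset.sum_neg_distrib]
  refine add_le_add le_rfl (Finset.sum_le_sum fun k hk => ?_)
  have := cartan_nonpos_of_adj (hN k hk)
  nlinarith [h0 k]

/-- A nonnegative vector such that twice each positive entry is at most the sum of neighbouring entries
cannot exist. -/
lemma not_forall_two_mul_le_sum {v : ι → ℤ} (h0 : ∀ i, 0 ≤ v i) (hv : v ≠ 0)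
    (H : ∀ i, 0 < v i → ∃ N : Finset ι, (∀ k ∈ N, Γ.graph.Adj k i) ∧ 2 * v i ≤ ∑ k ∈ N, v k) : False := by
  obtain ⟨i, hi, hp⟩ := exists_pair_pos (Γ := Γ) h0 hv
  obtain ⟨N, hN, hle⟩ := H i hi
  have := pair_le_of_adj h0 hN
  omega

/-- No nonempty set of nodes is such that each of its nodes has two neighbours in it. -/
lemma not_forall_exists_two_adj {T : Finset ι} (hT : T.Nonempty)
    (H : ∀ i ∈ T, ∃ k ∈ T, ∃ l ∈ T, k ≠ l ∧ Γ.graph.Adj k i ∧ Γ.graph.Adj l i) : False := by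
  obtain ⟨u, hu⟩ := hT
  refine not_forall_two_mul_le_sum (Γ := Γ) (v := fun i => if i ∈ T then 1 else 0)
    (fun i => by split_ifs <;> norm_num) (Function.ne_iff.mpr ⟨u, by simp [hu]⟩) fun i hi => ?_
  have hiT : i ∈ T := by
    by_contra h
    simp [h] at hi
  obtain ⟨k, hk, l, hl, hkl, hka, hla⟩ := H i hiT
  refine ⟨{k, l}, ?_, ?_⟩
  · intro x hx
    rcases Finset.mem_insert.mp hx with rfl | hx
    · exact hka
    · rw [Finset.mem_singleton.mp hx]; exact hla
  · rw [Finset.sum_pair hkl]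
    simp [hiT, hk, hl]

/-- On a cycle every node has two neighbours in the cycle, so its indicator vector would contradict
positive definiteness. -/
lemma graph_isAcyclic (Γ : WeightedVoganDiagram ι) : Γ.graph.IsAcyclic := by
  intro u c hc
  refine not_forall_exists_two_adj (Γ := Γ) (T := c.support.toFinset)
    ⟨u, List.mem_toFinset.mpr c.start_mem_support⟩ fun i hi => ?_
  obtain ⟨j, k, hjk, hset⟩ := Set.ncard_eq_two.mp
    (hc.ncard_neighborSet_toSubgraph_eq_two (List.mem_toFinset.mp hi))
  have hmem : ∀ l, l = j ∨ l = k → l ∈ c.support.toFinset ∧ Γ.graph.Adj l i := by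
    intro l hl
    have : l ∈ c.toSubgraph.neighborSet i := by rw [hset]; exact hl
    have h1 : c.toSubgraph.Adj i l := this
    refine ⟨?_, h1.adj_sub.symm⟩
    have h2 := h1.snd_mem
    rw [SimpleGraph.Walk.mem_verts_toSubgraph] at h2
    exact List.mem_toFinset.mpr h2
  exact ⟨j, (hmem j (.inl rfl)).1, k, (hmem k (.inr rfl)).1, hjk, (hmem j (.inl rfl)).2,
    (hmem k (.inr rfl)).2⟩

lemma adj_θ {i j : ι} : Γ.graph.Adj (Γ.θ i) (Γ.θ j) ↔ Γ.graph.Adj i j := by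
  simp [graph, Γ.θ_cartan]

/-- The automorphism of the graph. -/
def graphIso (Γ : WeightedVoganDiagram ι) : Γ.graph ≃g Γ.graph where
  toEquiv := Γ.θ
  map_rel_iff' := adj_θ

lemma dist_θ (i j : ι) (hr : Γ.graph.Reachable i j) :
    Γ.graph.dist (Γ.θ i) (Γ.θ j) = Γ.graph.dist i j := by
  have key : ∀ i j, Γ.graph.Reachable i j → Γ.graph.dist (Γ.θ i) (Γ.θ j) ≤ Γ.graph.dist i j := by
    intro i j hr
    obtain ⟨p, hp⟩ := hr.exists_walk_length_eq_dist
    have := SimpleGraph.dist_le (p.map Γ.graphIso.toHom)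
    rw [SimpleGraph.Walk.length_map, hp] at this
    exact this
  refine le_antisymm (key i j hr) ?_
  have := key (Γ.θ i) (Γ.θ j) (hr.map Γ.graphIso.toHom)
  rwa [Γ.θ_θ, Γ.θ_θ] at this

lemma reachable_θ {i j : ι} (hr : Γ.graph.Reachable i j) : Γ.graph.Reachable (Γ.θ i) (Γ.θ j) :=
  hr.map Γ.graphIso.toHom

/-- If a node is joined to its image, then no node of its component is fixed. -/
lemma θ_ne_of_reachable {i k : ι} (hi : Γ.graph.Adj i (Γ.θ i)) (hk : Γ.graph.Reachable k i) :
    Γ.θ k ≠ k := by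
  intro h0
  -- In a forest two adjacent nodes are never at the same distance from a third one; a fixed node
  -- would be equidistant from `i` and `θ i`.
  refine Γ.graph_isAcyclic.dist_ne_of_adj hi hk ?_
  conv_rhs => rw [← h0, dist_θ _ _ hk]

/-- The support of a root lies in one component. -/
lemma IsRoot.exists_reachable {v : ι → ℤ} (hv : Γ.IsRoot v) :
    ∃ k, ∀ i, v i ≠ 0 → Γ.graph.Reachable k i := by
  induction hv with
  | simple i =>
    refine ⟨i, fun j hj => ?_⟩
    have : j = i := by
      by_contra h
      exact hj (Pi.single_eq_of_ne h 1)
    rw [this]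
  | reflection j v _ ih =>
    obtain ⟨k, hk⟩ := ih
    refine ⟨k, fun i hi => ?_⟩
    by_cases hvi : v i = 0
    · have hij : i = j := by
        by_contra h
        simp [hvi, h] at hi
      subst hij
      have hp : ∑ l, v l * Γ.cartan l i ≠ 0 := by
        intro h
        simp [hvi, h] at hi
      obtain ⟨l, -, hl⟩ := Finset.exists_ne_zero_of_sum_ne_zero hp
      have hvl := left_ne_zero_of_mul hl
      have hli : l ≠ i := by rintro rfl; exact hvl hvi
      exact (hk l hvl).trans (SimpleGraph.Adj.reachable ⟨hli, right_ne_zero_of_mul hl⟩)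
    · exact hk i hvi

/-- No node of the support is fixed, so the contributions to the weight pair off under `θ`. -/
lemma even_weight_of_adj {v : ι → ℤ} (hv : Γ.IsRoot v) (hfix : Γ.act v = v) {i : ι} (hvi : v i ≠ 0)
    (hi : Γ.graph.Adj i (Γ.θ i)) : Even (Γ.weight v) := by
  obtain ⟨k, hk⟩ := hv.exists_reachable
  have hne : ∀ j, v j ≠ 0 → Γ.θ j ≠ j := fun j hj =>
    θ_ne_of_reachable hi ((hk j hj).symm.trans (hk i hvi))
  have h1 : ((Γ.weight v : ℤ) : ZMod 2) = 0 := by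
    rw [weight]
    push_cast
    refine Finset.sum_involution (fun j _ => Γ.θ j) ?_ ?_ (fun _ _ => Finset.mem_univ _)
      fun j _ => Γ.θ_θ j
    · intro j _
      rw [Γ.ω_θ, ← act_apply v, hfix]
      exact CharTwo.add_self_eq_zero _
    · intro j _ hj
      refine hne j fun h0 => ?_
      rw [h0] at hj
      simp at hj
  exact (ZMod.intCast_zmod_eq_zero_iff_dvd _ 2).mp h1 |>.elim fun c hc => ⟨c, by rw [hc]; push_cast; ring⟩

lemma IsRealized.sub_nonneg (hΓ : Γ.IsRealized) {v : ι → ℤ} (h0 : ∀ k, 0 ≤ v k) {i : ι}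
    (hi : 0 < v i) (hne : v ≠ Pi.single i 1) (hv : Γ.IsRoot (v - Pi.single i 1)) (k : ι) :
    0 ≤ (v - Pi.single i 1 : ι → ℤ) k := by
  rcases hΓ.nonneg_or_nonpos _ hv with h | h
  · exact h k
  · exfalso
    apply hne
    funext j
    have h1 := h j
    have h2 := h0 j
    by_cases hj : j = i
    · subst hj
      simp at h1 ⊢
      omega
    · simp [hj] at h1 ⊢
      omega

/-- Reflecting would produce `α_i - α_j`, a root with coefficients of both signs. -/
lemma IsRealized.not_isRoot_add (hΓ : Γ.IsRealized) {i j : ι} (hij : i ≠ j)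
    (h : Γ.cartan i j = 0) : ¬ Γ.IsRoot (Pi.single i 1 + Pi.single j 1) := by
  intro hr
  have h1 := IsRoot.reflection j _ hr
  have h2 : ∑ k, (Pi.single i 1 + Pi.single j 1 : ι → ℤ) k * Γ.cartan k j = 2 := by
    simp [add_mul, Finset.sum_add_distrib, Pi.single_apply, h, Γ.cartan_diag]
  rw [h2] at h1
  rcases hΓ.nonneg_or_nonpos _ h1 with h3 | h3
  · have := h3 j
    simp [hij.symm] at this
  · have := h3 i
    simp [hij] at this

end WeightedVoganDiagram

/-! ### The sign of `θ` in terms of the painted length. -/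

namespace VoganBasis

open Module WeightedVoganDiagram

variable {g : Type*} [LieRing g] [LieAlgebra ℂ g] {θ : g →ₗ[ℂ] g} {τ : g →ₗ⋆[ℂ] g} {h e f : g}
  {ι : Type*} [Fintype ι] [DecidableEq ι] {Γ : WeightedVoganDiagram ι} (b : VoganBasis Γ θ h)

lemma exists_lie_x_neg_single {v : ι → ℤ} (hv : Γ.IsRoot v) {i : ι} (hp : 0 < Γ.pair v i)
    (hne : v ≠ Pi.single i 1) :
    ∃ c : ℂ, c ≠ 0 ∧ ⁅b.x (-Pi.single i 1), b.x v⁆ = c • b.x (v - Pi.single i 1) := by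
  obtain ⟨c, hc⟩ := b.exists_lie_x_x (-Pi.single i 1) v
    (by rw [neg_add_eq_sub]; exact sub_ne_zero.mpr hne)
  rw [neg_add_eq_sub] at hc
  refine ⟨c, ?_, hc⟩
  rintro rfl
  exact b.lie_x_neg_single_ne_zero hv hp (by rw [hc, zero_smul])

/-- `θ` is applied to the nonzero bracket of the lowering vector of `α_i` with `x_v`; the lowering
vector has the same sign as the raising one. -/
lemma sign_sub_single (hT : NoticedTriple θ τ h e f) {v : ι → ℤ} (hv : Γ.IsRoot v)
    (hfix : Γ.act v = v) {i : ι} (hi : Γ.θ i = i) (hp : 0 < Γ.pair v i) (hne : v ≠ Pi.single i 1) :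
    b.sign (v - Pi.single i 1) = b.sign (Pi.single i 1) * b.sign v := by
  obtain ⟨c, hc0, hc⟩ := b.exists_lie_x_neg_single hv hp hne
  have hfi : Γ.act (Pi.single i 1) = Pi.single i 1 := by rw [act_single, hi]
  have hr := b.realized.sub v i hv hp hne
  have h1 := congrArg θ hc
  rw [hT.θ_lie, b.θ_x_of_act_eq hT hv hfix,
    b.θ_x_of_act_eq hT (IsRoot.simple i).neg (by rw [act_neg, hfi]), map_smul,
    b.θ_x_of_act_eq hT hr (by rw [act_sub, hfix, hfi]), lie_smul, smul_lie, hc, smul_smul, smul_smul,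
    smul_smul, b.sign_neg hT (.simple i) hfi] at h1
  have h2 := smul_left_injective ℂ (b.x_ne_zero hr) h1
  refine mul_left_cancel₀ hc0 (h2.symm.trans ?_)
  ring

lemma sign_simple (hT : NoticedTriple θ τ h e f) {i : ι} (hi : Γ.θ i = i) :
    b.sign (Pi.single i 1) = if i ∈ Γ.J then -1 else 1 := by
  have hfi : Γ.act (Pi.single i 1) = Pi.single i 1 := by rw [act_single, hi]
  have h1 := b.θ_x_of_act_eq hT (.simple i) hfi
  split_ifs with hJ
  · rw [((b.mem_J_iff i).mp hJ).2, ← neg_one_smul ℂ] at h1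
    exact (smul_left_injective ℂ (b.x_ne_zero (.simple i)) h1).symm
  · refine (b.sign_eq_one_or hT (.simple i) hfi).resolve_right fun h2 => hJ ?_
    rw [h2, neg_one_smul] at h1
    exact (b.mem_J_iff i).mpr ⟨hi, h1⟩

/-- The two-step descent at a pair of swapped nodes that are not joined. -/
lemma sign_sub_single_sub_single (hT : NoticedTriple θ τ h e f) {v : ι → ℤ} (hv : Γ.IsRoot v)
    (hfix : Γ.act v = v) {i : ι} (hi : Γ.θ i ≠ i) (hadj : Γ.cartan i (Γ.θ i) = 0)
    (hp : 0 < Γ.pair v i) : Γ.IsRoot (v - Pi.single i 1 - Pi.single (Γ.θ i) 1) ∧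
      v - Pi.single i 1 ≠ Pi.single (Γ.θ i) 1 ∧ v ≠ Pi.single i 1 ∧
      Γ.IsRoot (v - Pi.single i 1) ∧
      b.sign (v - Pi.single i 1 - Pi.single (Γ.θ i) 1) = b.sign v := by
  have hne : v ≠ Pi.single i 1 := by
    rintro rfl
    rw [act_single] at hfix
    have := congrFun hfix i
    simp [hi] at this
  have hr1 := b.realized.sub v i hv hp hne
  have hp1 : 0 < Γ.pair (v - Pi.single i 1) (Γ.θ i) := by
    rw [pair_sub, pair_single, hadj, sub_zero, ← hfix, pair_act]
    exact hp
  have hne1 : v - Pi.single i 1 ≠ Pi.single (Γ.θ i) 1 := by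
    intro h0
    apply b.realized.not_isRoot_add hi.symm hadj
    rw [← h0, add_sub_cancel]
    exact hv
  have hr2 := b.realized.sub _ _ hr1 hp1 hne1
  refine ⟨hr2, hne1, hne, hr1, ?_⟩
  obtain ⟨c, hc0, hc⟩ := b.exists_lie_x_neg_single hv hp hne
  obtain ⟨d, hd0, hd⟩ := b.exists_lie_x_neg_single hr1 hp1 hne1
  obtain ⟨a, ha⟩ := b.exists_θ_x hT (IsRoot.simple (Γ := Γ) i).neg
  rw [act_neg, act_single] at ha
  have hcomm : ⁅b.x (-Pi.single i 1), b.x (-Pi.single (Γ.θ i) 1)⁆ = 0 := by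
    have h1 := b.realized.not_isRoot_add hi.symm hadj
    have h2 : (-Pi.single i 1 + -Pi.single (Γ.θ i) 1 : ι → ℤ) ≠ 0 := by
      intro h0
      have := congrFun h0 i
      simp [hi.symm] at this
    obtain ⟨a', ha'⟩ := b.exists_lie_x_x (-Pi.single i 1) (-Pi.single (Γ.θ i) 1) h2
    rw [ha', b.x_eq_zero, smul_zero]
    intro h3
    apply h1
    have := h3.neg
    rwa [neg_add, neg_neg, neg_neg] at this
  have ha0 : a ≠ 0 := by
    rintro rfl
    rw [zero_smul] at ha
    apply b.x_ne_zero (IsRoot.simple (Γ := Γ) i).neg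
    rw [← hT.θ_θ (b.x _), ha, map_zero]
  -- Lowering by `x_{-i}` and then by `θ x_{-i}`: `θ` interchanges the two operators, which commute
  -- because `α_i + α_{θ i}` is not a root. Hence the double bracket picks up only the sign of `v`.
  have hz : ⁅θ (b.x (-Pi.single i 1)), ⁅b.x (-Pi.single i 1), b.x v⁆⁆ =
      (a * c * d) • b.x (v - Pi.single i 1 - Pi.single (Γ.θ i) 1) := by
    rw [ha, hc, smul_lie, lie_smul, hd, smul_smul, smul_smul]
  have hfix2 : Γ.act (v - Pi.single i 1 - Pi.single (Γ.θ i) 1) =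
      v - Pi.single i 1 - Pi.single (Γ.θ i) 1 := by
    rw [act_sub, act_sub, hfix, act_single, act_single, Γ.θ_θ, sub_right_comm]
  have h1 := congrArg θ hz
  rw [hT.θ_lie, hT.θ_lie, hT.θ_θ, b.θ_x_of_act_eq hT hv hfix, lie_smul, lie_smul, leibniz_lie, map_smul,
    b.θ_x_of_act_eq hT hr2 hfix2, hz] at h1
  have h3 : ⁅b.x (-Pi.single i 1), θ (b.x (-Pi.single i 1))⁆ = 0 := by
    rw [ha, lie_smul, hcomm, smul_zero]
  rw [h3, zero_lie, zero_add, smul_smul, smul_smul, mul_comm (b.sign v)] at h1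
  have h2 := smul_left_injective ℂ (b.x_ne_zero hr2) h1
  exact (mul_left_cancel₀ (mul_ne_zero (mul_ne_zero ha0 hc0) hd0) h2).symm

/-- The sign of `θ` on the root space of a fixed positive root is determined by the painted length. -/
theorem sign_eq_neg_one_zpow (hT : NoticedTriple θ τ h e f) (n : ℕ) : ∀ v : ι → ℤ, v ∈ Γ.posRoots →
    Γ.act v = v → (∀ i, 0 < v i → ¬ Γ.graph.Adj i (Γ.θ i)) → ∑ i, v i = n →
    b.sign v = (-1) ^ Γ.paintedLength v := by
  induction n using Nat.strong_induction_on with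
  | _ n ih =>
  intro v hv hfix hadj hn
  -- Descent on the height: one step at a fixed node, which changes the sign exactly when the node
  -- is painted, or two steps at a swapped pair, which are unpainted and change nothing.
  obtain ⟨i, hi, hp⟩ := exists_pair_pos (Γ := Γ) hv.2 (b.isRoot_ne_zero hv.1)
  have hsum : ∀ j : ι, ∑ k, (Pi.single j 1 : ι → ℤ) k = 1 := fun j => by simp
  by_cases hθ : Γ.θ i = i
  · by_cases hne : v = Pi.single i 1
    · subst hne
      rw [b.sign_simple hT hθ, paintedLength]
      simp only [Pi.single_apply, Finset.sum_ite_eq']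
      split_ifs <;> simp
    · have hr := b.realized.sub v i hv.1 hp hne
      have hnn := b.realized.sub_nonneg hv.2 hi hne hr
      have hs : ∑ k, (v - Pi.single i 1 : ι → ℤ) k = n - 1 := by
        simp only [Pi.sub_apply, Finset.sum_sub_distrib, hsum, hn]
      have hpos : 0 ≤ (n : ℤ) - 1 := hs ▸ Finset.sum_nonneg fun k _ => hnn k
      have h1 := ih (n - 1) (by omega) (v - Pi.single i 1) ⟨hr, hnn⟩
        (by rw [act_sub, hfix, act_single, hθ]) (fun k hk => hadj k ?_) (by rw [hs]; omega)
      · have h2 := b.sign_sub_single hT hv.1 hfix hθ hp hne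
        rw [h1, b.sign_simple hT hθ] at h2
        have h3 : Γ.paintedLength (v - Pi.single i 1) =
            Γ.paintedLength v - if i ∈ Γ.J then 1 else 0 := by
          simp [paintedLength, Pi.single_apply]
        rw [h3] at h2
        split_ifs at h2 with hJ
        · rw [zpow_sub_one₀ (by norm_num)] at h2
          rw [inv_neg, inv_one, mul_neg_one, neg_one_mul, neg_inj] at h2
          exact h2.symm
        · rw [sub_zero, one_mul] at h2
          exact h2.symm
      · refine lt_of_lt_of_le hk ?_
        rw [Pi.sub_apply]
        have : (0 : ℤ) ≤ (Pi.single i 1 : ι → ℤ) k := by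
          rw [Pi.single_apply]; split_ifs <;> norm_num
        omega
  · have hc : Γ.cartan i (Γ.θ i) = 0 := cartan_eq_zero_of_not_adj (Ne.symm hθ) (hadj i hi)
    obtain ⟨hr2, hne1, hne, hr1, hs⟩ := b.sign_sub_single_sub_single hT hv.1 hfix hθ hc hp
    have hnn1 := b.realized.sub_nonneg hv.2 hi hne hr1
    have hvi : v (Γ.θ i) = v i := by rw [← act_apply v, hfix]
    have hnn2 := b.realized.sub_nonneg hnn1 (i := Γ.θ i) (by simp [hθ, hvi, hi]) hne1 hr2
    have hs2 : ∑ k, (v - Pi.single i 1 - Pi.single (Γ.θ i) 1 : ι → ℤ) k = n - 1 - 1 := by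
      simp only [Pi.sub_apply, Finset.sum_sub_distrib, hsum, hn]
    have hpos : 0 ≤ (n : ℤ) - 1 - 1 := hs2 ▸ Finset.sum_nonneg fun k _ => hnn2 k
    have h1 := ih (n - 1 - 1) (by omega) _ ⟨hr2, hnn2⟩
      (by rw [act_sub, act_sub, hfix, act_single, act_single, Γ.θ_θ, sub_right_comm])
      (fun k hk => hadj k ?_) (by rw [hs2]; omega)
    · rw [← hs, h1]
      congr 1
      have hJ : ∀ j, Γ.θ j ≠ j → j ∉ Γ.J := fun j hj hJ => hj (Γ.θ_of_mem_J j hJ)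
      have hθi : Γ.θ (Γ.θ i) ≠ Γ.θ i := by rw [Γ.θ_θ]; exact Ne.symm hθ
      simp [paintedLength, Pi.single_apply, hJ i hθ, hJ _ hθi]
    · refine lt_of_lt_of_le hk ?_
      rw [Pi.sub_apply, Pi.sub_apply]
      have : ∀ j, (0 : ℤ) ≤ (Pi.single j 1 : ι → ℤ) k := fun j => by
        rw [Pi.single_apply]; split_ifs <;> norm_num
      have := this i
      have := ‹∀ j, (0 : ℤ) ≤ (Pi.single j 1 : ι → ℤ) k› (Γ.θ i)
      omega

lemma sign_eq_one_iff (hT : NoticedTriple θ τ h e f) {v : ι → ℤ} (hv : v ∈ Γ.posRoots)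
    (hfix : Γ.act v = v) (hadj : ∀ i, 0 < v i → ¬ Γ.graph.Adj i (Γ.θ i)) :
    b.sign v = 1 ↔ Even (Γ.paintedLength v) := by
  rw [b.sign_eq_neg_one_zpow hT (∑ i, v i).toNat v hv hfix hadj
    (Int.toNat_of_nonneg (Finset.sum_nonneg fun i _ => hv.2 i)).symm]
  constructor
  · intro h1
    by_contra h2
    rw [Int.not_even_iff_odd] at h2
    rw [h2.neg_one_zpow] at h1
    norm_num at h1
  · exact Even.neg_one_zpow

lemma sign_eq_neg_one_iff (hT : NoticedTriple θ τ h e f) {v : ι → ℤ} (hv : v ∈ Γ.posRoots)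
    (hfix : Γ.act v = v) (hadj : ∀ i, 0 < v i → ¬ Γ.graph.Adj i (Γ.θ i)) :
    b.sign v = -1 ↔ Odd (Γ.paintedLength v) := by
  rw [← Int.not_even_iff_odd, ← b.sign_eq_one_iff hT hv hfix hadj]
  rcases b.sign_eq_one_or hT hv.1 hfix with h1 | h1 <;> rw [h1] <;> norm_num

/-- In weight one the exceptional clauses are void: `γ + θ γ` has even weight, and so has a fixed
root whose support contains an edge joining a node to its image. The two sets are thus the compact
and the noncompact fixed roots. -/
theorem encard_Pnp_eq_encard_Pp (b : VoganBasis Γ θ h) (hT : NoticedTriple θ τ h e f) :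
    (Γ.Pnp 1).encard = (Γ.Pp 1).encard := by
  have hadj : ∀ v, Γ.IsRoot v → Γ.act v = v → Γ.weight v = 1 →
      ∀ i, 0 < v i → ¬ Γ.graph.Adj i (Γ.θ i) := by
    intro v hv hfix hw i hi hadj
    have := even_weight_of_adj hv hfix hi.ne' hadj
    rw [hw] at this
    exact absurd this (by decide)
  have hpos : ∀ v, Γ.IsRoot v → Γ.weight v = 1 → v ∈ Γ.posRoots := fun v hv hw =>
    ⟨hv, b.realized.nonneg_of_weight_pos hv (by rw [hw]; norm_num)⟩
  have h1 : Γ.Pnp 1 = {v | Γ.IsRoot v ∧ Γ.weight v = 1 ∧ Γ.act v = v ∧ b.sign v = 1} := by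
    ext v
    simp only [Pnp, Set.mem_ofPred_eq]
    constructor
    · rintro ⟨hv, hw, hfix, hp, -⟩
      exact ⟨hv.1, hw, hfix, (b.sign_eq_one_iff hT hv hfix (hadj v hv.1 hfix hw)).mpr hp⟩
    · rintro ⟨hv, hw, hfix, hp⟩
      refine ⟨hpos v hv hw, hw, hfix,
        (b.sign_eq_one_iff hT (hpos v hv hw) hfix (hadj v hv hfix hw)).mp hp, ?_⟩
      rintro ⟨γ, -, rfl⟩
      rw [weight_add, weight_act] at hw
      omega
  have h2 : Γ.Pp 1 = {v | Γ.IsRoot v ∧ Γ.weight v = 1 ∧ Γ.act v = v ∧ b.sign v = -1} := by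
    ext v
    simp only [Pp, Set.mem_ofPred_eq, Set.mem_union]
    constructor
    · rintro (⟨hv, hw, hfix, hp⟩ | ⟨-, γ, -, -, hw⟩)
      · exact ⟨hv.1, hw, hfix, (b.sign_eq_neg_one_iff hT hv hfix (hadj v hv.1 hfix hw)).mpr hp⟩
      · omega
    · rintro ⟨hv, hw, hfix, hp⟩
      exact .inl ⟨hpos v hv hw, hw, hfix,
        (b.sign_eq_neg_one_iff hT (hpos v hv hw) hfix (hadj v hv hfix hw)).mp hp⟩
  rw [h1, h2]
  exact b.encard_sign_one_eq hT

end VoganBasis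

/-! ### Ideals of unions of components, and evenness of the weights on moved ones. -/

namespace VoganBasis

open Module WeightedVoganDiagram

variable {g : Type*} [LieRing g] [LieAlgebra ℂ g] {θ : g →ₗ[ℂ] g} {τ : g →ₗ⋆[ℂ] g} {h e f : g}
  {ι : Type*} [Fintype ι] [DecidableEq ι] {Γ : WeightedVoganDiagram ι} (b : VoganBasis Γ θ h)

/-- A root is supported on a union of components or on its complement. -/
lemma _root_.WeightedVoganDiagram.IsRoot.forall_eq_zero_or {v : ι → ℤ} (hv : Γ.IsRoot v) {C : Finset ι}
    (hC : ∀ i ∈ C, ∀ j, Γ.graph.Adj i j → j ∈ C) :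
    (∀ i, i ∉ C → v i = 0) ∨ (∀ i ∈ C, v i = 0) := by
  obtain ⟨k, hk⟩ := hv.exists_reachable
  have hreach : ∀ i j, Γ.graph.Reachable i j → i ∈ C → j ∈ C := by
    rintro i j ⟨p⟩
    induction p with
    | nil => exact id
    | cons hadj _ ih => exact fun hi => ih (hC _ hi _ hadj)
  by_cases hkC : k ∈ C
  · left
    intro i hi
    by_contra h0
    exact hi (hreach k i (hk i h0) hkC)
  · right
    intro i hi
    by_contra h0
    exact hkC (hreach i k (hk i h0).symm hi)

/-- The basis vectors of the ideal belonging to a set of nodes. -/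
def Supported (_ : VoganBasis Γ θ h) (C : Finset ι) : ι ⊕ {v // Γ.IsRoot v} → Prop
  | .inl i => i ∈ C
  | .inr r => ∀ i, i ∉ C → r.1 i = 0

lemma repr_x {v : ι → ℤ} {k : ι ⊕ {v // Γ.IsRoot v}} (hk : b.basis.repr (b.x v) k ≠ 0) :
    ∃ hv : Γ.IsRoot v, k = .inr ⟨v, hv⟩ := by
  by_cases hv : Γ.IsRoot v
  · refine ⟨hv, ?_⟩
    by_contra h0
    rw [b.x_eq hv, Basis.repr_self, Finsupp.single_eq_of_ne h0] at hk
    exact hk rfl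
  · rw [b.x_eq_zero hv] at hk
    simp at hk

lemma exists_repr_lie_ne_zero {z w : g} {k : ι ⊕ {v // Γ.IsRoot v}}
    (hk : b.basis.repr ⁅z, w⁆ k ≠ 0) :
    ∃ l, b.basis.repr z l ≠ 0 ∧ b.basis.repr ⁅b.basis l, w⁆ k ≠ 0 := by
  have : Finite {v // Γ.IsRoot v} := b.realized.finite.to_subtype
  let _ := Fintype.ofFinite {v // Γ.IsRoot v}
  have h1 : b.basis.repr ⁅z, w⁆ k = ∑ l, b.basis.repr z l * b.basis.repr ⁅b.basis l, w⁆ k := by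
    conv_lhs => rw [← b.basis.sum_repr z, sum_lie, map_sum, Finsupp.finsetSum_apply]
    exact Finset.sum_congr rfl fun l _ => by rw [smul_lie, map_smul, Finsupp.smul_apply, smul_eq_mul]
  rw [h1] at hk
  obtain ⟨l, -, hl⟩ := Finset.exists_ne_zero_of_sum_ne_zero hk
  exact ⟨l, left_ne_zero_of_mul hl, right_ne_zero_of_mul hl⟩

/-- Bracketing with `e` preserves the ideal belonging to a union of components. -/
lemma supported_of_repr_lie_e_ne_zero (hT : NoticedTriple θ τ h e f) {C : Finset ι}
    (hC : ∀ i ∈ C, ∀ j, Γ.graph.Adj i j → j ∈ C) {k l : ι ⊕ {v // Γ.IsRoot v}}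
    (hk : b.Supported C k) (hk0 : Γ.weight (b.wt k) = 0) (hl : b.basis.repr ⁅e, b.basis k⁆ l ≠ 0) :
    b.Supported C l ∧ Γ.weight (b.wt l) = 2 := by
  obtain ⟨m, hm, hml⟩ := b.exists_repr_lie_ne_zero hl
  have hm2 : Γ.weight (b.wt m) = 2 := by
    have h1 := b.repr_lie_h e m
    rw [hT.sl2.lie_h_e_smul ℂ, map_smul, Finsupp.smul_apply, smul_eq_mul] at h1
    have := mul_right_cancel₀ hm h1
    exact_mod_cast this.symm
  rcases m with i | u
  · simp [wt, weight] at hm2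
  rcases k with i | v
  · have h1 : ⁅b.basis (.inr u), b.basis (.inl i)⁆ = -((u.1 i : ℤ) : ℂ) • b.basis (.inr u) := by
      rw [← lie_skew, b.lie_inl_inr, neg_smul]
    rw [h1, map_smul, Finsupp.smul_apply, smul_eq_mul, Basis.repr_self] at hml
    have hlu : l = .inr u := by
      by_contra h0
      rw [Finsupp.single_eq_of_ne h0, mul_zero] at hml
      exact hml rfl
    subst hlu
    refine ⟨?_, hm2⟩
    refine (u.2.forall_eq_zero_or hC).resolve_right fun h2 => ?_
    rw [h2 i hk] at hml
    simp at hml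
  · have hsum : u.1 + v.1 ≠ 0 := by
      intro h0
      have h1 : Γ.weight (u.1 + v.1) = 2 := by
        rw [weight_add]
        change Γ.weight u.1 = 2 at hm2
        change Γ.weight v.1 = 0 at hk0
        omega
      rw [h0] at h1
      simp [weight] at h1
    obtain ⟨c, hc⟩ := b.exists_lie_x_x u.1 v.1 hsum
    rw [b.x_eq u.2, b.x_eq v.2] at hc
    rw [hc, map_smul, Finsupp.smul_apply, smul_eq_mul] at hml
    obtain ⟨hr, rfl⟩ := b.repr_x (right_ne_zero_of_mul hml)
    constructor
    · rcases u.2.forall_eq_zero_or hC with h1 | h1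
      · intro i hi
        change u.1 i + v.1 i = 0
        rw [h1 i hi, hk i hi, add_zero]
      · exfalso
        rcases hr.forall_eq_zero_or hC with h2 | h2
        · apply b.isRoot_ne_zero u.2
          funext i
          by_cases hi : i ∈ C
          · exact h1 i hi
          · have := h2 i hi
            rwa [Pi.add_apply, hk i hi, add_zero] at this
        · apply b.isRoot_ne_zero v.2
          funext i
          by_cases hi : i ∈ C
          · have := h2 i hi
            rwa [Pi.add_apply, h1 i hi, zero_add] at this
          · exact hk i hi
    · change Γ.weight (u.1 + v.1) = 2
      rw [weight_add]
      change Γ.weight u.1 = 2 at hm2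
      change Γ.weight v.1 = 0 at hk0
      omega

/-- The image under `θ` is supported on `θ C`, which is disjoint from `C`, and no basis vector
belongs to both ideals. -/
lemma not_supported_of_repr_θ_ne_zero (hT : NoticedTriple θ τ h e f) {C : Finset ι}
    (hθ : ∀ i ∈ C, Γ.θ i ∉ C) {k l : ι ⊕ {v // Γ.IsRoot v}}
    (hk : b.Supported C k) (hl : b.basis.repr (θ (b.basis k)) l ≠ 0) : ¬ b.Supported C l := by
  rcases k with i | v
  · rw [b.θ_inl, Basis.repr_self] at hl
    have : l = .inl (Γ.θ i) := by
      by_contra h0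
      rw [Finsupp.single_eq_of_ne h0] at hl
      exact hl rfl
    rw [this]
    exact hθ i hk
  · obtain ⟨c, hc⟩ := b.exists_θ_x hT v.2
    rw [b.x_eq v.2] at hc
    rw [hc, map_smul, Finsupp.smul_apply, smul_eq_mul] at hl
    obtain ⟨hr, rfl⟩ := b.repr_x (right_ne_zero_of_mul hl)
    intro hs
    apply b.isRoot_ne_zero v.2
    funext i
    by_cases hi : i ∈ C
    · have := hs (Γ.θ i) (hθ i hi)
      dsimp only at this
      rwa [act_apply, Γ.θ_θ] at this
    · exact hk i hi

/-- On the ideal belonging to a set of nodes that is moved by `θ`, the operator `ad e` is injective in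
degree zero. -/
lemma eq_zero_of_supported (hT : NoticedTriple θ τ h e f) {C : Finset ι}
    (hθ : ∀ i ∈ C, Γ.θ i ∉ C) {z : g} (hz : ∀ k, ¬ b.Supported C k → b.basis.repr z k = 0)
    (hhz : ⁅h, z⁆ = 0) (hez : ⁅e, z⁆ = 0) : z = 0 := by
  -- `z + θ z` is fixed by `θ` and still commutes with `h` and `e`, so noticedness kills it. But `θ
  -- z` has no components on `C`, so `z` has none either.
  have hθz : θ z = -z := by
    rw [← add_eq_zero_iff_eq_neg]
    apply hT.eq_zero
    · rw [map_add, hT.θ_θ, add_comm]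
    · rw [lie_add, hhz, add_zero]
      have := congrArg θ hhz
      rwa [hT.θ_lie, hT.θ_h, map_zero] at this
    · rw [lie_add, hez, add_zero]
      have := congrArg θ hez
      rwa [hT.θ_lie, hT.θ_e, map_zero, neg_lie, neg_eq_zero] at this
  have : Finite {v // Γ.IsRoot v} := b.realized.finite.to_subtype
  let _ := Fintype.ofFinite {v // Γ.IsRoot v}
  refine b.basis.ext_elem fun k => ?_
  rw [map_zero, Finsupp.zero_apply]
  by_cases hk : b.Supported C k
  · have h1 : b.basis.repr (θ z) k = 0 := by
      conv_lhs => rw [← b.basis.sum_repr z, map_sum, map_sum, Finsupp.finsetSum_apply]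
      refine Finset.sum_eq_zero fun l _ => ?_
      rw [map_smul, map_smul, Finsupp.smul_apply, smul_eq_mul, mul_eq_zero, or_iff_not_imp_left]
      intro hl
      by_contra h0
      refine b.not_supported_of_repr_θ_ne_zero hT hθ ?_ h0 hk
      by_contra h2
      exact hl (hz l h2)
    rwa [hθz, map_neg, Finsupp.neg_apply, neg_eq_zero] at h1
  · exact hz k hk

open Classical in
-- `ad e` maps degree zero of the ideal of `C` into degree two, and injectively, since noticedness
-- on `C ∪ θ C` forces the part of `e` in the ideal of `C` to be distinguished.
lemma card_supported_zero_le (hT : NoticedTriple θ τ h e f) [Fintype {v // Γ.IsRoot v}] {C : Finset ι}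
    (hC : ∀ i ∈ C, ∀ j, Γ.graph.Adj i j → j ∈ C) (hθ : ∀ i ∈ C, Γ.θ i ∉ C) :
    (Finset.univ.filter fun k => b.Supported C k ∧ Γ.weight (b.wt k) = 0).card ≤
      (Finset.univ.filter fun k => b.Supported C k ∧ Γ.weight (b.wt k) = 2).card := by
  set I := Finset.univ.filter fun k => b.Supported C k ∧ Γ.weight (b.wt k) = 0
  set I' := Finset.univ.filter fun k => b.Supported C k ∧ Γ.weight (b.wt k) = 2
  let N : (I → ℂ) →ₗ[ℂ] g := Fintype.linearCombination ℂ fun k => b.basis k.1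
  have hN : ∀ c k, b.basis.repr (N c) k = if hk : k ∈ I then c ⟨k, hk⟩ else 0 := by
    intro c k
    rw [Fintype.linearCombination_apply, map_sum, Finsupp.finsetSum_apply]
    split_ifs with hk
    · rw [Finset.sum_eq_single ⟨k, hk⟩]
      · simp
      · intro l _ hl
        have : k ≠ l.1 := fun h0 => hl (Subtype.ext h0.symm)
        simp [Finsupp.single_eq_of_ne this]
      · simp
    · refine Finset.sum_eq_zero fun l _ => ?_
      have : k ≠ l.1 := fun h0 => hk (h0 ▸ l.2)
      simp [Finsupp.single_eq_of_ne this]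
  let T : (I → ℂ) →ₗ[ℂ] (I' → ℂ) :=
    (LinearMap.pi fun k : I' => b.basis.coord k.1) ∘ₗ (LieAlgebra.ad ℂ g e : g →ₗ[ℂ] g) ∘ₗ N
  have hinj : Function.Injective T := by
    rw [← LinearMap.ker_eq_bot, LinearMap.ker_eq_bot']
    intro c hc
    have h1 : N c = 0 := by
      refine b.eq_zero_of_supported hT hθ (C := C) (fun k hk => ?_) ?_ ?_
      · rw [hN, dif_neg]
        exact fun h0 => hk (Finset.mem_filter.mp h0).2.1
      · refine b.basis.ext_elem fun k => ?_
        rw [b.repr_lie_h, hN, map_zero, Finsupp.zero_apply]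
        split_ifs with hk
        · rw [(Finset.mem_filter.mp hk).2.2, Int.cast_zero, zero_mul]
        · rw [mul_zero]
      · refine b.basis.ext_elem fun l => ?_
        rw [map_zero, Finsupp.zero_apply]
        by_cases hl : l ∈ I'
        · exact congrFun hc ⟨l, hl⟩
        · rw [Fintype.linearCombination_apply, lie_sum, map_sum, Finsupp.finsetSum_apply]
          refine Finset.sum_eq_zero fun k _ => ?_
          rw [lie_smul, map_smul, Finsupp.smul_apply]
          by_contra h0
          have hk := (Finset.mem_filter.mp k.2).2
          have := b.supported_of_repr_lie_e_ne_zero hT hC hk.1 hk.2 (right_ne_zero_of_smul h0)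
          exact hl (Finset.mem_filter.mpr ⟨Finset.mem_univ _, this⟩)
    funext k
    have h2 := hN c k.1
    rw [h1, dif_pos k.2] at h2
    simpa using h2.symm
  have := LinearMap.finrank_le_finrank_of_injective hinj
  rwa [Module.finrank_fintype_fun_eq_card, Module.finrank_fintype_fun_eq_card, Fintype.card_coe,
    Fintype.card_coe] at this

open Classical in
/-- The weights are even on a union of components that is disjoint from its image. -/
theorem ω_ne_one_of_disjoint [Module.Finite ℂ g] [LieAlgebra.IsKilling ℂ g] (b : VoganBasis Γ θ h)
    (hT : NoticedTriple θ τ h e f) {C : Finset ι}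
    (hC : ∀ i ∈ C, ∀ j, Γ.graph.Adj i j → j ∈ C) (hθ : ∀ i ∈ C, Γ.θ i ∉ C) {m : ι} (hm : m ∈ C) :
    Γ.ω m ≠ 1 := by
  intro hω
  have : Finite {v // Γ.IsRoot v} := b.realized.finite.to_subtype
  let _ := Fintype.ofFinite {v // Γ.IsRoot v}
  -- The grading is kept on `C` and made even outside by giving every simple root degree two. Off
  -- `C`, degree zero then consists of the Cartan part alone, and degree two contains at least as
  -- many simple root vectors. Hence `dim g_0 ≤ dim g_2`, contrary to the strict inequality
  -- available when some weight is one.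
  let x0 : ι → ℤ := fun i => if i ∈ C then Γ.ω i else 2
  let δ : ι ⊕ {v // Γ.IsRoot v} → ℤ := fun k => ∑ i, x0 i * b.wt k i
  have hδ : ∀ k, ⁅∑ i, (x0 i : ℂ) • b.y i, b.basis k⁆ = (δ k : ℂ) • b.basis k := by
    intro k
    rw [b.lie_sum_y_basis]
    push_cast [δ]
    rfl
  have hδC : ∀ r : {v // Γ.IsRoot v}, (∀ i, i ∉ C → r.1 i = 0) → δ (.inr r) = Γ.weight r.1 := by
    intro r hr
    refine Finset.sum_congr rfl fun i _ => ?_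
    change x0 i * r.1 i = _
    by_cases hi : i ∈ C
    · simp [x0, hi, mul_comm]
    · simp [hr i hi]
  have hsingle : ∀ i, δ (.inr ⟨Pi.single i 1, .simple i⟩) = x0 i := by
    intro i
    change ∑ j, x0 j * (Pi.single i 1 : ι → ℤ) j = x0 i
    simp [Pi.single_apply]
  have h1 := hT.compact.card_degree_two_lt b.basis hδ
    ⟨.inr ⟨Pi.single m 1, .simple m⟩, by rw [hsingle]; simp [x0, hm, hω]⟩
  refine absurd h1 (not_lt.mpr ?_)
  have h2 := b.card_supported_zero_le hT hC hθ
  set I := Finset.univ.filter fun k => b.Supported C k ∧ Γ.weight (b.wt k) = 0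
  set I' := Finset.univ.filter fun k => b.Supported C k ∧ Γ.weight (b.wt k) = 2
  have h3 : (Finset.univ.filter fun k => δ k = 0) ⊆ Cᶜ.image Sum.inl ∪ I := by
    intro k hk
    rw [Finset.mem_filter] at hk
    rw [Finset.mem_union, Finset.mem_image, Finset.mem_filter]
    rcases k with i | r
    · by_cases hi : i ∈ C
      · exact .inr ⟨Finset.mem_univ _, hi, by simp [wt, weight]⟩
      · exact .inl ⟨i, by simpa using hi, rfl⟩
    · right
      rcases r.2.forall_eq_zero_or hC with hr | hr
      · refine ⟨Finset.mem_univ _, hr, ?_⟩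
        rw [← hk.2, hδC r hr]
        rfl
      · exfalso
        apply b.isRoot_ne_zero r.2
        have h5 : ∑ i, r.1 i = 0 := by
          have h6 : δ (.inr r) = 2 * ∑ i, r.1 i := by
            rw [Finset.mul_sum]
            refine Finset.sum_congr rfl fun i _ => ?_
            change x0 i * r.1 i = _
            by_cases hi : i ∈ C
            · simp [hr i hi]
            · simp [x0, hi]
          have h7 := hk.2
          omega
        funext i
        rcases b.realized.nonneg_or_nonpos r.1 r.2 with h6 | h6
        · exact (Finset.sum_eq_zero_iff_of_nonneg fun i _ => h6 i).mp h5 i (Finset.mem_univ i)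
        · exact (Finset.sum_eq_zero_iff_of_nonpos fun i _ => h6 i).mp h5 i (Finset.mem_univ i)
  let σ : ι → ι ⊕ {v // Γ.IsRoot v} := fun i => .inr ⟨Pi.single i 1, .simple i⟩
  have hσ : Function.Injective σ := by
    intro i j hij
    have h4 : (Pi.single i 1 : ι → ℤ) = Pi.single j 1 := congrArg Subtype.val (Sum.inr_injective hij)
    by_contra h5
    have := congrFun h4 i
    simp [h5] at this
  have h4 : Cᶜ.image σ ∪ I' ⊆ (Finset.univ.filter fun k => δ k = 2) := by
    intro k hk
    rw [Finset.mem_union, Finset.mem_image, Finset.mem_filter] at hk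
    rw [Finset.mem_filter]
    refine ⟨Finset.mem_univ _, ?_⟩
    rcases hk with ⟨i, hi, rfl⟩ | ⟨-, hs, hw⟩
    · rw [hsingle]
      simp [x0, Finset.mem_compl.mp hi]
    · rcases k with i | r
      · simp [wt, weight] at hw
      · rw [hδC r hs]
        exact hw
  have h5 : Disjoint (Cᶜ.image σ) I' := by
    rw [Finset.disjoint_left]
    intro k hk hk'
    obtain ⟨i, hi, rfl⟩ := Finset.mem_image.mp hk
    have := (Finset.mem_filter.mp hk').2.1 i (Finset.mem_compl.mp hi)
    simp at this
  calc (Finset.univ.filter fun k => δ k = 0).card ≤ (Cᶜ.image Sum.inl ∪ I).card := Finset.card_le_card h3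
    _ ≤ (Cᶜ.image Sum.inl).card + I.card := Finset.card_union_le _ _
    _ ≤ Cᶜ.card + I'.card := add_le_add Finset.card_image_le h2
    _ = (Cᶜ.image σ ∪ I').card := by rw [Finset.card_union_of_disjoint h5, Finset.card_image_of_injective _ hσ]
    _ ≤ _ := Finset.card_le_card h4

end VoganBasis

namespace WeightedVoganDiagram

variable {ι : Type*} [Fintype ι] [DecidableEq ι] {Γ : WeightedVoganDiagram ι}

/-! ### Supports of roots -/

lemma IsConnectedSub.subset_of_closed {S T : Finset ι} (hS : Γ.IsConnectedSub S) {k : ι} (hkS : k ∈ S)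
    (hkT : k ∈ T) (hT : ∀ i ∈ T, ∀ j ∈ S, Γ.graph.Adj i j → j ∈ T) : S ⊆ T := by
  intro l hl
  obtain ⟨p⟩ := hS.preconnected ⟨k, hkS⟩ ⟨l, hl⟩
  have key : ∀ (u w : (S : Set ι)), (Γ.graph.induce (S : Set ι)).Walk u w → u.1 ∈ T → w.1 ∈ T := by
    intro u w q
    induction q with
    | nil => exact id
    | @cons a b c hadj _ ih => exact fun hu => ih (hT _ hu _ b.2 hadj)
  exact key _ _ p hkT

/-- The support of a positive root is connected. -/
lemma IsRealized.isConnectedSub_support (hΓ : Γ.IsRealized) (n : ℕ) : ∀ v : ι → ℤ, v ∈ Γ.posRoots →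
    v ≠ 0 → ∑ i, v i = n → Γ.IsConnectedSub (Finset.univ.filter fun i => v i ≠ 0) := by
  induction n with
  | zero =>
    intro v hv h0 hn
    refine absurd (funext fun i => ?_) h0
    exact (Finset.sum_eq_zero_iff_of_nonneg fun i _ => hv.2 i).mp hn i (Finset.mem_univ i)
  | succ n ih =>
    intro v hv h0 hn
    obtain ⟨i, hi, hp⟩ := exists_pair_pos (Γ := Γ) hv.2 h0
    by_cases hne : v = Pi.single i 1
    · have hS : (Finset.univ.filter fun j => v j ≠ 0) = {i} := by
        ext j
        rw [hne]
        simp [Pi.single_apply]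
      rw [hS, IsConnectedSub, Finset.coe_singleton]
      rw [SimpleGraph.connected_iff]
      refine ⟨fun a b => ?_, ⟨⟨i, rfl⟩⟩⟩
      rw [show a = b from Subtype.ext (a.2.trans b.2.symm)]
    · have hr := hΓ.sub v i hv.1 hp hne
      have hnn := hΓ.sub_nonneg hv.2 hi hne hr
      have hc := ih (v - Pi.single i 1) ⟨hr, hnn⟩ (sub_ne_zero.mpr hne) (by
        simp only [Pi.sub_apply, Finset.sum_sub_distrib, hn]
        simp)
      have hoff : ∀ j, j ≠ i → (v - Pi.single i 1 : ι → ℤ) j = v j := fun j hj => by simp [hj]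
      -- Subtracting `α_i` removes the node `i` from the support exactly when its coefficient is
      -- one; then `i` must have a neighbour in the remaining support, since otherwise `v - 2 α_i`
      -- would be a root of mixed signs.
      by_cases hvi : v i = 1
      · have hadj : ∃ j, v j ≠ 0 ∧ Γ.graph.Adj j i := by
          by_contra! hcon
          have h1 : Γ.pair v i = 2 := by
            rw [pair, Finset.sum_eq_single i]
            · rw [hvi, Γ.cartan_diag, one_mul]
            · intro j _ hj
              by_cases hvj : v j = 0
              · rw [hvj, zero_mul]
              · rw [cartan_eq_zero_of_not_adj hj (hcon j hvj), mul_zero]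
            · simp
          have h2 := IsRoot.reflection i v hv.1
          change Γ.IsRoot (v - Γ.pair v i • Pi.single i 1) at h2
          rw [h1] at h2
          obtain ⟨j, hj⟩ := Function.ne_iff.mp hne
          rcases hΓ.nonneg_or_nonpos _ h2 with h3 | h3
          · have := h3 i
            simp [hvi] at this
          · have hji : j ≠ i := by
              rintro rfl
              simp [hvi] at hj
            have h4 := h3 j
            have h5 := hv.2 j
            simp [hji] at h4 hj
            omega
        obtain ⟨j, hvj, hji⟩ := hadj
        have hpair := SimpleGraph.induce_pair_connected_of_adj hji
        have hset : (((Finset.univ.filter fun l => v l ≠ 0 : Finset ι)) : Set ι) =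
            ((Finset.univ.filter fun l => (v - Pi.single i 1 : ι → ℤ) l ≠ 0 : Finset ι) : Set ι) ∪
              {j, i} := by
          ext l
          simp only [Finset.coe_filter, Finset.mem_univ, true_and, Set.mem_ofPred_eq, Set.mem_union,
            Set.mem_insert_iff, Set.mem_singleton_iff]
          by_cases hl : l = i
          · subst hl; simp [hvi]
          · rw [hoff l hl]
            constructor
            · exact fun h => .inl h
            · rintro (h | rfl | h)
              · exact h
              · exact hvj
              · exact absurd h hl
        rw [IsConnectedSub, hset]
        refine SimpleGraph.induce_union_connected hc.preconnected hpair.preconnected ⟨j, ?_, by simp⟩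
        rw [Finset.coe_filter]
        exact ⟨Finset.mem_univ _, by rwa [hoff j hji.ne]⟩
      · have hS : (Finset.univ.filter fun l => v l ≠ 0) =
            Finset.univ.filter fun l => (v - Pi.single i 1 : ι → ℤ) l ≠ 0 := by
          ext l
          rw [Finset.mem_filter, Finset.mem_filter]
          refine and_congr_right fun _ => ?_
          by_cases hl : l = i
          · subst hl
            simp only [Pi.sub_apply, Pi.single_eq_same]
            omega
          · rw [hoff l hl]
        rw [hS]
        exact hc

/-! ### Special nodes -/

/-- A node at which there is a multiple bond to a longer root, or which has three neighbours. -/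
def Special (Γ : WeightedVoganDiagram ι) (i : ι) : Prop :=
  (∃ k, k ≠ i ∧ Γ.cartan k i ≤ -2) ∨
    ∃ N : Finset ι, N.card = 3 ∧ ∀ k ∈ N, Γ.graph.Adj k i

lemma adj_of_cartan_neg {k i : ι} (hki : k ≠ i) (h : Γ.cartan k i < 0) : Γ.graph.Adj k i :=
  ⟨hki, h.ne⟩

lemma Special.θ {i : ι} (hi : Γ.Special i) : Γ.Special (Γ.θ i) := by
  rcases hi with ⟨k, hk, h⟩ | ⟨N, hN, h⟩
  · exact .inl ⟨Γ.θ k, fun h0 => hk (Γ.θ.injective h0), by rwa [Γ.θ_cartan]⟩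
  · refine .inr ⟨N.image Γ.θ, by rw [Finset.card_image_of_injective _ Γ.θ.injective, hN], ?_⟩
    intro k hk
    obtain ⟨l, hl, rfl⟩ := Finset.mem_image.mp hk
    exact adj_θ.mpr (h l hl)

/-- There is no node at which the off-diagonal entries sum to `-4` or less. -/
lemma neg_four_lt_sum {i : ι} {N : Finset ι} (hN : ∀ k ∈ N, Γ.graph.Adj k i) :
    -4 < ∑ k ∈ N, Γ.cartan k i := by
  by_contra! hcon
  have hi : i ∉ N := fun h => (hN i h).ne rfl
  -- The null vector of the affine diagram `D₄`: twice the centre plus its neighbours.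
  let v : ι → ℤ := fun k => if k = i then 2 else if k ∈ N then 1 else 0
  have h0 : ∀ k, 0 ≤ v k := fun k => by dsimp only [v]; split_ifs <;> norm_num
  have hvi : v i = 2 := by simp [v]
  have hvN : ∀ k ∈ N, v k = 1 := fun k hk => by
    have : k ≠ i := fun h => hi (h ▸ hk)
    simp [v, this, hk]
  obtain ⟨j, hj, hp⟩ := exists_pair_pos (Γ := Γ) h0 (Function.ne_iff.mpr ⟨i, by simp [v]⟩)
  by_cases hji : j = i
  · subst hji
    have h1 := pair_le_of_subset (Γ := Γ) h0 hi
    rw [Finset.sum_congr rfl fun k hk => by rw [hvN k hk, one_mul], hvi] at h1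
    omega
  · have hjN : j ∈ N := by
      by_contra h
      simp [v, hji, h] at hj
    have h1 := pair_le_of_adj (Γ := Γ) h0 (i := j) (N := {i}) (by simpa using (hN j hjN).symm)
    rw [Finset.sum_singleton, hvi, hvN j hjN] at h1
    omega

lemma exists_adj_adj_of_isPath {i j : ι} {p : Γ.graph.Walk i j} (hp : p.IsPath) {k : ι}
    (hk : k ∈ p.support) (hki : k ≠ i) (hkj : k ≠ j) :
    ∃ l ∈ p.support, ∃ m ∈ p.support, l ≠ m ∧ Γ.graph.Adj l k ∧ Γ.graph.Adj m k := by
  obtain ⟨n, rfl, hn⟩ := SimpleGraph.Walk.mem_support_iff_exists_getVert.mp hk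
  have hn0 : n ≠ 0 := by
    rintro rfl
    exact hki p.getVert_zero
  have hnl : n ≠ p.length := by
    rintro rfl
    exact hkj p.getVert_length
  refine ⟨p.getVert (n - 1), p.getVert_mem_support _, p.getVert (n + 1), p.getVert_mem_support _, ?_,
    ?_, (p.adj_getVert_succ (by omega)).symm⟩
  · intro h0
    have := hp.getVert_injOn (by simp only [Set.mem_ofPred_eq]; omega)
      (by simp only [Set.mem_ofPred_eq]; omega) h0
    omega
  · have := p.adj_getVert_succ (i := n - 1) (by omega)
    rwa [Nat.sub_add_cancel (by omega)] at this

lemma exists_adj_of_walk {i j : ι} (p : Γ.graph.Walk i j) (hij : i ≠ j) :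
    ∃ l ∈ p.support, Γ.graph.Adj l i := by
  cases p with
  | nil => exact absurd rfl hij
  | cons h q => exact ⟨_, by simp, h.symm⟩

/-- A component contains at most one special node. -/
lemma Special.eq_of_reachable {i j : ι} (hi : Γ.Special i) (hj : Γ.Special j)
    (hij : Γ.graph.Reachable i j) : i = j := by
  by_contra hne
  obtain ⟨p, hp⟩ := hij.exists_isPath
  -- The null vector of an affine diagram with two forked or multiply bonded ends: two along the
  -- path, one at the further neighbours of its endpoints. No node of its support has positive
  -- pairing.
  let v : ι → ℤ := fun k =>
    if k ∈ p.support then 2 else if Γ.cartan k i ≠ 0 ∨ Γ.cartan k j ≠ 0 then 1 else 0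
  have h0 : ∀ k, 0 ≤ v k := fun k => by dsimp only [v]; split_ifs <;> norm_num
  have hv2 : ∀ k ∈ p.support, v k = 2 := fun k hk => by simp [v, hk]
  have hv1 : ∀ k l, l = i ∨ l = j → Γ.graph.Adj k l → 1 ≤ v k := by
    intro k l hl hk
    dsimp only [v]
    split_ifs with h1 h2
    · norm_num
    · norm_num
    · exfalso
      apply h2
      rcases hl with rfl | rfl
      · exact .inl hk.2
      · exact .inr hk.2
  have hend : ∀ l, (l = i ∨ l = j) → Γ.Special l → (∃ m ∈ p.support, Γ.graph.Adj m l) →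
      l ∈ p.support → Γ.pair v l ≤ 0 := by
    rintro l hl hs ⟨m, hm, hml⟩ hlp
    rcases hs with ⟨k, hk, hkl⟩ | ⟨N, hN, hadj⟩
    · have hka : Γ.graph.Adj k l := adj_of_cartan_neg hk (by omega)
      by_cases hkp : k ∈ p.support
      · have h1 := pair_le_of_subset (Γ := Γ) h0 (i := l) (N := {k}) (by simpa using hk.symm)
        rw [Finset.sum_singleton, hv2 k hkp, hv2 l hlp] at h1
        omega
      · have hkm : k ≠ m := fun h => hkp (h ▸ hm)
        have h1 := pair_le_of_subset (Γ := Γ) h0 (i := l) (N := {k, m})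
          (by simp [hk.symm, hml.ne.symm])
        rw [Finset.sum_pair hkm, hv2 m hm, hv2 l hlp] at h1
        have h2 := hv1 k l hl hka
        have h3 := cartan_nonpos_of_adj hml
        nlinarith
    · have h1 := pair_le_of_adj (Γ := Γ) h0 (i := l) (N := insert m N) (by
        intro k hk
        rcases Finset.mem_insert.mp hk with rfl | hk
        · exact hml
        · exact hadj k hk)
      have h2 : ∑ k ∈ insert m N, v k ≥ 4 := by
        rw [← Finset.add_sum_erase _ _ (Finset.mem_insert_self m N), hv2 m hm]
        have h3 : ∑ k ∈ (insert m N).erase m, v k ≥ ∑ k ∈ (insert m N).erase m, 1 := by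
          refine Finset.sum_le_sum fun k hk => hv1 k l hl ?_
          obtain ⟨hk1, hk2⟩ := Finset.mem_erase.mp hk
          exact hadj k ((Finset.mem_insert.mp hk2).resolve_left hk1)
        have h4 : 2 ≤ ((insert m N).erase m).card := by
          rw [Finset.erase_insert_eq_erase]
          have := Finset.pred_card_le_card_erase (s := N) (a := m)
          omega
        rw [Finset.sum_const, nsmul_eq_mul, mul_one] at h3
        have : (2 : ℤ) ≤ (((insert m N).erase m).card : ℤ) := by exact_mod_cast h4
        omega
      rw [hv2 l hlp] at h1
      omega
  obtain ⟨k, hk, hpk⟩ := exists_pair_pos (Γ := Γ) h0 (Function.ne_iff.mpr ⟨i, by simp [v]⟩)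
  refine absurd hpk (not_lt.mpr ?_)
  by_cases hki : k = i
  · subst hki
    exact hend k (.inl rfl) hi (exists_adj_of_walk p hne) p.start_mem_support
  by_cases hkj : k = j
  · subst hkj
    obtain ⟨m, hm, hadj⟩ := exists_adj_of_walk p.reverse (Ne.symm hne)
    rw [SimpleGraph.Walk.support_reverse, List.mem_reverse] at hm
    exact hend k (.inr rfl) hj ⟨m, hm, hadj⟩ p.end_mem_support
  by_cases hkp : k ∈ p.support
  · obtain ⟨l, hl, m, hm, hlm, hlk, hmk⟩ := exists_adj_adj_of_isPath hp hkp hki hkj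
    have h1 := pair_le_of_adj (Γ := Γ) h0 (i := k) (N := {l, m}) (by
      intro x hx
      rcases Finset.mem_insert.mp hx with rfl | hx
      · exact hlk
      · rw [Finset.mem_singleton.mp hx]; exact hmk)
    rw [Finset.sum_pair hlm, hv2 l hl, hv2 m hm, hv2 k hkp] at h1
    omega
  · have hvk : v k = 1 ∧ (Γ.cartan k i ≠ 0 ∨ Γ.cartan k j ≠ 0) := by
      dsimp only [v] at hk ⊢
      rw [if_neg hkp] at hk ⊢
      split_ifs at hk ⊢ with h1
      · exact ⟨rfl, h1⟩
      · exact absurd hk (lt_irrefl 0)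
    obtain ⟨l, hl, hadj⟩ : ∃ l ∈ p.support, Γ.graph.Adj l k := by
      rcases hvk.2 with h1 | h1
      · exact ⟨i, p.start_mem_support, SimpleGraph.Adj.symm ⟨hki, h1⟩⟩
      · exact ⟨j, p.end_mem_support, SimpleGraph.Adj.symm ⟨hkj, h1⟩⟩
    have h1 := pair_le_of_adj (Γ := Γ) h0 (i := k) (N := {l}) (by simpa using hadj)
    rw [Finset.sum_singleton, hv2 l hl, hvk.1] at h1
    omega

lemma special_of_three {i k l m : ι} (hk : Γ.graph.Adj k i) (hl : Γ.graph.Adj l i)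
    (hm : Γ.graph.Adj m i) (hkl : k ≠ l) (hkm : k ≠ m) (hlm : l ≠ m) : Γ.Special i := by
  refine .inr ⟨{k, l, m}, Finset.card_eq_three.mpr ⟨k, l, m, hkl, hkm, hlm, rfl⟩, ?_⟩
  intro x hx
  simp only [Finset.mem_insert, Finset.mem_singleton] at hx
  rcases hx with rfl | rfl | rfl <;> assumption

end WeightedVoganDiagram

namespace WeightedVoganDiagram

variable {ι : Type*} [Fintype ι] [DecidableEq ι] {Γ : WeightedVoganDiagram ι}

/-! ### Simply laced components -/

/-- The component of a node is simply laced. -/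
def SimplyLacedAt (Γ : WeightedVoganDiagram ι) (k : ι) : Prop :=
  ∀ i j, Γ.graph.Reachable k i → Γ.graph.Adj i j → Γ.cartan i j = -1

/-- The support of a vector lies in the component of a node. -/
def SupportedAt (Γ : WeightedVoganDiagram ι) (k : ι) (v : ι → ℤ) : Prop :=
  ∀ i, v i ≠ 0 → Γ.graph.Reachable k i

lemma cartan_eq_neg_one_of_not_special {i j : ι} (hj : ¬ Γ.Special j) (hij : Γ.graph.Adj i j) :
    Γ.cartan i j = -1 := by
  have h1 := cartan_nonpos_of_adj hij
  by_contra h2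
  exact hj (.inl ⟨i, hij.ne, by omega⟩)

/-- Between a fixed node and a moved node there is a fixed node joined to a moved node. -/
lemma exists_adj_of_reachable {i m : ι} (h : Γ.graph.Reachable i m) (hi : Γ.θ i = i) (hm : Γ.θ m ≠ m) :
    ∃ w n, Γ.graph.Reachable i w ∧ Γ.graph.Adj w n ∧ Γ.θ w = w ∧ Γ.θ n ≠ n ∧
      (w = i ∨ ∃ u, Γ.graph.Adj w u ∧ Γ.θ u = u) := by
  obtain ⟨p⟩ := h
  induction p with
  | nil => exact absurd hi hm
  | @cons a b c hab _ ih =>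
    by_cases hb : Γ.θ b = b
    · obtain ⟨w, n, hw, hwn, hfw, hn, h⟩ := ih hb hm
      refine ⟨w, n, hab.reachable.trans hw, hwn, hfw, hn, .inr ?_⟩
      rcases h with rfl | h
      · exact ⟨a, hab.symm, hi⟩
      · exact h
    · exact ⟨a, b, .rfl, hab, hi, hb, .inl rfl⟩

/-- A component that is stable under `θ`. -/
def StableAt (Γ : WeightedVoganDiagram ι) (k : ι) : Prop := Γ.graph.Reachable k (Γ.θ k)

lemma StableAt.reachable_θ {k i : ι} (hk : Γ.StableAt k) (hi : Γ.graph.Reachable k i) :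
    Γ.graph.Reachable k (Γ.θ i) :=
  SimpleGraph.Reachable.trans hk (WeightedVoganDiagram.reachable_θ hi)

/-- The image of a special node is special and lies in the same component, which has only one such
node. -/
lemma StableAt.θ_eq_of_special {k i : ι} (hk : Γ.StableAt k) (hi : Γ.graph.Reachable k i)
    (hs : Γ.Special i) : Γ.θ i = i :=
  (hs.eq_of_reachable hs.θ (hi.symm.trans (hk.reachable_θ hi))).symm

/-- A stable component with a moved node is simply laced. -/
lemma StableAt.simplyLacedAt {k m : ι} (hk : Γ.StableAt k) (hm : Γ.graph.Reachable k m)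
    (hmθ : Γ.θ m ≠ m) : Γ.SimplyLacedAt k := by
  intro i j hi hij
  have hj := hi.trans hij.reachable
  by_contra hne
  have h2 : Γ.cartan i j ≤ -2 := by
    have := cartan_nonpos_of_adj hij
    omega
  have hs : Γ.Special j := .inl ⟨i, hij.ne, h2⟩
  have hfj := hk.θ_eq_of_special hj hs
  -- Otherwise `i` and `θ i` would both have Cartan entry at most `-2` at `j`.
  have hfi : Γ.θ i = i := by
    by_contra hne'
    have h3 : Γ.cartan (Γ.θ i) j ≤ -2 := by
      have := Γ.θ_cartan i j
      rw [hfj] at this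
      omega
    have h4 := neg_four_lt_sum (Γ := Γ) (i := j) (N := {i, Γ.θ i}) (by
      intro x hx
      rcases Finset.mem_insert.mp hx with rfl | hx
      · exact hij
      · rw [Finset.mem_singleton.mp hx, ← hfj]; exact adj_θ.mpr hij)
    rw [Finset.sum_pair (Ne.symm hne')] at h4
    omega
  -- At the passage from fixed to moved nodes, `w` has the neighbours `n` and `θ n`. If `w ≠ j`, a
  -- third fixed neighbour makes it a second special node; if `w = j`, the entries at `i`, `n`, `θ
  -- n` add up to `-4` or less.
  obtain ⟨w, n, hw, hwn, hfw, hn, h⟩ := exists_adj_of_reachable (hj.symm.trans hm) hfj hmθ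
  have hwn' : Γ.graph.Adj w (Γ.θ n) := by rw [← hfw]; exact adj_θ.mpr hwn
  have hcase : ∀ u, Γ.graph.Adj w u → Γ.θ u = u → w ≠ j → False := by
    intro u hu hfu hwj
    have h1 : u ≠ n := by rintro rfl; exact hn hfu
    have h2 : u ≠ Γ.θ n := by rintro rfl; exact hn (Γ.θ.injective hfu)
    exact hwj ((special_of_three hu.symm hwn.symm hwn'.symm h1 h2 (Ne.symm hn)).eq_of_reachable hs
      hw.symm)
  by_cases hwj : w = j
  · subst hwj
    have h1 : i ≠ n := by rintro rfl; exact hn hfi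
    have h3 : i ≠ Γ.θ n := by rintro rfl; exact hn (Γ.θ.injective hfi)
    have h4 := neg_four_lt_sum (Γ := Γ) (i := w) (N := {i, n, Γ.θ n}) (by
      intro x hx
      simp only [Finset.mem_insert, Finset.mem_singleton] at hx
      rcases hx with rfl | rfl | rfl
      · exact hij
      · exact hwn.symm
      · exact hwn'.symm)
    rw [Finset.sum_insert (by simp [h1, h3]), Finset.sum_pair (Ne.symm hn)] at h4
    have h5 := cartan_nonpos_of_adj hwn.symm
    have h6 := cartan_nonpos_of_adj hwn'.symm
    omega
  · rcases h with h | ⟨u, hu, hfu⟩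
    · exact hwj h
    · exact hcase u hu hfu hwj

lemma simplyLacedAt_of_forall_not_special {k : ι}
    (hk : ∀ i, Γ.graph.Reachable k i → ¬ Γ.Special i) : Γ.SimplyLacedAt k :=
  fun _ _ hi hij => cartan_eq_neg_one_of_not_special (hk _ (hi.trans hij.reachable)) hij

/-! ### The form on a simply laced component -/

/-- The form given by the Cartan matrix. -/
def form (Γ : WeightedVoganDiagram ι) (v w : ι → ℤ) : ℤ := ∑ i, v i * Γ.pair w i

lemma pair_add (v w : ι → ℤ) (i : ι) : Γ.pair (v + w) i = Γ.pair v i + Γ.pair w i := by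
  simp [pair, add_mul, Finset.sum_add_distrib]

lemma pair_smul (a : ℤ) (v : ι → ℤ) (i : ι) : Γ.pair (a • v) i = a * Γ.pair v i := by
  simp [pair, Finset.mul_sum, mul_assoc]

lemma form_add_left (u v w : ι → ℤ) : Γ.form (u + v) w = Γ.form u w + Γ.form v w := by
  simp [form, add_mul, Finset.sum_add_distrib]

lemma form_sub_left (u v w : ι → ℤ) : Γ.form (u - v) w = Γ.form u w - Γ.form v w := by
  simp [form, sub_mul]

lemma form_smul_left (a : ℤ) (v w : ι → ℤ) : Γ.form (a • v) w = a * Γ.form v w := by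
  simp [form, Finset.mul_sum, mul_assoc]

lemma form_add_right (u v w : ι → ℤ) : Γ.form u (v + w) = Γ.form u v + Γ.form u w := by
  simp [form, pair_add, mul_add, Finset.sum_add_distrib]

lemma form_sub_right (u v w : ι → ℤ) : Γ.form u (v - w) = Γ.form u v - Γ.form u w := by
  simp [form, pair_sub, mul_sub]

lemma form_smul_right (a : ℤ) (v w : ι → ℤ) : Γ.form v (a • w) = a * Γ.form v w := by
  simp only [form, pair_smul, Finset.mul_sum]
  exact Finset.sum_congr rfl fun i _ => by ring

lemma form_single_left (j : ι) (w : ι → ℤ) : Γ.form (Pi.single j 1) w = Γ.pair w j := by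
  simp [form, Pi.single_apply]

lemma form_act (v w : ι → ℤ) : Γ.form (Γ.act v) (Γ.act w) = Γ.form v w := by
  rw [form, ← sum_comp_θ (Γ := Γ)]
  exact Finset.sum_congr rfl fun i _ => by rw [pair_act, act_apply, Γ.θ_θ]

lemma SimplyLacedAt.cartan_symm {k i j : ι} (hk : Γ.SimplyLacedAt k) (hi : Γ.graph.Reachable k i)
    (hj : Γ.graph.Reachable k j) : Γ.cartan i j = Γ.cartan j i := by
  by_cases hij : i = j
  · rw [hij]
  by_cases hadj : Γ.graph.Adj i j
  · rw [hk i j hi hadj, hk j i hj hadj.symm]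
  · rw [cartan_eq_zero_of_not_adj hij hadj,
      cartan_eq_zero_of_not_adj (Ne.symm hij) fun h => hadj h.symm]

lemma form_comm {k : ι} (hk : Γ.SimplyLacedAt k) {v w : ι → ℤ} (hv : Γ.SupportedAt k v)
    (hw : Γ.SupportedAt k w) : Γ.form v w = Γ.form w v := by
  simp only [form, pair, Finset.mul_sum]
  rw [Finset.sum_comm]
  refine Finset.sum_congr rfl fun i _ => Finset.sum_congr rfl fun j _ => ?_
  by_cases hvj : v j = 0
  · simp [hvj]
  by_cases hwi : w i = 0
  · simp [hwi]
  rw [hk.cartan_symm (hw i hwi) (hv j hvj)]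
  ring

lemma form_self_pos {k : ι} (hk : Γ.SimplyLacedAt k) {v : ι → ℤ} (hv : Γ.SupportedAt k v)
    (h0 : v ≠ 0) : 0 < Γ.form v v := by
  obtain ⟨d, hd, hsymm, hpos⟩ := Γ.exists_form
  have hconst : ∀ i, Γ.graph.Reachable k i → d i = d k := by
    have key : ∀ i j, Γ.graph.Walk i j → Γ.graph.Reachable k i → d j = d i := by
      intro i j p
      induction p with
      | nil => intro _; rfl
      | @cons a b c hab _ ih =>
        intro ha
        rw [ih (ha.trans hab.reachable)]
        have h1 := hsymm a b
        rw [hk a b ha hab, hk b a (ha.trans hab.reachable) hab.symm] at h1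
        push_cast at h1
        linarith
    rintro i ⟨p⟩
    exact key k i p .rfl
  have h1 : ∑ j, (v j : ℝ) / d j * (Γ.pair v j : ℝ) = (Γ.form v v : ℝ) / d k := by
    rw [form]
    push_cast
    rw [Finset.sum_div]
    refine Finset.sum_congr rfl fun j _ => ?_
    by_cases hvj : v j = 0
    · simp [hvj]
    · rw [hconst j (hv j hvj)]; ring
  have h2 := hpos v h0
  rw [h1] at h2
  have h3 := (div_pos_iff_of_pos_right (hd k)).mp h2
  exact_mod_cast h3

/-- By symmetry the off-diagonal terms come in equal pairs, and the diagonal terms carry the factor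
two. -/
lemma even_form_self {k : ι} (hk : Γ.SimplyLacedAt k) {v : ι → ℤ} (hv : Γ.SupportedAt k v) :
    Even (Γ.form v v) := by
  have h1 : ((Γ.form v v : ℤ) : ZMod 2) =
      ∑ p : ι × ι, ((v p.1 * (v p.2 * Γ.cartan p.2 p.1) : ℤ) : ZMod 2) := by
    rw [Fintype.sum_prod_type]
    simp only [form, pair, Finset.mul_sum]
    push_cast
    rfl
  have h2 : ((Γ.form v v : ℤ) : ZMod 2) = 0 := by
    rw [h1]
    refine Finset.sum_involution (fun p _ => p.swap) ?_ ?_ (fun _ _ => Finset.mem_univ _)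
      fun p _ => p.swap_swap
    · rintro ⟨i, j⟩ _
      have h3 : v i * (v j * Γ.cartan j i) = v j * (v i * Γ.cartan i j) := by
        by_cases hvi : v i = 0
        · simp [hvi]
        by_cases hvj : v j = 0
        · simp [hvj]
        rw [hk.cartan_symm (hv j hvj) (hv i hvi)]
        ring
      dsimp only [Prod.swap]
      rw [h3]
      exact CharTwo.add_self_eq_zero _
    · rintro ⟨i, j⟩ _ hne hswap
      have hij : j = i := congrArg Prod.fst hswap
      subst hij
      apply hne
      dsimp only
      rw [Γ.cartan_diag]
      have : (2 : ZMod 2) = 0 := rfl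
      push_cast
      rw [this]
      ring
  exact even_iff_two_dvd.mpr ((ZMod.intCast_zmod_eq_zero_iff_dvd _ 2).mp h2)

lemma SimplyLacedAt.of_reachable {k l : ι} (hk : Γ.SimplyLacedAt k) (h : Γ.graph.Reachable k l) :
    Γ.SimplyLacedAt l :=
  fun i j hi => hk i j (h.trans hi)

/-- Roots in a simply laced component have norm two. -/
lemma IsRoot.form_self {v : ι → ℤ} (hv : Γ.IsRoot v) (h0 : v ≠ 0) {k : ι} (hvk : Γ.SupportedAt k v)
    (hk : Γ.SimplyLacedAt k) : Γ.form v v = 2 := by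
  have key : ∀ v, Γ.IsRoot v →
      ∃ l, Γ.SupportedAt l v ∧ (Γ.SimplyLacedAt l → Γ.form v v = 2) := by
    intro v hv
    induction hv with
    | simple i =>
      refine ⟨i, fun j hj => ?_, fun _ => ?_⟩
      · have : j = i := by
          by_contra h
          exact hj (Pi.single_eq_of_ne h 1)
        rw [this]
      · rw [form_single_left, pair_single, Γ.cartan_diag]
    | reflection j v _ ih =>
      obtain ⟨l, hl, hf⟩ := ih
      change ∃ l, Γ.SupportedAt l (v - Γ.pair v j • Pi.single j 1) ∧ _
      by_cases hp : Γ.pair v j = 0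
      · change ∃ l, _ ∧ (_ → Γ.form (v - Γ.pair v j • Pi.single j 1) (v - Γ.pair v j • Pi.single j 1) = 2)
        rw [hp, zero_smul, sub_zero]
        exact ⟨l, hl, hf⟩
      have hlj : Γ.graph.Reachable l j := by
        obtain ⟨i, -, hi⟩ := Finset.exists_ne_zero_of_sum_ne_zero hp
        have hvi := left_ne_zero_of_mul hi
        by_cases hij : i = j
        · rw [← hij]; exact hl i hvi
        · exact (hl i hvi).trans (SimpleGraph.Adj.reachable ⟨hij, right_ne_zero_of_mul hi⟩)
      have hj : Γ.SupportedAt l (Pi.single j 1) := by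
        intro i hi
        have : i = j := by
          by_contra h
          exact hi (Pi.single_eq_of_ne h 1)
        rwa [this]
      refine ⟨l, fun i hi => ?_, fun hs => ?_⟩
      · by_cases hij : i = j
        · rwa [hij]
        · refine hl i ?_
          simpa [hij] using hi
      · change Γ.form (v - Γ.pair v j • Pi.single j 1) (v - Γ.pair v j • Pi.single j 1) = 2
        rw [form_sub_left, form_sub_right, form_sub_right, form_smul_left, form_smul_left,
          form_smul_right, form_smul_right, form_comm hs hl hj, form_single_left, form_single_left,
          pair_single, Γ.cartan_diag, hf hs]
        ring
  obtain ⟨l, hl, hf⟩ := key v hv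
  obtain ⟨i, hi⟩ := Function.ne_iff.mp h0
  exact hf (hk.of_reachable ((hvk i hi).trans (hl i hi).symm))

lemma pair_eq_sub {k : ι} (hk : Γ.SimplyLacedAt k) {v : ι → ℤ} (hv : Γ.SupportedAt k v) (i : ι) :
    Γ.pair v i = 2 * v i - ∑ l ∈ Finset.univ.filter (fun l => Γ.cartan l i ≠ 0 ∧ l ≠ i), v l := by
  rw [pair, ← Finset.add_sum_erase _ _ (Finset.mem_univ i), Γ.cartan_diag, mul_comm, sub_eq_add_neg,
    ← Finset.sum_neg_distrib, Finset.sum_filter]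
  congr 1
  rw [← Finset.add_sum_erase _ _ (Finset.mem_univ i), if_neg (by simp), zero_add]
  refine Finset.sum_congr rfl fun l hl => ?_
  have hli := Finset.ne_of_mem_erase hl
  split_ifs with h
  · by_cases hvl : v l = 0
    · simp [hvl]
    · rw [hk l i (hv l hvl) ⟨hli, h.1⟩]; ring
  · have : Γ.cartan l i = 0 := by
      by_contra h0
      exact h ⟨h0, hli⟩
    rw [this, mul_zero]

/-- A positive root whose support has no branching has all its coefficients equal to one. -/
lemma eq_one_of_card_le_two {v : ι → ℤ} (hv : v ∈ Γ.posRoots) (h0 : v ≠ 0) {k : ι}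
    (hvk : Γ.SupportedAt k v) (hk : Γ.SimplyLacedAt k)
    (hdeg : ∀ i, v i ≠ 0 → ∀ N : Finset ι, (∀ l ∈ N, v l ≠ 0 ∧ Γ.graph.Adj l i) → N.card ≤ 2) :
    v = fun i => if v i ≠ 0 then 1 else 0 := by
  set χ : ι → ℤ := fun i => if v i ≠ 0 then 1 else 0 with hχ
  have hχ1 : ∀ i, v i ≠ 0 → χ i = 1 := fun i hi => if_pos hi
  have hχ0 : ∀ i, v i = 0 → χ i = 0 := fun i hi => if_neg (not_not.mpr hi)
  have hχk : Γ.SupportedAt k χ := fun i hi => hvk i fun h => hi (hχ0 i h)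
  have hχne : χ ≠ 0 := by
    obtain ⟨i, hi⟩ := Function.ne_iff.mp h0
    refine Function.ne_iff.mpr ⟨i, ?_⟩
    rw [hχ1 i hi]; exact one_ne_zero
  -- At most two neighbours in the support keep the pairings of the indicator `χ` nonnegative, so
  -- `(v, χ) ≥ (χ, χ)`. As `(χ, χ)` is positive and even, it is at least two, and `(v - χ, v - χ) ≤
  -- 2 - (χ, χ) ≤ 0`.
  have hp : ∀ i, v i ≠ 0 → 0 ≤ Γ.pair χ i := by
    intro i hi
    rw [pair_eq_sub hk hχk, hχ1 i hi]
    have h1 := hdeg i hi (Finset.univ.filter fun l => (Γ.cartan l i ≠ 0 ∧ l ≠ i) ∧ v l ≠ 0) (by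
      intro l hl
      obtain ⟨-, ⟨h1, h2⟩, h3⟩ := Finset.mem_filter.mp hl
      exact ⟨h3, h2, h1⟩)
    have h2 : ∑ l ∈ Finset.univ.filter (fun l => Γ.cartan l i ≠ 0 ∧ l ≠ i), χ l =
        ((Finset.univ.filter fun l => (Γ.cartan l i ≠ 0 ∧ l ≠ i) ∧ v l ≠ 0).card : ℤ) := by
      rw [← Finset.filter_filter (fun l => Γ.cartan l i ≠ 0 ∧ l ≠ i) (fun l => v l ≠ 0),
        Finset.card_filter]
      push_cast
      rfl
    rw [h2]
    have : ((Finset.univ.filter fun l => (Γ.cartan l i ≠ 0 ∧ l ≠ i) ∧ v l ≠ 0).card : ℤ) ≤ 2 := by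
      exact_mod_cast h1
    omega
  have h1 : Γ.form χ χ ≤ Γ.form v χ := by
    refine Finset.sum_le_sum fun i _ => ?_
    by_cases hi : v i = 0
    · rw [hχ0 i hi, hi]
    · refine mul_le_mul_of_nonneg_right ?_ (hp i hi)
      rw [hχ1 i hi]
      have := hv.2 i
      omega
  have h2 := form_self_pos hk hχk hχne
  obtain ⟨c, hc⟩ := even_form_self hk hχk
  have h3 : Γ.form (v - χ) (v - χ) ≤ 0 := by
    rw [form_sub_left, form_sub_right, form_sub_right, form_comm hk hχk hvk,
      hv.1.form_self h0 hvk hk]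
    omega
  by_contra hne
  refine absurd (form_self_pos hk (v := v - χ) (fun i hi => ?_) (sub_ne_zero.mpr hne)) (not_lt.mpr h3)
  refine hvk i fun h => hi ?_
  rw [Pi.sub_apply, h, hχ0 i h, sub_zero]

end WeightedVoganDiagram

/-! ### Conditions on nodes read off from roots of weight two. -/

namespace WeightedVoganDiagram

variable {ι : Type*} [Fintype ι] [DecidableEq ι] {Γ : WeightedVoganDiagram ι}

lemma sum_ω_support {v : ι → ℤ} (hv : v = fun i => if v i ≠ 0 then 1 else 0) :
    (∑ i ∈ Finset.univ.filter (fun i => v i ≠ 0), Γ.ω i : ℕ) = Γ.weight v := by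
  rw [weight, Finset.sum_filter]
  push_cast
  refine Finset.sum_congr rfl fun i _ => ?_
  have := congrFun hv i
  split_ifs with h
  · rw [if_pos h] at this
    rw [this, one_mul]
  · rw [not_not.mp h, zero_mul]

lemma isStableSub_support_iff {v : ι → ℤ} :
    Γ.IsStableSub (Finset.univ.filter fun i => v i ≠ 0) ↔ ∀ i, v (Γ.θ i) ≠ 0 ↔ v i ≠ 0 := by
  constructor
  · intro h i
    have key : ∀ i, v i ≠ 0 → v (Γ.θ i) ≠ 0 := by
      intro i hi
      have h1 : Γ.θ i ∈ (Finset.univ.filter fun i => v i ≠ 0).image Γ.θ :=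
        Finset.mem_image_of_mem _ (Finset.mem_filter.mpr ⟨Finset.mem_univ _, hi⟩)
      rw [h] at h1
      exact (Finset.mem_filter.mp h1).2
    exact ⟨fun hi => Γ.θ_θ i ▸ key _ hi, key i⟩
  · intro h
    ext i
    rw [Finset.mem_image, Finset.mem_filter]
    constructor
    · rintro ⟨k, hk, rfl⟩
      exact ⟨Finset.mem_univ _, (h k).mpr (Finset.mem_filter.mp hk).2⟩
    · rintro ⟨-, hi⟩
      exact ⟨Γ.θ i, Finset.mem_filter.mpr ⟨Finset.mem_univ _, (h i).mpr hi⟩, Γ.θ_θ i⟩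

/-- A moved root of weight two whose coefficients are at most one. -/
lemma nodeCondition_of_eq_one {v : ι → ℤ} (hv : v = fun i => if v i ≠ 0 then 1 else 0)
    (hconn : Γ.IsConnectedSub (Finset.univ.filter fun i => v i ≠ 0)) (hw : Γ.weight v = 2)
    (hmoved : Γ.act v ≠ v) {j : ι} (hj : v j ≠ 0) : Γ.NodeCondition j := by
  refine .inl ⟨_, Finset.mem_filter.mpr ⟨Finset.mem_univ _, hj⟩, hconn, fun hst => hmoved ?_, ?_⟩
  · rw [isStableSub_support_iff] at hst
    funext i
    rw [act_apply, congrFun hv i, congrFun hv (Γ.θ i)]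
    simp only [hst i]
  · have := sum_ω_support (Γ := Γ) hv
    rw [hw] at this
    exact_mod_cast this

/-- A fixed root of weight two and odd painted length. -/
lemma nodeCondition_of_odd {v : ι → ℤ} (hv : v ∈ Γ.posRoots)
    (hconn : Γ.IsConnectedSub (Finset.univ.filter fun i => v i ≠ 0)) (hw : Γ.weight v = 2)
    (hfix : Γ.act v = v) (hp : Odd (Γ.paintedLength v)) {j : ι} (hj : v j ≠ 0) :
    Γ.NodeCondition j := by
  have hpos : ∀ i, v i ≠ 0 → 1 ≤ v i := fun i hi => by have := hv.2 i; omega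
  refine .inr ⟨_, Finset.mem_filter.mpr ⟨Finset.mem_univ _, hj⟩, hconn, ?_, .inl ⟨?_, ?_, v, hv, ?_, hfix,
    hw, hp, hpos j hj⟩⟩
  · rw [isStableSub_support_iff]
    intro i
    rw [← act_apply v, hfix]
  · obtain ⟨i, -, hi⟩ := Finset.exists_ne_zero_of_sum_ne_zero (show Γ.weight v ≠ 0 by rw [hw]; norm_num)
    refine Nat.pos_of_ne_zero fun h0 => ?_
    have := (Finset.sum_eq_zero_iff.mp h0) i (by simpa using left_ne_zero_of_mul hi)
    rw [this] at hi
    simp at hi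
  · have h1 : ((∑ i ∈ Finset.univ.filter (fun i => v i ≠ 0), Γ.ω i : ℕ) : ℤ) ≤ Γ.weight v := by
      rw [weight, Finset.sum_filter]
      push_cast
      refine Finset.sum_le_sum fun i _ => ?_
      split_ifs with h
      · exact le_mul_of_one_le_left (Int.natCast_nonneg _) (hpos i h)
      · rw [not_not.mp h, zero_mul]
    rw [hw] at h1
    exact_mod_cast h1
  · intro i hi
    by_contra h0
    exact hi (Finset.mem_filter.mpr ⟨Finset.mem_univ _, h0⟩)

/-! ### The two-row pattern -/

/-- A row of length `r` of a subdiagram with a swapped edge. -/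
structure IsRow (Γ : WeightedVoganDiagram ι) (S : Finset ι) (c : ℕ → ι) (r : ℕ) : Prop where
  mem : ∀ n < r, c n ∈ S
  swap : Γ.graph.Adj (c 0) (Γ.θ (c 0))
  adj : ∀ n, n + 1 < r → Γ.graph.Adj (c n) (c (n + 1))
  inj : ∀ m < r, ∀ n < r, c m = c n → m = n
  ne : ∀ m < r, ∀ n < r, c m ≠ Γ.θ (c n)

variable {S : Finset ι} {c : ℕ → ι} {r : ℕ}

lemma IsRow.length_le (hc : Γ.IsRow S c r) : r ≤ Fintype.card ι := by
  have : Function.Injective fun n : Fin r => c n := fun m n h =>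
    Fin.ext (hc.inj m m.2 n n.2 h)
  simpa using Fintype.card_le_of_injective _ this

/-- The neighbour of a node of a row in the direction of the swapped edge. -/
def pred (Γ : WeightedVoganDiagram ι) (c : ℕ → ι) : ℕ → ι
  | 0 => Γ.θ (c 0)
  | n + 1 => c n

lemma IsRow.adj_pred (hc : Γ.IsRow S c r) {n : ℕ} (hn : n < r) : Γ.graph.Adj (Γ.pred c n) (c n) := by
  cases n with
  | zero => exact hc.swap.symm
  | succ n => exact hc.adj n hn

lemma IsRow.pred_ne (hc : Γ.IsRow S c r) {n m : ℕ} (hn : n < r) (hm : m < r) (hnm : n ≤ m) :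
    Γ.pred c n ≠ c m := by
  cases n with
  | zero => exact (hc.ne m hm 0 (by omega)).symm
  | succ n =>
    intro h
    have := hc.inj n (by omega) m hm h
    omega

lemma IsRow.pred_ne_θ (hc : Γ.IsRow S c r) {n m : ℕ} (hn : n < r) (hm : m < r) (hnm : n < m) :
    Γ.pred c n ≠ Γ.θ (c m) := by
  cases n with
  | zero =>
    intro h
    have := hc.inj 0 (by omega) m hm (Γ.θ.injective h)
    omega
  | succ n => exact hc.ne n (by omega) m hm

/-- Such a bond would be a third neighbour of `c n`, besides its two neighbours along the row, and
make it special. -/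
lemma IsRow.not_adj_of_lt (hc : Γ.IsRow S c r)
    (hdeg : ∀ i ∈ S, ¬ Γ.Special i) {n m : ℕ} (hm : m < r) (hnm : n + 1 < m) :
    ¬ Γ.graph.Adj (c n) (c m) := by
  intro h
  refine hdeg (c n) (hc.mem n (by omega)) (special_of_three (hc.adj_pred (n := n) (by omega))
    (hc.adj n (by omega)).symm h.symm (hc.pred_ne (by omega) (by omega) (by omega))
    (hc.pred_ne (by omega) hm (by omega)) fun h0 => ?_)
  have := hc.inj (n + 1) (by omega) m hm h0
  omega

lemma IsRow.not_adj_θ_of_lt (hc : Γ.IsRow S c r)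
    (hdeg : ∀ i ∈ S, ¬ Γ.Special i) {n m : ℕ} (hm : m < r) (hnm : n < m) :
    ¬ Γ.graph.Adj (c n) (Γ.θ (c m)) := by
  intro h
  exact hdeg (c n) (hc.mem n (by omega)) (special_of_three (hc.adj_pred (n := n) (by omega))
    (hc.adj n (by omega)).symm h.symm (hc.pred_ne (by omega) (by omega) (by omega))
    (hc.pred_ne_θ (by omega) hm (by omega)) (hc.ne (n + 1) (by omega) m hm))

/-- The two rows up to `c n`, closed at both ends by swapped edges, would form a cycle. -/
lemma IsRow.not_adj_θ_self (hc : Γ.IsRow S c r) {n : ℕ} (hn : n < r) (hn0 : 0 < n) :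
    ¬ Γ.graph.Adj (c n) (Γ.θ (c n)) := by
  intro h
  let T : Finset ι := (Finset.range (n + 1)).image c ∪ (Finset.range (n + 1)).image fun m => Γ.θ (c m)
  have hT : ∀ m ≤ n, c m ∈ T ∧ Γ.θ (c m) ∈ T := fun m hm =>
    ⟨Finset.mem_union_left _ (Finset.mem_image_of_mem _ (Finset.mem_range.mpr (by omega))),
      Finset.mem_union_right _ (Finset.mem_image_of_mem (fun m => Γ.θ (c m))
        (Finset.mem_range.mpr (by omega)))⟩
  have hθT : ∀ i ∈ T, Γ.θ i ∈ T := by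
    intro i hi
    rcases Finset.mem_union.mp hi with hi | hi
    · obtain ⟨m, hm, rfl⟩ := Finset.mem_image.mp hi
      exact (hT m (by have := Finset.mem_range.mp hm; omega)).2
    · obtain ⟨m, hm, rfl⟩ := Finset.mem_image.mp hi
      rw [Γ.θ_θ]
      exact (hT m (by have := Finset.mem_range.mp hm; omega)).1
  have hnb : ∀ m ≤ n, ∃ k ∈ T, ∃ l ∈ T, k ≠ l ∧ Γ.graph.Adj k (c m) ∧ Γ.graph.Adj l (c m) := by
    intro m hm
    have hpT : Γ.pred c m ∈ T := by
      cases m with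
      | zero => exact (hT 0 hm).2
      | succ m => exact (hT m (by omega)).1
    by_cases hmn : m = n
    · subst hmn
      refine ⟨_, hpT, _, (hT m le_rfl).2, ?_, hc.adj_pred hn, h.symm⟩
      obtain ⟨l, rfl⟩ := Nat.exists_eq_succ_of_ne_zero hn0.ne'
      exact hc.ne l (by omega) (l + 1) hn
    · exact ⟨_, hpT, _, (hT (m + 1) (by omega)).1, hc.pred_ne (by omega) (by omega) (by omega),
        hc.adj_pred (by omega), (hc.adj m (by omega)).symm⟩
  have hnb' : ∀ i ∈ T, ∃ k ∈ T, ∃ l ∈ T, k ≠ l ∧ Γ.graph.Adj k i ∧ Γ.graph.Adj l i := by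
    intro i hi
    rcases Finset.mem_union.mp hi with hi | hi
    · obtain ⟨m, hm, rfl⟩ := Finset.mem_image.mp hi
      exact hnb m (by have := Finset.mem_range.mp hm; omega)
    · obtain ⟨m, hm, rfl⟩ := Finset.mem_image.mp hi
      obtain ⟨k, hk, l, hl, hkl, hka, hla⟩ := hnb m (by have := Finset.mem_range.mp hm; omega)
      exact ⟨_, hθT k hk, _, hθT l hl, fun h => hkl (Γ.θ.injective h), adj_θ.mpr hka, adj_θ.mpr hla⟩
  exact not_forall_exists_two_adj ⟨_, (hT 0 (by omega)).1⟩ hnb'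

/-- A row that cannot be extended exhausts the subdiagram together with its image. -/
lemma IsRow.eq_union (hc : Γ.IsRow S c r) (hr : 0 < r) (hmax : ∀ c', ¬ Γ.IsRow S c' (r + 1))
    (hconn : Γ.IsConnectedSub S) (hst : ∀ i ∈ S, Γ.θ i ∈ S) (hfix : ∀ i ∈ S, Γ.θ i ≠ i)
    (hdeg : ∀ i ∈ S, ¬ Γ.Special i) :
    S = (Finset.range r).image c ∪ (Finset.range r).image fun n => Γ.θ (c n) := by
  set T := (Finset.range r).image c ∪ (Finset.range r).image fun n => Γ.θ (c n) with hT
  have hmem : ∀ i, i ∈ T ↔ ∃ n < r, i = c n ∨ i = Γ.θ (c n) := by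
    intro i
    simp only [hT, Finset.mem_union, Finset.mem_image, Finset.mem_range]
    constructor
    · rintro (⟨n, hn, rfl⟩ | ⟨n, hn, rfl⟩)
      · exact ⟨n, hn, .inl rfl⟩
      · exact ⟨n, hn, .inr rfl⟩
    · rintro ⟨n, hn, rfl | rfl⟩
      · exact .inl ⟨n, hn, rfl⟩
      · exact .inr ⟨n, hn, rfl⟩
  have hθT : ∀ i, Γ.θ i ∈ T → i ∈ T := by
    intro i hi
    obtain ⟨n, hn, h | h⟩ := (hmem _).mp hi
    · exact (hmem i).mpr ⟨n, hn, .inr (by rw [← h, Γ.θ_θ])⟩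
    · exact (hmem i).mpr ⟨n, hn, .inl (Γ.θ.injective h)⟩
  have hpT : ∀ n < r, Γ.pred c n ∈ T := by
    intro n hn
    cases n with
    | zero => exact (hmem _).mpr ⟨0, hn, .inr rfl⟩
    | succ n => exact (hmem _).mpr ⟨n, by omega, .inl rfl⟩
  -- A neighbour outside both rows makes an inner node special, while at the end of the row it would
  -- lengthen the row.
  have key : ∀ n < r, ∀ y ∈ S, Γ.graph.Adj (c n) y → y ∈ T := by
    intro n hn y hy hadj
    by_contra hyT
    have hyc : ∀ m < r, c m ≠ y := fun m hm h => hyT ((hmem y).mpr ⟨m, hm, .inl h.symm⟩)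
    have hyθ : ∀ m < r, Γ.θ (c m) ≠ y := fun m hm h => hyT ((hmem y).mpr ⟨m, hm, .inr h.symm⟩)
    by_cases hnr : n + 1 < r
    · refine hdeg (c n) (hc.mem n hn) (special_of_three (hc.adj_pred hn) (hc.adj n hnr).symm hadj.symm
        (hc.pred_ne hn hnr (by omega)) (fun h => hyT (h ▸ hpT n hn)) (hyc _ hnr))
    · have hnr' : r = n + 1 := by omega
      refine hmax (fun m => if m < r then c m else y) ⟨?_, ?_, ?_, ?_, ?_⟩
      · intro m _
        split_ifs with h
        · exact hc.mem m h
        · exact hy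
      · simp only [hr, if_true]
        exact hc.swap
      · intro m hm
        have hm1 : m < r := by omega
        simp only [hm1, if_true]
        split_ifs with h
        · exact hc.adj m h
        · have : m = n := by omega
          rw [this]
          exact hadj
      · intro a ha b' hb hab
        split_ifs at hab with h1 h2 h2
        · exact hc.inj a h1 b' h2 hab
        · exact absurd hab (hyc a h1)
        · exact absurd hab.symm (hyc b' h2)
        · omega
      · intro a ha b' hb
        split_ifs with h1 h2 h2
        · exact hc.ne a h1 b' h2
        · intro h
          exact hyθ a h1 (by rw [h, Γ.θ_θ])
        · exact fun h => hyθ b' h2 h.symm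
        · exact (hfix y hy).symm
  apply Finset.Subset.antisymm
  · refine hconn.subset_of_closed (hc.mem 0 hr) ((hmem _).mpr ⟨0, hr, .inl rfl⟩) ?_
    intro i hi j hj hadj
    obtain ⟨n, hn, rfl | rfl⟩ := (hmem i).mp hi
    · exact key n hn j hj hadj
    · refine hθT j (key n hn _ (hst j hj) ?_)
      have := adj_θ.mpr hadj
      rwa [Γ.θ_θ] at this
  · intro i hi
    obtain ⟨n, hn, rfl | rfl⟩ := (hmem i).mp hi
    · exact hc.mem n hn
    · exact hst _ (hc.mem n hn)

/-- A row of maximal length starting at the swapped edge exhausts half of `S`; the total weight two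
then splits equally, leaving weight one on a single node of each row. -/
theorem isTwoRowPattern_of_adj (hconn : Γ.IsConnectedSub S) (hst : ∀ i ∈ S, Γ.θ i ∈ S)
    (hfix : ∀ i ∈ S, Γ.θ i ≠ i) (hdeg : ∀ i ∈ S, ¬ Γ.Special i) (hω : ∑ i ∈ S, Γ.ω i = 2) {i : ι}
    (hi : i ∈ S) (hadj : Γ.graph.Adj i (Γ.θ i)) : Γ.IsTwoRowPattern S := by
  classical
  have h1 : ∃ c, Γ.IsRow S c 1 :=
    ⟨fun _ => i, fun _ _ => hi, hadj, fun n hn => by omega, fun m hm n hn _ => by omega,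
      fun _ _ _ _ => (hfix i hi).symm⟩
  set r := Nat.findGreatest (fun r => ∃ c, Γ.IsRow S c r) (Fintype.card ι) with hr
  obtain ⟨c0, hc0⟩ := h1
  obtain ⟨c, hc⟩ : ∃ c, Γ.IsRow S c r := Nat.findGreatest_spec
    (P := fun r => ∃ c, Γ.IsRow S c r) hc0.length_le ⟨c0, hc0⟩
  have hr0 : 0 < r := Nat.le_findGreatest (P := fun r => ∃ c, Γ.IsRow S c r) hc0.length_le ⟨c0, hc0⟩
  have hmax : ∀ c', ¬ Γ.IsRow S c' (r + 1) := by
    intro c' hc'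
    have : r + 1 ≤ r := Nat.le_findGreatest (P := fun r => ∃ c, Γ.IsRow S c r) hc'.length_le ⟨c', hc'⟩
    omega
  have hS := hc.eq_union hr0 hmax hconn hst hfix hdeg
  have himg : ∀ f : ℕ → ι, (Finset.range r).image f = Finset.univ.image fun a : Fin r => f a := by
    intro f
    ext x
    simp only [Finset.mem_image, Finset.mem_range, Finset.mem_univ, true_and]
    constructor
    · rintro ⟨n, hn, rfl⟩
      exact ⟨⟨n, hn⟩, rfl⟩
    · rintro ⟨a, rfl⟩
      exact ⟨a, a.2, rfl⟩
  rw [himg, himg] at hS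
  have hinj : Function.Injective fun a : Fin r => c a := fun a b h => Fin.ext (hc.inj a a.2 b b.2 h)
  have hinj' : Function.Injective fun a : Fin r => Γ.θ (c a) := fun a b h => hinj (Γ.θ.injective h)
  have hsum : ∑ a : Fin r, Γ.ω (c a) = 1 := by
    have hdisj : Disjoint (Finset.univ.image fun a : Fin r => c a)
        (Finset.univ.image fun a : Fin r => Γ.θ (c a)) := by
      rw [Finset.disjoint_left]
      intro x hx hx'
      obtain ⟨a, -, rfl⟩ := Finset.mem_image.mp hx
      obtain ⟨b, -, hb⟩ := Finset.mem_image.mp hx'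
      exact hc.ne a a.2 b b.2 hb.symm
    rw [hS, Finset.sum_union hdisj, Finset.sum_image fun _ _ _ _ h => hinj h,
      Finset.sum_image fun _ _ _ _ h => hinj' h] at hω
    simp only [Γ.ω_θ] at hω
    omega
  obtain ⟨k, hk⟩ : ∃ k : Fin r, Γ.ω (c k) ≠ 0 := by
    by_contra! h
    simp [h] at hsum
  have hk1 : ∀ a, a ≠ k → Γ.ω (c a) = 0 ∧ Γ.ω (c k) = 1 := by
    intro a ha
    have h2 := Finset.add_sum_erase Finset.univ (fun a : Fin r => Γ.ω (c a)) (Finset.mem_univ k)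
    have h3 := Finset.single_le_sum (f := fun a : Fin r => Γ.ω (c a)) (fun _ _ => Nat.zero_le _)
      (Finset.mem_erase.mpr ⟨ha, Finset.mem_univ a⟩)
    omega
  have hk2 : Γ.ω (c k) = 1 := by
    have h3 := Finset.single_le_sum (f := fun a : Fin r => Γ.ω (c a)) (fun _ _ => Nat.zero_le _)
      (Finset.mem_univ k)
    omega
  have hcart : ∀ x y, x ∈ S → Γ.graph.Adj y x → Γ.cartan y x = -1 := fun x y hx hadj =>
    cartan_eq_neg_one_of_not_special (hdeg x hx) hadj
  refine ⟨r, fun a => c a, k, hS, hinj, fun a b => hc.ne a a.2 b b.2, ?_, ?_, ?_⟩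
  · intro a b
    by_cases hab : a = b
    · subst hab
      rw [Γ.cartan_diag]
      simp [CartanMatrix.A]
    have hab' : a.val ≠ b.val := fun h => hab (Fin.ext h)
    simp only [CartanMatrix.A, Matrix.of_apply, if_neg hab]
    split_ifs with h
    · refine hcart _ _ (hc.mem b b.2) ?_
      rcases h with h | h
      · have := hc.adj a (by omega)
        rwa [h] at this
      · have := hc.adj b (by omega)
        rw [h] at this
        exact this.symm
    · refine cartan_eq_zero_of_not_adj (fun h2 => hab (hinj h2)) fun h2 => ?_
      rcases lt_or_gt_of_ne hab' with h3 | h3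
      · exact hc.not_adj_of_lt hdeg b.2 (by omega) h2
      · exact hc.not_adj_of_lt hdeg a.2 (by omega) h2.symm
  · intro a b
    split_ifs with h
    · have ha : a = ⟨0, hr0⟩ := Fin.ext h.1
      have hb : b = ⟨0, hr0⟩ := Fin.ext h.2
      rw [ha, hb]
      exact hcart _ _ (hst _ (hc.mem 0 hr0)) hc.swap
    · refine cartan_eq_zero_of_not_adj (hc.ne a a.2 b b.2) fun h2 => ?_
      rcases lt_trichotomy a.val b.val with h3 | h3 | h3
      · exact hc.not_adj_θ_of_lt hdeg b.2 h3 h2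
      · have h4 : a = b := Fin.ext h3
        subst h4
        exact hc.not_adj_θ_self a.2 (Nat.pos_of_ne_zero fun h5 => h ⟨h5, h5⟩) h2
      · have h4 := adj_θ.mpr h2
        rw [Γ.θ_θ] at h4
        exact hc.not_adj_θ_of_lt hdeg a.2 h3 h4.symm
  · intro a
    split_ifs with h
    · rw [h, hk2]
    · exact (hk1 a h).1

end WeightedVoganDiagram

namespace WeightedVoganDiagram

variable {ι : Type*} [Fintype ι] [DecidableEq ι] {Γ : WeightedVoganDiagram ι}

/-! ### The branch node of a stable component -/

/-- A fixed node `f` with the three neighbours `b`, `θ b` and `a`, where `a` is fixed and `b` is moved. -/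
structure IsBranch (Γ : WeightedVoganDiagram ι) (f b a : ι) : Prop where
  θ_f : Γ.θ f = f
  θ_a : Γ.θ a = a
  θ_b : Γ.θ b ≠ b
  adj_b : Γ.graph.Adj f b
  adj_a : Γ.graph.Adj f a
  eq_of_adj : ∀ x, Γ.graph.Adj f x → x = b ∨ x = Γ.θ b ∨ x = a

lemma adj_θ_right {w n : ι} (hw : Γ.θ w = w) (h : Γ.graph.Adj w n) : Γ.graph.Adj w (Γ.θ n) := by
  rw [← hw]
  exact adj_θ.mpr h

lemma card_lt_four {i : ι} {N : Finset ι} (hN : ∀ k ∈ N, Γ.graph.Adj k i) : N.card < 4 := by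
  have h1 := neg_four_lt_sum hN
  have h2 : ∑ k ∈ N, Γ.cartan k i ≤ ∑ k ∈ N, (-1 : ℤ) :=
    Finset.sum_le_sum fun k hk => cartan_nonpos_of_adj (hN k hk)
  rw [Finset.sum_const, nsmul_eq_mul, mul_neg_one] at h2
  omega

/-- A node with three neighbours is special, hence fixed. The fixed node at which moved nodes begin
is special too, unless it is `f` itself, so it is `f`. Four neighbours being impossible, the third
one must be fixed. -/
lemma StableAt.exists_isBranch {k m f : ι} (hk : Γ.StableAt k) (hm : Γ.graph.Reachable k m)
    (hmθ : Γ.θ m ≠ m) (hf : Γ.graph.Reachable k f) {N : Finset ι} (hN : ∀ l ∈ N, Γ.graph.Adj l f)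
    (hcard : 2 < N.card) : ∃ b a, Γ.IsBranch f b a ∧ b ∈ N ∧ Γ.θ b ∈ N ∧ a ∈ N := by
  have hN3 : N.card = 3 := by
    have := card_lt_four hN
    omega
  have hs : Γ.Special f := .inr ⟨N, hN3, hN⟩
  have hff := hk.θ_eq_of_special hf hs
  obtain ⟨w, b, hw, hwb, hfw, hb, h⟩ := exists_adj_of_reachable (hf.symm.trans hm) hff hmθ
  have hwf : w = f := by
    rcases h with h | ⟨u, hu, hfu⟩
    · exact h
    · have h1 : u ≠ b := by rintro rfl; exact hb hfu
      have h2 : u ≠ Γ.θ b := by rintro rfl; exact hb (Γ.θ.injective hfu)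
      exact (special_of_three hu.symm hwb.symm (adj_θ_right hfw hwb).symm h1 h2
        (Ne.symm hb)).eq_of_reachable hs hw.symm
  subst hwf
  have hwb' := adj_θ_right hfw hwb
  obtain ⟨a, haN, ha⟩ : ∃ a ∈ N, a ∉ ({b, Γ.θ b} : Finset ι) := by
    by_contra! hcon
    have h1 := Finset.card_le_card (show N ⊆ {b, Γ.θ b} from hcon)
    have h2 := Finset.card_le_two (a := b) (b := Γ.θ b)
    omega
  have hab : a ≠ b := fun h => ha (by simp [h])
  have haθb : a ≠ Γ.θ b := fun h => ha (by simp [h])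
  have hcard4 : ∀ x, Γ.graph.Adj w x → x ≠ b → x ≠ Γ.θ b → x ≠ a → False := by
    intro x hx h1 h2 h3
    have h4 := card_lt_four (Γ := Γ) (i := w) (N := {x, a, b, Γ.θ b}) (by
      intro y hy
      simp only [Finset.mem_insert, Finset.mem_singleton] at hy
      rcases hy with rfl | rfl | rfl | rfl
      · exact hx.symm
      · exact hN _ haN
      · exact hwb.symm
      · exact hwb'.symm)
    rw [Finset.card_insert_of_notMem (by simp [h1, h2, h3]),
      Finset.card_insert_of_notMem (by simp [hab, haθb]), Finset.card_pair (Ne.symm hb)] at h4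
    omega
  have heq : ∀ x, Γ.graph.Adj w x → x = b ∨ x = Γ.θ b ∨ x = a := by
    intro x hx
    by_contra! hcon
    exact hcard4 x hx hcon.1 hcon.2.1 hcon.2.2
  have hθa : Γ.θ a = a := by
    by_contra h0
    refine hcard4 (Γ.θ a) (adj_θ_right hfw (hN a haN).symm) ?_ ?_ h0
    · intro h1
      apply haθb
      rw [← h1, Γ.θ_θ]
    · exact fun h1 => hab (Γ.θ.injective h1)
  have hNeq : N = {b, Γ.θ b, a} := by
    refine Finset.eq_of_subset_of_card_le ?_ ?_
    · intro x hx
      have := heq x (hN x hx).symm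
      simpa using this
    · rw [Finset.card_insert_of_notMem (by simp [Ne.symm hb, Ne.symm hab]),
        Finset.card_pair (Ne.symm haθb), hN3]
  refine ⟨b, a, ⟨hfw, hθa, hb, hwb, (hN a haN).symm, heq⟩, ?_, ?_, ?_⟩ <;> rw [hNeq] <;> simp

namespace IsBranch

variable {f b a : ι}

lemma stableAt (hB : Γ.IsBranch f b a) : Γ.StableAt f := by
  rw [StableAt, hB.θ_f]

lemma simplyLacedAt (hB : Γ.IsBranch f b a) : Γ.SimplyLacedAt f :=
  hB.stableAt.simplyLacedAt hB.adj_b.reachable hB.θ_b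

lemma adj_θb (hB : Γ.IsBranch f b a) : Γ.graph.Adj f (Γ.θ b) := adj_θ_right hB.θ_f hB.adj_b

lemma ne_of_moved (hB : Γ.IsBranch f b a) {x : ι} (hx : Γ.θ x ≠ x) : x ≠ f ∧ x ≠ a :=
  ⟨by rintro rfl; exact hx hB.θ_f, by rintro rfl; exact hx hB.θ_a⟩

lemma θ_moved {x : ι} (hx : Γ.θ x ≠ x) : Γ.θ (Γ.θ x) ≠ Γ.θ x := fun h => hx (Γ.θ.injective h)

lemma special (hB : Γ.IsBranch f b a) : Γ.Special f :=
  special_of_three hB.adj_b.symm hB.adj_θb.symm hB.adj_a.symm (Ne.symm hB.θ_b)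
    (hB.ne_of_moved hB.θ_b).2 (hB.ne_of_moved (θ_moved hB.θ_b)).2

lemma eq_of_special (hB : Γ.IsBranch f b a) {x : ι} (hx : Γ.graph.Reachable f x) (hs : Γ.Special x) :
    x = f :=
  hs.eq_of_reachable hB.special hx.symm

/-- The fixed nodes other than `f` are not joined to both fixed and moved nodes. -/
lemma eq_of_adj_adj (hB : Γ.IsBranch f b a) {w u n : ι} (hw : Γ.graph.Reachable f w) (hfw : Γ.θ w = w)
    (hu : Γ.graph.Adj w u) (hfu : Γ.θ u = u) (hn : Γ.graph.Adj w n) (hfn : Γ.θ n ≠ n) : w = f := by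
  have h1 : u ≠ n := by rintro rfl; exact hfn hfu
  have h2 : u ≠ Γ.θ n := by rintro rfl; exact θ_moved hfn hfu
  exact hB.eq_of_special hw (special_of_three hu.symm hn.symm (adj_θ_right hfw hn).symm h1 h2
    (Ne.symm hfn))

lemma not_adj_θ (hB : Γ.IsBranch f b a) {x : ι} (hx : Γ.graph.Reachable f x) :
    ¬ Γ.graph.Adj x (Γ.θ x) :=
  fun h => θ_ne_of_reachable h hx hB.θ_f

/-- A moved node has at most two neighbours. -/
lemma eq_or_eq_of_adj (hB : Γ.IsBranch f b a) {x k l m : ι} (hx : Γ.graph.Reachable f x)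
    (hxθ : Γ.θ x ≠ x) (hk : Γ.graph.Adj x k) (hl : Γ.graph.Adj x l) (hkl : k ≠ l)
    (hm : Γ.graph.Adj x m) : m = k ∨ m = l := by
  by_contra! hcon
  exact (hB.ne_of_moved hxθ).1 (hB.eq_of_special hx
    (special_of_three hk.symm hl.symm hm.symm hkl (Ne.symm hcon.1) (Ne.symm hcon.2)))

/-! #### The case in which `b` is an end node -/

lemma eq_or_eq_of_moved (hB : Γ.IsBranch f b a) (hb : ∀ x, Γ.graph.Adj b x → x = f) {m : ι}
    (hm : Γ.graph.Reachable f m) (hmθ : Γ.θ m ≠ m) : m = b ∨ m = Γ.θ b := by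
  have key : ∀ x y, Γ.graph.Walk x y → Γ.graph.Reachable f x →
      (x = b ∨ x = Γ.θ b ∨ Γ.θ x = x ∧ (x = f ∨ ∃ u, Γ.graph.Adj x u ∧ Γ.θ u = u)) →
      (y = b ∨ y = Γ.θ b ∨ Γ.θ y = y ∧ (y = f ∨ ∃ u, Γ.graph.Adj y u ∧ Γ.θ u = u)) := by
    intro x y p
    induction p with
    | nil => exact fun _ => id
    | @cons x z y hxz _ ih =>
      intro hx h
      refine ih (hx.trans hxz.reachable) ?_
      rcases h with rfl | rfl | ⟨hfx, h⟩
      · rw [hb z hxz]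
        exact .inr (.inr ⟨hB.θ_f, .inl rfl⟩)
      · have h1 := adj_θ.mpr hxz
        rw [Γ.θ_θ] at h1
        have h2 := hb _ h1
        have h3 : z = f := by
          rw [← Γ.θ_θ z, h2, hB.θ_f]
        rw [h3]
        exact .inr (.inr ⟨hB.θ_f, .inl rfl⟩)
      · by_cases hxf : x = f
        · subst hxf
          rcases hB.eq_of_adj z hxz with h | h | h
          · exact .inl h
          · exact .inr (.inl h)
          · rw [h]
            exact .inr (.inr ⟨hB.θ_a, .inr ⟨x, hB.adj_a.symm, hfx⟩⟩)
        · obtain ⟨u, hu, hfu⟩ := h.resolve_left hxf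
          by_cases hz : Γ.θ z = z
          · exact .inr (.inr ⟨hz, .inr ⟨x, hxz.symm, hfx⟩⟩)
          · exact absurd (hB.eq_of_adj_adj hx hfx hu hfu hxz hz) hxf
  obtain ⟨p⟩ := hm
  rcases key f m p .rfl (.inr (.inr ⟨hB.θ_f, .inl rfl⟩)) with h | h | h
  · exact .inl h
  · exact .inr h
  · exact absurd h.1 hmθ

lemma form_single_sub (hB : Γ.IsBranch f b a) (ε : ℤ) (hε : ε * ε = 1) :
    Γ.form (Pi.single b 1 + ε • Pi.single (Γ.θ b) 1) (Pi.single b 1 + ε • Pi.single (Γ.θ b) 1) = 4 := by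
  have h1 : Γ.cartan b (Γ.θ b) = 0 :=
    cartan_eq_zero_of_not_adj (Ne.symm hB.θ_b) (hB.not_adj_θ hB.adj_b.reachable)
  have h2 := Γ.cartan_eq_zero _ _ h1
  rw [form_add_left, form_add_right, form_add_right, form_smul_left, form_smul_left, form_smul_right,
    form_smul_right]
  simp only [form_single_left, pair_single, h1, h2, Γ.cartan_diag]
  linarith

/-- Only `b` and `θ b` are moved, so `v - θ v` is a nonzero integer multiple `Δ` of `α_b - α_{θ b}`
and has norm `4 Δ²`. The parallelogram law leaves `8 - 4 Δ²` for `v + θ v`; this is positive, so `Δ²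
= 1`. -/
lemma form_average (hB : Γ.IsBranch f b a) (hb : ∀ x, Γ.graph.Adj b x → x = f) {v : ι → ℤ}
    (hv : v ∈ Γ.posRoots) (hvf : Γ.SupportedAt f v) (h0 : v ≠ 0) (hmoved : Γ.act v ≠ v) :
    Γ.form (v + Γ.act v) (v + Γ.act v) = 4 := by
  have hsl := hB.simplyLacedAt
  have hvθ : ∀ i, v (Γ.θ i) ≠ 0 → Γ.graph.Reachable f i := by
    intro i hi
    have := hB.stableAt.reachable_θ (hvf _ hi)
    rwa [Γ.θ_θ] at this
  have hvf' : Γ.SupportedAt f (Γ.act v) := fun i hi => hvθ i (by rwa [act_apply] at hi)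
  set Δ := v b - v (Γ.θ b) with hΔ
  have hdiff : v - Γ.act v = Δ • (Pi.single b 1 + (-1 : ℤ) • Pi.single (Γ.θ b) 1) := by
    funext i
    rw [Pi.sub_apply, act_apply]
    by_cases hib : i = b
    · subst hib
      simp [Ne.symm hB.θ_b, hΔ]
    by_cases hib' : i = Γ.θ b
    · subst hib'
      simp [hB.θ_b, Γ.θ_θ, hΔ]
    have h1 : v i = v (Γ.θ i) := by
      by_cases hi : Γ.θ i = i
      · rw [hi]
      · by_contra h2
        have : Γ.graph.Reachable f i := by
          by_cases h3 : v i = 0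
          · exact hvθ i fun h4 => h2 (by rw [h3, h4])
          · exact hvf i h3
        rcases hB.eq_or_eq_of_moved hb this hi with h | h
        · exact hib h
        · exact hib' h
    simp [hib, hib', h1]
  have hΔ0 : Δ ≠ 0 := by
    intro h
    rw [h, zero_smul] at hdiff
    exact hmoved (sub_eq_zero.mp hdiff).symm
  have h1 : Γ.form (v - Γ.act v) (v - Γ.act v) = 4 * (Δ * Δ) := by
    rw [hdiff, form_smul_left, form_smul_right, hB.form_single_sub (-1) (by norm_num)]
    ring
  have h2 : Γ.form v v = 2 := hv.1.form_self h0 hvf hsl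
  have h3 : Γ.form (Γ.act v) (Γ.act v) = 2 := by rw [form_act, h2]
  have hW : v + Γ.act v ≠ 0 := by
    intro h
    apply h0
    funext i
    have h4 := congrFun h i
    rw [Pi.add_apply, act_apply, Pi.zero_apply] at h4
    have h5 := hv.2 i
    have h6 := hv.2 (Γ.θ i)
    rw [Pi.zero_apply]
    omega
  have h4 : 0 < Γ.form (v + Γ.act v) (v + Γ.act v) := by
    refine form_self_pos hsl (fun i hi => ?_) hW
    by_cases hvi : v i = 0
    · refine hvθ i fun h => hi ?_
      rw [Pi.add_apply, act_apply, hvi, h, add_zero]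
    · exact hvf i hvi
  have h5 : Γ.form (v + Γ.act v) (v + Γ.act v) + Γ.form (v - Γ.act v) (v - Γ.act v) = 8 := by
    rw [form_add_left, form_add_right, form_add_right, form_sub_left, form_sub_right, form_sub_right]
    omega
  have h6 : 0 < Δ * Δ := mul_self_pos.mpr hΔ0
  omega

/-- If `b` is an end node, then no moved root has `f` and its neighbours in its support. -/
theorem false_of_end (hB : Γ.IsBranch f b a) (hb : ∀ x, Γ.graph.Adj b x → x = f) {v : ι → ℤ}
    (hv : v ∈ Γ.posRoots) (hvf : Γ.SupportedAt f v) (hmoved : Γ.act v ≠ v) (hf0 : v f ≠ 0)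
    (hb0 : v b ≠ 0) (hθb0 : v (Γ.θ b) ≠ 0) : False := by
  have hsl := hB.simplyLacedAt
  have h0 : v ≠ 0 := fun h => hf0 (congrFun h f)
  have hpos : ∀ i, v i ≠ 0 → 1 ≤ v i := fun i hi => by have := hv.2 i; omega
  have hfb := (hB.ne_of_moved hB.θ_b).1
  have hfθb := (hB.ne_of_moved (θ_moved hB.θ_b)).1
  have hW4 := hB.form_average hb hv hvf h0 hmoved
  set W := v + Γ.act v with hW
  have hfixed : ∀ i, i ≠ b → i ≠ Γ.θ b → Γ.graph.Reachable f i → Γ.θ i = i := by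
    intro i h1 h2 hr
    by_contra h3
    rcases hB.eq_or_eq_of_moved hb hr h3 with h | h
    · exact h1 h
    · exact h2 h
  -- `N` is the least value that `W = v + θ v` could have coefficientwise if only `W ≥ 1` is kept at
  -- `b` and `θ b`. Its pairings on the support are nonnegative and its norm is a positive multiple
  -- of four, so `W`, of norm four, must equal `N`; but `W` is at least two at `b`.
  let N : ι → ℤ := fun i => if v i = 0 then 0 else if i = b ∨ i = Γ.θ b then 1 else 2
  let χ : ι → ℤ := fun i => if v i = 0 then 0 else 1
  have hN0 : ∀ i, v i = 0 → N i = 0 := fun i hi => if_pos hi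
  have hNf : ∀ i, v i ≠ 0 → i ≠ b → i ≠ Γ.θ b → N i = 2 := fun i hi h1 h2 => by
    simp [N, hi, h1, h2]
  have hNb : N b = 1 ∧ N (Γ.θ b) = 1 := by simp [N, hb0, hθb0]
  have hNle : ∀ i, 0 ≤ N i ∧ N i ≤ 2 := fun i => by dsimp only [N]; split_ifs <;> norm_num
  have hNs : Γ.SupportedAt f N := fun i hi => hvf i fun h => hi (hN0 i h)
  have hχs : Γ.SupportedAt f χ := fun i hi => hvf i fun h => hi (if_pos h)
  have hNχ : N = (2 : ℤ) • χ - (Pi.single b 1 + (1 : ℤ) • Pi.single (Γ.θ b) 1) := by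
    funext i
    by_cases hib : i = b
    · subst hib; simp [N, χ, hb0, Ne.symm hB.θ_b]
    by_cases hib' : i = Γ.θ b
    · subst hib'; simp [N, χ, hθb0, hB.θ_b]
    by_cases hvi : v i = 0 <;> simp [N, χ, hvi, hib, hib']
  have hW0 : ∀ i, v i = 0 → W i = 0 := by
    intro i hi
    rw [hW, Pi.add_apply, act_apply, hi, zero_add]
    by_contra h1
    have hr : Γ.graph.Reachable f i := by
      have := hB.stableAt.reachable_θ (hvf _ h1)
      rwa [Γ.θ_θ] at this
    have h2 : Γ.θ i ≠ i := fun h => h1 (by rw [h, hi])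
    rcases hB.eq_or_eq_of_moved hb hr h2 with rfl | rfl
    · exact hb0 hi
    · exact hθb0 hi
  have hWN : ∀ i, v i ≠ 0 → N i ≤ W i := by
    intro i hi
    rw [hW, Pi.add_apply, act_apply]
    by_cases hib : i = b
    · subst hib; rw [hNb.1]; have := hpos _ hb0; have := hpos _ hθb0; omega
    by_cases hib' : i = Γ.θ b
    · subst hib'; rw [hNb.2, Γ.θ_θ]; have := hpos _ hb0; have := hpos _ hθb0; omega
    rw [hNf i hi hib hib', hfixed i hib hib' (hvf i hi)]
    have := hpos i hi
    omega
  have hpair : ∀ i, v i ≠ 0 → 0 ≤ Γ.pair N i := by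
    intro i hi
    rw [pair_eq_sub hsl hNs]
    set F := Finset.univ.filter fun l => Γ.cartan l i ≠ 0 ∧ l ≠ i with hF
    have hFadj : ∀ l ∈ F, Γ.graph.Adj i l := fun l hl =>
      SimpleGraph.Adj.symm ⟨(Finset.mem_filter.mp hl).2.2, (Finset.mem_filter.mp hl).2.1⟩
    by_cases hif : i = f
    · subst hif
      have h1 : ∑ l ∈ F, N l ≤ ∑ l ∈ {b, Γ.θ b, a}, N l := by
        refine Finset.sum_le_sum_of_subset_of_nonneg (fun l hl => ?_) fun l _ _ => (hNle l).1
        simpa using hB.eq_of_adj l (hFadj l hl)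
      rw [Finset.sum_insert (by simp [Ne.symm hB.θ_b, (hB.ne_of_moved hB.θ_b).2]),
        Finset.sum_pair (hB.ne_of_moved (θ_moved hB.θ_b)).2, hNb.1, hNb.2] at h1
      rw [hNf i hi (Ne.symm hfb) (Ne.symm hfθb)]
      have := (hNle a).2
      omega
    by_cases hib : i = b ∨ i = Γ.θ b
    · have h1 : ∑ l ∈ F, N l ≤ ∑ l ∈ {f}, N l := by
        refine Finset.sum_le_sum_of_subset_of_nonneg (fun l hl => ?_) fun l _ _ => (hNle l).1
        have h2 := hFadj l hl
        rcases hib with rfl | rfl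
        · simpa using hb l h2
        · have h3 := adj_θ.mpr h2
          rw [Γ.θ_θ] at h3
          have h4 := hb _ h3
          rw [Finset.mem_singleton, ← Γ.θ_θ l, h4, hB.θ_f]
      rw [Finset.sum_singleton] at h1
      have h2 : N i = 1 := by
        rcases hib with rfl | rfl
        · exact hNb.1
        · exact hNb.2
      have := (hNle f).2
      omega
    · rw [not_or] at hib
      have hcard : F.card ≤ 2 := by
        by_contra! h1
        obtain ⟨F', hF', hF3⟩ := Finset.exists_subset_card_eq (show 3 ≤ F.card by omega)
        exact hif (hB.eq_of_special (hvf i hi)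
          (.inr ⟨F', hF3, fun k hk => (hFadj k (hF' hk)).symm⟩))
      have h1 : ∑ l ∈ F, N l ≤ F.card • (2 : ℤ) := Finset.sum_le_card_nsmul _ _ _ fun l _ => (hNle l).2
      rw [nsmul_eq_mul] at h1
      rw [hNf i hi hib.1 hib.2]
      have : (F.card : ℤ) ≤ 2 := by exact_mod_cast hcard
      omega
  have hle : Γ.form N N ≤ Γ.form W N := by
    refine Finset.sum_le_sum fun i _ => ?_
    by_cases hi : v i = 0
    · rw [hN0 i hi, hW0 i hi]
    · exact mul_le_mul_of_nonneg_right (hWN i hi) (hpair i hi)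
  have hbs : Γ.SupportedAt f (Pi.single b 1 + (1 : ℤ) • Pi.single (Γ.θ b) 1) := by
    intro i hi
    by_cases hib : i = b
    · rw [hib]; exact hB.adj_b.reachable
    · by_cases hib' : i = Γ.θ b
      · rw [hib']; exact hB.adj_θb.reachable
      · simp [hib, hib'] at hi
  have h4 : 4 ≤ Γ.form N N := by
    have h1 : 0 < Γ.form N N := form_self_pos hsl hNs fun h => by
      have := congrFun h b
      rw [hNb.1] at this
      exact one_ne_zero this
    have h2 : Γ.form N N = 4 * (Γ.form χ χ -
        Γ.form χ (Pi.single b 1 + (1 : ℤ) • Pi.single (Γ.θ b) 1) + 1) := by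
      rw [hNχ, form_sub_left, form_sub_right, form_sub_right, form_smul_left, form_smul_left,
        form_smul_right, form_smul_right, form_comm hsl hbs hχs, hB.form_single_sub 1 (by norm_num)]
      ring
    omega
  have hWs : Γ.SupportedAt f W := fun i hi => hvf i fun h => hi (hW0 i h)
  have h5 : Γ.form (W - N) (W - N) ≤ 0 := by
    rw [form_sub_left, form_sub_right, form_sub_right, form_comm hsl hNs hWs, hW4]
    omega
  have h6 : W = N := by
    by_contra hne
    refine absurd (form_self_pos hsl (v := W - N) (fun i hi => hvf i fun h => hi ?_)
      (sub_ne_zero.mpr hne)) (not_lt.mpr h5)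
    rw [Pi.sub_apply, hW0 i h, hN0 i h, sub_zero]
  have h7 := congrFun h6 b
  rw [hNb.1, hW, Pi.add_apply, act_apply] at h7
  have := hpos _ hb0
  have := hpos _ hθb0
  omega

end IsBranch

end WeightedVoganDiagram

namespace WeightedVoganDiagram

variable {ι : Type*} [Fintype ι] [DecidableEq ι] {Γ : WeightedVoganDiagram ι}

/-! ### Components of type `E₆` -/

/-- The component of `f` is of type `E₆` and `θ` acts nontrivially on it: the arms of the branch node
`f` are `b, c`, their images, and `a`. -/
structure IsE6 (Γ : WeightedVoganDiagram ι) (f b c a : ι) : Prop extends Γ.IsBranch f b a where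
  adj_c : Γ.graph.Adj b c
  θ_c : Γ.θ c ≠ c
  b_eq_of_adj : ∀ x, Γ.graph.Adj b x → x = f ∨ x = c
  c_eq_of_adj : ∀ x, Γ.graph.Adj c x → x = b
  a_eq_of_adj : ∀ x, Γ.graph.Adj a x → x = f

namespace IsBranch

variable {f b c a : ι}

lemma ne_of_adj (hB : Γ.IsBranch f b a) {x : ι} (hx : Γ.θ x ≠ x) (hc : Γ.graph.Adj b c) :
    b ≠ f ∧ b ≠ a ∧ Γ.θ b ≠ f ∧ Γ.θ b ≠ a ∧ x ≠ f ∧ x ≠ a ∧ Γ.θ x ≠ f ∧ Γ.θ x ≠ a ∧ f ≠ a ∧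
      b ≠ c ∧ Γ.θ b ≠ Γ.θ c ∧ c ≠ Γ.θ b ∧ Γ.θ c ≠ b := by
  have h1 := hB.ne_of_moved hB.θ_b
  have h2 := hB.ne_of_moved (θ_moved hB.θ_b)
  have h3 := hB.ne_of_moved hx
  have h4 := hB.ne_of_moved (θ_moved hx)
  have h5 : c ≠ Γ.θ b := by
    rintro rfl
    exact hB.not_adj_θ hB.adj_b.reachable hc
  refine ⟨h1.1, h1.2, h2.1, h2.2, h3.1, h3.2, h4.1, h4.2, hB.adj_a.ne, hc.ne,
    fun h => hc.ne (Γ.θ.injective h), h5, ?_⟩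
  rintro h
  apply h5
  rw [← h, Γ.θ_θ]

lemma not_adj_θb (hB : Γ.IsBranch f b a) (hc : Γ.graph.Adj b c) (hcf : c ≠ f) :
    ¬ Γ.graph.Adj c (Γ.θ b) := by
  intro h
  have hb := hB.adj_b
  have hb' := hB.adj_θb
  have hne := Ne.symm hB.θ_b
  refine not_forall_exists_two_adj (Γ := Γ) (T := {f, b, c, Γ.θ b}) ⟨f, by simp⟩ fun i hi => ?_
  simp only [Finset.mem_insert, Finset.mem_singleton] at hi
  rcases hi with rfl | rfl | rfl | rfl
  · exact ⟨b, by simp, Γ.θ b, by simp, hne, hb.symm, hb'.symm⟩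
  · exact ⟨f, by simp, c, by simp, hcf.symm, hb, hc.symm⟩
  · exact ⟨b, by simp, Γ.θ b, by simp, hne, hc, h.symm⟩
  · exact ⟨f, by simp, c, by simp, hcf.symm, hb', h⟩

lemma θ_ne_of_adj (hB : Γ.IsBranch f b a) (hc : Γ.graph.Adj b c) (hcf : c ≠ f) : Γ.θ c ≠ c := by
  intro h
  refine hB.not_adj_θb hc hcf ?_
  rw [← h]
  exact (adj_θ.mpr hc).symm

/-- A longer arm at `a` would complete the affine diagram `E₆`, whose null vector has the values 3;
2, 2, 2; 1, 1, 1. -/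
lemma eq_of_adj_a (hB : Γ.IsBranch f b a) (hc : Γ.graph.Adj b c) (hcf : c ≠ f) {x : ι}
    (hx : Γ.graph.Adj a x) : x = f := by
  by_contra hxf
  have hcθ := hB.θ_ne_of_adj hc hcf
  have hxθ : Γ.θ x = x := by
    by_contra h
    exact hB.adj_a.ne (hB.eq_of_adj_adj hB.adj_a.reachable hB.θ_a hB.adj_a.symm hB.θ_f hx h).symm
  obtain ⟨h1, h2, h3, h4, h5, h6, h7, h8, h9, h10, h11, h12, h13⟩ := hB.ne_of_adj hcθ hc
  have hxb : ∀ y, Γ.θ y ≠ y → x ≠ y := by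
    rintro y hy rfl
    exact hy hxθ
  have hx1 := hxb b hB.θ_b
  have hx2 := hxb _ (θ_moved hB.θ_b)
  have hx3 := hxb c hcθ
  have hx4 := hxb _ (θ_moved hcθ)
  have hbθ := hB.θ_b
  let v : ι → ℤ := fun i => if i = f then 3 else if i = b ∨ i = Γ.θ b ∨ i = a then 2 else
    if i = c ∨ i = Γ.θ c ∨ i = x then 1 else 0
  have vf : v f = 3 := by simp [v]
  have vb : v b = 2 := by simp [v, h1]
  have vb' : v (Γ.θ b) = 2 := by simp [v, h3]
  have va : v a = 2 := by simp [v, h9.symm]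
  have vc : v c = 1 := by simp [v, h5, h6, h10.symm, h12]
  have vc' : v (Γ.θ c) = 1 := by simp [v, h7, h8, h11.symm, h13]
  have vx : v x = 1 := by simp [v, hxf, hx1, hx2, hx.ne.symm]
  refine not_forall_two_mul_le_sum (Γ := Γ) (v := v)
    (fun i => by dsimp only [v]; split_ifs <;> norm_num) (Function.ne_iff.mpr ⟨f, by simp [vf]⟩)
    fun i hi => ?_
  have hi' : i = f ∨ (i = b ∨ i = Γ.θ b ∨ i = a) ∨ i = c ∨ i = Γ.θ c ∨ i = x := by
    by_contra h
    simp only [not_or] at h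
    simp [v, h] at hi
  rcases hi' with rfl | (rfl | rfl | rfl) | rfl | rfl | rfl
  · refine ⟨{b, Γ.θ b, a}, ?_, ?_⟩
    · simp only [Finset.mem_insert, Finset.mem_singleton]
      rintro k (rfl | rfl | rfl)
      exacts [hB.adj_b.symm, hB.adj_θb.symm, hB.adj_a.symm]
    · rw [Finset.sum_insert (by simp [hbθ.symm, h2]), Finset.sum_pair h4, vf, vb, vb', va]
      norm_num
  · refine ⟨{f, c}, ?_, ?_⟩
    · simp only [Finset.mem_insert, Finset.mem_singleton]
      rintro k (rfl | rfl)
      exacts [hB.adj_b, hc.symm]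
    · rw [Finset.sum_pair h5.symm, vf, vb, vc]; norm_num
  · refine ⟨{f, Γ.θ c}, ?_, ?_⟩
    · simp only [Finset.mem_insert, Finset.mem_singleton]
      rintro k (rfl | rfl)
      exacts [hB.adj_θb, adj_θ.mpr hc.symm]
    · rw [Finset.sum_pair h7.symm, vf, vb', vc']; norm_num
  · refine ⟨{f, x}, ?_, ?_⟩
    · simp only [Finset.mem_insert, Finset.mem_singleton]
      rintro k (rfl | rfl)
      exacts [hB.adj_a, hx.symm]
    · rw [Finset.sum_pair (Ne.symm hxf), vf, va, vx]; norm_num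
  · exact ⟨{b}, by simpa using hc, by rw [Finset.sum_singleton, vb, vc]; norm_num⟩
  · exact ⟨{Γ.θ b}, by simpa using adj_θ.mpr hc, by rw [Finset.sum_singleton, vb', vc']; norm_num⟩
  · exact ⟨{a}, by simpa using hx, by rw [Finset.sum_singleton, va, vx]; norm_num⟩

/-- A further node `x` would be fixed and close a cycle, or together with its image complete the
affine diagram `E₇`, whose null vector has the values 4; 3, 3, 2; 2, 2; 1, 1. -/
lemma eq_of_adj_c (hB : Γ.IsBranch f b a) (hc : Γ.graph.Adj b c) (hcf : c ≠ f) {x : ι}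
    (hx : Γ.graph.Adj c x) : x = b := by
  by_contra hxb
  have hcθ := hB.θ_ne_of_adj hc hcf
  have hxc' : Γ.graph.Adj (Γ.θ c) (Γ.θ x) := adj_θ.mpr hx
  have hc' : Γ.graph.Adj (Γ.θ b) (Γ.θ c) := adj_θ.mpr hc
  have hbθ := hB.θ_b
  have hfc : Γ.graph.Reachable f c := hB.adj_b.reachable.trans hc.reachable
  have hxθ : Γ.θ x ≠ x := by
    intro h
    rw [h] at hxc'
    refine not_forall_exists_two_adj (Γ := Γ) (T := {f, b, c, x, Γ.θ c, Γ.θ b}) ⟨f, by simp⟩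
      fun i hi => ?_
    have hxb' : Γ.θ b ≠ x := by
      intro h0
      apply hxb
      rw [← h, ← h0, Γ.θ_θ]
    have hcf' := (hB.ne_of_moved (θ_moved hcθ)).1
    simp only [Finset.mem_insert, Finset.mem_singleton] at hi
    rcases hi with rfl | rfl | rfl | rfl | rfl | rfl
    · exact ⟨b, by simp, Γ.θ b, by simp, hbθ.symm, hB.adj_b.symm, hB.adj_θb.symm⟩
    · exact ⟨f, by simp, c, by simp, hcf.symm, hB.adj_b, hc.symm⟩
    · exact ⟨b, by simp, x, by simp, Ne.symm hxb, hc, hx.symm⟩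
    · exact ⟨c, by simp, Γ.θ c, by simp, hcθ.symm, hx, hxc'⟩
    · exact ⟨Γ.θ b, by simp, x, by simp, hxb', hc', hxc'.symm⟩
    · exact ⟨f, by simp, Γ.θ c, by simp, hcf'.symm, hB.adj_θb, hc'.symm⟩
  obtain ⟨h1, h2, h3, h4, h5, h6, h7, h8, h9, h10, h11, h12, h13⟩ := hB.ne_of_adj hcθ hc
  obtain ⟨-, -, -, -, k1, k2, k3, k4, -⟩ := hB.ne_of_adj hxθ hc
  have k5 : x ≠ Γ.θ b := by
    rintro rfl
    exact hB.not_adj_θb hc hcf hx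
  have k6 : x ≠ Γ.θ c := by
    rintro rfl
    exact hB.not_adj_θ hfc hx
  have k7 : Γ.θ x ≠ b := by
    rintro h
    apply k5
    rw [← h, Γ.θ_θ]
  have k8 : Γ.θ x ≠ c := by
    rintro h
    apply k6
    rw [← h, Γ.θ_θ]
  have k9 : Γ.θ x ≠ Γ.θ b := fun h => hxb (Γ.θ.injective h)
  let v : ι → ℤ := fun i => if i = f then 4 else if i = b ∨ i = Γ.θ b then 3 else
    if i = c ∨ i = Γ.θ c ∨ i = a then 2 else if i = x ∨ i = Γ.θ x then 1 else 0
  have vf : v f = 4 := by simp [v]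
  have vb : v b = 3 := by simp [v, h1]
  have vb' : v (Γ.θ b) = 3 := by simp [v, h3]
  have va : v a = 2 := by simp [v, h9.symm, h2.symm, h4.symm]
  have vc : v c = 2 := by simp [v, h5, h10.symm, h12]
  have vc' : v (Γ.θ c) = 2 := by simp [v, h7, h11.symm, h13]
  have vx : v x = 1 := by simp [v, k1, hxb, k5, hx.ne.symm, k6, k2]
  have vx' : v (Γ.θ x) = 1 := by simp [v, k3, k7, k9, k8, hxc'.ne.symm, k4]
  refine not_forall_two_mul_le_sum (Γ := Γ) (v := v)
    (fun i => by dsimp only [v]; split_ifs <;> norm_num) (Function.ne_iff.mpr ⟨f, by simp [vf]⟩)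
    fun i hi => ?_
  have hi' : i = f ∨ (i = b ∨ i = Γ.θ b) ∨ (i = c ∨ i = Γ.θ c ∨ i = a) ∨ i = x ∨ i = Γ.θ x := by
    by_contra h
    simp only [not_or] at h
    simp [v, h] at hi
  rcases hi' with rfl | (rfl | rfl) | (rfl | rfl | rfl) | rfl | rfl
  · refine ⟨{b, Γ.θ b, a}, ?_, ?_⟩
    · simp only [Finset.mem_insert, Finset.mem_singleton]
      rintro k (rfl | rfl | rfl)
      exacts [hB.adj_b.symm, hB.adj_θb.symm, hB.adj_a.symm]
    · rw [Finset.sum_insert (by simp [hbθ.symm, h2]), Finset.sum_pair h4, vf, vb, vb', va]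
      norm_num
  · refine ⟨{f, c}, ?_, ?_⟩
    · simp only [Finset.mem_insert, Finset.mem_singleton]
      rintro k (rfl | rfl)
      exacts [hB.adj_b, hc.symm]
    · rw [Finset.sum_pair h5.symm, vf, vb, vc]; norm_num
  · refine ⟨{f, Γ.θ c}, ?_, ?_⟩
    · simp only [Finset.mem_insert, Finset.mem_singleton]
      rintro k (rfl | rfl)
      exacts [hB.adj_θb, hc'.symm]
    · rw [Finset.sum_pair h7.symm, vf, vb', vc']; norm_num
  · refine ⟨{b, x}, ?_, ?_⟩
    · simp only [Finset.mem_insert, Finset.mem_singleton]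
      rintro k (rfl | rfl)
      exacts [hc, hx.symm]
    · rw [Finset.sum_pair (Ne.symm hxb), vb, vc, vx]; norm_num
  · refine ⟨{Γ.θ b, Γ.θ x}, ?_, ?_⟩
    · simp only [Finset.mem_insert, Finset.mem_singleton]
      rintro k (rfl | rfl)
      exacts [hc', hxc'.symm]
    · rw [Finset.sum_pair k9.symm, vb', vc', vx']; norm_num
  · exact ⟨{f}, by simpa using hB.adj_a, by rw [Finset.sum_singleton, vf, va]; norm_num⟩
  · exact ⟨{c}, by simpa using hx, by rw [Finset.sum_singleton, vc, vx]; norm_num⟩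
  · exact ⟨{Γ.θ c}, by simpa using hxc', by rw [Finset.sum_singleton, vc', vx']; norm_num⟩

/-- If `b` has a neighbour other than `f`, then the component is of type `E₆`. -/
lemma isE6 (hB : Γ.IsBranch f b a) (hc : Γ.graph.Adj b c) (hcf : c ≠ f) : Γ.IsE6 f b c a where
  toIsBranch := hB
  adj_c := hc
  θ_c := hB.θ_ne_of_adj hc hcf
  b_eq_of_adj _ := hB.eq_or_eq_of_adj hB.adj_b.reachable hB.θ_b hB.adj_b.symm hc (Ne.symm hcf)
  c_eq_of_adj _ := hB.eq_of_adj_c hc hcf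
  a_eq_of_adj _ := hB.eq_of_adj_a hc hcf

end IsBranch

namespace IsE6

variable {f b c a : ι}

lemma ne (hE : Γ.IsE6 f b c a) :
    b ≠ f ∧ b ≠ a ∧ Γ.θ b ≠ f ∧ Γ.θ b ≠ a ∧ c ≠ f ∧ c ≠ a ∧ Γ.θ c ≠ f ∧ Γ.θ c ≠ a ∧ f ≠ a ∧
      b ≠ c ∧ Γ.θ b ≠ Γ.θ c ∧ c ≠ Γ.θ b ∧ Γ.θ c ≠ b ∧ Γ.θ b ≠ b ∧ Γ.θ c ≠ c := by
  obtain ⟨h1, h2, h3, h4, h5, h6, h7, h8, h9, h10, h11, h12, h13⟩ := hE.ne_of_adj hE.θ_c hE.adj_c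
  exact ⟨h1, h2, h3, h4, h5, h6, h7, h8, h9, h10, h11, h12, h13, hE.θ_b, hE.θ_c⟩

/-- The nodes of the component. -/
def nodes (Γ : WeightedVoganDiagram ι) (f b c a : ι) : Finset ι := {f, b, Γ.θ b, c, Γ.θ c, a}

lemma symm (hE : Γ.IsE6 f b c a) : Γ.IsE6 f (Γ.θ b) (Γ.θ c) a := by
  refine IsBranch.isE6 ⟨hE.θ_f, hE.θ_a, IsBranch.θ_moved hE.θ_b, hE.adj_θb, hE.adj_a, fun x hx => ?_⟩
    (adj_θ.mpr hE.adj_c) hE.ne.2.2.2.2.2.2.1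
  rw [Γ.θ_θ]
  rcases hE.eq_of_adj x hx with h | h | h <;> simp [h]

lemma θb_eq_of_adj (hE : Γ.IsE6 f b c a) {x : ι} (hx : Γ.graph.Adj (Γ.θ b) x) : x = f ∨ x = Γ.θ c :=
  hE.symm.b_eq_of_adj x hx

lemma θc_eq_of_adj (hE : Γ.IsE6 f b c a) {x : ι} (hx : Γ.graph.Adj (Γ.θ c) x) : x = Γ.θ b :=
  hE.symm.c_eq_of_adj x hx

lemma mem_nodes_of_adj (hE : Γ.IsE6 f b c a) :
    ∀ i ∈ nodes Γ f b c a, ∀ j, Γ.graph.Adj i j → j ∈ nodes Γ f b c a := by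
  intro i hi j hij
  simp only [nodes, Finset.mem_insert, Finset.mem_singleton] at hi ⊢
  rcases hi with rfl | rfl | rfl | rfl | rfl | rfl
  · rcases hE.eq_of_adj j hij with h | h | h <;> simp [h]
  · rcases hE.b_eq_of_adj j hij with h | h <;> simp [h]
  · rcases hE.θb_eq_of_adj hij with h | h <;> simp [h]
  · simp [hE.c_eq_of_adj j hij]
  · simp [hE.θc_eq_of_adj hij]
  · simp [hE.a_eq_of_adj j hij]

lemma reachable (hE : Γ.IsE6 f b c a) {i : ι} (hi : i ∈ nodes Γ f b c a) : Γ.graph.Reachable f i := by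
  have h1 : Γ.graph.Reachable f c := hE.adj_b.reachable.trans hE.adj_c.reachable
  simp only [nodes, Finset.mem_insert, Finset.mem_singleton] at hi
  rcases hi with rfl | rfl | rfl | rfl | rfl | rfl
  exacts [.rfl, hE.adj_b.reachable, hE.adj_θb.reachable, h1, hE.stableAt.reachable_θ h1,
    hE.adj_a.reachable]

lemma sum_eq (hE : Γ.IsE6 f b c a) {M : Type*} [AddCommMonoid M] {g : ι → M}
    (hg : ∀ i, i ∉ nodes Γ f b c a → g i = 0) :
    ∑ i, g i = g f + (g b + (g (Γ.θ b) + (g c + (g (Γ.θ c) + g a)))) := by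
  obtain ⟨h1, h2, h3, h4, h5, h6, h7, h8, h9, h10, h11, h12, h13, h14, h15⟩ := hE.ne
  rw [← Finset.sum_subset (Finset.subset_univ (nodes Γ f b c a)) fun i _ hi => hg i hi, nodes,
    Finset.sum_insert (by simp [h1.symm, h3.symm, h5.symm, h7.symm, h9]),
    Finset.sum_insert (by simp [h14.symm, h10, h13.symm, h2]),
    Finset.sum_insert (by simp [h12.symm, h11, h4]),
    Finset.sum_insert (by simp [h15.symm, h6]), Finset.sum_pair h8]

lemma pair_eq {k i : ι} (hs : Γ.SimplyLacedAt k) (hi : Γ.graph.Reachable k i) {N : Finset ι}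
    (hN : ∀ x, x ∈ N ↔ Γ.graph.Adj i x) (v : ι → ℤ) : Γ.pair v i = 2 * v i - ∑ l ∈ N, v l := by
  have hiN : i ∉ N := fun h => ((hN i).mp h).ne rfl
  rw [pair, ← Finset.sum_subset (Finset.subset_univ (insert i N)) fun x _ hx => ?_,
    Finset.sum_insert hiN, Γ.cartan_diag, sub_eq_add_neg, ← Finset.sum_neg_distrib, mul_comm]
  · congr 1
    refine Finset.sum_congr rfl fun x hx => ?_
    have hx' := (hN x).mp hx
    rw [hs x i (hi.trans hx'.reachable) hx'.symm, mul_neg_one]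
  · rw [Finset.mem_insert, not_or] at hx
    rw [cartan_eq_zero_of_not_adj hx.1 fun h => hx.2 ((hN x).mpr h.symm), mul_zero]

lemma pair_nodes (hE : Γ.IsE6 f b c a) (v : ι → ℤ) :
    Γ.pair v f = 2 * v f - (v b + (v (Γ.θ b) + v a)) ∧ Γ.pair v b = 2 * v b - (v f + v c) ∧
      Γ.pair v (Γ.θ b) = 2 * v (Γ.θ b) - (v f + v (Γ.θ c)) ∧ Γ.pair v c = 2 * v c - v b ∧
      Γ.pair v (Γ.θ c) = 2 * v (Γ.θ c) - v (Γ.θ b) ∧ Γ.pair v a = 2 * v a - v f := by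
  obtain ⟨h1, h2, h3, h4, h5, h6, h7, h8, h9, h10, h11, h12, h13, h14, h15⟩ := hE.ne
  have hs := hE.simplyLacedAt
  have hr : ∀ i ∈ nodes Γ f b c a, Γ.graph.Reachable f i := fun i => hE.reachable
  refine ⟨?_, ?_, ?_, ?_, ?_, ?_⟩
  · rw [pair_eq (N := {b, Γ.θ b, a}) hs .rfl ?_ v, Finset.sum_insert (by simp [h14.symm, h2]),
      Finset.sum_pair h4]
    intro x
    simp only [Finset.mem_insert, Finset.mem_singleton]
    refine ⟨?_, hE.eq_of_adj x⟩
    rintro (rfl | rfl | rfl)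
    exacts [hE.adj_b, hE.adj_θb, hE.adj_a]
  · rw [pair_eq (N := {f, c}) hs (hr _ (by simp [nodes])) ?_ v, Finset.sum_pair h5.symm]
    intro x
    simp only [Finset.mem_insert, Finset.mem_singleton]
    refine ⟨?_, hE.b_eq_of_adj x⟩
    rintro (rfl | rfl)
    exacts [hE.adj_b.symm, hE.adj_c]
  · rw [pair_eq (N := {f, Γ.θ c}) hs (hr _ (by simp [nodes])) ?_ v, Finset.sum_pair h7.symm]
    intro x
    simp only [Finset.mem_insert, Finset.mem_singleton]
    refine ⟨?_, hE.θb_eq_of_adj⟩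
    rintro (rfl | rfl)
    exacts [hE.adj_θb.symm, adj_θ.mpr hE.adj_c]
  · rw [pair_eq (N := {b}) hs (hr _ (by simp [nodes])) ?_ v, Finset.sum_singleton]
    intro x
    rw [Finset.mem_singleton]
    exact ⟨by rintro rfl; exact hE.adj_c.symm, hE.c_eq_of_adj x⟩
  · rw [pair_eq (N := {Γ.θ b}) hs (hr _ (by simp [nodes])) ?_ v, Finset.sum_singleton]
    intro x
    rw [Finset.mem_singleton]
    exact ⟨by rintro rfl; exact adj_θ.mpr hE.adj_c.symm, hE.θc_eq_of_adj⟩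
  · rw [pair_eq (N := {f}) hs (hr _ (by simp [nodes])) ?_ v, Finset.sum_singleton]
    intro x
    rw [Finset.mem_singleton]
    exact ⟨by rintro rfl; exact hE.adj_a.symm, hE.a_eq_of_adj x⟩

/-- The norm of a root. -/
lemma norm_eq (hE : Γ.IsE6 f b c a) {v : ι → ℤ} (hv : Γ.IsRoot v) (h0 : v ≠ 0)
    (hvs : ∀ i, i ∉ nodes Γ f b c a → v i = 0) :
    v f ^ 2 + 3 * (2 * v c - v b) ^ 2 + (3 * v b - 2 * v f) ^ 2 +
      3 * (2 * v (Γ.θ c) - v (Γ.θ b)) ^ 2 + (3 * v (Γ.θ b) - 2 * v f) ^ 2 +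
      3 * (2 * v a - v f) ^ 2 = 12 := by
  have h1 := hv.form_self h0 (k := f) (fun i hi => hE.reachable (by
    by_contra h
    exact hi (hvs i h))) hE.simplyLacedAt
  rw [form, hE.sum_eq fun i hi => by rw [hvs i hi, zero_mul]] at h1
  obtain ⟨h2, h3, h4, h5, h6, h7⟩ := hE.pair_nodes v
  rw [h2, h3, h4, h5, h6, h7] at h1
  -- The left-hand side is six times the form, with the squares completed outwards along each arm;
  -- roots have norm two, whence the twelve.
  linear_combination 6 * h1

lemma weight_eq (hE : Γ.IsE6 f b c a) {v : ι → ℤ} (hvs : ∀ i, i ∉ nodes Γ f b c a → v i = 0) :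
    Γ.weight v = v f * Γ.ω f + (v b + v (Γ.θ b)) * Γ.ω b + (v c + v (Γ.θ c)) * Γ.ω c + v a * Γ.ω a := by
  rw [weight, hE.sum_eq fun i hi => by rw [hvs i hi, zero_mul], Γ.ω_θ, Γ.ω_θ]
  ring

lemma paintedLength_eq (hE : Γ.IsE6 f b c a) {v : ι → ℤ} (hvs : ∀ i, i ∉ nodes Γ f b c a → v i = 0) :
    Γ.paintedLength v = (if f ∈ Γ.J then v f else 0) + if a ∈ Γ.J then v a else 0 := by
  have hJ : ∀ i, Γ.θ i ≠ i → i ∉ Γ.J := fun i hi h => hi (Γ.θ_of_mem_J i h)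
  have h1 : Γ.paintedLength v = ∑ i, if i ∈ Γ.J then v i else 0 := by
    rw [paintedLength, ← Finset.sum_filter, Finset.filter_mem_eq_inter, Finset.univ_inter]
  rw [h1, hE.sum_eq fun i hi => by rw [hvs i hi, ite_self], if_neg (hJ b hE.θ_b),
    if_neg (hJ _ (IsBranch.θ_moved hE.θ_b)), if_neg (hJ c hE.θ_c), if_neg (hJ _ (IsBranch.θ_moved hE.θ_c))]
  ring

lemma act_eq_of_eq (hE : Γ.IsE6 f b c a) {v : ι → ℤ} (hvs : ∀ i, i ∉ nodes Γ f b c a → v i = 0)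
    (hb : v b = v (Γ.θ b)) (hc : v c = v (Γ.θ c)) : Γ.act v = v := by
  funext i
  rw [act_apply]
  by_cases hi : i ∈ nodes Γ f b c a
  · simp only [nodes, Finset.mem_insert, Finset.mem_singleton] at hi
    rcases hi with rfl | rfl | rfl | rfl | rfl | rfl
    · rw [hE.θ_f]
    · exact hb.symm
    · rw [Γ.θ_θ, hb]
    · exact hc.symm
    · rw [Γ.θ_θ, hc]
    · rw [hE.θ_a]
  · rw [hvs i hi, hvs]
    intro h
    apply hi
    simp only [nodes, Finset.mem_insert, Finset.mem_singleton] at h ⊢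
    rcases h with h | h | h | h | h | h <;> have h := congrArg Γ.θ h <;>
      simp [Γ.θ_θ, hE.θ_f, hE.θ_a] at h <;> simp [h]

end IsE6

end WeightedVoganDiagram

/-! ### Coefficients of roots in type `E₆`. -/

namespace WeightedVoganDiagram

variable {ι : Type*} [Fintype ι] [DecidableEq ι] {Γ : WeightedVoganDiagram ι}

namespace IsE6

/-- The contribution of the branch node and one arm to the norm bounds all three coefficients,
leaving finitely many triples. -/
lemma arm_cases {p q r : ℤ} (hp : 0 ≤ p) (hq : 0 ≤ q) (hr : 0 ≤ r)
    (h : r ^ 2 + 3 * (2 * p - q) ^ 2 + (3 * q - 2 * r) ^ 2 ≤ 12) :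
    r = 0 ∧ q ≤ 1 ∧ p ≤ 1 ∧ (q = 0 ∧ p = 0 ∨ r ^ 2 + 3 * (2 * p - q) ^ 2 + (3 * q - 2 * r) ^ 2 = 12) ∨
      r = 1 ∧ q ≤ 1 ∧ p ≤ 1 ∧ p ≤ q ∨
      r = 2 ∧ (q = 1 ∧ p ≤ 1 ∨ q = 2 ∧ p = 1) ∨ r = 3 ∧ q = 2 ∧ p = 1 := by
  have hr3 : r ≤ 3 := by nlinarith [sq_nonneg (2 * p - q), sq_nonneg (3 * q - 2 * r)]
  have hq3 : q ≤ 3 := by nlinarith [sq_nonneg (2 * p - q), sq_nonneg r]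
  have hp2 : p ≤ 2 := by nlinarith [sq_nonneg (3 * q - 2 * r), sq_nonneg r]
  interval_cases r <;> interval_cases q <;> interval_cases p <;> simp at h ⊢

/-- The coefficients of a root which is not fixed by `θ`. -/
lemma coeff_cases {p q r q' p' s : ℤ} (hp : 0 ≤ p) (hq : 0 ≤ q) (hr : 0 ≤ r) (hq' : 0 ≤ q')
    (hp' : 0 ≤ p') (hne : ¬ (q = q' ∧ p = p'))
    (h : r ^ 2 + 3 * (2 * p - q) ^ 2 + (3 * q - 2 * r) ^ 2 + 3 * (2 * p' - q') ^ 2 +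
      (3 * q' - 2 * r) ^ 2 + 3 * (2 * s - r) ^ 2 = 12) :
    (p + p' ≤ 1 ∧ p ≤ 1 ∧ q ≤ 1 ∧ r ≤ 1 ∧ q' ≤ 1 ∧ p' ≤ 1 ∧ (r = 1 → s ≤ 1)) ∨
      r = 2 ∧ s = 1 ∧ (p + p' = 1 ∧ (q + q' = 2 ∨ q + q' = 3) ∨ p + p' = 2 ∧ q + q' = 3) := by
  have hs : r = 1 → s ≤ 1 := by
    rintro rfl
    nlinarith [sq_nonneg (2 * p - q), sq_nonneg (3 * q - 2 * 1), sq_nonneg (2 * p' - q'),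
      sq_nonneg (3 * q' - 2 * 1)]
  have h1 := arm_cases (p := p) (q := q) hp hq hr (by
    linarith [sq_nonneg (2 * p' - q'), sq_nonneg (3 * q' - 2 * r), sq_nonneg (2 * s - r)])
  have h2 := arm_cases (p := p') (q := q') hp' hq' hr (by
    linarith [sq_nonneg (2 * p - q), sq_nonneg (3 * q - 2 * r), sq_nonneg (2 * s - r)])
  have hs0 := sq_nonneg (2 * s - r)
  rcases h1 with ⟨hr0, h1, h1', h3⟩ | ⟨hr1, h1, h1', h3⟩ | ⟨hr2, h3⟩ | ⟨hr3, h3⟩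
  · left
    rcases h2 with ⟨-, h2, h2', h4⟩ | h2 | h2 | h2
    · rcases h3 with h3 | h3
      · omega
      · rcases h4 with h4 | h4
        · omega
        · subst hr0
          nlinarith
    all_goals omega
  · left
    omega
  · right
    have h4 : q' = 1 ∧ p' ≤ 1 ∨ q' = 2 ∧ p' = 1 := by omega
    have key : ∀ p q : ℤ, 0 ≤ p → (q = 1 ∧ p ≤ 1 ∨ q = 2 ∧ p = 1) →
        3 * (2 * p - q) ^ 2 + (3 * q - 2 * r) ^ 2 = 4 := by
      subst hr2
      rintro p q hp (⟨rfl, hp'⟩ | ⟨rfl, rfl⟩)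
      · interval_cases p <;> norm_num
      · norm_num
    have h5 := key p q hp h3
    have h6 := key p' q' hp' h4
    subst hr2
    have h7 : (s - 1) ^ 2 = 0 := by linarith
    have h8 : s - 1 = 0 := pow_eq_zero_iff (two_ne_zero) |>.mp h7
    omega
  · omega

variable {f b c a : ι}

/-- A root that is not fixed by `θ`. -/
lemma eq_of_moved (hE : Γ.IsE6 f b c a) {v : ι → ℤ} (hv : v ∈ Γ.posRoots) (h0 : v ≠ 0)
    (hvs : ∀ i, i ∉ nodes Γ f b c a → v i = 0) (hmoved : Γ.act v ≠ v) :
    (v c + v (Γ.θ c) ≤ 1 ∧ v c ≤ 1 ∧ v b ≤ 1 ∧ v f ≤ 1 ∧ v (Γ.θ b) ≤ 1 ∧ v (Γ.θ c) ≤ 1 ∧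
        (v f = 1 → v a ≤ 1)) ∨
      v f = 2 ∧ v a = 1 ∧ (v c + v (Γ.θ c) = 1 ∧ (v b + v (Γ.θ b) = 2 ∨ v b + v (Γ.θ b) = 3) ∨
        v c + v (Γ.θ c) = 2 ∧ v b + v (Γ.θ b) = 3) :=
  coeff_cases (hv.2 _) (hv.2 _) (hv.2 _) (hv.2 _) (hv.2 _)
    (fun h => hmoved (hE.act_eq_of_eq hvs h.1 h.2)) (hE.norm_eq hv.1 h0 hvs)

lemma _root_.WeightedVoganDiagram.IsRoot.add_single {v : ι → ℤ} (hv : Γ.IsRoot v) {j : ι}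
    (h : Γ.pair v j = -1) : Γ.IsRoot (v + Pi.single j 1) := by
  have h1 := IsRoot.reflection j v hv
  change Γ.IsRoot (v - Γ.pair v j • Pi.single j 1) at h1
  rwa [h, neg_smul, one_smul, sub_neg_eq_add] at h1

/-- The vector with the given coefficients at the nodes of the component. -/
def vec (Γ : WeightedVoganDiagram ι) (f b c a : ι) (r q q' p p' s : ℤ) : ι → ℤ :=
  fun i => if i = f then r else if i = b then q else if i = Γ.θ b then q' else
    if i = c then p else if i = Γ.θ c then p' else if i = a then s else 0

lemma vec_apply (hE : Γ.IsE6 f b c a) (r q q' p p' s : ℤ) :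
    vec Γ f b c a r q q' p p' s f = r ∧ vec Γ f b c a r q q' p p' s b = q ∧
      vec Γ f b c a r q q' p p' s (Γ.θ b) = q' ∧ vec Γ f b c a r q q' p p' s c = p ∧
      vec Γ f b c a r q q' p p' s (Γ.θ c) = p' ∧ vec Γ f b c a r q q' p p' s a = s := by
  obtain ⟨h1, h2, h3, h4, h5, h6, h7, h8, h9, h10, h11, h12, h13, h14, h15⟩ := hE.ne
  refine ⟨?_, ?_, ?_, ?_, ?_, ?_⟩
  · simp [vec]
  · simp [vec, h1]
  · simp [vec, h3, h14]
  · simp [vec, h5, h10.symm, h12]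
  · simp [vec, h7, h13, h11.symm, h15]
  · simp [vec, h9.symm, h2.symm, h4.symm, h6.symm, h8.symm]

lemma vec_eq_zero (r q q' p p' s : ℤ) {i : ι} (hi : i ∉ nodes Γ f b c a) :
    vec Γ f b c a r q q' p p' s i = 0 := by
  simp only [nodes, Finset.mem_insert, Finset.mem_singleton, not_or] at hi
  simp [vec, hi]

/-- Each root arises from the previous one by adding a simple root with which it has pairing `-1`.
-/
lemma isRoot_vec (hE : Γ.IsE6 f b c a) :
    Γ.IsRoot (vec Γ f b c a 1 1 1 1 0 1) ∧ Γ.IsRoot (vec Γ f b c a 1 1 1 1 1 1) ∧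
      Γ.IsRoot (vec Γ f b c a 2 1 1 1 1 1) := by
  obtain ⟨h1, h2, h3, h4, h5, h6, h7, h8, h9, h10, h11, h12, h13, h14, h15⟩ := hE.ne
  have key : ∀ {v w : ι → ℤ} {j : ι}, Γ.IsRoot v → Γ.pair v j = -1 → v + Pi.single j 1 = w → Γ.IsRoot w :=
    fun hv hp hw => hw ▸ hv.add_single hp
  have hadd : ∀ r q q' p p' s r1 q1 q1' p1 p1' s1 : ℤ,
      vec Γ f b c a r q q' p p' s + vec Γ f b c a r1 q1 q1' p1 p1' s1 =
        vec Γ f b c a (r + r1) (q + q1) (q' + q1') (p + p1) (p' + p1') (s + s1) := by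
    intros
    funext i
    simp only [vec, Pi.add_apply]
    split_ifs <;> simp
  have sf : (Pi.single f 1 : ι → ℤ) = vec Γ f b c a 1 0 0 0 0 0 := by
    funext i; simp [vec, Pi.single_apply]
  have sb : (Pi.single b 1 : ι → ℤ) = vec Γ f b c a 0 1 0 0 0 0 := by
    funext i
    by_cases hi : i = b
    · subst hi; simp [vec, h1]
    · simp [vec, hi]
  have sθb : (Pi.single (Γ.θ b) 1 : ι → ℤ) = vec Γ f b c a 0 0 1 0 0 0 := by
    funext i
    by_cases hi : i = Γ.θ b
    · subst hi; simp [vec, h3, h14]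
    · simp [vec, hi]
  have sc : (Pi.single c 1 : ι → ℤ) = vec Γ f b c a 0 0 0 1 0 0 := by
    funext i
    by_cases hi : i = c
    · subst hi; simp [vec, h5, h10.symm, h12]
    · simp [vec, hi]
  have sθc : (Pi.single (Γ.θ c) 1 : ι → ℤ) = vec Γ f b c a 0 0 0 0 1 0 := by
    funext i
    by_cases hi : i = Γ.θ c
    · subst hi; simp [vec, h7, h13, h11.symm, h15]
    · simp [vec, hi]
  have sa : (Pi.single a 1 : ι → ℤ) = vec Γ f b c a 0 0 0 0 0 1 := by
    funext i
    by_cases hi : i = a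
    · subst hi; simp [vec, h9.symm, h2.symm, h4.symm, h6.symm, h8.symm]
    · simp [vec, hi]
  have hp := fun r q q' p p' s : ℤ => hE.pair_nodes (vec Γ f b c a r q q' p p' s)
  have hv := hE.vec_apply
  simp only [(hv _ _ _ _ _ _).1, (hv _ _ _ _ _ _).2.1, (hv _ _ _ _ _ _).2.2.1,
    (hv _ _ _ _ _ _).2.2.2.1, (hv _ _ _ _ _ _).2.2.2.2.1, (hv _ _ _ _ _ _).2.2.2.2.2] at hp
  have r0 : Γ.IsRoot (vec Γ f b c a 1 0 0 0 0 0) := sf ▸ .simple f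
  have r1 : Γ.IsRoot (vec Γ f b c a 1 1 0 0 0 0) :=
    key r0 (by rw [(hp _ _ _ _ _ _).2.1]; norm_num) (by rw [sb, hadd]; norm_num)
  have r2 : Γ.IsRoot (vec Γ f b c a 1 1 1 0 0 0) :=
    key r1 (by rw [(hp _ _ _ _ _ _).2.2.1]; norm_num) (by rw [sθb, hadd]; norm_num)
  have r3 : Γ.IsRoot (vec Γ f b c a 1 1 1 1 0 0) :=
    key r2 (by rw [(hp _ _ _ _ _ _).2.2.2.1]; norm_num) (by rw [sc, hadd]; norm_num)
  have r4 : Γ.IsRoot (vec Γ f b c a 1 1 1 1 0 1) :=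
    key r3 (by rw [(hp _ _ _ _ _ _).2.2.2.2.2]; norm_num) (by rw [sa, hadd]; norm_num)
  have r5 : Γ.IsRoot (vec Γ f b c a 1 1 1 1 1 1) :=
    key r4 (by rw [(hp _ _ _ _ _ _).2.2.2.2.1]; norm_num) (by rw [sθc, hadd]; norm_num)
  exact ⟨r4, r5, key r5 (by rw [(hp _ _ _ _ _ _).1]; norm_num) (by rw [sf, hadd]; norm_num)⟩

lemma vec_nonneg {r q q' p p' s : ℤ} (hr : 0 ≤ r) (hq : 0 ≤ q) (hq' : 0 ≤ q') (hp : 0 ≤ p)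
    (hp' : 0 ≤ p') (hs : 0 ≤ s) (i : ι) : 0 ≤ vec Γ f b c a r q q' p p' s i := by
  dsimp only [vec]
  split_ifs <;> first | assumption | exact le_rfl

/-- The component without one of the end nodes moved by `θ`. -/
lemma nodeCondition_of_ne (hE : Γ.IsE6 f b c a) (hΓ : Γ.IsRealized)
    (hw : Γ.ω f + 2 * Γ.ω b + Γ.ω c + Γ.ω a = 2) {j : ι} (hj : j ∈ nodes Γ f b c a)
    (hjc : j ≠ Γ.θ c) : Γ.NodeCondition j := by
  obtain ⟨vf, vb, vb', vc, vc', va⟩ := hE.vec_apply 1 1 1 1 0 1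
  set v := vec Γ f b c a 1 1 1 1 0 1 with hv
  have hvs : ∀ i, i ∉ nodes Γ f b c a → v i = 0 := fun i => vec_eq_zero _ _ _ _ _ _
  have hpos : v ∈ Γ.posRoots := ⟨hE.isRoot_vec.1, vec_nonneg (by norm_num) (by norm_num) (by norm_num)
    (by norm_num) (by norm_num) (by norm_num)⟩
  have h0 : v ≠ 0 := fun h => by
    have := congrFun h f
    rw [vf] at this
    exact one_ne_zero this
  have hsum : 0 ≤ ∑ i, v i := Finset.sum_nonneg fun i _ => hpos.2 i
  refine nodeCondition_of_eq_one (v := v) (funext fun i => ?_)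
    (hΓ.isConnectedSub_support (∑ i, v i).toNat v hpos h0 (Int.toNat_of_nonneg hsum).symm) ?_ ?_ ?_
  · have h1 : v i = 0 ∨ v i = 1 := by
      rw [hv, vec]
      split_ifs <;> simp
    rcases h1 with h1 | h1 <;> simp [h1]
  · rw [hE.weight_eq hvs, vf, vb, vb', vc, vc', va]
    norm_cast
    omega
  · intro h
    have := congrFun h c
    rw [act_apply, vc, vc'] at this
    exact zero_ne_one this
  · simp only [nodes, Finset.mem_insert, Finset.mem_singleton] at hj
    rcases hj with rfl | rfl | rfl | rfl | rfl | rfl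
    · rw [vf]; exact one_ne_zero
    · rw [vb]; exact one_ne_zero
    · rw [vb']; exact one_ne_zero
    · rw [vc]; exact one_ne_zero
    · exact absurd rfl hjc
    · rw [va]; exact one_ne_zero

lemma nodes_symm (Γ : WeightedVoganDiagram ι) (f b c a : ι) :
    nodes Γ f (Γ.θ b) (Γ.θ c) a = nodes Γ f b c a := by
  ext i
  simp only [nodes, Finset.mem_insert, Finset.mem_singleton, Γ.θ_θ]
  tauto

lemma nodeCondition_of_sum (hE : Γ.IsE6 f b c a) (hΓ : Γ.IsRealized)
    (hw : Γ.ω f + 2 * Γ.ω b + Γ.ω c + Γ.ω a = 2) {j : ι} (hj : j ∈ nodes Γ f b c a) :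
    Γ.NodeCondition j := by
  by_cases hjc : j = Γ.θ c
  · refine hE.symm.nodeCondition_of_ne hΓ (by rw [Γ.ω_θ, Γ.ω_θ]; exact hw) (by rwa [nodes_symm]) ?_
    rw [Γ.θ_θ, hjc]
    exact hE.θ_c
  · exact hE.nodeCondition_of_ne hΓ hw hj hjc

/-- A fixed root of weight two and odd painted length involving the whole component. -/
lemma nodeCondition_of_odd (hE : Γ.IsE6 f b c a) (hΓ : Γ.IsRealized) {r : ℤ} (hr : 0 < r)
    (hroot : Γ.IsRoot (vec Γ f b c a r 1 1 1 1 1)) (hw : r * Γ.ω f + 2 * Γ.ω b + 2 * Γ.ω c + Γ.ω a = 2)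
    (hp : Odd ((if f ∈ Γ.J then r else 0) + if a ∈ Γ.J then 1 else 0)) {j : ι}
    (hj : j ∈ nodes Γ f b c a) : Γ.NodeCondition j := by
  obtain ⟨vf, vb, vb', vc, vc', va⟩ := hE.vec_apply r 1 1 1 1 1
  set v := vec Γ f b c a r 1 1 1 1 1 with hv
  have hvs : ∀ i, i ∉ nodes Γ f b c a → v i = 0 := fun i => vec_eq_zero _ _ _ _ _ _
  have hpos : v ∈ Γ.posRoots := ⟨hroot, vec_nonneg hr.le (by norm_num) (by norm_num)
    (by norm_num) (by norm_num) (by norm_num)⟩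
  have h0 : v ≠ 0 := fun h => by
    have := congrFun h b
    rw [vb] at this
    exact one_ne_zero this
  have hsum : 0 ≤ ∑ i, v i := Finset.sum_nonneg fun i _ => hpos.2 i
  refine WeightedVoganDiagram.nodeCondition_of_odd hpos
    (hΓ.isConnectedSub_support (∑ i, v i).toNat v hpos h0 (Int.toNat_of_nonneg hsum).symm) ?_
    (hE.act_eq_of_eq hvs (by rw [vb, vb']) (by rw [vc, vc'])) ?_ ?_
  · rw [hE.weight_eq hvs, vf, vb, vb', vc, vc', va]
    linarith
  · rw [hE.paintedLength_eq hvs, vf, va]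
    exact hp
  · simp only [nodes, Finset.mem_insert, Finset.mem_singleton] at hj
    rcases hj with rfl | rfl | rfl | rfl | rfl | rfl
    · rw [vf]; exact hr.ne'
    · rw [vb]; exact one_ne_zero
    · rw [vb']; exact one_ne_zero
    · rw [vc]; exact one_ne_zero
    · rw [vc']; exact one_ne_zero
    · rw [va]; exact one_ne_zero

end IsE6

end WeightedVoganDiagram

namespace VoganBasis

open Module WeightedVoganDiagram

variable {g : Type*} [LieRing g] [LieAlgebra ℂ g] {θ : g →ₗ[ℂ] g} {τ : g →ₗ⋆[ℂ] g} {h e f : g}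
  {ι : Type*} [Fintype ι] [DecidableEq ι] {Γ : WeightedVoganDiagram ι} (b : VoganBasis Γ θ h)

/-! ### The condition on the nodes -/

lemma odd_paintedLength (hT : NoticedTriple θ τ h e f) {v : ι → ℤ} (hv : b.coeff v e ≠ 0)
    (hfix : Γ.act v = v) (hadj : ∀ i, v i ≠ 0 → ¬ Γ.graph.Adj i (Γ.θ i)) : Odd (Γ.paintedLength v) :=
  (b.sign_eq_neg_one_iff hT (b.mem_posRoots hT hv) hfix fun i hi => hadj i hi.ne').mp
    (b.sign_eq_neg_one hT hv hfix)

lemma isConnectedSub_support (b : VoganBasis Γ θ h) {v : ι → ℤ} (hv : v ∈ Γ.posRoots) :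
    Γ.IsConnectedSub (Finset.univ.filter fun i => v i ≠ 0) :=
  b.realized.isConnectedSub_support (∑ i, v i).toNat v hv (b.isRoot_ne_zero hv.1)
    (Int.toNat_of_nonneg (Finset.sum_nonneg fun i _ => hv.2 i)).symm

/-- Not all the roots in the support of `e` lying in a component of type `E₆` have `2 n_a = n_f`. -/
lemma exists_coeff_ne_of_isE6 (hT : NoticedTriple θ τ h e f) {f' b' c a : ι}
    (hE : Γ.IsE6 f' b' c a) : ∃ v, b.coeff v e ≠ 0 ∧
      (∀ i, i ∉ IsE6.nodes Γ f' b' c a → v i = 0) ∧ v f' ≠ 2 * v a := by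
  by_contra! hcon
  have hfa := hE.adj_a.ne
  -- The invariant Cartan element with coordinates `1` at `f'` and `-2` at `a` is nonzero, so some
  -- root in the support of `e` does not vanish on it.
  have h1 := b.eq_zero_of_forall_support hT
    (fun i => if i = f' then 1 else if i = a then -2 else 0) (fun i => ?_) fun v hv => ?_
  · have := congrFun h1 f'
    simp at this
  · have h2 : Γ.θ i = f' ↔ i = f' := ⟨fun h => Γ.θ.injective (h.trans hE.θ_f.symm),
      fun h => by rw [h, hE.θ_f]⟩
    have h3 : Γ.θ i = a ↔ i = a := ⟨fun h => Γ.θ.injective (h.trans hE.θ_a.symm),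
      fun h => by rw [h, hE.θ_a]⟩
    simp only [h2, h3]
  · have h4 : ∑ i, (if i = f' then 1 else if i = a then -2 else 0 : ℂ) * (v i : ℂ) =
        (v f' : ℂ) - 2 * (v a : ℂ) := by
      rw [Finset.sum_eq_add f' a hfa]
      · simp [hfa.symm]
        ring
      · rintro i - ⟨h5, h6⟩
        simp [h5, h6]
      all_goals simp
    rw [h4]
    have h5 : v f' = 2 * v a := by
      rcases (b.isRoot_of_coeff_ne_zero hv).forall_eq_zero_or hE.mem_nodes_of_adj with h | h
      · exact hcon v hv h
      · rw [h f' (by simp [IsE6.nodes]), h a (by simp [IsE6.nodes]), mul_zero]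
    rw [h5]
    push_cast
    ring

/-- Unless removing one swapped end node leaves total weight two, the only weighted orbit is `f'` or
that of `c`, with weight one. A painted `a`, or a painted `f'` when `c` is weighted, yields an
explicit root for (I). Otherwise a root `u` in the support of `e` with `u_f ≠ 2 u_a` contradicts
weight two, by parity if it is fixed and by the list of moved roots if not. -/
theorem nodeCondition_of_isE6 (hT : NoticedTriple θ τ h e f) {f' b' c a : ι}
    (hE : Γ.IsE6 f' b' c a) {v : ι → ℤ} (hv : b.coeff v e ≠ 0)
    (hvs : ∀ i, i ∉ IsE6.nodes Γ f' b' c a → v i = 0) (hvf : v f' = 2) (hva : v a = 1)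
    (hcases : v c + v (Γ.θ c) = 1 ∧ (v b' + v (Γ.θ b') = 2 ∨ v b' + v (Γ.θ b') = 3) ∨
      v c + v (Γ.θ c) = 2 ∧ v b' + v (Γ.θ b') = 3) {j : ι} (hj : j ∈ IsE6.nodes Γ f' b' c a) :
    Γ.NodeCondition j := by
  have hw := b.weight_eq_two hT hv
  rw [hE.weight_eq hvs, hvf, hva] at hw
  by_cases hsum : Γ.ω f' + 2 * Γ.ω b' + Γ.ω c + Γ.ω a = 2
  · exact hE.nodeCondition_of_sum b.realized hsum hj
  have hω : Γ.ω b' = 0 ∧ Γ.ω a = 0 ∧ (Γ.ω f' = 1 ∧ Γ.ω c = 0 ∨ Γ.ω f' = 0 ∧ Γ.ω c = 1) := by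
    rcases hcases with ⟨h1, h2 | h2⟩ | ⟨h1, h2⟩ <;> rw [h1, h2] at hw <;> omega
  by_cases haJ : a ∈ Γ.J
  · refine hE.nodeCondition_of_odd b.realized two_pos hE.isRoot_vec.2.2 (by omega) ?_ hj
    rw [if_pos haJ]
    split_ifs <;> decide
  by_cases hfJ : f' ∈ Γ.J ∧ Γ.ω c = 1
  · refine hE.nodeCondition_of_odd b.realized one_pos hE.isRoot_vec.2.1 (by omega) ?_ hj
    rw [if_pos hfJ.1, if_neg haJ]
    decide
  exfalso
  obtain ⟨u, hu, hus, hne⟩ := b.exists_coeff_ne_of_isE6 hT hE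
  have hup := b.mem_posRoots hT hu
  have huw := b.weight_eq_two hT hu
  rw [hE.weight_eq hus, hω.1, hω.2.1] at huw
  by_cases hfix : Γ.act u = u
  · have h1 := b.odd_paintedLength hT hu hfix fun i hi => hE.not_adj_θ (hE.reachable (by
      by_contra h
      exact hi (hus i h)))
    rw [hE.paintedLength_eq hus, if_neg haJ, add_zero] at h1
    split_ifs at h1 with h2
    · rcases hω.2.2 with h3 | h3
      · rw [h3.1, h3.2] at huw
        obtain ⟨k, hk⟩ := h1
        push_cast at huw
        omega
      · exact hfJ ⟨h2, h3.2⟩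
    · exact absurd h1 (by decide)
  · have h1 := hE.eq_of_moved hup (b.isRoot_ne_zero hup.1) hus hfix
    rcases hω.2.2 with h3 | h3 <;> rw [h3.1, h3.2] at huw <;> push_cast at huw <;> omega

/-- The case of a fixed root in the support of `e`. -/
theorem nodeCondition_of_fixed (hT : NoticedTriple θ τ h e f) {v : ι → ℤ} (hv : b.coeff v e ≠ 0)
    (hfix : Γ.act v = v) {j : ι} (hj : v j ≠ 0) : Γ.NodeCondition j := by
  have hp := b.mem_posRoots hT hv
  have hw := b.weight_eq_two hT hv
  have hconn := b.isConnectedSub_support hp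
  by_cases hadj : ∃ i, v i ≠ 0 ∧ Γ.graph.Adj i (Γ.θ i)
  · obtain ⟨i, hi, hia⟩ := hadj
    obtain ⟨k, hk⟩ := hp.1.exists_reachable
    have hki : ∀ l, Γ.graph.Reachable k l → Γ.θ l ≠ l := fun l hl =>
      θ_ne_of_reachable hia (hl.symm.trans (hk i hi))
    have hst : Γ.StableAt k :=
      ((hk i hi).trans hia.reachable).trans (WeightedVoganDiagram.reachable_θ (hk i hi).symm)
    -- A special node of a stable component would be fixed, but the swapped edge leaves no fixed
    -- nodes.
    have hns : ∀ l, Γ.graph.Reachable k l → ¬ Γ.Special l := fun l hl hs =>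
      hki l hl (hst.θ_eq_of_special hl hs)
    have hone := eq_one_of_card_le_two hp (b.isRoot_ne_zero hp.1) hk
      (simplyLacedAt_of_forall_not_special hns) fun l hl N hN => by
        by_contra! hcard
        obtain ⟨N', hN', h3⟩ := Finset.exists_subset_card_eq (show 3 ≤ N.card by omega)
        exact hns l (hk l hl) (.inr ⟨N', h3, fun x hx => (hN x (hN' hx)).2⟩)
    have hmem : ∀ l, l ∈ Finset.univ.filter (fun i => v i ≠ 0) ↔ v l ≠ 0 := fun l => by simp
    have hstab : ∀ l, v (Γ.θ l) ≠ 0 ↔ v l ≠ 0 := fun l => by rw [← act_apply v, hfix]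
    refine .inr ⟨_, (hmem j).mpr hj, hconn, isStableSub_support_iff.mpr hstab, .inr
      (isTwoRowPattern_of_adj hconn (fun l hl => (hmem _).mpr ((hstab l).mpr ((hmem l).mp hl)))
        (fun l hl => hki l (hk l ((hmem l).mp hl))) (fun l hl => hns l (hk l ((hmem l).mp hl))) ?_
        ((hmem i).mpr hi) hia)⟩
    have := sum_ω_support (Γ := Γ) hone
    rw [hw] at this
    exact_mod_cast this
  · push Not at hadj
    exact nodeCondition_of_odd hp hconn hw hfix (b.odd_paintedLength hT hv hfix hadj) hj

/-- The case of a root in the support of `e` whose component is not stable. -/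
theorem nodeCondition_of_not_stableAt [Module.Finite ℂ g] [LieAlgebra.IsKilling ℂ g]
    (b : VoganBasis Γ θ h) (hT : NoticedTriple θ τ h e f) {v : ι → ℤ} (hv : b.coeff v e ≠ 0) {k : ι}
    (hk : ∀ i, v i ≠ 0 → Γ.graph.Reachable k i) (hst : ¬ Γ.StableAt k) {j : ι} (hj : v j ≠ 0) :
    Γ.NodeCondition j := by
  classical
  have hp := b.mem_posRoots hT hv
  have hw := b.weight_eq_two hT hv
  have hconn := b.isConnectedSub_support hp
  have hω : ∀ i, Γ.graph.Reachable k i → Γ.ω i ≠ 1 := by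
    intro i hi
    refine b.ω_ne_one_of_disjoint hT (C := Finset.univ.filter fun i => Γ.graph.Reachable k i)
      (fun i hi l hl => ?_) (fun i hi hi' => ?_) (by simpa using hi)
    · simp only [Finset.mem_filter, Finset.mem_univ, true_and] at hi ⊢
      exact hi.trans hl.reachable
    · simp only [Finset.mem_filter, Finset.mem_univ, true_and] at hi hi'
      exact hst (hi'.trans (WeightedVoganDiagram.reachable_θ hi.symm))
  refine .inl ⟨_, Finset.mem_filter.mpr ⟨Finset.mem_univ _, hj⟩, hconn, fun h => ?_, ?_⟩
  · rw [isStableSub_support_iff] at h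
    exact hst ((hk _ ((h j).mpr hj)).trans (WeightedVoganDiagram.reachable_θ (hk j hj).symm))
  · have hle : ∀ i, (if v i ≠ 0 then (Γ.ω i : ℤ) else 0) ≤ v i * Γ.ω i := by
      intro i
      have := hp.2 i
      split_ifs with h
      · nlinarith [(Γ.ω i).cast_nonneg (α := ℤ), show 1 ≤ v i by omega]
      · rw [not_not.mp h, zero_mul]
    have h1 : ((∑ i ∈ Finset.univ.filter (fun i => v i ≠ 0), Γ.ω i : ℕ) : ℤ) ≤ 2 := by
      rw [← hw, weight, Finset.sum_filter]
      push_cast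
      exact Finset.sum_le_sum fun i _ => hle i
    obtain ⟨m, -, hm⟩ := Finset.exists_ne_zero_of_sum_ne_zero
      (show Γ.weight v ≠ 0 by rw [hw]; norm_num)
    have hvm := left_ne_zero_of_mul hm
    have h2 : Γ.ω m ≤ ∑ i ∈ Finset.univ.filter (fun i => v i ≠ 0), Γ.ω i :=
      Finset.single_le_sum (f := Γ.ω) (fun _ _ => Nat.zero_le _)
        (Finset.mem_filter.mpr ⟨Finset.mem_univ _, hvm⟩)
    -- The support has total weight at most two and contains a node of nonzero weight; that weight
    -- is not one, so it is two and exhausts the total.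
    have h3 := hω m (hk m hvm)
    have h4 : Γ.ω m ≠ 0 := fun h => hm (by rw [h]; simp)
    omega

/-- The case of a moved root in the support of `e` in a stable component. -/
theorem nodeCondition_of_stableAt (hT : NoticedTriple θ τ h e f) {v : ι → ℤ} (hv : b.coeff v e ≠ 0)
    (hmoved : Γ.act v ≠ v) {k : ι} (hk : ∀ i, v i ≠ 0 → Γ.graph.Reachable k i) (hst : Γ.StableAt k)
    {j : ι} (hj : v j ≠ 0) : Γ.NodeCondition j := by
  have hp := b.mem_posRoots hT hv
  have hw := b.weight_eq_two hT hv
  have h0 := b.isRoot_ne_zero hp.1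
  have hconn := b.isConnectedSub_support hp
  obtain ⟨m, hm, hmθ⟩ : ∃ m, Γ.graph.Reachable k m ∧ Γ.θ m ≠ m := by
    obtain ⟨m, hm⟩ := Function.ne_iff.mp hmoved
    rw [act_apply] at hm
    refine ⟨m, ?_, fun h => hm (by rw [h])⟩
    by_cases hvm : v m = 0
    · have := hst.reachable_θ (hk (Γ.θ m) fun h => hm (by rw [h, hvm]))
      rwa [Γ.θ_θ] at this
    · exact hk m hvm
  have hsl := hst.simplyLacedAt hm hmθ
  by_cases hdeg : ∀ i, v i ≠ 0 → ∀ N : Finset ι, (∀ l ∈ N, v l ≠ 0 ∧ Γ.graph.Adj l i) → N.card ≤ 2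
  · exact nodeCondition_of_eq_one (eq_one_of_card_le_two hp h0 hk hsl hdeg) hconn hw hmoved hj
  push Not at hdeg
  obtain ⟨f', hf', N, hN, hcard⟩ := hdeg
  obtain ⟨b', a, hB, hb'N, hθb'N, haN⟩ :=
    hst.exists_isBranch hm hmθ (hk f' hf') (fun l hl => (hN l hl).2) hcard
  have hb' := (hN _ hb'N).1
  have hθb' := (hN _ hθb'N).1
  have ha := (hN _ haN).1
  have hkf : Γ.SupportedAt f' v := fun i hi => (hk f' hf').symm.trans (hk i hi)
  by_cases hend : ∀ x, Γ.graph.Adj b' x → x = f'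
  · exact (hB.false_of_end hend hp hkf hmoved hf' hb' hθb').elim
  push Not at hend
  obtain ⟨c, hc, hcf⟩ := hend
  have hE := hB.isE6 hc hcf
  have hvs : ∀ i, i ∉ IsE6.nodes Γ f' b' c a → v i = 0 :=
    (hp.1.forall_eq_zero_or hE.mem_nodes_of_adj).resolve_right fun h =>
      hf' (h f' (by simp [IsE6.nodes]))
  have hjn : j ∈ IsE6.nodes Γ f' b' c a := by
    by_contra h
    exact hj (hvs j h)
  rcases hE.eq_of_moved hp h0 hvs hmoved with h1 | ⟨h1, h2, h3⟩
  · have hpos := hp.2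
    have hone : ∀ i, v i ≤ 1 := by
      intro i
      by_cases hi : i ∈ IsE6.nodes Γ f' b' c a
      · have := hpos f'
        simp only [IsE6.nodes, Finset.mem_insert, Finset.mem_singleton] at hi
        rcases hi with rfl | rfl | rfl | rfl | rfl | rfl <;> omega
      · rw [hvs i hi]; exact zero_le_one
    refine nodeCondition_of_eq_one (funext fun i => ?_) hconn hw hmoved hj
    have := hone i
    have := hpos i
    split_ifs <;> omega
  · exact b.nodeCondition_of_isE6 hT hE hv hvs h1 h2 h3 hjn

/-- The cases are distinguished by a root occurring in `e` and involving `j`: fixed, moved in a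
stable component, or in a component that is not stable. -/
theorem nodeCondition [Module.Finite ℂ g] [LieAlgebra.IsKilling ℂ g]
    (b : VoganBasis Γ θ h) (hT : NoticedTriple θ τ h e f) (j : ι) : Γ.NodeCondition j := by
  obtain ⟨v, hv, hvj⟩ := b.exists_coeff_ne_zero hT j
  by_cases hfix : Γ.act v = v
  · exact b.nodeCondition_of_fixed hT hv hfix hvj.ne'
  obtain ⟨k, hk⟩ := (b.isRoot_of_coeff_ne_zero hv).exists_reachable
  by_cases hst : Γ.StableAt k
  · exact b.nodeCondition_of_stableAt hT hv hfix hk hst hvj.ne'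
  · exact b.nodeCondition_of_not_stableAt hT hv hk hst hvj.ne'

end VoganBasis

/-! ### The theorem for real semisimple Lie algebras. -/

open scoped TensorProduct
lemma WeightedVoganDiagram.IsAssociatedTo.exists_voganBasis {L : Type*} [LieRing L] [LieAlgebra ℝ L]
    [Module.Finite ℝ L] [LieAlgebra.IsSemisimple ℝ L] {θ : L ≃ₗ⁅ℝ⁆ L} {h : ℂ ⊗[ℝ] L} {ι : Type*} [Fintype ι]
    [DecidableEq ι] {Γ : WeightedVoganDiagram ι} (hΓ : Γ.IsAssociatedTo θ h) :
    Nonempty (VoganBasis Γ (complexTheta θ) h) := by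
  obtain ⟨H, hH, Ψ, ε, hcart, hθ, hJ, hω⟩ := hΓ
  have := hH.isCartan
  exact _root_.exists_voganBasis Ψ ε hcart (complexTheta θ) hH.stable hθ hJ hH.h_mem hω

theorem mainTheorem2 {L : Type*} [LieRing L] [LieAlgebra ℝ L] [Module.Finite ℝ L]
    [LieAlgebra.IsSemisimple ℝ L] (θ : L ≃ₗ⁅ℝ⁆ L) (hθ : IsCartanInvolution θ)
    (h e f : ℂ ⊗[ℝ] L) (hT : IsKSTriple θ h e f) (hN : IsNoticed θ e)
    {ι : Type*} [Fintype ι] [DecidableEq ι] (Γ : WeightedVoganDiagram ι)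
    (hΓ : Γ.IsAssociatedTo θ h) :
    (Γ.Pnp 1).encard = (Γ.Pp 1).encard ∧ ∀ j : ι, Γ.NodeCondition j := by
  obtain ⟨b⟩ := hΓ.exists_voganBasis
  have h1 := hT.noticedTriple hθ hN
  exact ⟨b.encard_Pnp_eq_encard_Pp h1, b.nodeCondition h1⟩
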